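/- Let $H$ be a finite-dimensional vector space over $\mathbb{C}$ equipped with a bilinear form $\langle\cdot,\cdot\rangle$, and let $\mathcal{S}(x): H\otimes H\to H\otimes H\otimes\mathbb{C}[[x]]$ be a linear map with $\mathcal{S}(0)=1$. **The module $V(H,\mathcal{S})$.** Let $T=T(H\otimes\mathbb{C}[t,t^{-1}])$ be the tensor algebra; write $a(n)=a\otimes t^n$ and $a(x)=\sum_{n\in\mathbb{Z}}a(n)x^{-n-1}$ for $a\in H$. Let $T^{+}\subset T$ be the span of all products $a^{(1)}(n_1)\cdots a^{(r)}(n_r)$ with $r\ge 1$, $a^{(i)}\in H$ and $n_1+\cdots+n_r\ge 0$. Then $V(H,\mathcal{S})$ is the quotient of the left $T$-module $\tilde V=T/TT^{+}$ by the relations $$a(x_1)b(x_2)w-\sum_{i}f_i(x_2-x_1)\,b^{(i)}(x_2)a^{(i)}(x_1)w=x_2^{-1}\delta\!\left(\frac{x_1}{x_2}\right)\langle a,b\rangle w\qquad(a,b\in H,\ w\in\tilde V),$$ where $\mathcal{S}(x)(b\otimes a)=\sum_i b^{(i)}\otimes a^{(i)}\otimes f_i(x)$ and $\delta(x)=\sum_{n\in\mathbb{Z}}x^n$.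 Let $\mathbf 1$ be the image of $1$; $V(H,\mathcal{S})$ is the universal vacuum $(H,\mathcal{S})$-module with generator $\mathbf 1$. **PBW type.** For $k\ge 0$ let $V(H,\mathcal{S})[k]$ be the span of the vectors $a^{(1)}(-m_1)\cdots a^{(r)}(-m_r)\mathbf 1$ with $r\ge 0$, $a^{(i)}\in H$, $m_i\ge 1$ and $m_1+\cdots+m_r\le k$; put $V(H,\mathcal{S})[-1]=0$. Because $\mathcal{S}(0)=1$, the graded space $\operatorname{gr}V(H,\mathcal{S})=\coprod_{k\ge 0}V(H,\mathcal{S})[k]/V(H,\mathcal{S})[k-1]$ is a module over the symmetric algebra $S(H\otimes t^{-1}\mathbb{C}[t^{-1}])$ with $(a\otimes t^{-m})\cdot(w+V(H,\mathcal{S})[k-1])=a(-m)w+V(H,\mathcal{S})[k+m-1]$ for $m\ge 1$. One says that $V(H,\mathcal{S})$ is of PBW type if this module is free. **Quantum vertex algebras.** A weak quantum vertex algebra is a vector space $V$ with a vector $\mathbf 1$ and a linear map $Y:V\to\operatorname{Hom}(V,V((x)))$ such that, for $v\in V$, $Y(\mathbf 1,x)v=v$, $Y(v,x)\mathbf 1\in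 V[[x]]$ with constant term $v$, and such that for any $u,v\in V$ there is $\sum_i v^{(i)}\otimes u^{(i)}\otimes f_i(x)\in V\otimes V\otimes\mathbb{C}((x))$ with $$x_0^{-1}\delta\!\left(\tfrac{x_1-x_2}{x_0}\right)Y(u,x_1)Y(v,x_2)-x_0^{-1}\delta\!\left(\tfrac{x_2-x_1}{-x_0}\right)\sum_i f_i(-x_0)Y(v^{(i)},x_2)Y(u^{(i)},x_1)=x_2^{-1}\delta\!\left(\tfrac{x_1-x_0}{x_2}\right)Y(Y(u,x_0)v,x_2),\tag{J}$$ where powers of binomials are expanded in nonnegative powers of the second variable. It is a quantum vertex algebra if there is a linear map $\mathcal{R}(x):V\otimes V\to V\otimes V\otimes\mathbb{C}((x))$ with $\mathcal{R}_{21}(-x)\mathcal{R}(x)=1$ and $\mathcal{R}_{12}(x)\mathcal{R}_{13}(x+z)\mathcal{R}_{23}(z)=\mathcal{R}_{23}(z)\mathcal{R}_{13}(x+z)\mathcal{R}_{12}(x)$ such that for all $u,v\in V$, (J) holds with $\sum_i v^{(i)}\otimes u^{(i)}\otimes f_i(x)=\mathcal{R}(x)(v\otimes u)$. It is nondegenerate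 if for every $n\ge 1$ the linear map $V^{\otimes n}\otimes\mathbb{C}((x_1))\cdots((x_n))\to V((x_1))\cdots((x_n))$, $u_1\otimes\cdots\otimes u_n\otimes f\mapsto f\,Y(u_1,x_1)\cdots Y(u_n,x_n)\mathbf 1$, is injective. **Theorem.** Suppose that $V(H,\mathcal{S})$ is of PBW type. Then there exists a unique weak quantum vertex algebra structure $Y$ on $V(H,\mathcal{S})$ with $\mathbf 1$ as the vacuum vector such that $Y(a(-1)\mathbf 1,x)=a(x)$ for all $a\in H$. Furthermore, with this structure $V(H,\mathcal{S})$ is a nondegenerate quantum vertex algebra. -/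

import Mathlib

open scoped TensorProduct LaurentPolynomial

noncomputable section

namespace QVA

section Coefficients

/-- The linear map `M ⊗ ℂ((x)) → M` sending `m ⊗ f(x)` to `f_s m`, where `f_s` is the coefficient
of `x ^ s` in `f(x)`. -/
def laurentCoeff (M : Type*) [AddCommGroup M] [Module ℂ M] (s : ℤ) :
    M ⊗[ℂ] LaurentSeries ℂ →ₗ[ℂ] M :=
  (TensorProduct.rid ℂ M).toLinearMap ∘ₗ
    LinearMap.lTensor M (HahnSeries.coeff.linearMap (R := ℂ) (V := ℂ) s)

/-- The linear map `M ⊗ ℂ[[x]] → M` sending `m ⊗ f(x)` to `f_s m`, where `f_s` is the coefficient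
of `x ^ s` in `f(x)`. -/
def powerCoeff (M : Type*) [AddCommGroup M] [Module ℂ M] (s : ℕ) :
    M ⊗[ℂ] PowerSeries ℂ →ₗ[ℂ] M :=
  (TensorProduct.rid ℂ M).toLinearMap ∘ₗ LinearMap.lTensor M (PowerSeries.coeff (R := ℂ) s)

end Coefficients

section VertexAlgebra

variable {V : Type*} [AddCommGroup V] [Module ℂ V]

open VertexOperator

/-- For `w ∈ V` and `k, l ∈ ℤ`, the linear map `V ⊗ V → V`, `v ⊗ u ↦ v_k u_l w`, where
`Y(v, x) = ∑ v_n x ^ (-n-1)`. -/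
def modePair (Y : V →ₗ[ℂ] VertexOperator ℂ V) (k l : ℤ) (w : V) : V ⊗[ℂ] V →ₗ[ℂ] V :=
  TensorProduct.lift <| LinearMap.mk₂ ℂ (fun v u => ncoeff (Y v) k (ncoeff (Y u) l w))
    (by intros; simp) (by intros; simp) (by intros; simp) (by intros; simp)

/-- The `𝒮`-Jacobi identity for `u, v ∈ V` and
`A = ∑ᵢ v⁽ⁱ⁾ ⊗ u⁽ⁱ⁾ ⊗ fᵢ(x) ∈ V ⊗ V ⊗ ℂ((x))`:
`x₀⁻¹ δ((x₁ - x₂) / x₀) Y(u, x₁) Y(v, x₂)`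
`- x₀⁻¹ δ((x₂ - x₁) / (-x₀)) ∑ᵢ fᵢ(-x₀) Y(v⁽ⁱ⁾, x₂) Y(u⁽ⁱ⁾, x₁)`
`= x₂⁻¹ δ((x₁ - x₀) / x₂) Y(Y(u, x₀) v, x₂)`,
where `δ(x) = ∑ₙ x ^ n` and powers of a binomial are expanded in nonnegative powers of its second
variable. The displayed equation compares, after application to `w ∈ V`, the coefficients of
`x₀ ^ (-l-1) x₁ ^ (-m-1) x₂ ^ (-n-1)`; each of the three sums has only finitely many nonzero terms.
(In the last sum `(-1) ^ i * (i-m-1).choose i = m.choose i` is used.) -/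
def SJacobi (Y : V →ₗ[ℂ] VertexOperator ℂ V) (u v : V)
    (A : (V ⊗[ℂ] V) ⊗[ℂ] LaurentSeries ℂ) : Prop :=
  ∀ (w : V) (l m n : ℤ),
    (∑ᶠ i : ℕ, ((-1) ^ i * Ring.choose l i : ℤ) •
        ncoeff (Y u) (m + l - i) (ncoeff (Y v) (n + i) w))
      - (∑ᶠ q : ℤ × ℕ, (l.negOnePow * ((-1) ^ q.2 * Ring.choose (l + q.1) q.2) : ℤ) •
        modePair Y (n + l + q.1 - q.2) (m + q.2) w (laurentCoeff (V ⊗[ℂ] V) q.1 A))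
      = ∑ᶠ i : ℕ, (Ring.choose m i) • ncoeff (Y (ncoeff (Y u) (l + i) v)) (m + n - i) w

/-- `(V, Y, 𝟏)` is a weak quantum vertex algebra. The map `Y` is linear with values in
`Hom(V, V((x)))`. -/
structure IsWeakQuantumVertexAlgebra (vac : V) (Y : V →ₗ[ℂ] VertexOperator ℂ V) : Prop where
  /-- `Y(𝟏, x) v = v`. -/
  vacuum : ∀ (v : V) (n : ℤ), ncoeff (Y vac) n v = if n = -1 then v else 0
  /-- `Y(v, x) 𝟏 ∈ V[[x]]`. -/
  creation_regular : ∀ (v : V) (n : ℤ), 0 ≤ n → ncoeff (Y v) n vac = 0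
  /-- `Y(v, x) 𝟏` has constant term `v`. -/
  creation : ∀ v : V, ncoeff (Y v) (-1) vac = v
  /-- The `𝒮`-Jacobi identity. -/
  jacobi : ∀ u v : V, ∃ A : (V ⊗[ℂ] V) ⊗[ℂ] LaurentSeries ℂ, SJacobi Y u v A

end VertexAlgebra

section YangBaxter

instance : IsScalarTower ℂ (LaurentSeries ℂ) (LaurentSeries ℂ) :=
  @IsScalarTower.right ℂ (LaurentSeries ℂ) _ _ HahnSeries.instAlgebra

instance : SMulCommClass ℂ (LaurentSeries ℂ) (LaurentSeries ℂ) :=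
  @Algebra.to_smulCommClass ℂ (LaurentSeries ℂ) _ _ HahnSeries.instAlgebra

instance : IsScalarTower ℂ (LaurentSeries (LaurentSeries ℂ)) (LaurentSeries (LaurentSeries ℂ)) :=
  @IsScalarTower.right ℂ _ _ _ (@HahnSeries.instAlgebra _ _ _ _ _ _ _ _ HahnSeries.instAlgebra)

instance : SMulCommClass ℂ (LaurentSeries (LaurentSeries ℂ)) (LaurentSeries (LaurentSeries ℂ)) :=
  @Algebra.to_smulCommClass ℂ _ _ _
    (@HahnSeries.instAlgebra _ _ _ _ _ _ _ _ HahnSeries.instAlgebra)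

/-- `f(x) ↦ f(-x)` on `ℂ((x))`. -/
def negVar : LaurentSeries ℂ →ₗ[ℂ] LaurentSeries ℂ where
  toFun f :=
    { coeff := fun n => (n.negOnePow : ℤ) • f.coeff n
      isPWO_support' := f.isPWO_support.mono fun n hn h0 => hn (by simp [h0]) }
  map_add' f g := by ext n; simp
  map_smul' c f := by ext n; simp [mul_left_comm]

/-- The field `ℂ((x))((z))`. -/
abbrev LaurentXZ : Type := LaurentSeries (LaurentSeries ℂ)

/-- `f ↦ f(x) ∈ ℂ((x))((z))`. -/
def substX : LaurentSeries ℂ →ₗ[ℂ] LaurentXZ :=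
  HahnSeries.single.linearMap (0 : ℤ)

/-- `f ↦ f(z) ∈ ℂ((x))((z))`. -/
def substZ : LaurentSeries ℂ →ₗ[ℂ] LaurentXZ where
  toFun f := f.map (HahnSeries.C : ℂ →+* LaurentSeries ℂ)
  map_add' f g := by ext n; simp
  map_smul' c f := by
    ext n m
    rw [HahnSeries.map_coeff]
    simp only [HahnSeries.coeff_smul, RingHom.id_apply, HahnSeries.map_coeff, HahnSeries.C_apply,
      HahnSeries.coeff_single, smul_eq_mul]
    split_ifs <;> simp

/-- `f ↦ f(x + z) ∈ ℂ((x))((z))`, expanded in nonnegative powers of `z`: by Taylor's formula, the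
coefficient of `z ^ i` is the `i`-th divided derivative of `f(x)`. -/
def substXaddZ : LaurentSeries ℂ →ₗ[ℂ] LaurentXZ where
  toFun f := HahnSeries.ofPowerSeries ℤ (LaurentSeries ℂ)
    (PowerSeries.mk fun i => LaurentSeries.hasseDeriv ℂ i f)
  map_add' f g := by
    rw [← map_add]; congr 1; ext i : 1; simp
  map_smul' c f := by
    ext n : 2
    rcases lt_or_ge n 0 with hn | hn
    · have h : n ∉ Set.range (Nat.castOrderEmbedding (α := ℤ)) := by
        rintro ⟨k, rfl⟩
        simp only [Nat.castOrderEmbedding_apply] at hn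
        omega
      simp [HahnSeries.ofPowerSeries_apply, HahnSeries.embDomain_of_notMem_range h]
    · lift n to ℕ using hn
      simp [HahnSeries.ofPowerSeries_apply_coeff]

/-- The `K`-linear extension `M ⊗ K → M ⊗ K` of a linear map `M → M ⊗ K`. -/
def extendScalars {M : Type*} [AddCommGroup M] [Module ℂ M] (K : Type*) [CommRing K] [Module ℂ K]
    [SMulCommClass ℂ K K] [IsScalarTower ℂ K K]
    (φ : M →ₗ[ℂ] M ⊗[ℂ] K) : M ⊗[ℂ] K →ₗ[ℂ] M ⊗[ℂ] K :=
  LinearMap.lTensor M (LinearMap.mul' ℂ K) ∘ₗ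
    (TensorProduct.assoc ℂ M K K).toLinearMap ∘ₗ LinearMap.rTensor K φ

variable {V : Type*} [AddCommGroup V] [Module ℂ V]

/-- Unitarity `𝒮₂₁(-x) 𝒮(x) = 1` on `V ⊗ V ⊗ ℂ((x))`, where `𝒮₂₁(x) = P 𝒮(x) P` with `P` the flip
of `V ⊗ V`. -/
def IsUnitary (S : V ⊗[ℂ] V →ₗ[ℂ] (V ⊗[ℂ] V) ⊗[ℂ] LaurentSeries ℂ) : Prop :=
  let P := (TensorProduct.comm ℂ V V).toLinearMap
  extendScalars (LaurentSeries ℂ) (LinearMap.rTensor _ P ∘ₗ LinearMap.lTensor _ negVar ∘ₗ S ∘ₗ P) ∘ₗ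
      extendScalars (LaurentSeries ℂ) S
    = LinearMap.id

section
variable (S : V ⊗[ℂ] V →ₗ[ℂ] (V ⊗[ℂ] V) ⊗[ℂ] LaurentSeries ℂ) (θ : LaurentSeries ℂ →ₗ[ℂ] LaurentXZ)

/-- `𝒮₁₂` on `V ⊗ V ⊗ V`, with the substitution `θ` applied to the Laurent series. -/
def map12 : (V ⊗[ℂ] V) ⊗[ℂ] V →ₗ[ℂ] ((V ⊗[ℂ] V) ⊗[ℂ] V) ⊗[ℂ] LaurentXZ :=
  (TensorProduct.rightComm ℂ (V ⊗[ℂ] V) LaurentXZ V).toLinearMap ∘ₗ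
    LinearMap.rTensor V (LinearMap.lTensor (V ⊗[ℂ] V) θ ∘ₗ S)

/-- `𝒮₁₃ = P₂₃ 𝒮₁₂ P₂₃` on `V ⊗ V ⊗ V`, with the substitution `θ` applied to the Laurent series. -/
def map13 : (V ⊗[ℂ] V) ⊗[ℂ] V →ₗ[ℂ] ((V ⊗[ℂ] V) ⊗[ℂ] V) ⊗[ℂ] LaurentXZ :=
  LinearMap.rTensor LaurentXZ (TensorProduct.rightComm ℂ V V V).toLinearMap ∘ₗ
    map12 S θ ∘ₗ (TensorProduct.rightComm ℂ V V V).toLinearMap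

/-- `𝒮₂₃` on `V ⊗ V ⊗ V`, with the substitution `θ` applied to the Laurent series. -/
def map23 : (V ⊗[ℂ] V) ⊗[ℂ] V →ₗ[ℂ] ((V ⊗[ℂ] V) ⊗[ℂ] V) ⊗[ℂ] LaurentXZ :=
  LinearMap.rTensor LaurentXZ (TensorProduct.assoc ℂ V V V).symm.toLinearMap ∘ₗ
    (TensorProduct.assoc ℂ V (V ⊗[ℂ] V) LaurentXZ).symm.toLinearMap ∘ₗ
    LinearMap.lTensor V (LinearMap.lTensor (V ⊗[ℂ] V) θ ∘ₗ S) ∘ₗ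
    (TensorProduct.assoc ℂ V V V).toLinearMap

end

/-- The quantum Yang-Baxter equation
`𝒮₁₂(x) 𝒮₁₃(x+z) 𝒮₂₃(z) = 𝒮₂₃(z) 𝒮₁₃(x+z) 𝒮₁₂(x)` on `V ⊗ V ⊗ V ⊗ ℂ((x))((z))`. -/
def IsYangBaxter (S : V ⊗[ℂ] V →ₗ[ℂ] (V ⊗[ℂ] V) ⊗[ℂ] LaurentSeries ℂ) : Prop :=
  extendScalars LaurentXZ (map12 S substX) ∘ₗ extendScalars LaurentXZ (map13 S substXaddZ) ∘ₗ
      extendScalars LaurentXZ (map23 S substZ)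
    = extendScalars LaurentXZ (map23 S substZ) ∘ₗ extendScalars LaurentXZ (map13 S substXaddZ) ∘ₗ
      extendScalars LaurentXZ (map12 S substX)

/-- `(V, Y, 𝟏)` with `𝒮(x) : V ⊗ V → V ⊗ V ⊗ ℂ((x))` is a quantum vertex algebra: a weak quantum
vertex algebra with a unitary rational quantum Yang-Baxter operator such that for all `u, v` the
`𝒮`-Jacobi identity holds with `∑ᵢ v⁽ⁱ⁾ ⊗ u⁽ⁱ⁾ ⊗ fᵢ(x) = 𝒮(x)(v ⊗ u)`. -/
structure IsQuantumVertexAlgebra (vac : V) (Y : V →ₗ[ℂ] VertexOperator ℂ V)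
    (S : V ⊗[ℂ] V →ₗ[ℂ] (V ⊗[ℂ] V) ⊗[ℂ] LaurentSeries ℂ) : Prop where
  weak : IsWeakQuantumVertexAlgebra vac Y
  unitary : IsUnitary S
  yangBaxter : IsYangBaxter S
  jacobi : ∀ u v : V, SJacobi Y u v (S (v ⊗ₜ[ℂ] u))

end YangBaxter

section Nondegenerate

/-- Exponents of monomials in `x₁, …, xₙ`, ordered by comparing first the exponents of `xₙ`, then
those of `xₙ₋₁`, and so on (the indices are in `(Fin n)ᵒᵈ`). A set of exponents is well-ordered
exactly when its exponents of `xₙ` are bounded below, for each exponent of `xₙ` those of `xₙ₋₁` are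
bounded below, and so on. Hence the Hahn series with these exponents and coefficients in `M` are
the elements of `M((x₁))⋯((xₙ))`. -/
abbrev Expo (n : ℕ) : Type := Lex ((Fin n)ᵒᵈ → ℤ)

/-- `ℂ((x₁))⋯((xₙ))`. -/
abbrev IterLaurent (n : ℕ) : Type := HahnSeries (Expo n) ℂ

variable {V : Type*} [AddCommGroup V] [Module ℂ V]

/-- `V((x₁))⋯((xₙ))`, a module over `ℂ((x₁))⋯((xₙ))`. -/
abbrev IterLaurentModule (n : ℕ) (V : Type*) [AddCommGroup V] [Module ℂ V] : Type _ :=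
  HahnModule (Expo n) ℂ V

/-- The coefficient of `x₁ ^ k₁ ⋯ xₙ ^ kₙ` in `Y(u₁, x₁) ⋯ Y(uₙ, xₙ) w`, as a multilinear function
of `u₁, …, uₙ`. -/
def prodCoeff (Y : V →ₗ[ℂ] VertexOperator ℂ V) (w : V) (n : ℕ) (k : Expo n) :
    MultilinearMap ℂ (fun _ : Fin n => V) V :=
  (LinearMap.applyₗ w : Module.End ℂ V →ₗ[ℂ] V).compMultilinearMap <|
    (MultilinearMap.mkPiAlgebraFin ℂ n (Module.End ℂ V)).compLinearMap fun i =>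
      (LinearMap.proj (ofLex k (OrderDual.toDual i)) ∘ₗ HVertexOperator.coeff) ∘ₗ Y

theorem prodCoeff_apply (Y : V →ₗ[ℂ] VertexOperator ℂ V) (w : V) (n : ℕ) (k : Expo n)
    (u : Fin n → V) : prodCoeff Y w n k u =
      (List.ofFn fun i => HVertexOperator.coeff (Y (u i)) (ofLex k (OrderDual.toDual i))).prod w :=
  rfl

theorem prodCoeff_isPWO (Y : V →ₗ[ℂ] VertexOperator ℂ V) (w : V) (n : ℕ) (u : Fin n → V) :
    (Function.support fun k : Expo n => prodCoeff Y w n k u).IsPWO := by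
  rw [Set.isPWO_iff_isWF]
  induction n generalizing w with
  | zero =>
    have : Subsingleton (Expo 0) := ⟨fun a b => funext fun i => (OrderDual.ofDual i).elim0⟩
    exact Set.subsingleton_of_subsingleton.wellFoundedOn
  | succ n ih =>
    have hval : ∀ k : Expo (n + 1), prodCoeff Y w (n + 1) k u =
        prodCoeff Y (HVertexOperator.coeff (Y (u (Fin.last n)))
          (ofLex k (OrderDual.toDual (Fin.last n))) w) n
          (toLex fun i : (Fin n)ᵒᵈ => ofLex k (OrderDual.toDual (OrderDual.ofDual i).castSucc))
          (fun i => u i.castSucc) := by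
      intro k
      simp only [prodCoeff_apply, List.ofFn_succ', List.concat_eq_append, List.prod_append,
        List.prod_singleton, Module.End.mul_apply]
      rfl
    have key := Set.WellFoundedOn.prod_lex_of_wellFoundedOn_fiber
      (s := Function.support fun k : Expo (n + 1) => prodCoeff Y w (n + 1) k u)
      (f := fun k : Expo (n + 1) => ofLex k (OrderDual.toDual (Fin.last n)))
      (g := fun k : Expo (n + 1) => (toLex fun i : (Fin n)ᵒᵈ =>
        ofLex k (OrderDual.toDual (OrderDual.ofDual i).castSucc) : Expo n))
      (rα := (· < ·)) (rβ := (· < ·)) ?_ ?_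
    · refine key.mono ?_ le_rfl
      rintro a b ⟨i, hi, hlt⟩
      refine Prod.lex_def.2 ?_
      rcases Fin.eq_castSucc_or_eq_last (OrderDual.ofDual i) with ⟨j, hj⟩ | hj
      · refine Or.inr ⟨hi _ ?_, OrderDual.toDual j, fun i' hi' => hi _ ?_, ?_⟩
        · obtain rfl : i = OrderDual.toDual j.castSucc := hj
          exact Fin.castSucc_lt_last j
        · obtain rfl : i = OrderDual.toDual j.castSucc := hj
          exact Fin.castSucc_lt_castSucc_iff.2 hi'
        · obtain rfl : i = OrderDual.toDual j.castSucc := hj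
          exact hlt
      · left
        obtain rfl : i = OrderDual.toDual (Fin.last n) := hj
        exact hlt
    · refine Set.WellFoundedOn.mapsTo _ (s := Function.support fun d : ℤ =>
        HVertexOperator.coeff (Y (u (Fin.last n))) d w) ?_ ?_
      · intro k hk h0
        rw [Function.mem_support, hval] at hk
        apply hk
        beta_reduce at h0
        rw [h0]
        simp [prodCoeff]
      · exact (HVertexOperator.coeff_isPWOsupport (Y (u (Fin.last n))) w).isWF
    · intro d
      refine Set.WellFoundedOn.mapsTo _ (s := Function.support fun k : Expo n =>
        prodCoeff Y (HVertexOperator.coeff (Y (u (Fin.last n))) d w) n k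
          (fun i => u i.castSucc)) ?_ (ih _ _)
      rintro k ⟨hk, rfl⟩
      rw [Function.mem_support, hval] at hk
      exact hk

/-- `Y(u₁, x₁) ⋯ Y(uₙ, xₙ) w ∈ V((x₁))⋯((xₙ))`, as a linear function of `u₁ ⊗ ⋯ ⊗ uₙ`. -/
def prodSeries (Y : V →ₗ[ℂ] VertexOperator ℂ V) (w : V) (n : ℕ) :
    (⨂[ℂ]^n V) →ₗ[ℂ] IterLaurentModule n V :=
  PiTensorProduct.lift
    { toFun := fun u => HahnModule.of ℂ
        { coeff := fun k => prodCoeff Y w n k u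
          isPWO_support' := prodCoeff_isPWO Y w n u }
      map_update_add' := by
        intro _ u i a b
        obtain rfl := Subsingleton.elim ‹DecidableEq (Fin n)› (instDecidableEqFin n)
        ext k
        exact (prodCoeff Y w n k).map_update_add u i a b
      map_update_smul' := by
        intro _ u i c a
        obtain rfl := Subsingleton.elim ‹DecidableEq (Fin n)› (instDecidableEqFin n)
        ext k
        exact (prodCoeff Y w n k).map_update_smul u i c a }

/-- The map `Zₙ : V^{⊗n} ⊗ ℂ((x₁))⋯((xₙ)) → V((x₁))⋯((xₙ))`,
`Zₙ(u₁ ⊗ ⋯ ⊗ uₙ ⊗ f) = f Y(u₁, x₁) ⋯ Y(uₙ, xₙ) 𝟏`. -/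
def mapZ (vac : V) (Y : V →ₗ[ℂ] VertexOperator ℂ V) (n : ℕ) :
    (⨂[ℂ]^n V) ⊗[ℂ] IterLaurent n →ₗ[ℂ] IterLaurentModule n V :=
  TensorProduct.lift <| LinearMap.mk₂ ℂ (fun t f => f • prodSeries Y vac n t)
    (by intros; simp) (by intros; simp [smul_comm])
    (by intros; rw [add_smul]) (by intros; rw [smul_assoc])

/-- Nondegeneracy: `Zₙ` is injective for every positive integer `n`. -/
def IsNondegenerate (vac : V) (Y : V →ₗ[ℂ] VertexOperator ℂ V) : Prop :=
  ∀ n : ℕ, 0 < n → Function.Injective (mapZ vac Y n)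

end Nondegenerate
end QVA

namespace QVA

section Modes

variable (H : Type*) [AddCommGroup H] [Module ℂ H]

/-- The tensor algebra `T(H ⊗ ℂ[t, t⁻¹])`. -/
abbrev ModeAlgebra : Type _ := TensorAlgebra ℂ (H ⊗[ℂ] ℂ[T;T⁻¹])

variable {H}

/-- The generator `a(n) = a ⊗ t ^ n`, as a linear function of `a ∈ H`. -/
def mode (n : ℤ) : H →ₗ[ℂ] ModeAlgebra H :=
  TensorAlgebra.ι ℂ ∘ₗ (TensorProduct.mk ℂ H ℂ[T;T⁻¹]).flip (LaurentPolynomial.T n)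

/-- The word `a⁽¹⁾(n₁) ⋯ a⁽ʳ⁾(nᵣ)` for the list `(a⁽¹⁾, n₁), …, (a⁽ʳ⁾, nᵣ)`. -/
def word (l : List (H × ℤ)) : ModeAlgebra H := (l.map fun p => mode p.2 p.1).prod

/-- The degree `n₁ + ⋯ + nᵣ` of a word. -/
def wordDegree (l : List (H × ℤ)) : ℤ := (l.map Prod.snd).sum

/-- The linear map `H ⊗ H → T(H ⊗ ℂ[t, t⁻¹])`, `b ⊗ a ↦ b(k) a(l)`. -/
def quad (k l : ℤ) : H ⊗[ℂ] H →ₗ[ℂ] ModeAlgebra H :=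
  LinearMap.mul' ℂ (ModeAlgebra H) ∘ₗ TensorProduct.map (mode k) (mode l)

variable (H) in
/-- The left ideal `J = T T⁺` of `T = T(H ⊗ ℂ[t, t⁻¹])`, where `T⁺` is the span of the words of
length at least `1` and of degree at least `0`. -/
def truncationIdeal : Submodule (ModeAlgebra H) (ModeAlgebra H) :=
  Submodule.span (ModeAlgebra H) {x | ∃ l : List (H × ℤ), l ≠ [] ∧ 0 ≤ wordDegree l ∧ x = word l}

variable (H) in
/-- The left `T(H ⊗ ℂ[t, t⁻¹])`-module `T(H ⊗ ℂ[t, t⁻¹]) / J`. -/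
abbrev TruncatedModule : Type _ := ModeAlgebra H ⧸ truncationIdeal H

variable (B : LinearMap.BilinForm ℂ H)
  (S : H ⊗[ℂ] H →ₗ[ℂ] (H ⊗[ℂ] H) ⊗[ℂ] PowerSeries ℂ)

section Relator

variable {W : Type*} [AddCommGroup W] [Module (ModeAlgebra H) W]

/-- The coefficient of `x₁ ^ (-m-1) x₂ ^ (-n-1)` in
`∑ᵢ fᵢ(x₂ - x₁) b⁽ⁱ⁾(x₂) a⁽ⁱ⁾(x₁) w`, where `𝒮(x)(b ⊗ a) = ∑ᵢ b⁽ⁱ⁾ ⊗ a⁽ⁱ⁾ ⊗ fᵢ(x)` and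
`a(x) = ∑ₙ a(n) x ^ (-n-1)`. The pair `q = (p, j)` stands for the monomial `x₂ ^ p x₁ ^ j` in
`(x₂ - x₁) ^ (p + j)`. If for every `a ∈ H` and `w ∈ W` one has `a(m) w = 0` for `m` large, then
only finitely many terms are nonzero. -/
def exchange (a b : H) (m n : ℤ) (w : W) : W :=
  ∑ᶠ q : ℕ × ℕ, (((-1) ^ q.2 * ((q.1 + q.2).choose q.2 : ℂ)) •
    quad (n + q.1) (m + q.2) (powerCoeff (H ⊗[ℂ] H) (q.1 + q.2) (S (b ⊗ₜ[ℂ] a)))) • w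

/-- The coefficient of `x₁ ^ (-m-1) x₂ ^ (-n-1)` in
`a(x₁) b(x₂) w - ∑ᵢ fᵢ(x₂ - x₁) b⁽ⁱ⁾(x₂) a⁽ⁱ⁾(x₁) w - x₂⁻¹ δ(x₁ / x₂) ⟨a, b⟩ w`. -/
def relator (a b : H) (m n : ℤ) (w : W) : W :=
  (mode m a * mode n b) • w - exchange S a b m n w -
    algebraMap ℂ (ModeAlgebra H) (if m + n + 1 = 0 then B a b else 0) • w

end Relator

/-- The submodule of `T(H ⊗ ℂ[t, t⁻¹]) / J` generated by the defining relations of `(H, 𝒮)`-modules: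
`a(x₁) b(x₂) w - ∑ᵢ fᵢ(x₂ - x₁) b⁽ⁱ⁾(x₂) a⁽ⁱ⁾(x₁) w = x₂⁻¹ δ(x₁ / x₂) ⟨a, b⟩ w`. -/
def relationSubmodule : Submodule (ModeAlgebra H) (TruncatedModule H) :=
  Submodule.span (ModeAlgebra H)
    {x | ∃ (a b : H) (m n : ℤ) (w : TruncatedModule H), x = relator B S a b m n w}

/-- The universal vacuum `(H, 𝒮)`-module `V(H, 𝒮)`. -/
def VacuumModule : Type _ := TruncatedModule H ⧸ relationSubmodule B S

instance : AddCommGroup (VacuumModule B S) :=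
  inferInstanceAs (AddCommGroup (TruncatedModule H ⧸ relationSubmodule B S))

instance : Module (ModeAlgebra H) (VacuumModule B S) :=
  inferInstanceAs (Module (ModeAlgebra H) (TruncatedModule H ⧸ relationSubmodule B S))

instance : Module ℂ (VacuumModule B S) :=
  Module.compHom _ (algebraMap ℂ (ModeAlgebra H))

instance : IsScalarTower ℂ (ModeAlgebra H) (VacuumModule B S) :=
  IsScalarTower.of_algebraMap_smul fun _ _ => rfl

/-- The quotient map `T(H ⊗ ℂ[t, t⁻¹]) / J → V(H, 𝒮)`. -/
def toVacuumModule : TruncatedModule H →ₗ[ModeAlgebra H] VacuumModule B S :=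
  (relationSubmodule B S).mkQ

theorem toVacuumModule_surjective : Function.Surjective (toVacuumModule B S) :=
  Submodule.mkQ_surjective _

theorem toVacuumModule_eq_zero {x : TruncatedModule H} (hx : x ∈ relationSubmodule B S) :
    toVacuumModule B S x = 0 :=
  (Submodule.Quotient.mk_eq_zero _).2 hx

/-- The generating vacuum-like vector `𝟏` of `V(H, 𝒮)`. -/
def vacuum : VacuumModule B S := toVacuumModule B S (Submodule.Quotient.mk 1)

theorem word_cons (p : H × ℤ) (l : List (H × ℤ)) : word (p :: l) = mode p.2 p.1 * word l := by
  simp [word]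

theorem wordDegree_cons {K : Type*} (p : K × ℤ) (l : List (K × ℤ)) :
    wordDegree (p :: l) = p.2 + wordDegree l := by
  simp [wordDegree]

theorem span_word : Submodule.span ℂ (Set.range (word (H := H))) = ⊤ := by
  rw [eq_top_iff]
  have hone : (1 : ModeAlgebra H) ∈ Submodule.span ℂ (Set.range (word (H := H))) :=
    Submodule.subset_span ⟨[], by simp [word]⟩
  rintro x -
  induction x using TensorAlgebra.induction with
  | algebraMap r => rw [Algebra.algebraMap_eq_smul_one]; exact Submodule.smul_mem _ _ hone
  | ι x =>
    induction x using TensorProduct.induction_on with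
    | zero => simp
    | tmul a p =>
      induction p using LaurentPolynomial.induction_on' with
      | add p q hp hq => rw [TensorProduct.tmul_add, map_add]; exact add_mem hp hq
      | C_mul_T n r =>
        rw [← LaurentPolynomial.smul_eq_C_mul, TensorProduct.tmul_smul, map_smul]
        exact Submodule.smul_mem _ _ (Submodule.subset_span ⟨[(a, n)], by simp [word, mode]⟩)
    | add x y hx hy => rw [map_add]; exact add_mem hx hy
  | mul x y hx hy =>
    have h := Submodule.mul_mem_mul hx hy
    rw [Submodule.span_mul_span] at h
    refine Submodule.span_mono ?_ h
    rintro _ ⟨_, ⟨l, rfl⟩, _, ⟨l', rfl⟩, rfl⟩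
    exact ⟨l ++ l', by simp [word]⟩
  | add x y hx hy => exact add_mem hx hy

/-- In `T(H ⊗ ℂ[t, t⁻¹]) / J` one has `a(m) w = 0` for `m` large. -/
theorem truncatedModule_truncation (a : H) (w : TruncatedModule H) :
    ∃ N : ℤ, ∀ m : ℤ, N ≤ m → mode m a • w = 0 := by
  obtain ⟨x, rfl⟩ := Submodule.Quotient.mk_surjective _ w
  have hx : x ∈ Submodule.span ℂ (Set.range (word (H := H))) := by rw [span_word]; trivial
  induction hx using Submodule.span_induction with
  | mem x hx =>
    obtain ⟨l, rfl⟩ := hx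
    refine ⟨-wordDegree l, fun m hm => ?_⟩
    rw [← Submodule.Quotient.mk_smul, Submodule.Quotient.mk_eq_zero]
    refine Submodule.subset_span ⟨(a, m) :: l, by simp, ?_, ?_⟩
    · rw [wordDegree_cons]; simp only; omega
    · rw [word_cons]; rfl
  | zero => exact ⟨0, fun m _ => by simp⟩
  | add x y _ _ hx hy =>
    obtain ⟨N, hN⟩ := hx
    obtain ⟨N', hN'⟩ := hy
    exact ⟨max N N', fun m hm => by
      rw [Submodule.Quotient.mk_add, smul_add, hN m (le_trans (le_max_left _ _) hm),
        hN' m (le_trans (le_max_right _ _) hm), add_zero]⟩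
  | smul c x _ hx =>
    obtain ⟨N, hN⟩ := hx
    exact ⟨N, fun m hm => by
      rw [Algebra.smul_def, ← smul_eq_mul, Submodule.Quotient.mk_smul, ← mul_smul,
        ← Algebra.commutes, mul_smul, hN m hm, smul_zero]⟩

theorem vacuumModule_truncation (a : H) (w : VacuumModule B S) :
    ∃ N : ℤ, ∀ m : ℤ, N ≤ m → mode m a • w = 0 := by
  obtain ⟨x, rfl⟩ := toVacuumModule_surjective B S w
  obtain ⟨N, hN⟩ := truncatedModule_truncation a x
  exact ⟨N, fun m hm => by rw [← map_smul, hN m hm, map_zero]⟩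

theorem exchange_finite {W : Type*} [AddCommGroup W] [Module (ModeAlgebra H) W]
    (hW : ∀ (a : H) (w : W), ∃ N : ℤ, ∀ m : ℤ, N ≤ m → mode m a • w = 0)
    (A : (H ⊗[ℂ] H) ⊗[ℂ] PowerSeries ℂ) (m n : ℤ) (w : W) :
    (Function.support fun q : ℕ × ℕ => (((-1) ^ q.2 * ((q.1 + q.2).choose q.2 : ℂ)) •
      quad (n + q.1) (m + q.2) (powerCoeff (H ⊗[ℂ] H) (q.1 + q.2) A)) • w).Finite := by
  induction A using TensorProduct.induction_on with
  | zero => simp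
  | add A A' h h' =>
    refine (h.union h').subset fun q hq => ?_
    by_contra hc
    simp only [Set.mem_union, Function.mem_support, not_or, not_not] at hc
    apply hq
    simp only [map_add, smul_add, add_smul, hc.1, hc.2, add_zero]
  | tmul X f =>
    induction X using TensorProduct.induction_on with
    | zero => simp
    | add X X' h h' =>
      refine (h.union h').subset fun q hq => ?_
      by_contra hc
      simp only [Set.mem_union, Function.mem_support, not_or, not_not] at hc
      apply hq
      simp only [TensorProduct.add_tmul, map_add, smul_add, add_smul, hc.1, hc.2, add_zero]
    | tmul b a =>
      obtain ⟨N, hN⟩ := hW a w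
      have hP : ∀ j : ℕ, ∃ P : ℤ, ∀ k : ℤ, P ≤ k → mode k b • mode (m + j) a • w = 0 :=
        fun j => hW b _
      choose P hP using hP
      have hfin : (⋃ j ∈ Set.Iio (N - m).toNat,
          (fun p : ℕ => (p, j)) '' Set.Iio (P j - n).toNat).Finite :=
        (Set.finite_Iio _).biUnion fun j _ => (Set.finite_Iio _).image _
      refine hfin.subset ?_
      rintro ⟨p, j⟩ hq
      have hval : quad (n + p) (m + j) (powerCoeff (H ⊗[ℂ] H) (p + j) ((b ⊗ₜ[ℂ] a) ⊗ₜ[ℂ] f)) =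
          PowerSeries.coeff (p + j) f • (mode (n + p) b * mode (m + j) a) := by
        simp [quad, powerCoeff]
      have hne : mode (n + p) b • mode (m + j) a • w ≠ 0 := by
        intro h0
        apply hq
        simp only [hval, smul_smul]
        rw [Algebra.smul_def, mul_smul, mul_smul, h0, smul_zero]
      simp only [Set.mem_iUnion, Set.mem_image, Set.mem_Iio, Prod.mk.injEq, exists_prop]
      refine ⟨j, ?_, p, ?_, rfl, rfl⟩
      · by_contra hj
        apply hne
        rw [hN _ (by omega), smul_zero]
      · by_contra hp
        exact hne (hP j _ (by omega))

/-- The defining relations hold in `V(H, 𝒮)`. -/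
theorem relator_vacuumModule (a b : H) (m n : ℤ) (w : VacuumModule B S) :
    relator B S a b m n w = 0 := by
  obtain ⟨x, rfl⟩ := toVacuumModule_surjective B S w
  have h : toVacuumModule B S (relator B S a b m n x) = 0 :=
    toVacuumModule_eq_zero B S (Submodule.subset_span ⟨a, b, m, n, x, rfl⟩)
  rw [relator, map_sub, map_sub, map_smul, map_smul, exchange,
    map_finsum _ (exchange_finite truncatedModule_truncation _ m n x)] at h
  simp only [map_smul] at h
  exact h

/-- The subspace `V(H, 𝒮)[k]`, spanned by the vectors `a⁽¹⁾(-m₁) ⋯ a⁽ʳ⁾(-mᵣ) 𝟏` with `r ≥ 0`,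
`mᵢ ≥ 1` and `m₁ + ⋯ + mᵣ ≤ k`. It is zero for `k < 0`. -/
def filtration (k : ℤ) : Submodule ℂ (VacuumModule B S) :=
  Submodule.span ℂ {x | ∃ l : List (H × ℤ), (∀ p ∈ l, p.2 < 0) ∧ -wordDegree l ≤ k ∧
    x = word l • vacuum B S}

theorem filtration_mono {k k' : ℤ} (h : k ≤ k') : filtration B S k ≤ filtration B S k' :=
  Submodule.span_mono fun _ ⟨l, hl, hk, hx⟩ => ⟨l, hl, hk.trans h, hx⟩

theorem wordDegree_nonpos {K : Type*} {l : List (K × ℤ)} (hl : ∀ p ∈ l, p.2 < 0) : wordDegree l ≤ 0 := by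
  induction l with
  | nil => simp [wordDegree]
  | cons p l ih =>
    rw [wordDegree_cons]
    have h1 := hl p (by simp)
    have h2 := ih fun q hq => hl q (by simp [hq])
    omega

theorem filtration_neg {k : ℤ} (hk : k < 0) : filtration B S k = ⊥ := by
  rw [filtration, Submodule.span_eq_bot]
  rintro x ⟨l, hl, hle, rfl⟩
  have := wordDegree_nonpos hl
  omega

theorem mode_smul_mem_of_neg {m : ℤ} (hm : m < 0) (a : H) {k : ℤ} {x : VacuumModule B S}
    (hx : x ∈ filtration B S k) : mode m a • x ∈ filtration B S (k - m) := by
  induction hx using Submodule.span_induction with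
  | mem x hx =>
    obtain ⟨l, hl, hle, rfl⟩ := hx
    refine Submodule.subset_span ⟨(a, m) :: l, ?_, ?_, ?_⟩
    · intro p hp
      rcases List.mem_cons.1 hp with rfl | hp
      · exact hm
      · exact hl p hp
    · rw [wordDegree_cons]; simp only; omega
    · rw [word_cons, mul_smul]
  | zero => rw [smul_zero]; exact zero_mem _
  | add x y _ _ hx hy => rw [smul_add]; exact add_mem hx hy
  | smul c x _ hx => rw [smul_comm]; exact Submodule.smul_mem _ _ hx

theorem mode_smul_vacuum {m : ℤ} (hm : 0 ≤ m) (a : H) : mode m a • vacuum B S = 0 := by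
  have h : mode m a • (Submodule.Quotient.mk 1 : TruncatedModule H) = 0 := by
    rw [← Submodule.Quotient.mk_smul, Submodule.Quotient.mk_eq_zero]
    exact Submodule.subset_span ⟨[(a, m)], by simp, by simpa [wordDegree] using hm,
      by simp [word]⟩
  rw [vacuum, ← map_smul, h, map_zero]

/-- If every `b(k) a(l) x` with `k = n + p`, `l = m + j` lies in a subspace, so does
the corresponding term of the exchange relation. -/
theorem exchange_term_mem {F : Submodule ℂ (VacuumModule B S)} {k l : ℤ} {x : VacuumModule B S}
    (h : ∀ a b : H, mode k b • mode l a • x ∈ F) (X : H ⊗[ℂ] H) (c : ℂ) :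
    (c • quad k l X) • x ∈ F := by
  rw [smul_assoc]
  refine Submodule.smul_mem _ _ ?_
  induction X using TensorProduct.induction_on with
  | zero => rw [map_zero, zero_smul]; exact zero_mem _
  | tmul b a => simpa [quad, mul_smul] using h a b
  | add X X' h h' => rw [map_add, add_smul]; exact add_mem h h'

theorem relation_eq (a b : H) (m n : ℤ) (w : VacuumModule B S) :
    mode m a • mode n b • w = exchange S a b m n w + (if m + n + 1 = 0 then B a b else 0) • w := by
  have h := relator_vacuumModule B S a b m n w
  rw [relator, mul_smul, algebraMap_smul, sub_sub, sub_eq_zero] at h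
  exact h

theorem mode_smul_mem_of_nonneg {m : ℤ} (hm : 0 ≤ m) (a : H) {k : ℤ} {x : VacuumModule B S}
    (hx : x ∈ filtration B S k) : mode m a • x ∈ filtration B S (k - m - 1) := by
  suffices key : ∀ N : ℕ, ∀ k : ℤ, k < N → ∀ m : ℤ, 0 ≤ m → ∀ (a : H),
      ∀ x ∈ filtration B S k, mode m a • x ∈ filtration B S (k - m - 1) from
    key (k + 1).toNat k (by omega) m hm a x hx
  clear hx x hm a k m
  intro N
  induction N with
  | zero =>
    intro k hk m _ a x hx
    rw [filtration_neg B S (by exact_mod_cast hk), Submodule.mem_bot] at hx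
    rw [hx, smul_zero]
    exact zero_mem _
  | succ N ih =>
    intro k hk m hm a x hx
    push_cast at hk
    induction hx using Submodule.span_induction with
    | zero => rw [smul_zero]; exact zero_mem _
    | add x y _ _ hx hy => rw [smul_add]; exact add_mem hx hy
    | smul c x _ hx => rw [smul_comm]; exact Submodule.smul_mem _ _ hx
    | mem x hx =>
      obtain ⟨l, hl, hle, rfl⟩ := hx
      cases l with
      | nil =>
        rw [show word ([] : List (H × ℤ)) = 1 by simp [word], one_smul, mode_smul_vacuum B S hm]
        exact zero_mem _
      | cons p l =>
        obtain ⟨b, n⟩ := p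
        have hn : n < 0 := hl (b, n) (by simp)
        rw [wordDegree_cons] at hle
        simp only at hle
        have hw : word l • vacuum B S ∈ filtration B S (k + n) :=
          Submodule.subset_span ⟨l, fun p hp => hl p (by simp [hp]), by omega, rfl⟩
        rw [word_cons, mul_smul, relation_eq]
        refine add_mem ?_ ?_
        · refine finsum_induction (· ∈ filtration B S (k - m - 1)) (zero_mem _)
            (fun _ _ => add_mem) fun q => exchange_term_mem B S (fun a' b' => ?_) _ _
          have h1 := ih (k + n) (by omega) (m + q.2) (by omega) a' _ hw
          rcases lt_or_ge (n + q.1) 0 with h0 | h0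
          · exact filtration_mono B S (by omega) (mode_smul_mem_of_neg B S h0 b' h1)
          · exact filtration_mono B S (by omega) (ih _ (by omega) _ h0 b' _ h1)
        · split_ifs with h0
          · exact Submodule.smul_mem _ _ (filtration_mono B S (by omega) hw)
          · rw [zero_smul]; exact zero_mem _

theorem mode_smul_mem (m : ℤ) (a : H) {k : ℤ} {x : VacuumModule B S}
    (hx : x ∈ filtration B S k) : mode m a • x ∈ filtration B S (k - m) := by
  rcases lt_or_ge m 0 with h | h
  · exact mode_smul_mem_of_neg B S h a hx
  · exact filtration_mono B S (by omega) (mode_smul_mem_of_nonneg B S h a hx)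

/-- If `𝒮(0) = 1` then `a(m) b(n) - b(n) a(m)` lowers the filtration by one more step than
expected, for `m, n < 0`. -/
theorem mode_comm_mem (hS : ∀ t, powerCoeff (H ⊗[ℂ] H) 0 (S t) = t) {m n : ℤ} (hm : m < 0)
    (hn : n < 0) (a b : H) {k : ℤ} {x : VacuumModule B S} (hx : x ∈ filtration B S k) :
    mode m a • mode n b • x - mode n b • mode m a • x ∈ filtration B S (k - m - n - 1) := by
  rw [relation_eq, if_neg (by omega), zero_smul, add_zero, ← Submodule.Quotient.mk_eq_zero,
    Submodule.Quotient.mk_sub, sub_eq_zero, ← Submodule.mkQ_apply, exchange,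
    map_finsum _ (exchange_finite (vacuumModule_truncation B S) _ m n x),
    finsum_eq_single _ (0, 0)]
  · simp [hS, quad, mul_smul]
  · rintro ⟨p, j⟩ hq
    rw [Submodule.mkQ_apply, Submodule.Quotient.mk_eq_zero]
    have hpj : 0 < p + j := by
      rw [Nat.pos_iff_ne_zero]
      intro h0
      exact hq (by rw [Prod.mk.injEq]; omega)
    exact exchange_term_mem B S (fun a' b' => filtration_mono B S (by omega)
      (mode_smul_mem B S (n + p) b' (mode_smul_mem B S (m + j) a' hx))) _ _

/-- The component `V(H, 𝒮)[k] / V(H, 𝒮)[k-1]` of the associated graded space. -/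
abbrev GrPiece (k : ℕ) : Type _ :=
  filtration B S k ⧸ (filtration B S (k - 1)).submoduleOf (filtration B S k)

/-- The associated graded space `gr V(H, 𝒮) = ∐_{k ≥ 0} V(H, 𝒮)[k] / V(H, 𝒮)[k-1]`. -/
abbrev Gr : Type _ := DirectSum ℕ fun k => GrPiece B S k

/-- The action of `a(-m)` as a linear endomorphism of `V(H, 𝒮)`. -/
def modeEnd (m : ℤ) (a : H) : Module.End ℂ (VacuumModule B S) where
  toFun x := mode m a • x
  map_add' := smul_add _
  map_smul' _ _ := smul_comm _ _ _

/-- The map `V[k] / V[k-1] → V[k+m] / V[k+m-1]`, `w + V[k-1] ↦ a(-m) w + V[k+m-1]`. -/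
def grPieceMode (m : ℕ) (a : H) (k : ℕ) : GrPiece B S k →ₗ[ℂ] GrPiece B S (k + m) :=
  Submodule.mapQ _ _
    ((modeEnd B S (-m) a).restrict fun x hx => by
      have := mode_smul_mem B S (-m) a hx
      rwa [sub_neg_eq_add, ← Nat.cast_add] at this)
    (by
      intro x hx
      have := mode_smul_mem B S (-m) a (k := k - 1) (x := x) hx
      exact filtration_mono B S (by push_cast; omega) this)

theorem grPieceMode_mk (m : ℕ) (a : H) (k : ℕ) (x : filtration B S k)
    (h : mode (-m) a • (x : VacuumModule B S) ∈ filtration B S (k + m : ℕ)) :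
    grPieceMode B S m a k (Submodule.Quotient.mk x) = Submodule.Quotient.mk ⟨_, h⟩ :=
  rfl

/-- The action of `a(-m)` on `gr V(H, 𝒮)`, as a linear function of `a ∈ H`. -/
def grMode (m : ℕ) : H →ₗ[ℂ] Module.End ℂ (Gr B S) where
  toFun a := DirectSum.toModule ℂ ℕ _ fun k =>
    DirectSum.lof ℂ ℕ (fun k => GrPiece B S k) (k + m) ∘ₗ grPieceMode B S m a k
  map_add' a b := by
    refine DirectSum.linearMap_ext ℂ fun k => LinearMap.ext fun y => ?_
    obtain ⟨x, rfl⟩ := Submodule.Quotient.mk_surjective _ y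
    simp only [LinearMap.comp_apply, DirectSum.toModule_lof, LinearMap.add_apply]
    rw [← map_add]
    exact congrArg _ (congrArg Submodule.Quotient.mk (Subtype.ext (by simp [modeEnd, add_smul])))
  map_smul' c a := by
    refine DirectSum.linearMap_ext ℂ fun k => LinearMap.ext fun y => ?_
    obtain ⟨x, rfl⟩ := Submodule.Quotient.mk_surjective _ y
    simp only [LinearMap.comp_apply, DirectSum.toModule_lof, LinearMap.smul_apply, RingHom.id_apply]
    rw [← map_smul]
    exact congrArg _ (congrArg Submodule.Quotient.mk (Subtype.ext (by simp [modeEnd])))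

variable (H) in
/-- `H ⊗ t⁻¹ ℂ[t⁻¹]`. -/
abbrev NegativeModes : Type _ := H ⊗[ℂ] AddMonoidAlgebra.supported ℂ ℂ (Set.Iio (0 : ℤ))

/-- The linear map `H ⊗ t⁻¹ ℂ[t⁻¹] → End(gr V(H, 𝒮))`, `a ⊗ t ^ (-m) ↦ a(-m)` for `m ≥ 1`. -/
def grAction : NegativeModes H →ₗ[ℂ] Module.End ℂ (Gr B S) :=
  TensorProduct.lift <| LinearMap.flip <|
    (Finsupp.linearCombination ℂ fun n : ℤ => grMode B S (-n).toNat) ∘ₗ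
      (AddMonoidAlgebra.coeffLinearEquiv ℂ).toLinearMap ∘ₗ Submodule.subtype _

theorem grMode_lof (m : ℕ) (a : H) (k : ℕ) (x : filtration B S k)
    (h : mode (-m) a • (x : VacuumModule B S) ∈ filtration B S (k + m : ℕ)) :
    grMode B S m a (DirectSum.lof ℂ ℕ (fun k => GrPiece B S k) k (Submodule.Quotient.mk x)) =
      DirectSum.lof ℂ ℕ (fun k => GrPiece B S k) (k + m) (Submodule.Quotient.mk ⟨_, h⟩) := by
  simp only [grMode, LinearMap.coe_mk, AddHom.coe_mk, DirectSum.toModule_lof, LinearMap.comp_apply]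
  rw [grPieceMode_mk]

theorem lof_congr {k k' : ℕ} (hk : k = k') {x y : VacuumModule B S} (hx : x ∈ filtration B S k)
    (hy : y ∈ filtration B S k') (h : x - y ∈ filtration B S (k - 1)) :
    DirectSum.lof ℂ ℕ (fun k => GrPiece B S k) k (Submodule.Quotient.mk ⟨x, hx⟩) =
      DirectSum.lof ℂ ℕ (fun k => GrPiece B S k) k' (Submodule.Quotient.mk ⟨y, hy⟩) := by
  subst hk
  congr 1
  exact (Submodule.Quotient.eq _).2 h

theorem grMode_comm (hS : ∀ t, powerCoeff (H ⊗[ℂ] H) 0 (S t) = t) {m n : ℕ} (hm : 0 < m)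
    (hn : 0 < n) (a b : H) : Commute (grMode B S m a) (grMode B S n b) := by
  refine DirectSum.linearMap_ext ℂ fun k => LinearMap.ext fun y => ?_
  obtain ⟨x, rfl⟩ := Submodule.Quotient.mk_surjective _ y
  have mem : ∀ (m : ℕ) (a : H) (k : ℕ) (x : VacuumModule B S), x ∈ filtration B S k →
      mode (-m) a • x ∈ filtration B S (k + m : ℕ) := by
    intro m a k x hx
    have := mode_smul_mem B S (-m) a hx
    rwa [sub_neg_eq_add, ← Nat.cast_add] at this
  obtain ⟨x, hx⟩ := x
  simp only [LinearMap.comp_apply, Module.End.mul_apply]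
  rw [grMode_lof B S n b k ⟨x, hx⟩ (mem _ _ _ _ hx), grMode_lof B S m a k ⟨x, hx⟩ (mem _ _ _ _ hx),
    grMode_lof B S m a (k + n) ⟨_, mem _ _ _ _ hx⟩ (mem _ _ _ _ (mem _ _ _ _ hx)),
    grMode_lof B S n b (k + m) ⟨_, mem _ _ _ _ hx⟩ (mem _ _ _ _ (mem _ _ _ _ hx))]
  refine lof_congr B S (by omega) _ _ (filtration_mono B S ?_
    (mode_comm_mem B S hS (m := -m) (n := -n) (by omega) (by omega) a b hx))
  push_cast
  omega

theorem grAction_comm (hS : ∀ t, powerCoeff (H ⊗[ℂ] H) 0 (S t) = t) (x y : NegativeModes H) :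
    Commute (grAction B S x) (grAction B S y) := by
  induction x using TensorProduct.induction_on with
  | zero => rw [map_zero]; exact Commute.zero_left _
  | add x x' h h' => rw [map_add]; exact h.add_left h'
  | tmul a p =>
    induction y using TensorProduct.induction_on with
    | zero => rw [map_zero]; exact Commute.zero_right _
    | add y y' h h' => rw [map_add]; exact h.add_right h'
    | tmul b p' =>
      obtain ⟨p, hp⟩ := p
      obtain ⟨p', hp'⟩ := p'
      simp only [grAction, TensorProduct.lift.tmul, LinearMap.flip_apply, LinearMap.comp_apply,
        Finsupp.linearCombination_apply, Finsupp.sum, LinearMap.sum_apply, LinearMap.smul_apply]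
      refine Commute.sum_left _ _ _ fun i hi => Commute.sum_right _ _ _ fun j hj => ?_
      have hi' : i < 0 := hp hi
      have hj' : j < 0 := hp' hj
      exact ((grMode_comm B S hS (by omega) (by omega) a b).smul_left _).smul_right _

/-- If `𝒮(0) = 1`, the algebra homomorphism `S(H ⊗ t⁻¹ ℂ[t⁻¹]) → End(gr V(H, 𝒮))` with
`a ⊗ t ^ (-m) ↦ a(-m)` for `m ≥ 1`. -/
def symAction (hS : ∀ t, powerCoeff (H ⊗[ℂ] H) 0 (S t) = t) :
    SymmetricAlgebra ℂ (NegativeModes H) →ₐ[ℂ] Module.End ℂ (Gr B S) :=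
  RingCon.liftₐ _ (TensorAlgebra.lift ℂ (grAction B S)) <| by
    refine RingCon.ringConGen_le.2 fun x y h => ?_
    induction h with
    | mul_comm x y =>
      rw [RingCon.ker_apply, map_mul, map_mul]
      simp only [AlgHom.toRingHom_eq_coe, RingHom.coe_coe, TensorAlgebra.lift_ι_apply]
      exact grAction_comm B S hS x y

theorem symAction_ι (hS : ∀ t, powerCoeff (H ⊗[ℂ] H) 0 (S t) = t) (x : NegativeModes H) :
    symAction B S hS (SymmetricAlgebra.ι ℂ _ x) = grAction B S x := by
  change TensorAlgebra.lift ℂ (grAction B S) (TensorAlgebra.ι ℂ x) = _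
  simp

/-- The `S(H ⊗ t⁻¹ ℂ[t⁻¹])`-module structure on `gr V(H, 𝒮)`, for `𝒮(0) = 1`. -/
abbrev grModule (hS : ∀ t, powerCoeff (H ⊗[ℂ] H) 0 (S t) = t) :
    Module (SymmetricAlgebra ℂ (NegativeModes H)) (Gr B S) :=
  Module.compHom _ (symAction B S hS).toRingHom

/-- `V(H, 𝒮)` is of PBW type: `gr V(H, 𝒮)` is a free `S(H ⊗ t⁻¹ ℂ[t⁻¹])`-module. -/
def IsPBWType (hS : ∀ t, powerCoeff (H ⊗[ℂ] H) 0 (S t) = t) : Prop :=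
  letI := grModule B S hS
  Module.Free (SymmetricAlgebra ℂ (NegativeModes H)) (Gr B S)

end Modes

end QVA

end

/-!
A formal distribution `c(z₀, z₁)` that lies in `U((z₀, z₁))` after multiplication by a power of
`z₀ - z₁` has residues `res c n` at `z₀ = z₁`, and satisfies a formal Jacobi identity
(`jacobi_formal`). For a distribution in three variables with poles on the diagonals the iterated
residues obey the rules of contour deformation (`Tri.res_resres`, `resres_comm`).

*Existence.* For a fixed vector `w`, let `a(n)`, `a ∈ H`, act on the `V(H, 𝒮)`-valued fields `g(z)`
in `fieldSpace` by the residues of `(z₀ - z₁) ^ n a(z₀) g(z₁)`. Deforming contours in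
`a(z₀) b(z₁) g(z₂)` shows that this action satisfies the relations of `V(H, 𝒮)`
(`relator_fieldSpace`), and the identity field applied to `w` is a vacuum vector for it. By the
universal property there is a map `u ↦ Y(u, z) w` compatible with the actions (`exists_vertexMap`).
Induction on `u` and `v` over the words in the modes then gives associativity
(`exists_pole_fieldCorr`) and weak `𝒮`-locality (`exists_swap`) of all vertex operators, with
exchange coefficients in `ℂ[[x]]`; together these are the `𝒮`-Jacobi identity (`sJacobi_of_swap`).
Uniqueness follows from associativity, as `V(H, 𝒮)` is generated from `𝟏` by the modes of `H`.

*Nondegeneracy.* If `V(H, 𝒮)` is of PBW type, then its associated graded space is a polynomial ring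
on the variables `bᵢ(-m)`, for a basis `bᵢ` of `H`. To leading order in the filtration the vector
`Y(u₁, x₁) ⋯ Y(uₙ, xₙ) 𝟏` has as symbol the product of the translates, by `x₁, …, xₙ`, of the
symbols of `u₁, …, uₙ`. Products of translations of a polynomial ring are linearly independent over
`ℂ((x₁))⋯((xₙ))`: this comes down to Hermite interpolation at the distinct points `x₁, …, xₙ`.
Comparing leading terms gives injectivity (`isNondegenerate_of_isPBWType`).

*Braiding.* Nondegeneracy for `n = 2` makes the exchange of `Y(u, z₀)` and `Y(v, z₁)` unique, hence
linear in `u` and `v`; this is `R` (`exists_braiding`). Exchanging twice gives unitarity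
(`isUnitary_braiding`). Exchanging three fields in the two possible orders and nondegeneracy for
`n = 3` give an identity for power series in the differences of three variables (`hexagon`), which
becomes the Yang–Baxter equation (`isYangBaxter_braiding`) by restriction to `x₁ = x`, `x₂ = 0`,
`x₃ = -z`.
-/

open scoped TensorProduct LaurentPolynomial

noncomputable section

set_option linter.unusedSectionVars false

namespace QVA

open Finset Module
open scoped PowerSeries
open OrderDual (toDual ofDual)
open LinearMap (lTensor comp_apply lTensor_tmul rTensor_tmul BilinForm)
open MvPolynomial (monomial aeval_X aeval)
open PowerSeries (coeff heval evalNegHom coeff_mk)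
open HahnSeries (coeff_single_mul ofPowerSeries)
open DirectSum (lof)
open VertexOperator (ncoeff)

variable {U U' : Type*} [AddCommGroup U] [Module ℂ U] [AddCommGroup U'] [Module ℂ U']
  {E E' : Type*} [AddCommGroup E] [Module ℂ E] [AddCommGroup E'] [Module ℂ E']
  {V X Y : Type*} [AddCommGroup V] [Module ℂ V] [AddCommGroup X] [Module ℂ X]
  [AddCommGroup Y] [Module ℂ Y]
  {H : Type*} [AddCommGroup H] [Module ℂ H] {B : BilinForm ℂ H}
  {S : H ⊗[ℂ] H →ₗ[ℂ] (H ⊗[ℂ] H) ⊗[ℂ] ℂ⟦X⟧}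

/-- Formal distributions in two variables, written `∑ c m n z₀ ^ (-m-1) z₁ ^ (-n-1)`. -/
local notation "Dist₂" U:max => ℤ → ℤ → U

/-- Formal distributions in three variables, written
`∑ c m n e z₀ ^ (-m-1) z₁ ^ (-n-1) z₂ ^ (-e-1)`. -/
local notation "Dist₃" U:max => ℤ → ℤ → ℤ → U

/-- `𝕍 B S` is the vacuum module `V(H, 𝒮)`. -/
local notation "𝕍" => VacuumModule

/-! ### Residues of formal distributions in two variables -/

section

lemma iter_succ (d : End ℂ E) (k : ℕ) (x : E) : (d ^ (k + 1)) x = d ((d ^ k) x) := by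
  rw [pow_succ', End.mul_apply]

lemma iter_mem {d : End ℂ E} {P : E → Prop} (hd : ∀ x, P x → P (d x)) {x : E} (hx : P x) (k : ℕ) :
    P ((d ^ k) x) := by
  induction k with
  | zero => exact hx
  | succ k ih => rw [iter_succ]; exact hd _ ih

lemma iter_intertwine {d : End ℂ E} {d' : End ℂ E'} {P : E → Prop} (hd : ∀ x, P x → P (d x))
    {A : E → E'} (hA : ∀ x, P x → A (d x) = d' (A x)) {x : E} (hx : P x) (k : ℕ) :
    A ((d ^ k) x) = (d' ^ k) (A x) := by
  induction k with
  | zero => rfl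
  | succ k ih => rw [iter_succ, hA _ (iter_mem hd hx k), ih, iter_succ]

lemma iter_map {d : End ℂ E} {d' : End ℂ E'} {A : E → E'} (hA : ∀ x, A (d x) = d' (A x)) (k : ℕ)
    (x : E) : A ((d ^ k) x) = (d' ^ k) (A x) :=
  iter_intertwine (P := fun _ => True) (fun _ h => h) (fun x _ => hA x) trivial k

lemma finsum_eq_sum_range {M : Type*} [AddCommMonoid M] {f : ℕ → M} {K : ℕ}
    (h : ∀ i, K ≤ i → f i = 0) : ∑ᶠ i, f i = ∑ i ∈ range K, f i :=
  finsum_eq_sum_of_support_subset _ fun i hi => by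
    by_contra hc
    exact hi (h i (by simpa using hc))

lemma finsum_int_eq_sum_range {M : Type*} [AddCommMonoid M] {f : ℤ → M} (A : ℤ) (L : ℕ)
    (h : ∀ m, f m ≠ 0 → A ≤ m ∧ m < A + L) : ∑ᶠ m, f m = ∑ j ∈ range L, f (A + j) := by
  have hinj : Function.Injective fun j : ℕ => A + (j : ℤ) := fun i j hij => by simpa using hij
  rw [finsum_eq_sum_of_support_subset (s := (range L).map ⟨_, hinj⟩), sum_map]
  · rfl
  · intro m hm
    obtain ⟨h1, h2⟩ := h m hm
    simp only [coe_map, Function.Embedding.coeFn_mk, Set.mem_image, coe_range, Set.mem_Iio]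
    exact ⟨(m - A).toNat, by omega, by omega⟩

/-- Multiplication by `z₀ - z₁` on formal distributions `∑ c m n z₀ ^ (-m-1) z₁ ^ (-n-1)`. -/
def dif : End ℂ (Dist₂ U) where
  toFun c := fun m n => c (m + 1) n - c m (n + 1)
  map_add' c c' := by ext m n; simp; abel
  map_smul' r c := by ext m n; simp [smul_sub]

variable {N : ℤ} {k : ℕ} {c c' : Dist₂ U}

lemma dif_apply (c : Dist₂ U) (m n : ℤ) : dif c m n = c (m + 1) n - c m (n + 1) := rfl

/-- The coefficients of `c` vanish for large first mode: in each power of the second variable, the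
poles in the first variable are bounded uniformly. -/
def Tr0 (N : ℤ) (c : Dist₂ U) : Prop := ∀ m n, N ≤ m → c m n = 0

/-- The coefficients of `c` vanish for large second mode. -/
def Tr1 (N : ℤ) (c : Dist₂ U) : Prop := ∀ m n, N ≤ n → c m n = 0

lemma Tr0.dif (h : Tr0 N c) : Tr0 N (dif c) := fun m n hm => by
  rw [dif_apply, h _ _ (by omega), h _ _ hm, sub_zero]

lemma Tr1.dif (h : Tr1 N c) : Tr1 N (dif c) := fun m n hm => by
  rw [dif_apply, h _ _ hm, h _ _ (by omega), sub_zero]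

lemma Tr0.dif_pow (h : Tr0 N c) (k : ℕ) : Tr0 N ((QVA.dif ^ k) c) := iter_mem (fun _ => Tr0.dif) h k

lemma Tr1.dif_pow (h : Tr1 N c) (k : ℕ) : Tr1 N ((QVA.dif ^ k) c) := iter_mem (fun _ => Tr1.dif) h k

lemma Tr0.mono {N N' : ℤ} (h : Tr0 N c) (hN : N ≤ N') : Tr0 N' c :=
  fun m n hm => h m n (hN.trans hm)

lemma Tr1.mono {N N' : ℤ} (h : Tr1 N c) (hN : N ≤ N') : Tr1 N' c :=
  fun m n hm => h m n (hN.trans hm)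

lemma Tr0.add (h : Tr0 N c) (h' : Tr0 N c') : Tr0 N (c + c') :=
  fun m n hm => by simp [h m n hm, h' m n hm]

lemma Tr1.add (h : Tr1 N c) (h' : Tr1 N c') : Tr1 N (c + c') :=
  fun m n hm => by simp [h m n hm, h' m n hm]

lemma Tr0.smul (r : ℂ) (h : Tr0 N c) : Tr0 N (r • c) := fun m n hm => by simp [h m n hm]

lemma Tr1.smul (r : ℂ) (h : Tr1 N c) : Tr1 N (r • c) := fun m n hm => by simp [h m n hm]

/-- The formal distribution `c` lies in `U((z₀, z₁))`. -/
def Reg (c : Dist₂ U) : Prop := (∃ N, Tr0 N c) ∧ ∃ N, Tr1 N c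

lemma Reg.dif (h : Reg c) : Reg (dif c) := ⟨h.1.imp fun _ => Tr0.dif, h.2.imp fun _ => Tr1.dif⟩

lemma Reg.add (h : Reg c) (h' : Reg c') : Reg (c + c') := by
  obtain ⟨⟨M, hM⟩, N, hN⟩ := h
  obtain ⟨⟨M', hM'⟩, N', hN'⟩ := h'
  exact ⟨⟨max M M', (hM.mono (le_max_left _ _)).add (hM'.mono (le_max_right _ _))⟩,
    max N N', (hN.mono (le_max_left _ _)).add (hN'.mono (le_max_right _ _))⟩

lemma Reg.smul (r : ℂ) (h : Reg c) : Reg (r • c) :=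
  ⟨h.1.imp fun _ => Tr0.smul r, h.2.imp fun _ => Tr1.smul r⟩

lemma Reg.finite (h : Reg c) (F : ℤ → ℤ) (t : ℤ) :
    (Function.support fun m => F m • c m (t - m)).Finite := by
  obtain ⟨⟨M, hM⟩, N, hN⟩ := h
  refine (Set.finite_Ioo (t - N) M).subset fun m hm => ?_
  rw [Set.mem_Ioo]
  by_contra hc
  apply hm
  rcases not_and_or.1 hc with hc | hc
  · simp only [hN m (t - m) (by omega), smul_zero]
  · simp only [hM m (t - m) (by omega), smul_zero]

/-- For `c ∈ U((z₀, z₁))`, the coefficient of `x ^ p` in the Taylor expansion of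
`c(z₁ + x, z₁)`, a distribution in `z₁`; it is zero for `p < 0`. -/
def Tay (p : ℤ) (c : Dist₂ U) : ℤ → U := fun s =>
  if p < 0 then 0 else ∑ᶠ m : ℤ, Ring.choose (-m - 1) p.toNat • c m (s - p - 1 - m)

lemma Tay_neg {p : ℤ} (hp : p < 0) (c : Dist₂ U) : Tay p c = 0 := by ext s; simp [Tay, hp]

lemma Tay_natCast (p : ℕ) (c : Dist₂ U) (s : ℤ) :
    Tay p c s = ∑ᶠ m : ℤ, Ring.choose (-m - 1) p • c m (s - p - 1 - m) := by simp [Tay]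

lemma Tay_dif (p : ℤ) (h : Reg c) : Tay p (dif c) = Tay (p - 1) c := by
  rcases lt_or_ge p 0 with hp | hp
  · rw [Tay_neg hp, Tay_neg (by omega)]
  lift p to ℕ using hp
  ext s
  have key : Tay p (dif c) s = ∑ᶠ m : ℤ,
      (Ring.choose (-m) p - Ring.choose (-m - 1) p) • c m (s - p - m) := by
    rw [Tay_natCast]
    simp only [dif_apply, smul_sub]
    rw [finsum_sub_distrib]
    · simp only [sub_smul]
      rw [finsum_sub_distrib (h.finite _ _) (h.finite _ _)]
      congr 1
      · refine Eq.trans ?_ (finsum_comp_equiv (Equiv.addRight (1 : ℤ))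
          (f := fun m => Ring.choose (-m) p • c m (s - p - m)))
        refine finsum_congr fun m => ?_
        simp only [Equiv.coe_addRight]
        congr 2 <;> ring
      · refine finsum_congr fun m => ?_
        congr 2; ring
    · obtain ⟨⟨M, hM⟩, N, hN⟩ := h
      refine (Set.finite_Ioo (s - p - 1 - N) M).subset fun m hm => ?_
      rw [Set.mem_Ioo]
      by_contra hc
      apply hm
      rcases not_and_or.1 hc with hc | hc
      · simp only [hN (m + 1) (s - p - 1 - m) (by omega), smul_zero]
      · simp only [hM (m + 1) (s - p - 1 - m) (by omega), smul_zero]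
    · have := h.finite (fun m => Ring.choose (-m - 1) p) (s - p)
      have e : (fun m => Ring.choose (-m - 1) p • c m (s - p - 1 - m + 1)) =
          fun m => Ring.choose (-m - 1) p • c m (s - p - m) := by
        ext m; congr 2; ring
      change (Function.support _).Finite
      rw [e]
      exact this
  rw [key]
  rcases p with _ | p
  · rw [Nat.cast_zero, Tay_neg (by omega)]
    simp
  · rw [show ((p + 1 : ℕ) : ℤ) - 1 = p by push_cast; ring, Tay_natCast]
    refine finsum_congr fun m => ?_
    have hp := Ring.choose_succ_succ (-m - 1) p
    rw [sub_add_cancel] at hp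
    rw [hp, add_sub_cancel_right]
    congr 2
    push_cast
    ring

lemma Tay_add (p : ℤ) (h : Reg c) (h' : Reg c') : Tay p (c + c') = Tay p c + Tay p c' := by
  ext s
  simp only [Tay, Pi.add_apply, smul_add]
  split_ifs
  · simp
  · exact finsum_add_distrib (h.finite _ _) (h'.finite _ _)

lemma Tay_map (p : ℤ) (h : Reg c) (φ : U →ₗ[ℂ] U') (s : ℤ) :
    Tay p (fun m n => φ (c m n)) s = φ (Tay p c s) := by
  simp only [Tay]
  split_ifs
  · simp
  · have := AddMonoidHom.map_finsum φ.toAddMonoidHom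
      (h.finite (fun m => Ring.choose (-m - 1) p.toNat) (s - p - 1))
    simp only [LinearMap.toAddMonoidHom_coe, map_zsmul] at this
    rw [this]

lemma Tay_smul (p : ℤ) (h : Reg c) (r : ℂ) : Tay p (r • c) = r • Tay p c := by
  ext s
  exact Tay_map p h (r • LinearMap.id) s

lemma Tay_shift (p : ℤ) (c : Dist₂ U) (s j : ℤ) :
    Tay p (fun m n => c m (n + j)) s = Tay p c (s + j) := by
  simp only [Tay]
  split_ifs
  · rfl
  · refine finsum_congr fun m => ?_
    congr 2; ring

/-- The formal distribution `c`, expanded in the region `|z₀| > |z₁|`, becomes an element of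
`U((z₀, z₁))` when multiplied by `(z₀ - z₁) ^ k`. -/
def Pole (k : ℕ) (c : Dist₂ U) : Prop := Reg ((dif ^ k) c)

lemma Pole.mono {k k' : ℕ} (h : Pole k c) (hk : k ≤ k') : Pole k' c := by
  induction hk with
  | refl => exact h
  | step _ ih => unfold Pole; rw [pow_succ']; exact ih.dif

lemma Pole.dif_pow {k j : ℕ} (h : Pole (k + j) c) : Pole k ((dif ^ j) c) := by
  unfold Pole at h ⊢
  rwa [← End.mul_apply, ← pow_add]

lemma Pole.dif (h : Pole k c) : Pole k (dif c) := by
  have := (h.mono (Nat.le_succ k)).dif_pow (j := 1)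
  rwa [pow_one] at this

lemma Pole.add (h : Pole k c) (h' : Pole k c') :
    Pole k (c + c') := by unfold Pole; rw [map_add]; exact Reg.add h h'

lemma Pole.smul (r : ℂ) (h : Pole k c) : Pole k (r • c) := by
  unfold Pole; rw [map_smul]; exact Reg.smul r h

lemma Pole.zero (k : ℕ) : Pole k (0 : Dist₂ U) := by
  unfold Pole; rw [map_zero]; exact ⟨⟨0, fun _ _ _ => rfl⟩, 0, fun _ _ _ => rfl⟩

open Classical in
/-- The coefficient of `x ^ (-l-1)` in the expansion of `c(z₁ + x, z₁)` at `x = 0`, for a formal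
distribution `c` which has only a pole at `z₀ = z₁`. It is a distribution in `z₁`, and corresponds
to the residue of `(z₀ - z₁) ^ l c(z₀, z₁)` at `z₀ = z₁`. -/
def res (c : Dist₂ U) (l : ℤ) : ℤ → U :=
  if h : ∃ k : ℕ, Pole k c then Tay (h.choose - l - 1) ((dif ^ h.choose) c) else 0

lemma res_eq (h : Pole k c) (l : ℤ) : res c l = Tay (k - l - 1) ((dif ^ k) c) := by
  have step : ∀ j : ℕ, ∀ k : ℕ, Pole k c →
      Tay ((k + j : ℕ) - l - 1) ((dif ^ (k + j)) c) = Tay (k - l - 1) ((dif ^ k) c) := by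
    intro j
    induction j with
    | zero => intros; rfl
    | succ j ih =>
      intro k hk
      rw [← ih k hk, ← add_assoc, iter_succ, Tay_dif _ (hk.mono (Nat.le_add_right k j))]
      congr 1; push_cast; ring
  have he : ∃ k : ℕ, Pole k c := ⟨k, h⟩
  rw [res, dif_pos he]
  rcases le_total k he.choose with hle | hle
  · obtain ⟨j, hj⟩ := Nat.exists_eq_add_of_le hle
    rw [hj]; exact step j k h
  · obtain ⟨j, hj⟩ := Nat.exists_eq_add_of_le hle
    conv_rhs => rw [hj]
    exact (step j _ he.choose_spec).symm

lemma res_dif (h : Pole k c) (l : ℤ) : res (dif c) l = res c (l + 1) := by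
  rw [res_eq h.dif, res_eq h, ← End.mul_apply, ← pow_succ, iter_succ, Tay_dif _ h]
  congr 1; ring

lemma res_eq_zero (h : Pole k c) {l : ℤ} (hl : k ≤ l) : res c l = 0 := by
  rw [res_eq h, Tay_neg (by omega)]

lemma res_add (h : Pole k c) (h' : Pole k c') (l : ℤ) : res (c + c') l = res c l + res c' l := by
  rw [res_eq (h.add h'), res_eq h, res_eq h', map_add, Tay_add _ h h']

lemma res_smul (h : Pole k c) (r : ℂ) (l : ℤ) :
    res (r • c) l = r • res c l := by rw [res_eq (h.smul r), res_eq h, map_smul, Tay_smul _ h]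

lemma res_zero (l : ℤ) : res (0 : Dist₂ U) l = 0 := by
  have := res_smul (Pole.zero (U := U) 0) 0 l
  simpa using this

lemma dif_pow_map (k : ℕ) (c : Dist₂ U) (φ : U →ₗ[ℂ] U') :
    (dif ^ k) (fun m n => φ (c m n)) = fun m n => φ ((dif ^ k) c m n) :=
  (iter_map (A := fun c m n => φ (c m n)) (fun c => by ext m n; simp [dif_apply]) k c).symm

lemma Reg.map (h : Reg c) (φ : U →ₗ[ℂ] U') : Reg fun m n => φ (c m n) :=
  ⟨h.1.imp fun _ hN m n hm => (congrArg φ (hN m n hm)).trans (map_zero φ),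
    h.2.imp fun _ hN m n hm => (congrArg φ (hN m n hm)).trans (map_zero φ)⟩

lemma Pole.map (h : Pole k c) (φ : U →ₗ[ℂ] U') :
    Pole k fun m n => φ (c m n) := by unfold Pole; rw [dif_pow_map]; exact Reg.map h φ

lemma res_map (h : Pole k c) (φ : U →ₗ[ℂ] U') (l s : ℤ) :
    res (fun m n => φ (c m n)) l s = φ (res c l s) := by
  rw [res_eq (h.map φ), res_eq h, dif_pow_map, Tay_map _ h]

lemma dif_pow_shift (k : ℕ) (c : Dist₂ U) (i j : ℤ) :
    (dif ^ k) (fun m n => c (m + i) (n + j)) = fun m n => (dif ^ k) c (m + i) (n + j) :=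
  (iter_map (A := fun c m n => c (m + i) (n + j)) (fun c => by
    ext m n; simp only [dif_apply]; congr 2 <;> ring) k c).symm

lemma Pole.shift (h : Pole k c) (i j : ℤ) : Pole k fun m n => c (m + i) (n + j) := by
  unfold Pole; rw [dif_pow_shift]
  obtain ⟨⟨M, hM⟩, N, hN⟩ := h
  exact ⟨⟨M - i, fun m n hm => hM _ _ (by omega)⟩, N - j, fun m n hn => hN _ _ (by omega)⟩

lemma res_shift (h : Pole k c) (l s j : ℤ) :
    res (fun m n => c m (n + j)) l s = res c l (s + j) := by
  have h1 := h.shift 0 j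
  have h2 := dif_pow_shift k c 0 j
  simp only [add_zero] at h1 h2
  rw [res_eq h1, res_eq h, h2, Tay_shift]

lemma res_shift_fst (h : Pole k c) (l s : ℤ) :
    res (fun m n => c (m + 1) n) l s = res c l (s + 1) + res c (l + 1) s := by
  have h1 : (fun m n => c (m + 1) n) = (fun m n => c m (n + 1)) + dif c := by
    ext m n; simp [dif_apply]
  have h2 := h.shift 0 1
  simp only [add_zero] at h2
  rw [h1, res_add h2 h.dif, res_dif h, Pi.add_apply, res_shift h]

/-- A bound on the poles of the residues in terms of the bounds for `(z₀ - z₁) ^ k c`. -/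
lemma Tay_eq_zero {M N : ℤ} (h0 : Tr0 M c) (h1 : Tr1 N c) {p s : ℤ}
    (h : M + N + p ≤ s) : Tay p c s = 0 := by
  simp only [Tay]
  split_ifs
  · rfl
  · refine finsum_eq_zero_of_forall_eq_zero fun m => ?_
    rcases lt_or_ge m M with hm | hm
    · rw [h1 _ _ (by omega), smul_zero]
    · rw [h0 _ _ hm, smul_zero]

/-- The coefficient of `z₀ ^ (-m-1) z₁ ^ (-n-1)` in `(z₀ - z₁) ^ l c(z₀, z₁)`, expanded in
nonnegative powers of `z₁`. -/
def mulPow01 (l m n : ℤ) (c : Dist₂ U) : U :=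
  ∑ᶠ i : ℕ, ((-1) ^ i * Ring.choose l i : ℤ) • c (m + l - i) (n + i)

/-- The coefficient of `z₀ ^ (-m-1) z₁ ^ (-n-1)` in `(z₀ - z₁) ^ l c(z₀, z₁)`, expanded in
nonnegative powers of `z₀`. -/
def mulPow10 (l m n : ℤ) (c : Dist₂ U) : U :=
  ∑ᶠ i : ℕ, (l.negOnePow * ((-1) ^ i * Ring.choose l i) : ℤ) • c (m + i) (n + l - i)

lemma mulPow01_eq (h : Tr1 N c) (l m n : ℤ) {K : ℕ} (hK : N ≤ n + K) : mulPow01 l m n c =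
      ∑ i ∈ range K, ((-1) ^ i * Ring.choose l i : ℤ) • c (m + l - i) (n + i) :=
  finsum_eq_sum_range fun i hi => by rw [h _ _ (by omega), smul_zero]

lemma mulPow10_eq (h : Tr0 N c) (l m n : ℤ) {K : ℕ} (hK : N ≤ m + K) :
    mulPow10 l m n c = ∑ i ∈ range K,
      (l.negOnePow * ((-1) ^ i * Ring.choose l i) : ℤ) • c (m + i) (n + l - i) :=
  finsum_eq_sum_range fun i hi => by rw [h _ _ (by omega), smul_zero]

lemma mulPow01_zero (m n : ℤ) (c : Dist₂ U) : mulPow01 0 m n c = c m n := by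
  rw [mulPow01, finsum_eq_single _ 0]
  · simp
  · intro i hi
    rw [Ring.choose_zero_pos ℤ (Nat.pos_of_ne_zero hi), mul_zero, zero_smul]

lemma mulPow01_dif (h : Tr1 N c) (l m n : ℤ) : mulPow01 l m n (dif c) = mulPow01 (l + 1) m n c := by
  obtain ⟨K, hK⟩ : ∃ K : ℕ, N ≤ n + K := ⟨(N - n).toNat, by omega⟩
  rw [mulPow01_eq h.dif l m n hK, mulPow01_eq h (l + 1) m n (K := K + 1) (by push_cast; omega)]
  simp only [dif_apply, smul_sub, sum_sub_distrib]
  rw [sum_range_succ' (n := K)]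
  simp only [Ring.choose_succ_succ, mul_add, add_smul, sum_add_distrib]
  rw [sub_eq_iff_eq_add]
  have e1 : ∑ x ∈ range K, ((-1) ^ (x + 1) * Ring.choose l x : ℤ) •
      c (m + (l + 1) - (x + 1 : ℕ)) (n + (x + 1 : ℕ)) =
      - ∑ x ∈ range K, ((-1) ^ x * Ring.choose l x : ℤ) • c (m + l - x) (n + x + 1) := by
    rw [← sum_neg_distrib]
    refine sum_congr rfl fun x _ => ?_
    rw [← neg_smul]
    congr 2
    · ring
    · push_cast; ring
    · push_cast; ring
  have e2 : ∑ x ∈ range K, ((-1) ^ x * Ring.choose l x : ℤ) • c (m + l - x + 1) (n + x) =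
      ∑ x ∈ range K, ((-1) ^ (x + 1) * Ring.choose l (x + 1) : ℤ) •
        c (m + (l + 1) - (x + 1 : ℕ)) (n + (x + 1 : ℕ)) + c (m + l + 1) n := by
    have h0 := sum_range_succ (fun x : ℕ => ((-1) ^ x * Ring.choose l x : ℤ) •
      c (m + l - x + 1) (n + x)) K
    rw [h _ (n + K) (by omega), smul_zero, add_zero] at h0
    rw [← h0, sum_range_succ']
    congr 1
    · refine sum_congr rfl fun x _ => ?_
      congr 2; push_cast; ring
    · simp
  have e3 : ((-1) ^ 0 * Ring.choose (l + 1) 0 : ℤ) • c (m + (l + 1) - (0 : ℕ)) (n + (0 : ℕ)) =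
      c (m + l + 1) n := by
    simp [add_assoc]
  rw [e1, e2, e3]
  abel

lemma mulPow10_eq_swap (h : Tr0 N c) (l m n : ℤ) :
    mulPow10 l m n c = (l.negOnePow : ℤ) • mulPow01 l n m fun m n => c n m := by
  obtain ⟨K, hK⟩ : ∃ K : ℕ, N ≤ m + K := ⟨(N - m).toNat, by omega⟩
  rw [mulPow10_eq h l m n hK, mulPow01_eq (N := N) (fun _ _ hn => h _ _ hn) l n m hK, smul_sum]
  simp only [smul_smul]

lemma mulPow10_zero (h : Tr0 N c) (m n : ℤ) : mulPow10 0 m n c = c m n := by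
  rw [mulPow10_eq_swap h, mulPow01_zero]
  simp

lemma mulPow10_dif (h : Tr0 N c) (l m n : ℤ) : mulPow10 l m n (dif c) = mulPow10 (l + 1) m n c := by
  have e : (fun m n => dif c n m) = dif (-fun m n => c n m) := by ext m n; simp [dif_apply]; abel
  rw [mulPow10_eq_swap h.dif, mulPow10_eq_swap h, e,
    mulPow01_dif (N := N) fun m n hn => by simp [h n m hn]]
  simp [mulPow01, Int.negOnePow_succ, finsum_neg_distrib]

lemma mulPow01_dif_pow (h : Tr1 N c) (k : ℕ) (l m n : ℤ) :
    mulPow01 l m n ((dif ^ k) c) = mulPow01 (l + k) m n c := by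
  induction k generalizing l with
  | zero => simp
  | succ k ih =>
    rw [iter_succ, mulPow01_dif (h.dif_pow k), ih]
    congr 1; push_cast; ring

lemma mulPow10_dif_pow (h : Tr0 N c) (k : ℕ) (l m n : ℤ) :
    mulPow10 l m n ((dif ^ k) c) = mulPow10 (l + k) m n c := by
  induction k generalizing l with
  | zero => simp
  | succ k ih =>
    rw [iter_succ, mulPow10_dif (h.dif_pow k), ih]
    congr 1; push_cast; ring

end

/-! ### The formal Jacobi identity -/

lemma choose_neg_one_sub (p i : ℕ) :
    Ring.choose (-1 - (p : ℤ)) i = (-1) ^ i * ((p + i).choose p : ℤ) := by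
  have h := Ring.choose_neg (1 + (p : ℤ)) i
  rw [show -(1 + (p : ℤ)) = -1 - p by ring, show (1 + (p : ℤ)) + i - 1 = ((p + i : ℕ) : ℤ) by
    push_cast; ring, Ring.choose_natCast, Int.negOnePow_def] at h
  rw [h, Nat.choose_symm_add]
  simp [Units.smul_def]

lemma mulPow01_sub_mulPow10 {M N : ℤ} {g : Dist₂ U} (h0 : Tr0 M g) (h1 : Tr1 N g) (p : ℕ)
    (m n : ℤ) : mulPow01 (-1 - p) m n g - mulPow10 (-1 - p) m n g =
      ∑ᶠ m' : ℤ, Ring.choose (m - m' - 1) p • g m' (m + n - 1 - p - m') := by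
  obtain ⟨K₁, hK₁⟩ : ∃ K : ℕ, N ≤ n + K := ⟨(N - n).toNat, by omega⟩
  obtain ⟨K₂, hK₂⟩ : ∃ K : ℕ, M ≤ m + K := ⟨(M - m).toNat, by omega⟩
  rw [mulPow01_eq h1 _ _ _ hK₁, mulPow10_eq h0 _ _ _ hK₂,
    finsum_int_eq_sum_range (m - p - K₁) (K₁ + (p + K₂)), sum_range_add,
    sum_range_add, ← sum_range_reflect]
  · have e1 : ∑ x ∈ range p, Ring.choose (m - (m - p - K₁ + (K₁ + x : ℕ)) - 1) p •
        g (m - p - K₁ + (K₁ + x : ℕ)) (m + n - 1 - p - (m - p - K₁ + (K₁ + x : ℕ))) = 0 := by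
      refine sum_eq_zero fun x hx => ?_
      have hx' := mem_range.1 hx
      rw [show m - (m - p - K₁ + ((K₁ + x : ℕ) : ℤ)) - 1 = ((p - 1 - x : ℕ) : ℤ) by omega,
        Ring.choose_natCast, Nat.choose_eq_zero_of_lt (by omega), Nat.cast_zero, zero_smul]
    rw [e1, zero_add, sub_eq_add_neg, ← sum_neg_distrib]
    congr 1
    · refine sum_congr rfl fun x hx => ?_
      have hx' := mem_range.1 hx
      rw [choose_neg_one_sub, ← mul_assoc, ← pow_add, ← two_mul, pow_mul, neg_one_sq, one_pow,
        one_mul, show m - (m - p - K₁ + (x : ℤ)) - 1 = ((p + (K₁ - 1 - x) : ℕ) : ℤ) by omega,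
        Ring.choose_natCast]
      congr 2 <;> omega
    · refine sum_congr rfl fun x hx => ?_
      rw [choose_neg_one_sub, ← neg_smul, show m - (m - p - K₁ + ((K₁ + (p + x) : ℕ) : ℤ)) - 1 =
        -1 - (x : ℤ) by omega, choose_neg_one_sub, add_comm x p, Nat.choose_symm_add,
        ← mul_assoc ((-1) ^ x : ℤ), ← pow_add, ← two_mul x, pow_mul, neg_one_sq, one_pow, one_mul]
      congr 2
      · have : ((-1 - p : ℤ).negOnePow : ℤ) = -(-1) ^ p := by
          rw [show (-1 - p : ℤ) = -((p : ℤ) + 1) by ring, Int.negOnePow_neg, Int.negOnePow_succ]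
          simp [Int.negOnePow_def]
        rw [this]; ring
      · omega
      · omega
  · intro m' hm'
    by_contra hc
    apply hm'
    rcases lt_or_ge m' M with h | h
    · rw [h1 _ _ (by push_cast at hc; omega), smul_zero]
    · rw [h0 _ _ h, smul_zero]

lemma sum_choose_smul_Tay {M N : ℤ} {g : Dist₂ U} (h0 : Tr0 M g) (h1 : Tr1 N g) (p : ℕ)
    (m n : ℤ) : ∑ᶠ i : ℕ, Ring.choose m i • Tay (p - i) g (m + n - i) =
      ∑ᶠ m' : ℤ, Ring.choose (m - m' - 1) p • g m' (m + n - 1 - p - m') := by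
  rw [finsum_eq_sum_range (K := p + 1)
    (fun i hi => by rw [Tay_neg (by omega), Pi.zero_apply, smul_zero])]
  have e : ∀ i ∈ range (p + 1), Ring.choose m i • Tay (p - i) g (m + n - i) =
      ∑ᶠ m' : ℤ, (Ring.choose m i * Ring.choose (-m' - 1) (p - i)) • g m' (m + n - 1 - p - m') := by
    intro i hi
    have hi' := mem_range.1 hi
    rw [show (p : ℤ) - i = ((p - i : ℕ) : ℤ) by omega, Tay_natCast,
      smul_finsum' _ (Reg.finite ⟨⟨M, h0⟩, N, h1⟩ _ _)]
    refine finsum_congr fun m' => ?_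
    rw [mul_smul]
    congr 3
    omega
  rw [sum_congr rfl e, ← finsum_sum_comm]
  · refine finsum_congr fun m' => ?_
    rw [← sum_smul]
    congr 1
    rw [show m - m' - 1 = m + (-m' - 1) by ring, Ring.add_choose_eq p (Commute.all _ _),
      Finset.Nat.sum_antidiagonal_eq_sum_range_succ_mk]
  · intro i _
    exact Reg.finite ⟨⟨M, h0⟩, N, h1⟩ (fun m' => Ring.choose m i * Ring.choose (-m' - 1) (p - i)) _

/-- The Jacobi identity for two formal distributions, expanded in the regions `|z₀| > |z₁|` and
`|z₁| > |z₀|`, which agree after multiplication by `(z₀ - z₁) ^ k`. -/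
lemma jacobi_formal {c c' : Dist₂ U} {k : ℕ} {M N : ℤ} (h : (dif ^ k) c = (dif ^ k) c')
    (h1 : Tr1 N c) (h0 : Tr0 M c') (l m n : ℤ) : mulPow01 l m n c - mulPow10 l m n c' =
      ∑ᶠ i : ℕ, Ring.choose m i • res c (l + i) (m + n - i) := by
  have g1 : Tr1 N ((dif ^ k) c) := h1.dif_pow k
  have g0 : Tr0 M ((dif ^ k) c) := h ▸ h0.dif_pow k
  have hp : Pole k c := ⟨⟨M, g0⟩, N, g1⟩
  rcases le_or_gt (k : ℤ) l with hl | hl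
  · obtain ⟨j, rfl⟩ : ∃ j : ℕ, l = k + j := ⟨(l - k).toNat, by omega⟩
    have e1 := mulPow01_dif_pow h1 (k + j) 0 m n
    have e2 := mulPow10_dif_pow h0 (k + j) 0 m n
    rw [mulPow01_zero, add_comm k j, pow_add, End.mul_apply, h, zero_add] at e1
    rw [mulPow10_zero (h0.dif_pow _), add_comm k j, pow_add, End.mul_apply, zero_add] at e2
    rw [show (k : ℤ) + j = ((j + k : ℕ) : ℤ) by push_cast; ring, ← e1, ← e2, sub_self,
      finsum_eq_zero_of_forall_eq_zero]
    intro i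
    rw [res_eq_zero hp (by push_cast; omega), Pi.zero_apply, smul_zero]
  · obtain ⟨p, rfl⟩ : ∃ p : ℕ, l = -1 - p + k := ⟨(k - 1 - l).toNat, by omega⟩
    rw [← mulPow01_dif_pow h1, ← mulPow10_dif_pow h0, ← h, mulPow01_sub_mulPow10 g0 g1,
      ← sum_choose_smul_Tay g0 g1]
    refine finsum_congr fun i => ?_
    rw [res_eq hp]
    rw [show (k : ℤ) - (-1 - p + k + i) - 1 = p - i by ring]

/-- Weak associativity: if multiplication by `(z₀ - z₁) ^ k` leaves no pole in `z₀` of order greater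
than `m`, the second term of the Jacobi identity vanishes. -/
lemma assoc_formal {c : Dist₂ U} {k : ℕ} {M N : ℤ} (h1 : Tr1 N c) (h0 : Tr0 M ((dif ^ k) c))
    (l m n : ℤ) (hm : M ≤ m) : mulPow01 l m n c =
      ∑ᶠ i : ℕ, Ring.choose m i • res c (l + i) (m + n - i) := by
  have g1 : Tr1 N ((dif ^ k) c) := h1.dif_pow k
  have hp : Pole k c := ⟨⟨M, h0⟩, N, g1⟩
  rcases le_or_gt (k : ℤ) l with hl | hl
  · obtain ⟨j, rfl⟩ : ∃ j : ℕ, l = k + j := ⟨(l - k).toNat, by omega⟩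
    have e1 := mulPow01_dif_pow h1 (k + j) 0 m n
    rw [mulPow01_zero, add_comm k j, pow_add, End.mul_apply, zero_add, h0.dif_pow j _ _ hm] at e1
    rw [show (k : ℤ) + j = ((j + k : ℕ) : ℤ) by push_cast; ring, ← e1,
      finsum_eq_zero_of_forall_eq_zero]
    intro i
    rw [res_eq_zero hp (by push_cast; omega), Pi.zero_apply, smul_zero]
  · obtain ⟨p, rfl⟩ : ∃ p : ℕ, l = -1 - p + k := ⟨(k - 1 - l).toNat, by omega⟩
    have e2 : mulPow10 (-1 - p) m n ((dif ^ k) c) = 0 := by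
      rw [mulPow10_eq h0 _ _ _ (K := 0) (by simpa using hm)]; simp
    rw [← mulPow01_dif_pow h1, ← sub_zero (mulPow01 _ _ _ _), ← e2, mulPow01_sub_mulPow10 h0 g1,
      ← sum_choose_smul_Tay h0 g1]
    refine finsum_congr fun i => ?_
    rw [res_eq hp]
    rw [show (k : ℤ) - (-1 - p + k + i) - 1 = p - i by ring]

/-! ### Iterated residues of formal distributions in three variables -/

section

/-- Multiplication by `z₀ - z₁` on formal distributions in `z₀, z₁, z₂`. -/
def d01 : End ℂ (Dist₃ U) where
  toFun c := fun m n e => c (m + 1) n e - c m (n + 1) e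
  map_add' c c' := by ext m n e; simp; abel
  map_smul' r c := by ext m n e; simp [smul_sub]

/-- Multiplication by `z₀ - z₂` on formal distributions in `z₀, z₁, z₂`. -/
def d02 : End ℂ (Dist₃ U) where
  toFun c := fun m n e => c (m + 1) n e - c m n (e + 1)
  map_add' c c' := by ext m n e; simp; abel
  map_smul' r c := by ext m n e; simp [smul_sub]

/-- Multiplication by `z₁ - z₂` on formal distributions in `z₀, z₁, z₂`. -/
def d12 : End ℂ (Dist₃ U) where
  toFun c := fun m n e => c m (n + 1) e - c m n (e + 1)
  map_add' c c' := by ext m n e; simp; abel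
  map_smul' r c := by ext m n e; simp [smul_sub]

lemma d01_apply (c : Dist₃ U) (m n e : ℤ) : d01 c m n e = c (m + 1) n e - c m (n + 1) e := rfl

lemma d02_apply (c : Dist₃ U) (m n e : ℤ) : d02 c m n e = c (m + 1) n e - c m n (e + 1) := rfl

lemma d12_apply (c : Dist₃ U) (m n e : ℤ) : d12 c m n e = c m (n + 1) e - c m n (e + 1) := rfl

lemma commute_d01_d02 : Commute (d01 : End ℂ (Dist₃ U)) d02 := by
  ext c m n e
  simp only [End.mul_apply, d01_apply, d02_apply]
  abel

lemma commute_d01_d12 : Commute (d01 : End ℂ (Dist₃ U)) d12 := by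
  ext c m n e
  simp only [End.mul_apply, d01_apply, d12_apply]
  abel

lemma commute_d02_d12 : Commute (d02 : End ℂ (Dist₃ U)) d12 := by
  ext c m n e
  simp only [End.mul_apply, d02_apply, d12_apply]
  abel

lemma d12_pow_apply (k : ℕ) (c : Dist₃ U) (m : ℤ) : (d12 ^ k) c m = (dif ^ k) (c m) :=
  iter_map (A := fun c : Dist₃ U => c m) (fun _ => rfl) k c

lemma d01_pow_apply (k : ℕ) (c : Dist₃ U) (m n e : ℤ) :
    (d01 ^ k) c m n e = (dif ^ k) (fun m n => c m n e) m n :=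
  congrFun₂ (iter_map (A := fun (c : Dist₃ U) m n => c m n e) (fun _ => rfl) k c) m n

lemma d02_pow_apply (k : ℕ) (c : Dist₃ U) (m n e : ℤ) :
    (d02 ^ k) c m n e = (dif ^ k) (fun m e => c m n e) m e :=
  congrFun₂ (iter_map (A := fun (c : Dist₃ U) m e => c m n e) (fun _ => rfl) k c) m e

/-- The residues at `z₁ = z₂`; the result is a distribution in `z₀, z₂`. -/
def res12 (c : Dist₃ U) (n : ℤ) : Dist₂ U := fun m e => res (c m) n e

/-- The residues at `z₀ = z₁`; the result is a distribution in `z₁, z₂`. -/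
def res01 (c : Dist₃ U) (l : ℤ) : Dist₂ U := fun n e => res (fun m n' => c m n' e) l n

/-- The iterated residues at `z₁ = z₂` and `z₀ = z₂`. With `z₀ = z₂ + x₀` and `z₁ = z₂ + x₁`, they
are the coefficients of a distribution in `x₀, x₁`, expanded in the region `|x₀| > |x₁|`, with
distributions in `z₂` as coefficients. -/
def resres (c : Dist₃ U) : Dist₃ U := fun m n => res (res12 c n) m

lemma Pole.congr_sub {k : ℕ} {c c' : Dist₂ U} (h : Pole k c) (h' : Pole k c') :
    Pole k (c - c') := by rw [sub_eq_add_neg, ← neg_one_smul ℂ c']; exact h.add (h'.smul _)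

lemma res_sub {k : ℕ} {c c' : Dist₂ U} (h : Pole k c) (h' : Pole k c') (l : ℤ) :
    res (c - c') l = res c l - res c' l := by
  rw [sub_eq_add_neg, ← neg_one_smul ℂ c', res_add h (h'.smul _), res_smul h', neg_one_smul,
    ← sub_eq_add_neg]

/-- If the residues of `d ^ i c` lie in `Z`, the residues of `c` lie in `Z` up to a power of `D`,
where multiplication by `d` acts on the residues `r 0 n` by `D` and a shift of `n`. -/
lemma pow_residue_mem {M : Type*} [AddCommGroup M] [Module ℂ M] (D : End ℂ M)
    (Z : Submodule ℂ M) (hZ : ∀ x ∈ Z, D x ∈ Z) (r : ℕ → ℤ → M) (ε : ℂ) (k : ℕ)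
    (hr : ∀ i n, r (i + 1) n = D (r i n) + ε • r i (n + 1)) (h0 : ∀ i (n : ℤ), k ≤ n → r i n = 0)
    (i : ℕ) (h : ∀ n, r i n ∈ Z) (n : ℤ) : (D ^ (i + (k - n).toNat)) (r 0 n) ∈ Z := by
  induction i generalizing r n with
  | zero => exact iter_mem (P := (· ∈ Z)) hZ (h n) _
  | succ i ih =>
    obtain ⟨q, hq⟩ : ∃ q : ℕ, (k - n).toNat = q := ⟨_, rfl⟩
    induction q generalizing n with
    | zero => rw [h0 0 n (by omega), map_zero]; exact zero_mem _
    | succ q ihq =>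
      have h1 := ih (fun i n => r (i + 1) n) (fun i n => hr (i + 1) n) (fun i n => h0 (i + 1) n) h n
      have h2 := ihq (n + 1) (by omega)
      rw [show i + 1 + (k - (n + 1)).toNat = i + (k - n).toNat by omega] at h2
      have h3 : D (r 0 n) = r (0 + 1) n - ε • r 0 (n + 1) := by rw [hr]; abel
      rw [show i + 1 + (k - n).toNat = i + (k - n).toNat + 1 by omega, pow_succ,
        End.mul_apply, h3, map_sub, map_smul]
      exact sub_mem h1 (Z.smul_mem _ h2)

section

variable {k : ℕ} {c : Dist₃ U} (h : ∀ m, Pole k (c m))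
include h

lemma pole12_shift (j : ℤ) (m : ℤ) : Pole k fun n e => c m n (e + j) := by
  have := (h m).shift 0 j
  simpa only [add_zero] using this

lemma pole12_d01 (m : ℤ) : Pole k (d01 c m) := by
  have := (h m).shift 1 0
  simp only [add_zero] at this
  exact (h (m + 1)).congr_sub this

lemma pole12_d02 (m : ℤ) : Pole k (d02 c m) := (h (m + 1)).congr_sub (pole12_shift h 1 m)

lemma res12_d01 (n : ℤ) : res12 (d01 c) n = dif (res12 c n) - res12 c (n + 1) := by
  ext m e
  have h2 := (h m).shift 1 0
  simp only [add_zero] at h2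
  have : res12 (d01 c) n m e = res (c (m + 1)) n e - res (fun n e => c m (n + 1) e) n e := by
    rw [← Pi.sub_apply, ← res_sub (h (m + 1)) h2]; rfl
  rw [this, res_shift_fst (h m), ← sub_sub]
  rfl

lemma res12_d02 (n : ℤ) : res12 (d02 c) n = dif (res12 c n) := by
  ext m e
  have : res12 (d02 c) n m e = res (c (m + 1)) n e - res (fun n e => c m n (e + 1)) n e := by
    rw [← Pi.sub_apply, ← res_sub (h (m + 1)) (pole12_shift h 1 m)]; rfl
  rw [this, res_shift (h m)]
  rfl

lemma res12_d12 (n : ℤ) : res12 (d12 c) n = res12 c (n + 1) := by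
  ext m e
  exact congrFun (res_dif (h m) n) e

lemma res12_eq_zero {n : ℤ} (hn : k ≤ n) : res12 c n = 0 := by
  ext m e
  rw [res12, res_eq_zero (h m) hn]; rfl

lemma pole12_d01_pow (i : ℕ) : ∀ m, Pole k ((d01 ^ i) c m) :=
  iter_mem (P := fun c : Dist₃ U => ∀ m, Pole k (c m)) (fun _ => pole12_d01) h i

lemma pole12_d02_pow (i : ℕ) : ∀ m, Pole k ((d02 ^ i) c m) :=
  iter_mem (P := fun c : Dist₃ U => ∀ m, Pole k (c m)) (fun _ => pole12_d02) h i

lemma res12_d02_pow (j : ℕ) (n : ℤ) : res12 ((d02 ^ j) c) n = (dif ^ j) (res12 c n) :=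
  iter_intertwine (P := fun c : Dist₃ U => ∀ m, Pole k (c m)) (A := fun c => res12 c n)
    (fun _ => pole12_d02) (fun _ h => res12_d02 h n) h j

/-- The pole order of `res12 c n`, in terms of that of `c` in its first variable. -/
lemma dif_pow_res12_mem (Z : Submodule ℂ (Dist₂ U)) (hZ : ∀ x ∈ Z, dif x ∈ Z) (i j : ℕ)
    (hc : ∀ n, res12 ((d01 ^ i) ((d02 ^ j) c)) n ∈ Z) (n : ℤ) :
    (dif ^ (i + (k - n).toNat + j)) (res12 c n) ∈ Z := by
  have h' := pole12_d02_pow h j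
  have := pow_residue_mem dif Z hZ (fun i n => res12 ((d01 ^ i) ((d02 ^ j) c)) n) (-1) k
    (fun i n => by
      rw [iter_succ, res12_d01 (pole12_d01_pow h' i), neg_one_smul, ← sub_eq_add_neg])
    (fun i n hn => res12_eq_zero (pole12_d01_pow h' i) hn) i hc n
  rw [pow_add, End.mul_apply, ← res12_d02_pow h]
  exact this

end

section

variable {k : ℕ} {c : Dist₃ U} (h : ∀ e, Pole k fun m n => c m n e)
include h

lemma pole01_shift (i j : ℤ) (e : ℤ) : Pole k fun m n => c (m + i) (n + j) e := (h e).shift i j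

lemma pole01_d12 (e : ℤ) : Pole k fun m n => d12 c m n e := by
  have := pole01_shift h 0 1 e
  simp only [add_zero] at this
  exact this.congr_sub (h (e + 1))

lemma pole01_d02 (e : ℤ) : Pole k fun m n => d02 c m n e := by
  have := pole01_shift h 1 0 e
  simp only [add_zero] at this
  exact this.congr_sub (h (e + 1))

lemma res01_d12 (l : ℤ) : res01 (d12 c) l = dif (res01 c l) := by
  ext n e
  have h1 := pole01_shift h 0 1 e
  simp only [add_zero] at h1
  have : res01 (d12 c) l n e = res (fun m n => c m (n + 1) e) l n -
      res (fun m n => c m n (e + 1)) l n := by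
    rw [← Pi.sub_apply, ← res_sub h1 (h (e + 1))]; rfl
  rw [this, res_shift (h e)]
  rfl

lemma res01_d02 (l : ℤ) : res01 (d02 c) l = dif (res01 c l) + res01 c (l + 1) := by
  ext n e
  have h1 := pole01_shift h 1 0 e
  simp only [add_zero] at h1
  have : res01 (d02 c) l n e = res (fun m n => c (m + 1) n e) l n -
      res (fun m n => c m n (e + 1)) l n := by
    rw [← Pi.sub_apply, ← res_sub h1 (h (e + 1))]; rfl
  rw [this, res_shift_fst (h e), Pi.add_apply, Pi.add_apply, dif_apply]
  simp only [res01]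
  abel

lemma res01_d01 (l : ℤ) : res01 (d01 c) l = res01 c (l + 1) := by
  ext n e
  exact congrFun (res_dif (h e) l) n

lemma res01_eq_zero {l : ℤ} (hl : k ≤ l) : res01 c l = 0 := by
  ext n e
  rw [res01, res_eq_zero (h e) hl]; rfl

lemma pole01_d12_pow (i : ℕ) : ∀ e, Pole k fun m n => (d12 ^ i) c m n e :=
  iter_mem (P := fun c : Dist₃ U => ∀ e, Pole k fun m n => c m n e) (fun _ => pole01_d12) h i

lemma pole01_d02_pow (i : ℕ) : ∀ e, Pole k fun m n => (d02 ^ i) c m n e :=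
  iter_mem (P := fun c : Dist₃ U => ∀ e, Pole k fun m n => c m n e) (fun _ => pole01_d02) h i

lemma res01_d12_pow (j : ℕ) (l : ℤ) : res01 ((d12 ^ j) c) l = (dif ^ j) (res01 c l) :=
  iter_intertwine (P := fun c : Dist₃ U => ∀ e, Pole k fun m n => c m n e) (A := fun c => res01 c l)
    (fun _ => pole01_d12) (fun _ h => res01_d12 h l) h j

/-- The pole order of `res01 c l`, in terms of that of `c` in its last variable. -/
lemma dif_pow_res01_mem (Z : Submodule ℂ (Dist₂ U)) (hZ : ∀ x ∈ Z, dif x ∈ Z) (i j : ℕ)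
    (hc : ∀ l, res01 ((d02 ^ i) ((d12 ^ j) c)) l ∈ Z) (l : ℤ) :
    (dif ^ (i + (k - l).toNat + j)) (res01 c l) ∈ Z := by
  have h' := pole01_d12_pow h j
  have := pow_residue_mem dif Z hZ (fun i n => res01 ((d02 ^ i) ((d12 ^ j) c)) n) 1 k (fun i n => by
      rw [iter_succ, res01_d02 (pole01_d02_pow h' i), one_smul])
    (fun i n hn => res01_eq_zero (pole01_d02_pow h' i) hn) i hc l
  rw [pow_add, End.mul_apply, ← res01_d12_pow h]
  exact this

end

/-- The formal distribution `c`, expanded in the region `|z₀| > |z₁| > |z₂|`, has poles of order at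
most `i`, `j`, `k` at `z₀ = z₁`, `z₀ = z₂`, `z₁ = z₂` and no other singularities. -/
structure Tri (i j k : ℕ) (c : Dist₃ U) : Prop where
  pole01 : ∀ e, Pole i fun m n => c m n e
  bound12 : ∃ N, ∀ m, Tr0 N ((dif ^ k) (c m)) ∧ Tr1 N ((dif ^ k) (c m))
  bound : ∃ N, ∀ m n e, N ≤ m ∨ N ≤ n ∨ N ≤ e → (d01 ^ i) ((d02 ^ j) ((d12 ^ k) c)) m n e = 0

variable {i j k : ℕ} {c : Dist₃ U}

lemma Tri.pole12 (h : Tri i j k c) (m : ℤ) : Pole k (c m) := by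
  obtain ⟨N, hN⟩ := h.bound12
  exact ⟨⟨N, (hN m).1⟩, N, (hN m).2⟩

lemma Tri.d01 (h : Tri (i + 1) j k c) : Tri i j k (d01 c) where
  pole01 e := by
    have := (h.pole01 e).dif_pow (j := 1)
    rwa [pow_one] at this
  bound12 := by
    obtain ⟨N, hN⟩ := h.bound12
    refine ⟨N, fun m => ?_⟩
    have e1 : (dif ^ k) (QVA.d01 c m) = (dif ^ k) (c (m + 1)) -
        fun n e => (dif ^ k) (c m) (n + 1) e := by
      have := dif_pow_shift k (c m) 1 0
      simp only [add_zero] at this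
      rw [← this, ← map_sub]; rfl
    rw [e1]
    exact ⟨fun n e hn => by
        rw [Pi.sub_apply, Pi.sub_apply, (hN _).1 _ _ hn, (hN _).1 _ _ (by omega), sub_zero],
      fun n e hn => by
        rw [Pi.sub_apply, Pi.sub_apply, (hN _).2 _ _ hn, (hN _).2 _ _ hn, sub_zero]⟩
  bound := by
    have e : (QVA.d01 ^ i) ((QVA.d02 ^ j) ((d12 ^ k) (QVA.d01 c))) =
        (QVA.d01 ^ (i + 1)) ((QVA.d02 ^ j) ((d12 ^ k) c)) := by
      simp only [← End.mul_apply]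
      rw [← (commute_d01_d12.pow_right k).eq, ← mul_assoc (QVA.d02 ^ j),
        ← (commute_d01_d02.pow_right j).eq, pow_succ]
      simp only [mul_assoc]
    rw [e]
    exact h.bound

lemma Tri.d02 (h : Tri i (j + 1) k c) : Tri i j k (d02 c) where
  pole01 := pole01_d02 h.pole01
  bound12 := by
    obtain ⟨N, hN⟩ := h.bound12
    refine ⟨N, fun m => ?_⟩
    have e1 : (dif ^ k) (QVA.d02 c m) = (dif ^ k) (c (m + 1)) -
        fun n e => (dif ^ k) (c m) n (e + 1) := by
      have := dif_pow_shift k (c m) 0 1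
      simp only [add_zero] at this
      rw [← this, ← map_sub]; rfl
    rw [e1]
    exact ⟨fun n e hn => by
        rw [Pi.sub_apply, Pi.sub_apply, (hN _).1 _ _ hn, (hN _).1 _ _ hn, sub_zero],
      fun n e hn => by
        rw [Pi.sub_apply, Pi.sub_apply, (hN _).2 _ _ hn, (hN _).2 _ _ (by omega), sub_zero]⟩
  bound := by
    have e : (QVA.d01 ^ i) ((QVA.d02 ^ j) ((d12 ^ k) (QVA.d02 c))) =
        (QVA.d01 ^ i) ((QVA.d02 ^ (j + 1)) ((d12 ^ k) c)) := by
      simp only [← End.mul_apply]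
      rw [← (commute_d02_d12.pow_right k).eq, pow_succ]
      simp only [mul_assoc]
    rw [e]
    exact h.bound

lemma Tri.d12 (h : Tri i j (k + 1) c) : Tri i j k (d12 c) where
  pole01 := pole01_d12 h.pole01
  bound12 := by
    obtain ⟨N, hN⟩ := h.bound12
    exact ⟨N, fun m => by
      have := hN m
      rwa [pow_succ, End.mul_apply] at this⟩
  bound := by
    have := h.bound
    rwa [pow_succ] at this

lemma res12_tr1 {k : ℕ} {N : ℤ}
    (h : ∀ m, Tr0 N ((dif ^ k) (c m)) ∧ Tr1 N ((dif ^ k) (c m))) (n : ℤ) :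
    Tr1 (N + N + (k - n - 1)) (res12 c n) := by
  intro m e he
  rw [res12, res_eq (k := k) ⟨⟨N, (h m).1⟩, N, (h m).2⟩]
  exact Tay_eq_zero (h m).1 (h m).2 he

/-- The space `U((z₀, z₁))` of regular distributions. -/
def trSubmodule : Submodule ℂ (Dist₂ U) where
  carrier := {c | Reg c}
  zero_mem' := ⟨⟨0, fun _ _ _ => rfl⟩, 0, fun _ _ _ => rfl⟩
  add_mem' h h' := h.add h'
  smul_mem' r _ h := h.smul r

lemma Tri.d01_pow (a : ℕ) (h : Tri (i + a) j k c) : Tri i j k ((QVA.d01 ^ a) c) := by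
  induction a generalizing i with
  | zero => exact h
  | succ a ih => rw [pow_succ']; exact Tri.d01 (ih (by rwa [add_right_comm]))

lemma Tri.d02_pow (a : ℕ) (h : Tri i (j + a) k c) : Tri i j k ((QVA.d02 ^ a) c) := by
  induction a generalizing j with
  | zero => exact h
  | succ a ih => rw [pow_succ']; exact Tri.d02 (ih (by rwa [add_right_comm]))

lemma Tri.d12_pow (a : ℕ) (h : Tri i j (k + a) c) : Tri i j k ((QVA.d12 ^ a) c) := by
  induction a generalizing k with
  | zero => exact h
  | succ a ih => rw [pow_succ']; exact Tri.d12 (ih (by rwa [add_right_comm]))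

/-- A distribution without poles on the diagonals. -/
lemma Tri.exists_bound (h : Tri 0 0 0 c) :
    ∃ N, ∀ m n e, N ≤ m ∨ N ≤ n ∨ N ≤ e → c m n e = 0 := h.bound

/-- `res12 c n` has bounded first mode if `c` has no pole at `z₀ = z₁` and `z₀ = z₂`. -/
lemma Tri.res12_tr0 {k : ℕ} (h : Tri 0 0 k c) : ∃ N, ∀ n, Tr0 N (res12 c n) := by
  obtain ⟨N, hN⟩ := h.bound
  refine ⟨N, fun n m e hm => ?_⟩
  rw [res12, res_eq (h.pole12 m), ← d12_pow_apply]
  have : (QVA.d12 ^ k) c m = 0 := by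
    ext n e
    exact hN m n e (Or.inl hm)
  rw [this, Tay]
  split_ifs
  · rfl
  · simp

lemma Tri.pole_res12 (h : Tri i j k c) (n : ℤ) : Pole (i + (k - n).toNat + j) (res12 c n) := by
  refine dif_pow_res12_mem h.pole12 trSubmodule (fun _ => Reg.dif) i j (fun n => ?_) n
  have h1 : Tri 0 0 k ((QVA.d01 ^ i) ((QVA.d02 ^ j) c)) :=
    Tri.d01_pow i (Tri.d02_pow j (by simpa using h))
  obtain ⟨N, hN⟩ := h1.res12_tr0
  obtain ⟨N', hN'⟩ := h1.bound12
  exact ⟨⟨N, hN n⟩, _, res12_tr1 hN' n⟩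

lemma Tri.pole_res12_zero {j k : ℕ} (h : Tri 0 j k c) (n : ℤ) : Pole j (res12 c n) := by
  unfold Pole
  rw [← res12_d02_pow h.pole12]
  have h1 : Tri 0 0 k ((QVA.d02 ^ j) c) := Tri.d02_pow j (by simpa using h)
  obtain ⟨N, hN⟩ := h1.res12_tr0
  obtain ⟨N', hN'⟩ := h1.bound12
  exact ⟨⟨N, hN n⟩, _, res12_tr1 hN' n⟩

lemma Tri.pole_res01 (h : Tri i j k c) (l : ℤ) : Pole (j + (i - l).toNat + k) (res01 c l) := by
  refine dif_pow_res01_mem h.pole01 trSubmodule (fun _ => Reg.dif) j k (fun l => ?_) l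
  have h1 : Tri i 0 0 ((QVA.d02 ^ j) ((QVA.d12 ^ k) c)) :=
    Tri.d02_pow j (Tri.d12_pow k (by simpa using h))
  obtain ⟨N, hN⟩ := h1.bound
  have key : res01 ((QVA.d02 ^ j) ((QVA.d12 ^ k) c)) l = fun n e =>
      Tay (i - l - 1) (fun m n => (QVA.d01 ^ i) ((QVA.d02 ^ j) ((QVA.d12 ^ k) c)) m n e) n := by
    ext n e
    rw [res01, res_eq (h1.pole01 e)]
    refine congrArg (fun g => Tay _ g n) ?_
    ext m n
    exact (d01_pow_apply i _ m n e).symm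
  rw [key]
  refine ⟨⟨N + N + (i - l - 1), fun n e hn => ?_⟩, N, fun n e he => ?_⟩
  · exact Tay_eq_zero (fun m n hm => hN m n e (Or.inl hm))
      (fun m n hm => hN m n e (Or.inr (Or.inl hm))) hn
  · have : (fun m n => (QVA.d01 ^ i) ((QVA.d02 ^ j) ((QVA.d12 ^ k) c)) m n e) = 0 := by
      ext m n
      exact hN m n e (Or.inr (Or.inr he))
    change Tay _ (fun m n => (QVA.d01 ^ i) ((QVA.d02 ^ j) ((QVA.d12 ^ k) c)) m n e) n = 0
    rw [this]
    simp [Tay]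

lemma Tri.resres_d01 (h : Tri i j k c) : resres (QVA.d01 c) = dif (resres c) := by
  ext m n : 2
  rw [dif_apply, resres, res12_d01 h.pole12, res_sub (h.pole_res12 n).dif
    ((h.pole_res12 (n + 1)).mono (by omega)), res_dif (h.pole_res12 n)]
  rfl

lemma Tri.resres_d02 (h : Tri i j k c) : resres (QVA.d02 c) = fun m n => resres c (m + 1) n := by
  ext m n : 2
  rw [resres, res12_d02 h.pole12, res_dif (h.pole_res12 n)]
  rfl

lemma Tri.resres_d12 (h : Tri i j k c) : resres (QVA.d12 c) = fun m n => resres c m (n + 1) := by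
  ext m n : 2
  rw [resres, res12_d12 h.pole12]
  rfl

lemma Tri.resres_d01_pow (a : ℕ) (h : Tri (i + a) j k c) :
    resres ((QVA.d01 ^ a) c) = (dif ^ a) (resres c) := by
  induction a generalizing i with
  | zero => rfl
  | succ a ih =>
    have h' : Tri (i + 1 + a) j k c := by rwa [add_right_comm]
    rw [iter_succ, Tri.resres_d01 (h'.d01_pow a), ih h', iter_succ]

lemma Tri.tr1_resres (h : Tri i j k c) : Tr1 k (resres c) := by
  intro m n hn
  rw [resres, res12_eq_zero h.pole12 hn, res_zero]

lemma Tri.pole_resres (h : Tri i j k c) : Pole i (resres c) := by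
  have h0 : Tri (0 + i) j k c := by rwa [zero_add]
  unfold Pole
  rw [← Tri.resres_d01_pow i h0]
  have h1 := Tri.d01_pow i h0
  exact ⟨⟨j, fun m n hm => res_eq_zero (h1.pole_res12_zero n) hm⟩, k, h1.tr1_resres⟩

end

lemma Tay_eq_sum {c : Dist₂ U} {M N : ℤ} (h0 : Tr0 M c) (h1 : Tr1 N c) (p : ℕ) (s : ℤ)
    {I : Finset ℤ} (hI : Ioo (s - p - 1 - N) M ⊆ I) :
    Tay p c s = ∑ m ∈ I, Ring.choose (-m - 1) p • c m (s - p - 1 - m) := by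
  rw [Tay_natCast]
  refine finsum_eq_sum_of_support_subset _ fun m hm => hI ?_
  rw [mem_Ioo]
  by_contra hc
  apply hm
  rcases not_and_or.1 hc with hc | hc
  · simp only [h1 m _ (by omega : N ≤ s - p - 1 - m), smul_zero]
  · simp only [h0 m _ (by omega : M ≤ m), smul_zero]

lemma sum_choose_mul_choose (a b : ℤ) (p q : ℕ) :
    ∑ i ∈ range (p + q + 1), (i.choose p : ℤ) * Ring.choose a i *
      Ring.choose b (p + q - i) = Ring.choose a p * Ring.choose (a + b - p) q := by
  rw [show p + q + 1 = p + (q + 1) by ring, sum_range_add]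
  rw [sum_eq_zero (s := range p) fun i hi => by
    rw [Nat.choose_eq_zero_of_lt (mem_range.1 hi)]; simp, zero_add,
    show a + b - p = (a - p) + b by ring, Ring.add_choose_eq _ (Commute.all _ _),
    Finset.Nat.sum_antidiagonal_eq_sum_range_succ_mk, mul_sum]
  refine sum_congr rfl fun t ht => ?_
  have h := Ring.choose_smul_choose a (n := p + t) (k := p) (by omega)
  rw [nsmul_eq_mul] at h
  rw [h, Nat.add_sub_cancel_left, Nat.add_sub_add_left, mul_assoc]

lemma resres_of_bound {G : Dist₃ U} (h : Tri 0 0 0 G) (i n : ℤ) :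
    resres G i n = Tay (-i - 1) (fun m e => Tay (-n - 1) (G m) e) := by
  have h1 : res12 G n = fun m e => Tay (-n - 1) (G m) e := by
    ext m e
    rw [res12, res_eq (h.pole12 m)]
    simp
  rw [resres, res_eq (h.pole_res12_zero n), ← h1]
  simp

/-- The iterated residues of a distribution without poles on the diagonals, as Taylor
coefficients. -/
lemma resres_eq_sum {G : Dist₃ U} (h : Tri 0 0 0 G) {N : ℤ}
    (hN : ∀ m n e, N ≤ m ∨ N ≤ n ∨ N ≤ e → G m n e = 0) (i j : ℕ) (e : ℤ) {I : Finset ℤ}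
    (hI : Ioo (e - i - j - 2 - 2 * N) N ⊆ I) (hI' : ∀ m ∈ I, m < N) :
    resres G (-1 - i) (-1 - j) e = ∑ m ∈ I, ∑ n ∈ I,
      (Ring.choose (-m - 1) i * Ring.choose (-n - 1) j) • G m n (e - i - j - 2 - m - n) := by
  rw [resres_of_bound h, show -(-1 - (i : ℤ)) - 1 = i by ring, show -(-1 - (j : ℤ)) - 1 = j by ring]
  rw [Tay_eq_sum (M := N) (N := N + N + j) (I := I)]
  · refine sum_congr rfl fun m hm => ?_
    have hm := hI' m hm
    rw [Tay_eq_sum (M := N) (N := N) (I := I) (fun n e hn => hN _ _ _ (Or.inr (Or.inl hn)))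
      (fun n e hn => hN _ _ _ (Or.inr (Or.inr hn))), smul_sum]
    · refine sum_congr rfl fun n hn => ?_
      rw [smul_smul]
      congr 2; omega
    · exact (Ioo_subset_Ioo (by omega) le_rfl).trans hI
  · intro m e hm
    have : G m = 0 := by
      ext n e
      exact hN m n e (Or.inl hm)
    beta_reduce
    rw [this]
    simp [Tay]
  · intro m e he
    exact Tay_eq_zero (fun n e hn => hN _ _ _ (Or.inr (Or.inl hn)))
      (fun n e hn => hN _ _ _ (Or.inr (Or.inr hn))) he
  · exact (Ioo_subset_Ioo (by omega) le_rfl).trans hI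

/-- The two ways of expanding a distribution without poles on the diagonals in
`z₀ = z₂ + x₀` and `z₁ = z₂ + x₁`. -/
lemma res_resres_of_bound {G : Dist₃ U} (h : Tri 0 0 0 G) (l n : ℤ) :
    res (resres G) l n = res (res01 G l) n := by
  obtain ⟨N, hN⟩ := h.exists_bound
  rcases le_or_gt 0 l with hl | hl
  · rw [res_eq_zero h.pole_resres (by simpa using hl), res01_eq_zero h.pole01 (by simpa using hl),
      res_zero]
    rfl
  obtain ⟨p, rfl⟩ : ∃ p : ℕ, l = -1 - p := ⟨(-1 - l).toNat, by omega⟩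
  have hl' : (0 : ℕ) - (-1 - (p : ℤ)) - 1 = p := by push_cast; ring
  have hX := resres_of_bound h
  have hX1 : ∀ i n : ℤ, 0 ≤ n → resres G i n = 0 := fun i n hn =>
    h.tr1_resres i n (by simpa using hn)
  have hX0 : ∀ i n : ℤ, 0 ≤ i → resres G i n = 0 := fun i n hn => by
    rw [hX, Tay_neg (by omega)]
  have hR : res01 G (-1 - p) = fun n e => Tay p (fun m n => G m n e) n := by
    ext n e
    rw [res01, res_eq (h.pole01 e), hl']
    rfl
  rw [res_eq h.pole_resres, hl', pow_zero, End.one_apply]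
  rcases le_or_gt 0 n with hn | hn
  · have hP : Pole 0 (res01 G (-1 - p)) := by
      rw [hR]
      refine ⟨⟨N + N + p, fun n e hn => ?_⟩, N, fun n e he => ?_⟩
      · exact Tay_eq_zero (fun m n hm => hN m n e (Or.inl hm))
          (fun m n hm => hN m n e (Or.inr (Or.inl hm))) hn
      · have : (fun m n => G m n e) = 0 := by
          ext m n
          exact hN m n e (Or.inr (Or.inr he))
        simp only [pow_zero, End.one_apply, this]
        simp [Tay]
    rw [res_eq_zero hP (by simpa using hn), Tay_natCast]
    refine finsum_eq_zero_of_forall_eq_zero fun m => ?_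
    rcases le_or_gt 0 m with hm | hm
    · rw [hX0 _ _ hm, smul_zero]
    rcases le_or_gt 0 (n - p - 1 - m) with hm' | hm'
    · rw [hX1 _ _ hm', smul_zero]
    · rw [show -m - 1 = ((-m - 1).toNat : ℤ) by omega, Ring.choose_natCast,
        Nat.choose_eq_zero_of_lt (by omega), Nat.cast_zero, zero_smul]
  obtain ⟨q, rfl⟩ : ∃ q : ℕ, n = -1 - q := ⟨(-1 - n).toNat, by omega⟩
  ext e
  set A : ℤ := e - p - q - 2 - 2 * N with hA
  set I := Ioo A N with hI
  have hP : Pole 0 (res01 G (-1 - p)) := by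
    rw [hR]
    refine ⟨⟨N + N + p, fun n e hn => ?_⟩, N, fun n e he => ?_⟩
    · exact Tay_eq_zero (fun m n hm => hN m n e (Or.inl hm))
        (fun m n hm => hN m n e (Or.inr (Or.inl hm))) hn
    · have : (fun m n => G m n e) = 0 := by
        ext m n
        exact hN m n e (Or.inr (Or.inr he))
      simp only [pow_zero, End.one_apply, this]
      simp [Tay]
  have hL : Tay p (resres G) (-1 - q) e = ∑ m ∈ I, ∑ n ∈ I,
      (Ring.choose (-m - 1) p * Ring.choose (-m - 1 + (-n - 1) - p) q) •
        G m n (e - p - q - 2 - m - n) := by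
    have h1 : Tay p (resres G) (-1 - q) = ∑ i ∈ range (p + q + 1),
        (i.choose p : ℤ) • resres G (-1 - i) (-1 - (p + q - i : ℕ)) := by
      rw [Tay_natCast, finsum_int_eq_sum_range (-1 - (p + q : ℕ)) (p + q + 1), ← sum_range_reflect]
      · refine sum_congr rfl fun i hi => ?_
        rw [mem_range] at hi
        have e1 : -(-1 - ((p + q : ℕ) : ℤ) + ((p + q + 1 - 1 - i : ℕ) : ℤ)) - 1 = (i : ℕ) := by
          omega
        rw [e1, Ring.choose_natCast]
        congr 2 <;> omega
      · intro m hm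
        constructor
        · by_contra hc
          exact hm (by rw [hX1 _ _ (by omega), smul_zero])
        · by_contra hc
          exact hm (by rw [hX0 _ _ (by omega), smul_zero])
    have h2 : ∀ i ∈ range (p + q + 1), resres G (-1 - i) (-1 - (p + q - i : ℕ)) e =
        ∑ m ∈ I, ∑ n ∈ I, (Ring.choose (-m - 1) i * Ring.choose (-n - 1) (p + q - i)) •
          G m n (e - p - q - 2 - m - n) := by
      intro i hi
      rw [mem_range] at hi
      rw [resres_eq_sum h hN i (p + q - i) e (I := I) (Ioo_subset_Ioo (by omega) le_rfl)
        fun m hm => (mem_Ioo.1 hm).2]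
      refine sum_congr rfl fun m _ => sum_congr rfl fun n _ => ?_
      congr 2; omega
    rw [h1, Finset.sum_apply]
    simp only [Pi.smul_apply]
    rw [sum_congr rfl fun i hi => by rw [h2 i hi]]
    simp only [smul_sum, smul_smul]
    rw [sum_comm]
    refine sum_congr rfl fun m _ => ?_
    rw [sum_comm]
    refine sum_congr rfl fun n _ => ?_
    rw [← sum_smul, ← sum_choose_mul_choose]
    simp only [mul_assoc]
  have hRR : res (res01 G (-1 - p)) (-1 - q) e = ∑ m ∈ I, ∑ n ∈ I,
      (Ring.choose (-m - 1) p * Ring.choose (-m - 1 + (-n - 1) - p) q) •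
        G m n (e - p - q - 2 - m - n) := by
    rw [res_eq hP, pow_zero, End.one_apply, show (0 : ℕ) - (-1 - (q : ℤ)) - 1 = q by
      push_cast; ring, hR, Tay_natCast]
    have h1 : ∀ n' : ℤ, Ring.choose (-n' - 1) q • Tay p (fun m n => G m n (e - q - 1 - n')) n' =
        ∑ m ∈ I, (Ring.choose (-m - 1) p * Ring.choose (-n' - 1) q) •
          G m (n' - p - 1 - m) (e - q - 1 - n') := by
      intro n'
      rcases le_or_gt (e - q - 1 - N) n' with hn' | hn'
      · rw [Tay_eq_sum (M := N) (N := N) (I := I) (fun m n hn => hN _ _ _ (Or.inl hn))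
          (fun m n hn => hN _ _ _ (Or.inr (Or.inl hn))), smul_sum]
        · refine sum_congr rfl fun m _ => ?_
          rw [smul_smul, mul_comm]
        · exact Ioo_subset_Ioo (by omega) le_rfl
      · have : (fun m n => G m n (e - q - 1 - n')) = 0 := by
          ext m n
          exact hN m n _ (Or.inr (Or.inr (by omega)))
        rw [this, sum_eq_zero fun m _ => by
          rw [hN m _ _ (Or.inr (Or.inr (by omega))), smul_zero]]
        simp [Tay]
    rw [finsum_congr h1]
    have h2 : ∀ m ∈ I, (Function.support fun n' : ℤ => (Ring.choose (-m - 1) p *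
        Ring.choose (-n' - 1) q) • G m (n' - p - 1 - m) (e - q - 1 - n')).Finite := by
      intro m hm
      refine (Set.finite_Icc (e - q - 1 - N) (N + p + 1 + m)).subset fun n' hn' => ?_
      rw [Set.mem_Icc]
      by_contra hc
      apply hn'
      rcases not_and_or.1 hc with hc | hc
      · simp only [hN m (n' - p - 1 - m) (e - q - 1 - n') (Or.inr (Or.inr (by omega))), smul_zero]
      · simp only [hN m (n' - p - 1 - m) (e - q - 1 - n') (Or.inr (Or.inl (by omega))), smul_zero]
    rw [finsum_sum_comm _ _ h2]
    refine sum_congr rfl fun m hm => ?_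
    rw [hI, mem_Ioo] at hm
    rw [← finsum_comp_equiv (Equiv.addRight (p + 1 + m : ℤ))]
    rw [finsum_eq_sum_of_support_subset (s := I)]
    · refine sum_congr rfl fun n _ => ?_
      simp only [Equiv.coe_addRight]
      congr 2
      · congr 1; ring
      · ring
      · ring
    · intro n hn
      rw [hI, coe_Ioo, Set.mem_Ioo]
      by_contra hc
      apply hn
      simp only [Equiv.coe_addRight]
      rcases not_and_or.1 hc with hc | hc
      · rw [hN m _ _ (Or.inr (Or.inr (by omega))), smul_zero]
      · rw [hN m _ _ (Or.inr (Or.inl (by omega))), smul_zero]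
  rw [hL, hRR]

lemma res_resres_d02 {i j k : ℕ} {c : Dist₃ U} (h : Tri i j k c) (l n : ℤ) :
    res (resres (d02 c)) l n = res (resres c) l (n + 1) + res (resres c) (l + 1) n := by
  rw [h.resres_d02, res_shift_fst h.pole_resres]

lemma res_res01_d02 {i j k : ℕ} {c : Dist₃ U} (h : Tri i j k c) (l n : ℤ) :
    res (res01 (d02 c) l) n = res (res01 c l) (n + 1) + res (res01 c (l + 1)) n := by
  rw [res01_d02 h.pole01, res_add (h.pole_res01 l).dif
    ((h.pole_res01 (l + 1)).mono (by omega)), res_dif (h.pole_res01 l)]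

/-- The residues at `z₀ = z₁` followed by those at `z₁ = z₂`, in terms of the iterated residues at
`z₁ = z₂` and `z₀ = z₂`. -/
lemma Tri.res_resres {i j k : ℕ} {c : Dist₃ U} (h : Tri i j k c) (l n : ℤ) :
    res (resres c) l n = res (res01 c l) n := by
  induction i generalizing c l with
  | succ i ih =>
    have := ih (Tri.d01 h) (l - 1)
    rwa [h.resres_d01, res_dif h.pole_resres, res01_d01 h.pole01, sub_add_cancel] at this
  | zero =>
    induction k generalizing c n with
    | succ k ih =>
      have := ih (n - 1) (Tri.d12 h)
      rwa [h.resres_d12, res_shift h.pole_resres, res01_d12 h.pole01, res_dif (h.pole_res01 l),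
        sub_add_cancel] at this
    | zero =>
      induction j generalizing c l n with
      | zero => exact res_resres_of_bound h l n
      | succ j ih =>
        -- a pole only at `z₀ = z₂`: both sides vanish for `l ≥ 0`, and their difference changes
        -- sign under `(l, n) ↦ (l + 1, n - 1)`
        rcases le_or_gt 0 l with hl | hl
        · rw [res_eq_zero h.pole_resres (by simpa using hl),
            res01_eq_zero h.pole01 (by simpa using hl), res_zero]
          rfl
        obtain ⟨q, hq⟩ : ∃ q : ℕ, (-l).toNat = q := ⟨_, rfl⟩
        induction q generalizing l n with
        | zero => omega
        | succ q ihq =>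
          have h1 := ih l (n - 1) (Tri.d02 h)
          rw [res_resres_d02 h, res_res01_d02 h, sub_add_cancel] at h1
          have h2 : res (resres c) (l + 1) (n - 1) = res (res01 c (l + 1)) (n - 1) := by
            rcases le_or_gt 0 (l + 1) with hl1 | hl1
            · rw [res_eq_zero h.pole_resres (by simpa using hl1),
                res01_eq_zero h.pole01 (by simpa using hl1), res_zero]
              rfl
            · exact ihq (l + 1) (n - 1) hl1 (by omega)
          rwa [h2, add_left_inj] at h1

/-! ### Products with power series in a difference of two variables -/

/-- The sequence `φ (t ^ s x)` is eventually zero. -/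
def LocNil (t : End ℂ E) (φ : E →ₗ[ℂ] U) (x : E) : Prop := ∃ Q : ℕ, ∀ s, Q ≤ s → φ ((t ^ s) x) = 0

/-- `φ (f(t) x)` for a power series `f`, meaningful if `φ (t ^ s x)` vanishes for `s` large. -/
def pwEval (t : End ℂ E) (f : ℂ⟦X⟧) (φ : E →ₗ[ℂ] U) (x : E) : U :=
  ∑ᶠ s : ℕ, coeff s f • φ ((t ^ s) x)

lemma pwEval_eq_sum {t : End ℂ E} {φ : E →ₗ[ℂ] U} {x : E} {Q : ℕ}
    (h : ∀ s, Q ≤ s → φ ((t ^ s) x) = 0) (f : ℂ⟦X⟧) :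
    pwEval t f φ x = ∑ s ∈ range Q, coeff s f • φ ((t ^ s) x) :=
  finsum_eq_sum_range fun s hs => by rw [h s hs, smul_zero]

lemma pwEval_add {t : End ℂ E} {φ : E →ₗ[ℂ] U} {x y : E} (hx : LocNil t φ x)
    (hy : LocNil t φ y) (f : ℂ⟦X⟧) :
    pwEval t f φ (x + y) = pwEval t f φ x + pwEval t f φ y := by
  obtain ⟨Q, hQ⟩ := hx
  obtain ⟨Q', hQ'⟩ := hy
  have h1 : ∀ s, max Q Q' ≤ s → φ ((t ^ s) x) = 0 := fun s hs => hQ s (le_of_max_le_left hs)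
  have h2 : ∀ s, max Q Q' ≤ s → φ ((t ^ s) y) = 0 :=
    fun s hs => hQ' s (le_of_max_le_right hs)
  rw [pwEval_eq_sum h1, pwEval_eq_sum h2, pwEval_eq_sum (Q := max Q Q') fun s hs => by
    rw [map_add, map_add, h1 s hs, h2 s hs, add_zero], ← sum_add_distrib]
  simp only [map_add, smul_add]

lemma pwEval_smul (t : End ℂ E) (φ : E →ₗ[ℂ] U) (x : E) (f : ℂ⟦X⟧) (r : ℂ) :
    pwEval t f φ (r • x) = r • pwEval t f φ x := by
  simp only [pwEval, map_smul, smul_finsum, smul_comm r]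

lemma pwEval_zero (t : End ℂ E) (φ : E →ₗ[ℂ] U) (f : ℂ⟦X⟧) :
    pwEval t f φ 0 = 0 := by simpa using pwEval_smul t φ 0 f 0

lemma pwEval_add_series {t : End ℂ E} {φ : E →ₗ[ℂ] U} {x : E} (hx : LocNil t φ x)
    (f g : ℂ⟦X⟧) : pwEval t (f + g) φ x = pwEval t f φ x + pwEval t g φ x := by
  obtain ⟨Q, hQ⟩ := hx
  simp only [pwEval_eq_sum hQ, ← sum_add_distrib, map_add, add_smul]

lemma pwEval_smul_series {t : End ℂ E} {φ : E →ₗ[ℂ] U} {x : E}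
    (f : ℂ⟦X⟧) (r : ℂ) : pwEval t (r • f) φ x = r • pwEval t f φ x := by
  simp only [pwEval, smul_finsum, PowerSeries.coeff_smul, smul_eq_mul, mul_smul]

lemma pwEval_one (t : End ℂ E) (φ : E →ₗ[ℂ] U) (x : E) : pwEval t 1 φ x = φ x := by
  rw [pwEval, finsum_eq_single _ 0 fun s hs => by
    rw [PowerSeries.coeff_one, if_neg hs, zero_smul]]
  simp

lemma pwEval_comp (t : End ℂ E) (f : ℂ⟦X⟧) (φ : E →ₗ[ℂ] U) (x : E)
    {t' : End ℂ E'} {d : E →ₗ[ℂ] E'} (h : ∀ x, d (t x) = t' (d x)) (φ' : E' →ₗ[ℂ] U)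
    (hφ : ∀ x, φ x = φ' (d x)) : pwEval t f φ x = pwEval t' f φ' (d x) := by
  have hs : ∀ s x, d ((t ^ s) x) = (t' ^ s) (d x) := by
    intro s
    induction s with
    | zero => exact fun x => rfl
    | succ s ih =>
      intro x
      rw [pow_succ, pow_succ, End.mul_apply, End.mul_apply, ih, h]
  simp only [pwEval, hφ, hs]

lemma pwEval_sum_functional {ι : Type*} (I : Finset ι) (a : ι → ℂ) (t : End ℂ E)
    (f : ℂ⟦X⟧) (φ : ι → E →ₗ[ℂ] U) (x : E) (h : ∀ i ∈ I, LocNil t (φ i) x) :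
    pwEval t f (∑ i ∈ I, a i • φ i) x = ∑ i ∈ I, a i • pwEval t f (φ i) x := by
  choose! Q hQ using h
  have hle : ∀ i ∈ I, Q i ≤ I.sup Q := fun i hi => le_sup hi
  have h1 : ∀ s, I.sup Q ≤ s → (∑ i ∈ I, a i • φ i) ((t ^ s) x) = 0 := by
    intro s hs
    rw [LinearMap.sum_apply]
    exact sum_eq_zero fun i hi => by
      rw [LinearMap.smul_apply, hQ i hi s ((hle i hi).trans hs), smul_zero]
  rw [pwEval_eq_sum h1]
  simp only [LinearMap.sum_apply, smul_sum]
  rw [sum_comm]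
  refine sum_congr rfl fun i hi => ?_
  rw [pwEval_eq_sum (Q := I.sup Q) fun s hs => hQ i hi s ((hle i hi).trans hs), smul_sum]
  refine sum_congr rfl fun s _ => ?_
  rw [LinearMap.smul_apply, smul_comm]

/-- Product of power series: `φ ((f g)(t) x)` as an iterated sum. -/
lemma pwEval_mul {t : End ℂ E} {φ : E →ₗ[ℂ] U} {x : E} (hx : LocNil t φ x) (f g : ℂ⟦X⟧) :
    pwEval t (f * g) φ x = ∑ᶠ s : ℕ, coeff s f • pwEval t g φ ((t ^ s) x) := by
  obtain ⟨Q, hQ⟩ := hx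
  have h1 : ∀ s r, Q ≤ r → φ ((t ^ r) ((t ^ s) x)) = 0 := fun s r hr => by
    rw [← End.mul_apply, ← pow_add]; exact hQ _ (by omega)
  rw [pwEval_eq_sum hQ, finsum_eq_sum_range (K := Q) fun s hs => by
    rw [pwEval, finsum_eq_zero_of_forall_eq_zero fun r => ?_, smul_zero]
    rw [← End.mul_apply, ← pow_add, hQ _ (by omega), smul_zero]]
  have h2 : ∀ s ∈ range Q, coeff s f • pwEval t g φ ((t ^ s) x) = ∑ r ∈ range (Q - s),
        (coeff s f * coeff r g) • φ ((t ^ (s + r)) x) := by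
    intro s hs
    rw [pwEval_eq_sum (Q := Q - s) fun r hr => by
      rw [← End.mul_apply, ← pow_add]; exact hQ _ (by omega), smul_sum]
    refine sum_congr rfl fun r _ => ?_
    rw [← End.mul_apply, ← pow_add, smul_smul, add_comm]
  rw [sum_congr rfl h2]
  simp only [PowerSeries.coeff_mul, sum_smul]
  rw [sum_sigma', sum_sigma']
  refine sum_bij' (fun x _ => ⟨x.2.1, x.2.2⟩) (fun x _ => ⟨x.1 + x.2, (x.1, x.2)⟩)
    ?_ ?_ ?_ ?_ ?_
  · rintro ⟨s, i, j⟩ h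
    simp only [mem_sigma, mem_range, HasAntidiagonal.mem_antidiagonal] at h ⊢
    omega
  · rintro ⟨i, j⟩ h
    simp [HasAntidiagonal.mem_antidiagonal] at h ⊢
    omega
  · rintro ⟨s, i, j⟩ h
    simp only [mem_sigma, mem_range, HasAntidiagonal.mem_antidiagonal] at h
    obtain ⟨_, rfl⟩ := h
    rfl
  · rintro ⟨i, j⟩ h
    rfl
  · rintro ⟨s, i, j⟩ h
    simp only [mem_sigma, mem_range, HasAntidiagonal.mem_antidiagonal] at h
    obtain ⟨_, rfl⟩ := h
    rfl

/-- The divided derivative `f ^ (i) / i!` of a power series. -/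
def hasse (i : ℕ) (f : ℂ⟦X⟧) : ℂ⟦X⟧ :=
  PowerSeries.mk fun s => ((s + i).choose i : ℂ) * coeff (s + i) f

lemma coeff_hasse (i s : ℕ) (f : ℂ⟦X⟧) : coeff s (hasse i f) =
    ((s + i).choose i : ℂ) * coeff (s + i) f := coeff_mk _ _

/-- If multiplication by `t` acts on the residues `r s n` of `t ^ s D` as `τ` plus `ε` times the
shift of `n`, then `f(t)` acts according to Taylor's formula. -/
lemma pwEval_taylor {t : End ℂ E} {τ : End ℂ E'} {ρ : E →ₗ[ℂ] U}
    {ev : E' →ₗ[ℂ] U} {D : E} {n : ℤ} {ε : ℂ} (hρ : LocNil t ρ D) (r : ℕ → ℤ → E')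
    (hev : ∀ s, ρ ((t ^ s) D) = ev (r s n))
    (hr : ∀ s n, r (s + 1) n = τ (r s n) + ε • r s (n + 1)) {K : ℕ}
    (hK : ∀ i : ℕ, K ≤ i → r 0 (n + i) = 0) (hτ : ∀ i : ℕ, LocNil τ ev (r 0 (n + i)))
    (f : ℂ⟦X⟧) :
    pwEval t f ρ D = ∑ i ∈ range K, ε ^ i • pwEval τ (hasse i f) ev (r 0 (n + i)) := by
  -- the binomial theorem for the commuting operators `τ` and `ε` times the shift
  have key : ∀ s, r s n = ∑ i ∈ range (s + 1),
      ((s.choose i : ℂ) * ε ^ i) • (τ ^ (s - i)) (r 0 (n + i)) := by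
    let T : End ℂ (ℤ → E') := LinearMap.compLeft τ ℤ
    let W : End ℂ (ℤ → E') := ε • LinearMap.funLeft ℂ E' (· + 1)
    have hT : ∀ j g n, (T ^ j) g n = (τ ^ j) (g n) := fun j g n =>
      iter_map (A := fun g : ℤ → E' => g n) (fun _ => rfl) j g
    have hS : ∀ (j : ℕ) g n, (W ^ j) g n = ε ^ j • g (n + j) := by
      intro j
      induction j with
      | zero => exact fun g n => by simp
      | succ j ih =>
        intro g n
        rw [iter_succ]
        change ε • (W ^ j) g (n + 1) = _
        rw [ih, smul_smul, pow_succ']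
        congr 2; push_cast; ring
    have hc : Commute T W := by
      ext g n
      change τ (ε • g (n + 1)) = ε • τ (g (n + 1))
      rw [map_smul]
    have hR : ∀ s, r s = ((T + W) ^ s) (r 0) := by
      intro s
      induction s with
      | zero => rfl
      | succ s ih =>
        rw [iter_succ, ← ih]
        ext n : 1
        exact hr s n
    intro s
    rw [hR, hc.add_pow']
    rw [LinearMap.sum_apply, Finset.sum_apply, Finset.Nat.sum_antidiagonal_eq_sum_range_succ_mk,
      ← sum_range_reflect]
    refine sum_congr rfl fun i hi => ?_
    rw [mem_range] at hi
    simp only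
    rw [show s + 1 - 1 - i = s - i by omega, show s - (s - i) = i by omega, LinearMap.smul_apply,
      Pi.smul_apply, End.mul_apply, hT, hS, map_smul, Nat.choose_symm (by omega),
      ← Nat.cast_smul_eq_nsmul ℂ, smul_smul]
  obtain ⟨Q, hQ⟩ := hρ
  choose q hq using hτ
  set P := max Q ((range K).sup q + K) with hP
  have hP1 : ∀ s, P ≤ s → ρ ((t ^ s) D) = 0 := fun s hs => hQ s (le_of_max_le_left hs)
  rw [pwEval_eq_sum hP1]
  have h1 : ∀ s ∈ range P, coeff s f • ρ ((t ^ s) D) =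
      ∑ i ∈ range K, if i ≤ s then (coeff s f * ((s.choose i : ℂ) * ε ^ i)) •
        ev ((τ ^ (s - i)) (r 0 (n + i))) else 0 := by
    intro s _
    rw [hev, key, map_sum, smul_sum]
    simp only [map_smul, smul_smul]
    rw [← sum_filter]
    symm
    refine sum_subset_zero_on_sdiff ?_ ?_ fun _ _ => rfl
    · intro i hi
      rw [mem_filter] at hi
      rw [mem_range]; omega
    · intro i hi
      simp only [mem_sdiff, mem_filter, mem_range, not_and, not_le] at hi
      rw [hK i (by by_contra hc; have := hi.2 (by omega); omega), map_zero, map_zero, smul_zero]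
  rw [sum_congr rfl h1, sum_comm]
  refine sum_congr rfl fun i hi => ?_
  have hi' := mem_range.1 hi
  have hle : q i ≤ (range K).sup q := le_sup hi
  rw [pwEval_eq_sum (Q := P - i) fun s hs => hq i s (by omega), smul_sum, ← sum_filter]
  refine (sum_bij (fun s _ => s + i) ?_ ?_ ?_ ?_).symm
  · intro s hs
    rw [mem_range] at hs
    rw [mem_filter, mem_range]; omega
  · intro a _ b _ hab; omega
  · intro s hs
    rw [mem_filter, mem_range] at hs
    exact ⟨s - i, mem_range.2 (by omega), by omega⟩
  · intro s _
    rw [coeff_hasse, smul_smul, Nat.add_sub_cancel]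
    congr 1; ring

section

lemma pwEval_sub_functional {t : End ℂ E}
    {φ φ' : E →ₗ[ℂ] U} {x : E} (h : LocNil t φ x) (h' : LocNil t φ' x) (f : ℂ⟦X⟧) :
    pwEval t f (φ - φ') x = pwEval t f φ x - pwEval t f φ' x := by
  obtain ⟨Q, hQ⟩ := h
  obtain ⟨Q', hQ'⟩ := h'
  have h1 : ∀ s, max Q Q' ≤ s → φ ((t ^ s) x) = 0 := fun s hs => hQ s (le_of_max_le_left hs)
  have h2 : ∀ s, max Q Q' ≤ s → φ' ((t ^ s) x) = 0 :=
    fun s hs => hQ' s (le_of_max_le_right hs)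
  rw [pwEval_eq_sum h1, pwEval_eq_sum h2, pwEval_eq_sum (Q := max Q Q') fun s hs => by
    rw [LinearMap.sub_apply, h1 s hs, h2 s hs, sub_zero], ← sum_sub_distrib]
  simp only [LinearMap.sub_apply, smul_sub]

/-- The coefficient functionals of formal distributions in two variables. -/
def ev2 (m n : ℤ) : (Dist₂ U) →ₗ[ℂ] U := LinearMap.proj n ∘ₗ LinearMap.proj m

/-- The coefficient functionals of formal distributions in three variables. -/
def ev3 (m n e : ℤ) : (Dist₃ U) →ₗ[ℂ] U := LinearMap.proj e ∘ₗ LinearMap.proj n ∘ₗ LinearMap.proj m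

lemma ev2_apply (m n : ℤ) (c : Dist₂ U) : ev2 m n c = c m n := rfl

lemma ev3_apply (m n e : ℤ) (c : Dist₃ U) : ev3 m n e c = c m n e := rfl

variable {c c' : Dist₂ U}

/-- Of the coefficients with modes above given ones, only finitely many are nonzero. -/
def Up2 (c : Dist₂ U) : Prop := ∀ m n, ∃ Q : ℕ, ∀ i j : ℕ, Q ≤ i + j → c (m + i) (n + j) = 0

/-- Of the coefficients with modes above given ones, only finitely many are nonzero. -/
def Up3 (c : Dist₃ U) : Prop :=
  ∀ m n e, ∃ Q : ℕ, ∀ i j l : ℕ, Q ≤ i + j + l → c (m + i) (n + j) (e + l) = 0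

lemma Up2.of_tr0 {M : ℤ} (h0 : Tr0 M c) (h1 : ∀ m, ∃ N : ℤ, ∀ n, N ≤ n → c m n = 0) : Up2 c := by
  intro m n
  choose N hN using h1
  refine ⟨(M - m).toNat + (range (M - m).toNat).sup fun i => (N (m + i) - n).toNat,
    fun i j hij => ?_⟩
  rcases lt_or_ge i (M - m).toNat with hi | hi
  · have := le_sup (f := fun i : ℕ => (N (m + i) - n).toNat) (mem_range.2 hi)
    exact hN _ _ (by omega)
  · exact h0 _ _ (by omega)

lemma Up2.add (h : Up2 c) (h' : Up2 c') : Up2 (c + c') := by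
  intro m n
  obtain ⟨Q, hQ⟩ := h m n
  obtain ⟨Q', hQ'⟩ := h' m n
  exact ⟨max Q Q', fun i j hij => by
    rw [Pi.add_apply, Pi.add_apply, hQ i j (le_of_max_le_left hij),
      hQ' i j (le_of_max_le_right hij), add_zero]⟩

lemma Up2.smul (h : Up2 c) (r : ℂ) : Up2 (r • c) := by
  intro m n
  obtain ⟨Q, hQ⟩ := h m n
  exact ⟨Q, fun i j hij => by rw [Pi.smul_apply, Pi.smul_apply, hQ i j hij, smul_zero]⟩

lemma Up2.dif (h : Up2 c) : Up2 (dif c) := by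
  intro m n
  obtain ⟨Q, hQ⟩ := h (m + 1) n
  obtain ⟨Q', hQ'⟩ := h m (n + 1)
  exact ⟨max Q Q', fun i j hij => by
    rw [dif_apply, show m + i + 1 = m + 1 + i by ring, show n + j + 1 = n + 1 + j by ring,
      hQ i j (le_of_max_le_left hij), hQ' i j (le_of_max_le_right hij), sub_zero]⟩

lemma dif_pow_apply_eq_zero (s : ℕ) {m n : ℤ}
    (h : ∀ i j : ℕ, i + j = s → c (m + i) (n + j) = 0) : ((-dif : End ℂ _) ^ s) c m n = 0 := by
  induction s generalizing m n with
  | zero => simpa using h 0 0 rfl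
  | succ s ih =>
    rw [iter_succ]
    have h1 := ih (m := m + 1) (n := n) fun i j hij => by
      have := h (i + 1) j (by omega)
      rwa [Nat.cast_succ, add_comm (i : ℤ), ← add_assoc] at this
    have h2 := ih (m := m) (n := n + 1) fun i j hij => by
      have := h i (j + 1) (by omega)
      rwa [Nat.cast_succ, add_comm (j : ℤ), ← add_assoc] at this
    rw [LinearMap.neg_apply, Pi.neg_apply, Pi.neg_apply, dif_apply, h1, h2, sub_zero, neg_zero]

lemma Up2.locNil (h : Up2 c) (m n : ℤ) : LocNil (-QVA.dif) (ev2 m n) c := by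
  obtain ⟨Q, hQ⟩ := h m n
  exact ⟨Q, fun s hs => dif_pow_apply_eq_zero s fun i j hij => hQ i j (by omega)⟩

/-- The product of `c` with the power series `f(z₁ - z₀)`. -/
def act2 (f : ℂ⟦X⟧) (c : Dist₂ U) : Dist₂ U := fun m n => pwEval (-dif) f (ev2 m n) c

lemma act2_apply_eq_zero {m n : ℤ}
    (h : ∀ i j : ℕ, c (m + i) (n + j) = 0) (f : ℂ⟦X⟧) : act2 f c m n = 0 :=
  finsum_eq_zero_of_forall_eq_zero fun s => by
    rw [ev2_apply, dif_pow_apply_eq_zero s fun i j _ => h i j, smul_zero]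

lemma Tr0.act2 {M : ℤ} (h : Tr0 M c) (f : ℂ⟦X⟧) : Tr0 M (act2 f c) :=
  fun _ _ hm => act2_apply_eq_zero (fun _ _ => h _ _ (by omega)) f

lemma Up2.act2 (h : Up2 c) (f : ℂ⟦X⟧) : Up2 (act2 f c) := by
  intro m n
  obtain ⟨Q, hQ⟩ := h m n
  refine ⟨Q, fun i j hij => act2_apply_eq_zero (fun i' j' => ?_) f⟩
  have := hQ (i + i') (j + j') (by omega)
  rwa [Nat.cast_add, Nat.cast_add, ← add_assoc, ← add_assoc] at this

lemma act2_add (h : Up2 c) (h' : Up2 c') (f : ℂ⟦X⟧) : act2 f (c + c') = act2 f c + act2 f c' := by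
  ext m n
  exact pwEval_add (h.locNil m n) (h'.locNil m n) f

lemma act2_smul (c : Dist₂ U) (f : ℂ⟦X⟧) (r : ℂ) : act2 f (r • c) = r • act2 f c := by
  ext m n
  exact pwEval_smul _ _ _ f r

lemma act2_zero (f : ℂ⟦X⟧) : act2 f (0 : Dist₂ U) = 0 := by
  ext m n
  exact pwEval_zero _ _ f

lemma act2_add_series (h : Up2 c) (f g : ℂ⟦X⟧) : act2 (f + g) c = act2 f c + act2 g c := by
  ext m n
  exact pwEval_add_series (h.locNil m n) f g

lemma act2_smul_series (c : Dist₂ U) (f : ℂ⟦X⟧) (r : ℂ) : act2 (r • f) c = r • act2 f c := by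
  ext m n
  exact pwEval_smul_series f r

lemma act2_one (c : Dist₂ U) : act2 1 c = c := by
  ext m n
  exact pwEval_one _ _ _

lemma dif_act2 (h : Up2 c) (f : ℂ⟦X⟧) : dif (act2 f c) = act2 f (dif c) := by
  ext m n
  have h1 : act2 f (dif c) m n = pwEval (-dif) f (ev2 (m + 1) n - ev2 m (n + 1)) c :=
    (pwEval_comp (-dif) f (ev2 (m + 1) n - ev2 m (n + 1)) c
      (d := (dif : End ℂ (Dist₂ U))) (t' := (-dif : End ℂ (Dist₂ U)))
      (fun x => by simp) (ev2 m n) fun x => rfl).symm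
  rw [h1, pwEval_sub_functional (h.locNil _ _) (h.locNil _ _)]
  rfl

lemma dif_pow_act2 (h : Up2 c) (f : ℂ⟦X⟧) (k : ℕ) :
    (dif ^ k) (act2 f c) = act2 f ((dif ^ k) c) := by
  refine (iter_intertwine (P := Up2) (fun _ h => h.dif) (fun _ h => ?_) h k).symm
  exact (dif_act2 h f).symm

lemma neg_dif_pow_act2 (h : Up2 c) (f : ℂ⟦X⟧) (s : ℕ) :
    ((-dif : End ℂ _) ^ s) (act2 f c) = act2 f (((-dif : End ℂ _) ^ s) c) := by
  refine (iter_intertwine (P := Up2) (fun x h => ?_) (fun x h => ?_) h s).symm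
  · rw [LinearMap.neg_apply, ← neg_one_smul ℂ]; exact h.dif.smul _
  · rw [LinearMap.neg_apply, LinearMap.neg_apply, dif_act2 h, ← neg_one_smul ℂ, act2_smul,
      neg_one_smul]

lemma act2_act2 (h : Up2 c) (f g : ℂ⟦X⟧) : act2 f (act2 g c) = act2 (f * g) c := by
  ext m n
  have h1 := pwEval_mul (h.locNil m n) f g
  change pwEval _ _ _ _ = pwEval _ _ _ _
  rw [h1, pwEval]
  refine finsum_congr fun s => ?_
  rw [neg_dif_pow_act2 h]
  rfl

lemma act2_map (f : ℂ⟦X⟧) (h : Up2 c) (φ : U →ₗ[ℂ] U') (m n : ℤ) :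
    act2 f (fun m n => φ (c m n)) m n = φ (act2 f c m n) := by
  obtain ⟨Q, hQ⟩ := h.locNil m n
  have h1 : ∀ s, (((-dif : End ℂ _) ^ s) fun m n => φ (c m n)) =
      fun m n => φ (((-dif : End ℂ _) ^ s) c m n) := fun s =>
    (iter_map (A := fun c m n => φ (c m n)) (fun c => by ext m n; simp [dif_apply]) s c).symm
  change pwEval _ _ _ _ = φ (pwEval _ _ _ _)
  rw [pwEval_eq_sum hQ, pwEval_eq_sum (Q := Q) fun s hs => by
    rw [h1]; exact (congrArg φ (hQ s hs)).trans (map_zero φ), map_sum]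
  refine sum_congr rfl fun s _ => ?_
  rw [h1, map_smul]
  rfl

variable {k : ℕ} {c c' : Dist₃ U} {t : End ℂ (Dist₃ U)}

/-- Linear operators on formal distributions in three variables, like multiplication by
`zᵢ - zⱼ`, for which a coefficient of the result depends only on the coefficients obtained by
raising one of the modes by one. -/
def IsShift (t : End ℂ (Dist₃ U)) : Prop :=
  ∀ c m n e, c (m + 1) n e = 0 → c m (n + 1) e = 0 → c m n (e + 1) = 0 → t c m n e = 0

lemma isShift_neg_d01 : IsShift (-d01 : End ℂ (Dist₃ U)) :=
  fun c m n e h0 h1 _ => by simp [d01_apply, h0, h1]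

lemma isShift_neg_d02 : IsShift (-d02 : End ℂ (Dist₃ U)) :=
  fun c m n e h0 _ h2 => by simp [d02_apply, h0, h2]

lemma isShift_neg_d12 : IsShift (-d12 : End ℂ (Dist₃ U)) :=
  fun c m n e _ h1 h2 => by simp [d12_apply, h1, h2]

lemma IsShift.pow_apply_eq_zero (ht : IsShift t) (s : ℕ) {m n e : ℤ}
    (h : ∀ i j l : ℕ, i + j + l = s → c (m + i) (n + j) (e + l) = 0) : (t ^ s) c m n e = 0 := by
  induction s generalizing m n e with
  | zero => simpa using h 0 0 0 rfl
  | succ s ih =>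
    rw [iter_succ]
    refine ht _ _ _ _ (ih fun i j l hij => ?_) (ih fun i j l hij => ?_) (ih fun i j l hij => ?_)
    · have := h (i + 1) j l (by omega)
      rwa [Nat.cast_succ, add_comm (i : ℤ), ← add_assoc] at this
    · have := h i (j + 1) l (by omega)
      rwa [Nat.cast_succ, add_comm (j : ℤ), ← add_assoc] at this
    · have := h i j (l + 1) (by omega)
      rwa [Nat.cast_succ, add_comm (l : ℤ), ← add_assoc] at this

lemma Up3.locNil (h : Up3 c) (ht : IsShift t) (m n e : ℤ) : LocNil t (ev3 m n e) c := by
  obtain ⟨Q, hQ⟩ := h m n e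
  exact ⟨Q, fun s hs => ht.pow_apply_eq_zero s fun i j l hij => hQ i j l (by omega)⟩

/-- The product of `c` with the power series `f(t)`, where `t` is multiplication by a difference
of two of the variables. -/
def act3 (t : End ℂ (Dist₃ U)) (f : ℂ⟦X⟧) (c : Dist₃ U) :
    Dist₃ U := fun m n e => pwEval t f (ev3 m n e) c

lemma act3_apply_eq_zero (ht : IsShift t)
    {m n e : ℤ} (h : ∀ i j l : ℕ, c (m + i) (n + j) (e + l) = 0)
    (f : ℂ⟦X⟧) : act3 t f c m n e = 0 :=
  finsum_eq_zero_of_forall_eq_zero fun s => by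
    rw [ev3_apply, ht.pow_apply_eq_zero s fun i j l _ => h i j l, smul_zero]

lemma Up3.act3 (h : Up3 c) (ht : IsShift t) (f : ℂ⟦X⟧) : Up3 (act3 t f c) := by
  intro m n e
  obtain ⟨Q, hQ⟩ := h m n e
  refine ⟨Q, fun i j l hij => act3_apply_eq_zero ht (fun i' j' l' => ?_) f⟩
  have := hQ (i + i') (j + j') (l + l') (by omega)
  rwa [Nat.cast_add, Nat.cast_add, Nat.cast_add, ← add_assoc, ← add_assoc, ← add_assoc] at this

lemma Up3.add (h : Up3 c) (h' : Up3 c') : Up3 (c + c') := by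
  intro m n e
  obtain ⟨Q, hQ⟩ := h m n e
  obtain ⟨Q', hQ'⟩ := h' m n e
  exact ⟨max Q Q', fun i j l hij => by
    rw [Pi.add_apply, Pi.add_apply, Pi.add_apply, hQ i j l (le_of_max_le_left hij),
      hQ' i j l (le_of_max_le_right hij), add_zero]⟩

lemma Up3.d12 (h : Up3 c) : Up3 (d12 c) := by
  intro m n e
  obtain ⟨Q, hQ⟩ := h m (n + 1) e
  obtain ⟨Q', hQ'⟩ := h m n (e + 1)
  exact ⟨max Q Q', fun i j l hij => by
    rw [d12_apply, show n + j + 1 = n + 1 + j by ring, show e + l + 1 = e + 1 + l by ring,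
      hQ i j l (le_of_max_le_left hij), hQ' i j l (le_of_max_le_right hij),
      sub_zero]⟩

lemma Up3.d01 (h : Up3 c) : Up3 (d01 c) := by
  intro m n e
  obtain ⟨Q, hQ⟩ := h (m + 1) n e
  obtain ⟨Q', hQ'⟩ := h m (n + 1) e
  exact ⟨max Q Q', fun i j l hij => by
    rw [d01_apply, show n + j + 1 = n + 1 + j by ring, show m + i + 1 = m + 1 + i by ring,
      hQ i j l (le_of_max_le_left hij), hQ' i j l (le_of_max_le_right hij),
      sub_zero]⟩

lemma Up3.d02 (h : Up3 c) : Up3 (d02 c) := by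
  intro m n e
  obtain ⟨Q, hQ⟩ := h (m + 1) n e
  obtain ⟨Q', hQ'⟩ := h m n (e + 1)
  exact ⟨max Q Q', fun i j l hij => by
    rw [d02_apply, show e + l + 1 = e + 1 + l by ring, show m + i + 1 = m + 1 + i by ring,
      hQ i j l (le_of_max_le_left hij), hQ' i j l (le_of_max_le_right hij),
      sub_zero]⟩

lemma act3_add (ht : IsShift t) (h : Up3 c) (h' : Up3 c') (f : ℂ⟦X⟧) :
    act3 t f (c + c') = act3 t f c + act3 t f c' := by
  ext m n e
  exact pwEval_add (h.locNil ht m n e) (h'.locNil ht m n e) f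

lemma act3_smul (t : End ℂ (Dist₃ U)) (c : Dist₃ U) (f : ℂ⟦X⟧)
    (r : ℂ) : act3 t f (r • c) = r • act3 t f c := by
  ext m n e
  exact pwEval_smul _ _ _ f r

lemma act3_zero (t : End ℂ (Dist₃ U)) (f : ℂ⟦X⟧) : act3 t f 0 = 0 := by
  ext m n e
  exact pwEval_zero _ _ f

lemma act3_neg_d12 (f : ℂ⟦X⟧) (c : Dist₃ U) (m : ℤ) : act3 (-d12) f c m = act2 f (c m) := by
  ext n e
  exact pwEval_comp _ f _ c (d := LinearMap.proj m) (fun _ => rfl) _ fun _ => rfl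

lemma act3_neg_d01 (f : ℂ⟦X⟧) (c : Dist₃ U) (m n e : ℤ) :
    act3 (-d01) f c m n e = act2 f (fun m n => c m n e) m n :=
  pwEval_comp _ f _ c (d := LinearMap.pi fun m => LinearMap.pi fun n => ev3 m n e)
    (fun _ => rfl) _ fun _ => rfl

lemma act3_neg_d02 (f : ℂ⟦X⟧) (c : Dist₃ U) (m n e : ℤ) :
    act3 (-d02) f c m n e = act2 f (fun m e => c m n e) m e :=
  pwEval_comp _ f _ c (d := LinearMap.pi fun m => LinearMap.pi fun e => ev3 m n e)
    (fun _ => rfl) _ fun _ => rfl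

lemma sub_act3 (ht : IsShift t) {d : End ℂ (Dist₃ U)} (hc : Commute t d) (h : Up3 c) (f : ℂ⟦X⟧)
    {m n e m₁ n₁ e₁ m₂ n₂ e₂ : ℤ} (hd : ∀ x, d x m n e = x m₁ n₁ e₁ - x m₂ n₂ e₂) :
    d (act3 t f c) m n e = act3 t f (d c) m n e := by
  have h1 : act3 t f (d c) m n e = pwEval t f (ev3 m₁ n₁ e₁ - ev3 m₂ n₂ e₂) c :=
    (pwEval_comp _ f _ c (fun x => (LinearMap.congr_fun hc.eq x).symm) _ fun x => (hd x).symm).symm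
  rw [h1, pwEval_sub_functional (h.locNil ht _ _ _) (h.locNil ht _ _ _), hd]
  rfl

lemma d12_act3 (ht : IsShift t) (hc : Commute t d12) (h : Up3 c) (f : ℂ⟦X⟧) :
    d12 (act3 t f c) = act3 t f (d12 c) := by
  ext m n e
  exact sub_act3 ht hc h f fun _ => rfl

lemma d01_act3 (ht : IsShift t) (hc : Commute t d01) (h : Up3 c) (f : ℂ⟦X⟧) :
    d01 (act3 t f c) = act3 t f (d01 c) := by
  ext m n e
  exact sub_act3 ht hc h f fun _ => rfl

lemma d02_act3 (ht : IsShift t) (hc : Commute t d02) (h : Up3 c) (f : ℂ⟦X⟧) :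
    d02 (act3 t f c) = act3 t f (d02 c) := by
  ext m n e
  exact sub_act3 ht hc h f fun _ => rfl

lemma d12_pow_act3 (ht : IsShift t) (hc : Commute t d12) (h : Up3 c) (f : ℂ⟦X⟧) (k : ℕ) :
    (d12 ^ k) (act3 t f c) = act3 t f ((d12 ^ k) c) :=
  (iter_intertwine (P := Up3) (A := act3 t f) (fun _ => Up3.d12)
    (fun _ h => (d12_act3 ht hc h f).symm) h k).symm

lemma d01_pow_act3 (ht : IsShift t) (hc : Commute t d01) (h : Up3 c) (f : ℂ⟦X⟧) (k : ℕ) :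
    (d01 ^ k) (act3 t f c) = act3 t f ((d01 ^ k) c) :=
  (iter_intertwine (P := Up3) (A := act3 t f) (fun _ => Up3.d01)
    (fun _ h => (d01_act3 ht hc h f).symm) h k).symm

lemma d02_pow_act3 (ht : IsShift t) (hc : Commute t d02) (h : Up3 c) (f : ℂ⟦X⟧) (k : ℕ) :
    (d02 ^ k) (act3 t f c) = act3 t f ((d02 ^ k) c) :=
  (iter_intertwine (P := Up3) (A := act3 t f) (fun _ => Up3.d02)
    (fun _ h => (d02_act3 ht hc h f).symm) h k).symm

lemma Up3.d12_pow (h : Up3 c) (k : ℕ) : Up3 ((QVA.d12 ^ k) c) := iter_mem (fun _ => Up3.d12) h k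

lemma Up3.d02_pow (h : Up3 c) (k : ℕ) : Up3 ((QVA.d02 ^ k) c) := iter_mem (fun _ => Up3.d02) h k

lemma Up3.d01_pow (h : Up3 c) (k : ℕ) : Up3 ((QVA.d01 ^ k) c) := iter_mem (fun _ => Up3.d01) h k

/-- For modes of `z₀` bounded below, the distributions `(z₁ - z₂) ^ k c` in `z₁, z₂` have uniformly
bounded poles. -/
def Bdd12 (k : ℕ) (c : Dist₃ U) : Prop :=
  ∀ m, ∃ N, ∀ m', m ≤ m' → Tr0 N ((dif ^ k) (c m')) ∧ Tr1 N ((dif ^ k) (c m'))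

/-- For modes of `z₂` bounded below, the distributions `(z₀ - z₁) ^ k c` in `z₀, z₁` have uniformly
bounded poles. -/
def Bdd01 (k : ℕ) (c : Dist₃ U) : Prop :=
  ∀ e, ∃ N, ∀ e', e ≤ e' → Tr0 N ((dif ^ k) fun m n => c m n e') ∧
    Tr1 N ((dif ^ k) fun m n => c m n e')

lemma Bdd12.pole (h : Bdd12 k c) (m : ℤ) : Pole k (c m) := by
  obtain ⟨N, hN⟩ := h m
  exact ⟨⟨N, (hN m le_rfl).1⟩, N, (hN m le_rfl).2⟩

lemma Bdd01.pole (h : Bdd01 k c) (e : ℤ) : Pole k fun m n => c m n e := by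
  obtain ⟨N, hN⟩ := h e
  exact ⟨⟨N, (hN e le_rfl).1⟩, N, (hN e le_rfl).2⟩

/-- The bounds of `Bdd12` pass to the image under an operator like `t ^ s` or `f(t)`. -/
lemma bound12_of_comm {F : Dist₃ U → Dist₃ U}
    (hF : ∀ c m n e, (∀ i j l : ℕ, c (m + i) (n + j) (e + l) = 0) → F c m n e = 0)
    (hd : (d12 ^ k) (F c) = F ((d12 ^ k) c)) {m N : ℤ}
    (hN : ∀ m', m ≤ m' → Tr0 N ((dif ^ k) (c m')) ∧ Tr1 N ((dif ^ k) (c m'))) (m' : ℤ)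
    (hm : m ≤ m') : Tr0 N ((dif ^ k) (F c m')) ∧ Tr1 N ((dif ^ k) (F c m')) := by
  rw [← d12_pow_apply, hd]
  refine ⟨fun n e hn => hF _ _ _ _ fun i j l => ?_, fun n e hn => hF _ _ _ _ fun i j l => ?_⟩ <;>
  rw [d12_pow_apply]
  · exact (hN _ (by omega)).1 _ _ (by omega)
  · exact (hN _ (by omega)).2 _ _ (by omega)

/-- The bounds of `Bdd01` pass to the image under an operator like `t ^ s` or `f(t)`. -/
lemma bound01_of_comm {F : Dist₃ U → Dist₃ U}
    (hF : ∀ c m n e, (∀ i j l : ℕ, c (m + i) (n + j) (e + l) = 0) → F c m n e = 0)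
    (hd : (d01 ^ k) (F c) = F ((d01 ^ k) c)) {e N : ℤ}
    (hN : ∀ e', e ≤ e' → Tr0 N ((dif ^ k) fun m n => c m n e') ∧
      Tr1 N ((dif ^ k) fun m n => c m n e')) (e' : ℤ) (he : e ≤ e') :
    Tr0 N ((dif ^ k) fun m n => F c m n e') ∧ Tr1 N ((dif ^ k) fun m n => F c m n e') := by
  refine ⟨fun m n hn => ?_, fun m n hn => ?_⟩ <;> rw [← d01_pow_apply, hd] <;>
  refine hF _ _ _ _ fun i j l => ?_ <;> rw [d01_pow_apply]
  · exact (hN _ (by omega)).1 _ _ (by omega)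
  · exact (hN _ (by omega)).2 _ _ (by omega)

lemma Bdd12.act3 (ht : IsShift t) (hc : Commute t d12) (hc3 : Up3 c) (h : Bdd12 k c) (f : ℂ⟦X⟧) :
    Bdd12 k (act3 t f c) := fun m => (h m).imp fun _ =>
  bound12_of_comm (fun _ _ _ _ h => act3_apply_eq_zero ht h f) (d12_pow_act3 ht hc hc3 f k)

lemma Bdd01.act3 (ht : IsShift t) (hc : Commute t d01) (hc3 : Up3 c) (h : Bdd01 k c) (f : ℂ⟦X⟧) :
    Bdd01 k (act3 t f c) := fun e => (h e).imp fun _ =>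
  bound01_of_comm (fun _ _ _ _ h => act3_apply_eq_zero ht h f) (d01_pow_act3 ht hc hc3 f k)

lemma commute_pow_apply {t d : End ℂ E}
    (hc : Commute t d) (s k : ℕ) (c : E) : (d ^ k) ((t ^ s) c) = (t ^ s) ((d ^ k) c) :=
  LinearMap.congr_fun (hc.symm.pow_pow k s).eq c

/-- Taylor's formula for the residues of a product with a power series in a difference of variables,
for a slice `π` of distributions in three variables on which `d` acts as the multiplication by the
difference of the two variables of the slice. -/
lemma res_slice_act3 (ht : IsShift t) {d : End ℂ (Dist₃ U)} (hc : Commute t d)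
    {π : (Dist₃ U) →ₗ[ℂ] Dist₂ U} (hπ : ∀ c, π (d c) = dif (π c))
    (hev : ∀ a b, ∃ m n e, ev2 a b ∘ₗ π = ev3 m n e) {f : ℂ⟦X⟧} {D : Dist₃ U}
    (h3 : Up3 ((d ^ k) D)) (hd : (d ^ k) (act3 t f D) = act3 t f ((d ^ k) D)) {N : ℤ}
    (hb : ∀ s, Tr0 N ((dif ^ k) (π ((t ^ s) D))) ∧ Tr1 N ((dif ^ k) (π ((t ^ s) D))))
    (hba : Tr0 N ((dif ^ k) (π (act3 t f D))) ∧ Tr1 N ((dif ^ k) (π (act3 t f D)))) {n : ℤ}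
    (hkn : n < k) {ε : ℂ} (r : ℕ → ℤ → Dist₂ U)
    (hr : ∀ s n, r (s + 1) n = (-dif : End ℂ (Dist₂ U)) (r s n) + ε • r s (n + 1))
    (hK : ∀ i : ℕ, (k - n).toNat ≤ i → r 0 (n + i) = 0) (h2 : ∀ i : ℕ, Up2 (r 0 (n + i)))
    {a m e : ℤ} (hra : ∀ s, res (π ((t ^ s) D)) n a = r s n m e) :
    res (π (act3 t f D)) n a =
      (∑ i ∈ range (k - n).toNat, ε ^ i • act2 (hasse i f) (r 0 (n + i))) m e := by
  obtain ⟨p, hp⟩ : ∃ p : ℕ, (k - n - 1 : ℤ) = p := ⟨(k - n - 1).toNat, by omega⟩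
  set I := Ioo (a - p - 1 - N) N
  let ρ : (Dist₃ U) →ₗ[ℂ] U := ∑ b ∈ I, ((Ring.choose (-b - 1) p : ℤ) : ℂ) •
    (ev2 b (a - p - 1 - b) ∘ₗ π)
  have hval : ∀ c : Dist₃ U, Tr0 N ((dif ^ k) (π c)) ∧ Tr1 N ((dif ^ k) (π c)) →
      res (π c) n a = ρ ((d ^ k) c) := by
    intro c h
    rw [res_eq ⟨⟨N, h.1⟩, N, h.2⟩, hp, Tay_eq_sum h.1 h.2 p a subset_rfl, LinearMap.sum_apply]
    refine sum_congr rfl fun b _ => ?_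
    rw [LinearMap.smul_apply, comp_apply, ev2_apply, iter_map hπ, Int.cast_smul_eq_zsmul]
  have hloc : ∀ b ∈ I, LocNil t (ev2 b (a - p - 1 - b) ∘ₗ π) ((d ^ k) D) := fun b _ => by
    obtain ⟨m, n, e, h⟩ := hev b (a - p - 1 - b)
    rw [h]
    exact h3.locNil ht _ _ _
  have h1 : res (π (act3 t f D)) n a = pwEval t f (ρ ∘ₗ (d ^ k)) D := by
    rw [hval _ hba, hd, pwEval_comp t f _ D (d := d ^ k) (t' := t) (fun x => by
        simpa using (commute_pow_apply hc 1 k x)) ρ (fun _ => rfl),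
      pwEval_sum_functional I _ t f _ _ hloc, LinearMap.sum_apply]
    refine sum_congr rfl fun b _ => ?_
    obtain ⟨m, n, e, h⟩ := hev b (a - p - 1 - b)
    rw [h]
    rfl
  have hlocρ : LocNil t (ρ ∘ₗ (d ^ k)) D := by
    choose! Q hQ using hloc
    refine ⟨I.sup Q, fun s hs => ?_⟩
    rw [comp_apply, commute_pow_apply hc, LinearMap.sum_apply]
    refine sum_eq_zero fun i hi => ?_
    rw [LinearMap.smul_apply, hQ i hi s ((le_sup hi).trans hs), smul_zero]
  rw [h1, pwEval_taylor (ev := ev2 m e) hlocρ r (fun s => (hval _ (hb s)).symm.trans (hra s)) hr hK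
    (fun i => (h2 i).locNil m e), Finset.sum_apply, Finset.sum_apply]
  rfl

/-- Taylor's formula for the residues at `z₁ = z₂` of a product with a power series in a
difference of variables. -/
lemma res12_act3 (ht : IsShift t) (hc : Commute t d12)
    (hp : ∀ c, (∀ m, Pole k (c m)) → ∀ m, Pole k (t c m)) {ε : ℂ}
    (hr : ∀ c, (∀ m, Pole k (c m)) → ∀ n, res12 (t c) n = -dif (res12 c n) + ε • res12 c (n + 1))
    {D : Dist₃ U} (h3 : Up3 D) (hB : Bdd12 k D) (n : ℤ)
    (h2 : ∀ i : ℕ, Up2 (res12 D (n + i))) (f : ℂ⟦X⟧) :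
    res12 (act3 t f D) n = ∑ i ∈ range (k - n).toNat,
      ε ^ i • act2 (hasse i f) (res12 D (n + i)) := by
  ext m e
  obtain ⟨N, hN⟩ := hB m
  have hd := d12_pow_act3 ht hc h3 f k
  have hba := bound12_of_comm (fun c m n e h => act3_apply_eq_zero ht h f) hd hN
  have hpoles : ∀ s m, Pole k ((t ^ s) D m) := fun s =>
    iter_mem (P := fun c : Dist₃ U => ∀ m, Pole k (c m)) hp hB.pole s
  rcases le_or_gt (k : ℤ) n with hkn | hkn
  · rw [show (k - n).toNat = 0 by omega]
    exact congrFun (res_eq_zero ⟨⟨N, (hba m le_rfl).1⟩, N, (hba m le_rfl).2⟩ hkn) e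
  exact res_slice_act3 ht hc (π := LinearMap.proj m) (fun _ => rfl) (fun a b => ⟨m, a, b, rfl⟩)
    (h3.d12_pow k) hd
    (fun s => bound12_of_comm (fun c m n e h => ht.pow_apply_eq_zero s fun i j l _ => h i j l)
      (commute_pow_apply hc s k D) hN m le_rfl)
    (hba m le_rfl) hkn (fun s n => res12 ((t ^ s) D) n) (fun s n => by
      rw [iter_succ, hr _ (hpoles s)]; rfl)
    (fun i hi => res12_eq_zero (hpoles 0) (by omega)) h2 fun _ => rfl

/-- Taylor's formula for the residues at `z₀ = z₁` of a product with a power series in a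
difference of variables. -/
lemma res01_act3 (ht : IsShift t) (hc : Commute t d01)
    (hp : ∀ c, (∀ e, Pole k fun m n => c m n e) → ∀ e, Pole k fun m n => t c m n e) {ε : ℂ}
    (hr : ∀ c, (∀ e, Pole k fun m n => c m n e) → ∀ n,
      res01 (t c) n = -dif (res01 c n) + ε • res01 c (n + 1))
    {D : Dist₃ U} (h3 : Up3 D) (hB : Bdd01 k D) (n : ℤ)
    (h2 : ∀ i : ℕ, Up2 (res01 D (n + i))) (f : ℂ⟦X⟧) :
    res01 (act3 t f D) n = ∑ i ∈ range (k - n).toNat,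
      ε ^ i • act2 (hasse i f) (res01 D (n + i)) := by
  ext m e
  obtain ⟨N, hN⟩ := hB e
  have hd := d01_pow_act3 ht hc h3 f k
  have hba := bound01_of_comm (fun c m n e h => act3_apply_eq_zero ht h f) hd hN
  have hpoles : ∀ s e, Pole k fun m n => (t ^ s) D m n e := fun s =>
    iter_mem (P := fun c : Dist₃ U => ∀ e, Pole k fun m n => c m n e) hp hB.pole s
  rcases le_or_gt (k : ℤ) n with hkn | hkn
  · rw [show (k - n).toNat = 0 by omega]
    exact congrFun (res_eq_zero ⟨⟨N, (hba e le_rfl).1⟩, N, (hba e le_rfl).2⟩ hkn) m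
  exact res_slice_act3 ht hc (π := LinearMap.pi fun m => LinearMap.pi fun n => ev3 m n e)
    (fun _ => rfl) (fun a b => ⟨a, b, e, rfl⟩) (h3.d01_pow k) hd
    (fun s => bound01_of_comm (fun c m n e h => ht.pow_apply_eq_zero s fun i j l _ => h i j l)
      (commute_pow_apply hc s k D) hN e le_rfl)
    (hba e le_rfl) hkn (fun s n => res01 ((t ^ s) D) n) (fun s n => by
      rw [iter_succ, hr _ (hpoles s)]; rfl)
    (fun i hi => res01_eq_zero (hpoles 0) (by omega)) h2 fun _ => rfl

lemma res12_neg (h : ∀ m, Pole k (c m)) (n : ℤ) : res12 (-c) n = -res12 c n := by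
  ext m e
  change res ((-c) m) n e = -res (c m) n e
  rw [Pi.neg_apply, ← neg_one_smul ℂ, res_smul (h m), neg_one_smul]
  rfl

lemma res01_neg (h : ∀ e, Pole k fun m n => c m n e) (l : ℤ) : res01 (-c) l = -res01 c l := by
  ext n e
  have := res_smul (h e) (-1) l
  rw [neg_one_smul, neg_one_smul] at this
  exact congrFun this n

lemma pole_neg {c : Dist₂ U} (h : Pole k c) : Pole k (-c) := by
  rw [← neg_one_smul ℂ]; exact h.smul _

lemma commute_neg_d01_d12 :
    Commute (-d01 : End ℂ (Dist₃ U)) d12 := Commute.neg_left (R := End ℂ (Dist₃ U)) commute_d01_d12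

lemma commute_neg_d02_d12 :
    Commute (-d02 : End ℂ (Dist₃ U)) d12 := Commute.neg_left (R := End ℂ (Dist₃ U)) commute_d02_d12

lemma commute_neg_d02_d01 : Commute (-d02 : End ℂ (Dist₃ U)) d01 :=
  Commute.neg_left (R := End ℂ (Dist₃ U)) commute_d01_d02.symm

lemma commute_neg_d12_d01 : Commute (-d12 : End ℂ (Dist₃ U)) d01 :=
  Commute.neg_left (R := End ℂ (Dist₃ U)) commute_d01_d12.symm

section

variable {D : Dist₃ U} (h3 : Up3 D) (n : ℤ) (f : ℂ⟦X⟧)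
include h3

lemma res12_act3_d01 (hB : Bdd12 k D) (h2 : ∀ i : ℕ, Up2 (res12 D (n + i))) :
    res12 (act3 (-d01) f D) n = ∑ i ∈ range (k - n).toNat, act2 (hasse i f) (res12 D (n + i)) := by
  have := res12_act3 isShift_neg_d01 commute_neg_d01_d12 (ε := 1)
    (fun c hc m => pole_neg (pole12_d01 hc m))
    (fun c hc n => by
      rw [LinearMap.neg_apply, res12_neg (pole12_d01 hc), res12_d01 hc, one_smul, neg_sub,
        sub_eq_neg_add]) h3 hB n h2 f
  simpa using this

lemma res12_act3_d02 (hB : Bdd12 k D) (h2 : ∀ i : ℕ, Up2 (res12 D (n + i))) (hn : n < k) :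
    res12 (act3 (-d02) f D) n = act2 f (res12 D n) := by
  have := res12_act3 isShift_neg_d02 commute_neg_d02_d12 (ε := 0)
    (fun c hc m => pole_neg (pole12_d02 hc m))
    (fun c hc n => by
      rw [LinearMap.neg_apply, res12_neg (pole12_d02 hc), res12_d02 hc, zero_smul, add_zero])
    h3 hB n h2 f
  rw [this, sum_eq_single_of_mem 0 (mem_range.2 (by omega)) fun i _ hi => by
    rw [zero_pow hi, zero_smul]]
  rw [pow_zero, one_smul, Nat.cast_zero, add_zero]
  congr 1
  ext s
  simp [coeff_hasse]

lemma res01_act3_d02 (hB : Bdd01 k D) (h2 : ∀ i : ℕ, Up2 (res01 D (n + i))) :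
    res01 (act3 (-d02) f D) n = ∑ i ∈ range (k - n).toNat,
      (-1 : ℂ) ^ i • act2 (hasse i f) (res01 D (n + i)) :=
  res01_act3 isShift_neg_d02 commute_neg_d02_d01 (ε := -1)
    (fun c hc e => pole_neg (pole01_d02 hc e))
    (fun c hc n => by
      rw [LinearMap.neg_apply, res01_neg (pole01_d02 hc), res01_d02 hc, neg_one_smul, neg_add])
    h3 hB n h2 f

lemma res01_act3_d12 (hB : Bdd01 k D) (h2 : ∀ i : ℕ, Up2 (res01 D (n + i))) (hn : n < k) :
    res01 (act3 (-d12) f D) n = act2 f (res01 D n) := by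
  have := res01_act3 isShift_neg_d12 commute_neg_d12_d01 (ε := 0)
    (fun c hc m => pole_neg (pole01_d12 hc m))
    (fun c hc n => by
      rw [LinearMap.neg_apply, res01_neg (pole01_d12 hc), res01_d12 hc, zero_smul, add_zero])
    h3 hB n h2 f
  rw [this, sum_eq_single_of_mem 0 (mem_range.2 (by omega)) fun i _ hi => by
    rw [zero_pow hi, zero_smul]]
  rw [pow_zero, one_smul, Nat.cast_zero, add_zero]
  congr 1
  ext s
  simp [coeff_hasse]

end

end

/-! ### Exchange of iterated residues -/

/-- Exchange of the first two variables. -/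
def swap01 (c : Dist₃ U) : Dist₃ U := fun n m e => c m n e

lemma resres_comm_of_bound {G : Dist₃ U} (h : Tri 0 0 0 G) (h' : Tri 0 0 0 (swap01 G))
    (m n : ℤ) : resres G m n = resres (swap01 G) n m := by
  have hX0 : ∀ {G : Dist₃ U} (_ : Tri 0 0 0 G) (m n : ℤ), 0 ≤ m → resres G m n = 0 :=
    fun h m n hm => by rw [resres_of_bound h, Tay_neg (by omega)]
  have hX1 : ∀ {G : Dist₃ U} (_ : Tri 0 0 0 G) (m n : ℤ), 0 ≤ n → resres G m n = 0 :=
    fun h m n hn => h.tr1_resres m n (by simpa using hn)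
  rcases le_or_gt 0 m with hm | hm
  · rw [hX0 h _ _ hm, hX1 h' _ _ hm]
  rcases le_or_gt 0 n with hn | hn
  · rw [hX1 h _ _ hn, hX0 h' _ _ hn]
  obtain ⟨i, rfl⟩ : ∃ i : ℕ, m = -1 - i := ⟨(-1 - m).toNat, by omega⟩
  obtain ⟨j, rfl⟩ : ∃ j : ℕ, n = -1 - j := ⟨(-1 - n).toNat, by omega⟩
  obtain ⟨N, hN⟩ := h.exists_bound
  ext e
  rw [resres_eq_sum h hN i j e (I := Ioo (e - i - j - 2 - 2 * N) N) subset_rfl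
    fun m hm => (mem_Ioo.1 hm).2,
    resres_eq_sum h' (N := N) (fun m n e hm => hN _ _ _ (by tauto)) j i e
    (I := Ioo (e - i - j - 2 - 2 * N) N) (Ioo_subset_Ioo (by omega) le_rfl)
    fun m hm => (mem_Ioo.1 hm).2, sum_comm]
  refine sum_congr rfl fun m _ => sum_congr rfl fun n _ => ?_
  rw [mul_comm]
  simp only [swap01]
  congr 1
  congr 1
  ring

lemma resres_d02_pow {i j k : ℕ} (a : ℕ) {c : Dist₃ U} (h : Tri i (j + a) k c) :
    resres ((d02 ^ a) c) = fun m n => resres c (m + a) n := by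
  induction a generalizing j with
  | zero => simp
  | succ a ih =>
    have h' : Tri i (j + 1 + a) k c := by rwa [add_right_comm]
    rw [iter_succ, Tri.resres_d02 (h'.d02_pow a), ih h']
    ext m n : 2
    beta_reduce
    rw [show m + 1 + (a : ℤ) = m + ((a + 1 : ℕ) : ℤ) by push_cast; ring]

lemma resres_d12_pow {i j k : ℕ} (a : ℕ) {c : Dist₃ U} (h : Tri i j (k + a) c) :
    resres ((d12 ^ a) c) = fun m n => resres c m (n + a) := by
  induction a generalizing k with
  | zero => simp
  | succ a ih =>
    have h' : Tri i j (k + 1 + a) c := by rwa [add_right_comm]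
    rw [iter_succ, Tri.resres_d12 (h'.d12_pow a), ih h']
    ext m n : 2
    beta_reduce
    rw [show n + 1 + (a : ℤ) = n + ((a + 1 : ℕ) : ℤ) by push_cast; ring]

/-- `resres` in terms of a distribution without poles on the diagonals. -/
lemma resres_eq_bounded {j k : ℕ} {c : Dist₃ U} (h : Tri 0 j k c) (m n : ℤ) :
    resres c m n = resres ((d02 ^ j) ((d12 ^ k) c)) (m - j) (n - k) := by
  have h0 : Tri 0 j (0 + k) c := by rwa [zero_add]
  rw [resres_d02_pow (j := 0) j (by rw [zero_add]; exact h0.d12_pow k), resres_d12_pow k h0]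
  simp

lemma Tri.bounded {j k : ℕ} {c : Dist₃ U} (h : Tri 0 j k c) :
    Tri 0 0 0 ((QVA.d02 ^ j) ((QVA.d12 ^ k) c)) := Tri.d02_pow j (Tri.d12_pow k (by simpa using h))

lemma swap01_d02_pow (j : ℕ) (c : Dist₃ U) : swap01 ((d02 ^ j) c) = (d12 ^ j) (swap01 c) :=
  iter_map (A := swap01) (fun _ => rfl) j c

lemma swap01_d12_pow (j : ℕ) (c : Dist₃ U) : swap01 ((d12 ^ j) c) = (d02 ^ j) (swap01 c) :=
  iter_map (A := swap01) (fun _ => rfl) j c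

/-- For a distribution without pole at `z₀ = z₁` the order of the residues does not matter. -/
lemma resres_comm {j k : ℕ} {c : Dist₃ U} (h : Tri 0 j k c) (h' : Tri 0 k j (swap01 c))
    (m n : ℤ) : resres c m n = resres (swap01 c) n m := by
  have e : swap01 ((d02 ^ j) ((d12 ^ k) c)) = (d02 ^ k) ((d12 ^ j) (swap01 c)) := by
    rw [swap01_d02_pow, swap01_d12_pow, ← End.mul_apply, ← End.mul_apply,
      (commute_d02_d12.pow_pow k j).eq]
  rw [resres_eq_bounded h, resres_eq_bounded h', ← e]
  exact resres_comm_of_bound h.bounded (by rw [e]; exact h'.bounded) _ _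

lemma isShift_d01 : IsShift (d01 : End ℂ (Dist₃ U)) :=
  fun c m n e h0 h1 _ => by simp [d01_apply, h0, h1]

lemma resres_functional (j k : ℕ) (N m n e : ℤ) :
    ∃ (I : Finset (ℤ × ℤ)) (a : ℤ × ℤ → ℂ) (q : ℤ × ℤ → ℤ), ∀ c : Dist₃ U, Tri 0 j k c →
      (∀ m n e, N ≤ m ∨ N ≤ n ∨ N ≤ e → (d02 ^ j) ((d12 ^ k) c) m n e = 0) →
      resres c m n e = ∑ p ∈ I, a p • (d02 ^ j) ((d12 ^ k) c) p.1 p.2 (q p) := by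
  rcases le_or_gt 0 (m - j) with hm | hm
  · refine ⟨∅, 0, 0, fun c h _ => ?_⟩
    rw [resres_eq_bounded h, resres_of_bound h.bounded, Tay_neg (by omega)]
    rfl
  rcases le_or_gt 0 (n - k) with hn | hn
  · refine ⟨∅, 0, 0, fun c h _ => ?_⟩
    rw [resres_eq_bounded h, h.bounded.tr1_resres _ _ (by simpa using hn)]
    rfl
  obtain ⟨i, hi⟩ : ∃ i : ℕ, m - j = -1 - i := ⟨(-1 - (m - j)).toNat, by omega⟩
  obtain ⟨l, hl⟩ : ∃ l : ℕ, n - k = -1 - l := ⟨(-1 - (n - k)).toNat, by omega⟩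
  set I := Ioo (e - i - l - 2 - 2 * N) N with hI
  refine ⟨I ×ˢ I, fun p => ((Ring.choose (-p.1 - 1) i * Ring.choose (-p.2 - 1) l : ℤ) : ℂ),
    fun p => e - i - l - 2 - p.1 - p.2, fun c h hN => ?_⟩
  rw [resres_eq_bounded h, hi, hl, resres_eq_sum h.bounded hN i l e (I := I) subset_rfl
    fun m hm => (mem_Ioo.1 hm).2, sum_product]
  simp only [Int.cast_smul_eq_zsmul]

lemma Tri.mono01 {i j k : ℕ} {c : Dist₃ U} (h : Tri i j k c) : Tri (i + 1) j k c where
  pole01 e := (h.pole01 e).mono (Nat.le_succ i)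
  bound12 := h.bound12
  bound := by
    obtain ⟨N, hN⟩ := h.bound
    refine ⟨N, fun m n e hm => ?_⟩
    rw [iter_succ, d01_apply, hN _ _ _ (by omega), hN _ _ _ (by omega), sub_zero]

lemma Tri.d01_pow_zero {j k : ℕ} {c : Dist₃ U} (h : Tri 0 j k c) (s : ℕ) :
    Tri 0 j k ((QVA.d01 ^ s) c) := iter_mem (P := Tri 0 j k) (fun _ h => h.mono01.d01) h s

/-- The iterated residues of the product with a power series in `z₀ - z₁`. -/
lemma resres_act3 {j k : ℕ} {c : Dist₃ U} (h : Tri 0 j k c) (h3 : Up3 c)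
    (f : ℂ⟦X⟧) (hf : Tri 0 j k (act3 d01 f c)) (m n : ℤ) :
    resres (act3 d01 f c) m n = pwEval dif f (ev2 m n) (resres c) := by
  have hpow : ∀ s, resres ((d01 ^ s) c) = (dif ^ s) (resres c) := fun s =>
    iter_intertwine (P := Tri 0 j k) (fun _ h => h.mono01.d01)
      (fun _ h => by exact h.resres_d01) h s
  obtain ⟨N, hN⟩ := h.bound
  obtain ⟨N', hN'⟩ := hf.bound
  set M := max N N' with hM
  have hb : ∀ s m n e, M ≤ m ∨ M ≤ n ∨ M ≤ e → (d02 ^ j) ((d12 ^ k) ((d01 ^ s) c)) m n e = 0 := by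
    intro s m n e hm
    rw [commute_pow_apply commute_d01_d12 s k, commute_pow_apply commute_d01_d02 s j]
    refine isShift_d01.pow_apply_eq_zero s fun i j l _ => hN _ _ _ (by omega)
  have hloc : ∀ m n e, LocNil d01 (ev3 m n e) ((d02 ^ j) ((d12 ^ k) c)) := fun m n e =>
    ((h3.d12_pow k).d02_pow j).locNil isShift_d01 m n e
  have hlocX : LocNil dif (ev2 m n) (resres c) := by
    refine ⟨(j - m).toNat + (k - n).toNat, fun s hs => ?_⟩
    have h0 : ∀ s : ℕ, ∀ m n : ℤ, (j - m).toNat + (k - n).toNat ≤ s →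
        (dif ^ s) (resres c) m n = 0 := by
      intro s
      induction s with
      | zero =>
        intro m n hs
        exact h.tr1_resres m n (by omega)
      | succ s ih =>
        intro m n hs
        rcases le_or_gt (j : ℤ) m with hm | hm
        · rw [← hpow]
          exact res_eq_zero ((h.d01_pow_zero _).pole_res12_zero n) hm
        rcases le_or_gt (k : ℤ) n with hn | hn
        · rw [← hpow]
          exact (h.d01_pow_zero _).tr1_resres m n hn
        rw [iter_succ, dif_apply, ih _ _ (by omega), ih _ _ (by omega), sub_zero]
    exact h0 s m n hs
  obtain ⟨Q, hQ⟩ := hlocX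
  ext e
  obtain ⟨I, a, q, hI⟩ := resres_functional (U := U) j k M m n e
  rw [hI _ hf fun m n e hm => hN' m n e (by omega), pwEval_eq_sum hQ, Finset.sum_apply]
  simp only [Pi.smul_apply, ← hpow, ev2_apply]
  have h1 : ∀ s, resres ((d01 ^ s) c) m n e =
      (∑ p ∈ I, a p • ev3 p.1 p.2 (q p)) ((d01 ^ s) ((d02 ^ j) ((d12 ^ k) c))) := by
    intro s
    rw [hI _ (h.d01_pow_zero s) (hb s), commute_pow_apply commute_d01_d12 s k,
      commute_pow_apply commute_d01_d02 s j, LinearMap.sum_apply]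
    rfl
  have h2 : ∑ p ∈ I, a p • (d02 ^ j) ((d12 ^ k) (act3 d01 f c)) p.1 p.2 (q p) =
      pwEval d01 f (∑ p ∈ I, a p • ev3 p.1 p.2 (q p)) ((d02 ^ j) ((d12 ^ k) c)) := by
    have h4 := pwEval_sum_functional I a (d01 : End ℂ (Dist₃ U)) f
      (fun p => ev3 p.1 p.2 (q p)) ((d02 ^ j) ((d12 ^ k) c)) fun p _ => hloc p.1 p.2 (q p)
    rw [h4, d12_pow_act3 isShift_d01 commute_d01_d12 h3,
      d02_pow_act3 isShift_d01 commute_d01_d02 (h3.d12_pow k)]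
    rfl
  rw [h2, pwEval_eq_sum (Q := Q) fun s hs => ?_]
  · simp only [h1]
  · rw [← h1]
    have := hQ s hs
    rw [← hpow] at this
    exact congrFun this e

lemma neg_dif_pow_apply (s : ℕ) (c : Dist₂ U) (m n : ℤ) :
    ((-dif : End ℂ (Dist₂ U)) ^ s) c m n = ∑ x ∈ HasAntidiagonal.antidiagonal s,
      ((-1) ^ x.2 * ((x.1 + x.2).choose x.2 : ℂ)) • c (m + x.2) (n + x.1) := by
  let A : End ℂ (Dist₂ U) :=
    { toFun := fun c m n => c m (n + 1)
      map_add' := fun _ _ => rfl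
      map_smul' := fun _ _ => rfl }
  let A' : End ℂ (Dist₂ U) :=
    { toFun := fun c m n => -c (m + 1) n
      map_add' := fun c c' => by ext m n; simp; abel
      map_smul' := fun r c => by ext m n; simp }
  have hA : ∀ (j : ℕ) c m n, (A ^ j) c m n = c m (n + j) := by
    intro j
    induction j with
    | zero => intro c m n; simp
    | succ j ih =>
      intro c m n
      rw [iter_succ]
      change (A ^ j) c m (n + 1) = _
      rw [ih]; congr 1; push_cast; ring
  have hA' : ∀ (j : ℕ) c m n, (A' ^ j) c m n = ((-1 : ℂ) ^ j) • c (m + j) n := by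
    intro j
    induction j with
    | zero => intro c m n; simp
    | succ j ih =>
      intro c m n
      rw [iter_succ]
      change -(A' ^ j) c (m + 1) n = _
      rw [ih, pow_succ', neg_one_mul, neg_smul, show m + 1 + (j : ℤ) = m + ((j + 1 : ℕ) : ℤ) by
        push_cast; ring]
  have hc : Commute A A' := by
    ext c m n
    rfl
  have hd : (-dif : End ℂ (Dist₂ U)) = A + A' := by
    ext c m n
    change -(c (m + 1) n - c m (n + 1)) = c m (n + 1) + -c (m + 1) n
    abel
  rw [hd, hc.add_pow', LinearMap.sum_apply, Finset.sum_apply, Finset.sum_apply]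
  refine sum_congr rfl fun x hx => ?_
  rw [HasAntidiagonal.mem_antidiagonal] at hx
  rw [LinearMap.smul_apply, Pi.smul_apply, Pi.smul_apply, End.mul_apply, hA, hA', ← hx,
    ← Nat.cast_smul_eq_nsmul ℂ, smul_smul, mul_comm, Nat.choose_symm_add]

lemma act2_eq_finsum {c : Dist₂ U} (h : Up2 c) (f : ℂ⟦X⟧) (m n : ℤ) :
    act2 f c m n = ∑ᶠ q : ℕ × ℕ, (((-1) ^ q.2 * ((q.1 + q.2).choose q.2 : ℂ)) *
      coeff (q.1 + q.2) f) • c (m + q.2) (n + q.1) := by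
  obtain ⟨Q, hQ⟩ := h m n
  have h1 : ∀ s, Q ≤ s → ev2 m n (((-dif : End ℂ (Dist₂ U)) ^ s) c) = 0 := fun s hs =>
    dif_pow_apply_eq_zero s fun i j hij => hQ i j (by omega)
  change pwEval _ _ _ _ = _
  rw [pwEval_eq_sum h1, finsum_eq_sum_of_support_subset
    (s := (range Q).biUnion HasAntidiagonal.antidiagonal), sum_biUnion]
  · refine sum_congr rfl fun s _ => ?_
    rw [ev2_apply, neg_dif_pow_apply, smul_sum]
    refine sum_congr rfl fun x hx => ?_
    rw [HasAntidiagonal.mem_antidiagonal] at hx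
    rw [hx, smul_smul, mul_comm]
  · intro s _ t _ hst
    rw [Function.onFun, disjoint_left]
    intro x hx hx'
    rw [HasAntidiagonal.mem_antidiagonal] at hx hx'
    exact hst (hx.symm.trans hx')
  · intro q hq
    simp only [coe_biUnion, Set.mem_iUnion]
    refine ⟨q.1 + q.2, ?_, ?_⟩
    · rw [mem_coe, mem_range]
      by_contra hc
      exact hq (by simp only [hQ q.2 q.1 (by omega), smul_zero])
    · rw [mem_coe, HasAntidiagonal.mem_antidiagonal]

/-! ### Relations and universal property of `V(H, 𝒮)` -/

section

/-- Every element of `M ⊗ N ⊗ ℂ[[x]]` is a finite sum of pure tensors. -/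
lemma exists_sum_tmul {M N P : Type*} [AddCommGroup M] [Module ℂ M] [AddCommGroup N] [Module ℂ N]
    [AddCommGroup P] [Module ℂ P] (A : (M ⊗[ℂ] N) ⊗[ℂ] P) :
    ∃ (r : ℕ) (u : Fin r → M) (v : Fin r → N) (f : Fin r → P), A = ∑ i, (u i ⊗ₜ v i) ⊗ₜ f i := by
  have key : ∀ X : (M ⊗[ℂ] N) ⊗[ℂ] P, ∃ l : List (M × N × P),
      X = (l.map fun x => (x.1 ⊗ₜ[ℂ] x.2.1) ⊗ₜ[ℂ] x.2.2).sum := by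
    intro X
    induction X using TensorProduct.induction_on with
    | zero => exact ⟨[], by simp⟩
    | add X Y hX hY =>
      obtain ⟨l, rfl⟩ := hX
      obtain ⟨l', rfl⟩ := hY
      exact ⟨l ++ l', by simp⟩
    | tmul Y p =>
      induction Y using TensorProduct.induction_on with
      | zero => exact ⟨[], by simp⟩
      | add X Y hX hY =>
        obtain ⟨l, hl⟩ := hX
        obtain ⟨l', hl'⟩ := hY
        exact ⟨l ++ l', by rw [TensorProduct.add_tmul, hl, hl']; simp⟩
      | tmul u v => exact ⟨[(u, v, p)], by simp⟩
  obtain ⟨l, hl⟩ := key A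
  refine ⟨l.length, fun i => l[i].1, fun i => l[i].2.1, fun i => l[i].2.2, ?_⟩
  rw [hl, ← Fin.sum_univ_fun_getElem]
  rfl

variable (S)

variable {W : Type*} [AddCommGroup W] [Module (ModeAlgebra H) W] [Module ℂ W]
  [IsScalarTower ℂ (ModeAlgebra H) W]

lemma up2_mode_mode (hW : ∀ (a : H) (w : W), ∃ N : ℤ, ∀ m : ℤ, N ≤ m → mode m a • w = 0)
    (a b : H) (w : W) : Up2 fun m n => mode n b • mode m a • w := by
  obtain ⟨N, hN⟩ := hW a w
  exact Up2.of_tr0 (M := N) (fun m n hm => by rw [hN m hm, smul_zero]) fun m => hW b _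

/-- The right hand side of the exchange relation in terms of products with power series. -/
lemma exchange_eq_sum {a b : H} {r : ℕ} {β α : Fin r → H} {f : Fin r → ℂ⟦X⟧}
    (h : S (b ⊗ₜ a) = ∑ i, (β i ⊗ₜ α i) ⊗ₜ f i)
    (hW : ∀ (a : H) (w : W), ∃ N : ℤ, ∀ m : ℤ, N ≤ m → mode m a • w = 0) (m n : ℤ) (w : W) :
    exchange S a b m n w = ∑ i, act2 (f i) (fun m n => mode n (β i) • mode m (α i) • w) m n := by
  rw [exchange, h]
  have h1 : ∀ i, act2 (f i) (fun m n => mode n (β i) • mode m (α i) • w) m n =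
      ∑ᶠ q : ℕ × ℕ, (((-1) ^ q.2 * ((q.1 + q.2).choose q.2 : ℂ)) •
        quad (n + q.1) (m + q.2) (powerCoeff (H ⊗[ℂ] H) (q.1 + q.2)
          ((β i ⊗ₜ[ℂ] α i) ⊗ₜ[ℂ] f i))) • w := by
    intro i
    rw [act2_eq_finsum (up2_mode_mode hW _ _ _)]
    refine finsum_congr fun q => ?_
    have hval : quad (n + q.1) (m + q.2) (powerCoeff (H ⊗[ℂ] H) (q.1 + q.2)
        ((β i ⊗ₜ[ℂ] α i) ⊗ₜ[ℂ] f i)) = coeff (q.1 + q.2) (f i) •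
          (mode (n + q.1) (β i) * mode (m + q.2) (α i)) := by
      simp [quad, powerCoeff]
    rw [hval, smul_smul (M := ℂ) (α := ModeAlgebra H), smul_assoc, mul_smul (mode (n + q.1) (β i))]
  simp only [h1]
  rw [← finsum_sum_comm _ _ fun i _ => exchange_finite hW _ m n w]
  refine finsum_congr fun q => ?_
  rw [map_sum, map_sum, smul_sum, sum_smul]

end

section

variable (B S) {W : Type*} [AddCommGroup W] [Module (ModeAlgebra H) W] [Module ℂ W]
  [IsScalarTower ℂ (ModeAlgebra H) W]

/-- The span of the words in negative modes of degree at least `-k`, applied to `w₀`. -/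
def wordFiltration (w₀ : W) (k : ℤ) : Submodule ℂ W :=
  Submodule.span ℂ {x | ∃ l : List (H × ℤ), (∀ p ∈ l, p.2 < 0) ∧ -wordDegree l ≤ k ∧
    x = word l • w₀}

variable {w₀ : W}

lemma wordFiltration_mono {k k' : ℤ} (h : k ≤ k') :
    wordFiltration (H := H) w₀ k ≤ wordFiltration (H := H) w₀ k' :=
  Submodule.span_mono fun _ ⟨l, hl, hk, hx⟩ => ⟨l, hl, hk.trans h, hx⟩

lemma wordFiltration_neg {k : ℤ} (hk : k < 0) : wordFiltration (H := H) w₀ k = ⊥ := by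
  rw [wordFiltration, Submodule.span_eq_bot]
  rintro x ⟨l, hl, hle, rfl⟩
  have := wordDegree_nonpos hl
  omega

lemma mode_smul_mem_wordFiltration_of_neg {m : ℤ} (hm : m < 0) (a : H) {k : ℤ} {x : W}
    (hx : x ∈ wordFiltration (H := H) w₀ k) :
    mode m a • x ∈ wordFiltration (H := H) w₀ (k - m) := by
  induction hx using Submodule.span_induction with
  | mem x hx =>
    obtain ⟨l, hl, hle, rfl⟩ := hx
    refine Submodule.subset_span ⟨(a, m) :: l, ?_, ?_, ?_⟩
    · intro p hp
      rcases List.mem_cons.1 hp with rfl | hp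
      · exact hm
      · exact hl p hp
    · rw [wordDegree_cons]; simp only; omega
    · rw [word_cons, mul_smul]
  | zero => rw [smul_zero]; exact zero_mem _
  | add x y _ _ hx hy => rw [smul_add]; exact add_mem hx hy
  | smul c x _ hx => rw [smul_comm]; exact Submodule.smul_mem _ _ hx

lemma quad_smul_mem {F : Submodule ℂ W} {k l : ℤ} {x : W}
    (h : ∀ a b : H, mode k b • mode l a • x ∈ F) (X : H ⊗[ℂ] H) (c : ℂ) :
    (c • quad k l X) • x ∈ F := by
  rw [smul_assoc]
  refine Submodule.smul_mem _ _ ?_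
  induction X using TensorProduct.induction_on with
  | zero => rw [map_zero, zero_smul]; exact zero_mem _
  | tmul b a => simpa [quad, mul_smul] using h a b
  | add X X' h h' => rw [map_add, add_smul]; exact add_mem h h'

variable (hrel : ∀ (a b : H) (m n : ℤ) (w : W), relator B S a b m n w = 0)
  (hw₀ : ∀ (a : H) (n : ℤ), 0 ≤ n → mode n a • w₀ = 0)
include hrel hw₀

lemma mode_smul_mem_wordFiltration_of_nonneg {m : ℤ} (hm : 0 ≤ m) (a : H) {k : ℤ} {x : W}
    (hx : x ∈ wordFiltration (H := H) w₀ k) :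
    mode m a • x ∈ wordFiltration (H := H) w₀ (k - m - 1) := by
  suffices key : ∀ N : ℕ, ∀ k : ℤ, k < N → ∀ m : ℤ, 0 ≤ m → ∀ (a : H),
      ∀ x ∈ wordFiltration (H := H) w₀ k, mode m a • x ∈ wordFiltration (H := H) w₀ (k - m - 1) from
    key (k + 1).toNat k (by omega) m hm a x hx
  clear hx x hm a k m
  intro N
  induction N with
  | zero =>
    intro k hk m _ a x hx
    rw [wordFiltration_neg (by exact_mod_cast hk), Submodule.mem_bot] at hx
    rw [hx, smul_zero]
    exact zero_mem _
  | succ N ih =>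
    intro k hk m hm a x hx
    push_cast at hk
    induction hx using Submodule.span_induction with
    | zero => rw [smul_zero]; exact zero_mem _
    | add x y _ _ hx hy => rw [smul_add]; exact add_mem hx hy
    | smul c x _ hx => rw [smul_comm]; exact Submodule.smul_mem _ _ hx
    | mem x hx =>
      obtain ⟨l, hl, hle, rfl⟩ := hx
      cases l with
      | nil =>
        rw [show word ([] : List (H × ℤ)) = 1 by simp [word], one_smul, hw₀ a m hm]
        exact zero_mem _
      | cons p l =>
        obtain ⟨b, n⟩ := p
        have hn : n < 0 := hl (b, n) (by simp)
        rw [wordDegree_cons] at hle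
        simp only at hle
        have hw : word l • w₀ ∈ wordFiltration (H := H) w₀ (k + n) :=
          Submodule.subset_span ⟨l, fun p hp => hl p (by simp [hp]), by omega, rfl⟩
        have hr := hrel a b m n (word l • w₀)
        rw [relator, mul_smul, algebraMap_smul, sub_sub, sub_eq_zero] at hr
        rw [word_cons, mul_smul, hr]
        refine add_mem ?_ ?_
        · refine finsum_induction (· ∈ wordFiltration (H := H) w₀ (k - m - 1)) (zero_mem _)
            (fun _ _ => add_mem) fun q => quad_smul_mem (fun a' b' => ?_) _ _
          have h1 := ih (k + n) (by omega) (m + q.2) (by omega) a' _ hw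
          rcases lt_or_ge (n + q.1) 0 with h0 | h0
          · exact wordFiltration_mono (by omega) (mode_smul_mem_wordFiltration_of_neg h0 b' h1)
          · exact wordFiltration_mono (by omega) (ih _ (by omega) _ h0 b' _ h1)
        · split_ifs with h0
          · exact Submodule.smul_mem _ _ (wordFiltration_mono (by omega) hw)
          · rw [zero_smul]; exact zero_mem _

lemma word_smul_mem_wordFiltration (l : List (H × ℤ)) :
    word l • w₀ ∈ wordFiltration (H := H) w₀ (-wordDegree l) ∧
      ((∃ p ∈ l, 0 ≤ p.2) → word l • w₀ ∈ wordFiltration (H := H) w₀ (-wordDegree l - 1)) := by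
  induction l with
  | nil =>
    refine ⟨Submodule.subset_span ⟨[], by simp, by simp, rfl⟩, ?_⟩
    rintro ⟨p, hp, _⟩
    simp at hp
  | cons p l ih =>
    rw [word_cons, mul_smul, wordDegree_cons]
    rcases lt_or_ge p.2 0 with h | h
    · refine ⟨wordFiltration_mono (by omega) (mode_smul_mem_wordFiltration_of_neg h p.1 ih.1), ?_⟩
      rintro ⟨q, hq, hq0⟩
      rcases List.mem_cons.1 hq with rfl | hq
      · omega
      · exact wordFiltration_mono (by omega)
          (mode_smul_mem_wordFiltration_of_neg h p.1 (ih.2 ⟨q, hq, hq0⟩))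
    · have := mode_smul_mem_wordFiltration_of_nonneg B S hrel hw₀ h p.1 ih.1
      exact ⟨wordFiltration_mono (by omega) this, fun _ => wordFiltration_mono (by omega) this⟩

lemma word_smul_eq_zero {l : List (H × ℤ)} (hl : l ≠ []) (hd : 0 ≤ wordDegree l) :
    word l • w₀ = 0 := by
  have h := word_smul_mem_wordFiltration B S hrel hw₀ l
  have hex : ∃ p ∈ l, 0 ≤ p.2 := by
    by_contra hc
    push Not at hc
    cases l with
    | nil => exact hl rfl
    | cons p l =>
      have h1 := hc p (by simp)
      have h2 := wordDegree_nonpos (l := l) fun q hq => hc q (by simp [hq])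
      rw [wordDegree_cons] at hd
      omega
  have := h.2 hex
  rwa [wordFiltration_neg (by omega), Submodule.mem_bot] at this

/-- The universal property of the vacuum module. -/
lemma exists_vacuumModule_hom : ∃ Φ : 𝕍 B S →ₗ[ModeAlgebra H] W, Φ (vacuum B S) = w₀ := by
  let Φ₀ : TruncatedModule H →ₗ[ModeAlgebra H] W :=
    (truncationIdeal H).liftQ (LinearMap.toSpanSingleton (ModeAlgebra H) W w₀) (by
      rw [truncationIdeal, Submodule.span_le]
      rintro x ⟨l, hl, hd, rfl⟩
      exact word_smul_eq_zero B S hrel hw₀ hl hd)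
  have hΦ₀ : Φ₀ (Submodule.Quotient.mk 1) = w₀ := by
    change (1 : ModeAlgebra H) • w₀ = w₀
    rw [one_smul]
  refine ⟨(relationSubmodule B S).liftQ Φ₀ ?_, hΦ₀⟩
  rw [relationSubmodule, Submodule.span_le]
  rintro x ⟨a, b, m, n, w, rfl⟩
  change Φ₀ _ = 0
  rw [relator, map_sub, map_sub, map_smul, map_smul, exchange,
    map_finsum _ (exchange_finite truncatedModule_truncation _ m n w)]
  simp only [map_smul]
  exact hrel a b m n (Φ₀ w)

end

/-! ### The residue action of `a(z)` satisfies the relations of `V(H, 𝒮)` -/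

lemma exists_bound_of_nested {P : ℕ → ℕ → ℕ → Prop} (h0 : ∃ E, ∀ x, E ≤ x → ∀ y z, P x y z)
    (h1 : ∀ x, ∃ E, ∀ y, E ≤ y → ∀ z, P x y z) (h2 : ∀ x y, ∃ E, ∀ z, E ≤ z → P x y z) :
    ∃ Q, ∀ x y z, Q ≤ x + y + z → P x y z := by
  obtain ⟨E, hE⟩ := h0
  choose M hM using h1
  choose N hN using h2
  refine ⟨E + (range E).sup M +
    (range E).sup fun x => (range (M x)).sup (N x), fun x y z hxyz => ?_⟩
  rcases le_or_gt E x with hx | hx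
  · exact hE x hx y z
  have h1 := le_sup (f := M) (mem_range.2 hx)
  have h2 := le_sup (f := fun x => (range (M x)).sup (N x)) (mem_range.2 hx)
  rcases le_or_gt (M x) y with hy | hy
  · exact hM x y hy z
  have h3 := le_sup (f := N x) (mem_range.2 hy)
  refine hN x y z ?_
  omega

lemma exists_nat_bound {P : ℤ → Prop} (h : ∃ N : ℤ, ∀ m, N ≤ m → P m) (m : ℤ) :
    ∃ E : ℕ, ∀ i : ℕ, E ≤ i → P (m + i) := by
  obtain ⟨N, hN⟩ := h
  exact ⟨(N - m).toNat, fun i hi => hN _ (by omega)⟩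

/-- A criterion for `Up3` when the operator with modes `e` is applied first, then the one with
modes `m`, and the one with modes `n` last. -/
lemma Up3.of_nested {c : Dist₃ U} (h0 : ∃ N : ℤ, ∀ e, N ≤ e → ∀ m n, c m n e = 0)
    (h1 : ∀ e, ∃ N : ℤ, ∀ m, N ≤ m → ∀ n, c m n e = 0)
    (h2 : ∀ e m, ∃ N : ℤ, ∀ n, N ≤ n → c m n e = 0) : Up3 c := by
  intro m n e
  obtain ⟨Q, hQ⟩ := exists_bound_of_nested (P := fun l i j => c (m + i) (n + j) (e + l) = 0)
    ((exists_nat_bound h0 e).imp fun E hE l hl i j => hE l hl _ _)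
    (fun l => (exists_nat_bound (h1 (e + l)) m).imp fun E hE i hi j => hE i hi _)
    (fun l i => exists_nat_bound (h2 (e + l) (m + i)) n)
  exact ⟨Q, fun i j l hij => hQ l i j (by omega)⟩

/-- The coefficients of `c` vanish for large first mode. -/
def Van0 (N : ℤ) (c : Dist₃ U) : Prop := ∀ m, N ≤ m → ∀ n e, c m n e = 0

lemma Van0.shift {N : ℤ} {c : Dist₃ U} (h : Van0 N c)
    {t : End ℂ (Dist₃ U)} (ht : IsShift t) : Van0 N (t c) := fun m hm n e =>
  ht c m n e (h _ (by omega) _ _) (h _ hm _ _) (h _ hm _ _)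

lemma Van0.shift_pow {N : ℤ} {c : Dist₃ U} (h : Van0 N c) {t : End ℂ (Dist₃ U)} (ht : IsShift t)
    (k : ℕ) : Van0 N ((t ^ k) c) := iter_mem (P := Van0 N) (fun _ h => h.shift ht) h k

lemma isShift_d02 : IsShift (d02 : End ℂ (Dist₃ U)) :=
  fun c m n e h0 _ h2 => by simp [d02_apply, h0, h2]

lemma isShift_d12 : IsShift (d12 : End ℂ (Dist₃ U)) :=
  fun c m n e _ h1 h2 => by simp [d12_apply, h1, h2]

lemma Van0.act3 {N : ℤ} {c : Dist₃ U} (h : Van0 N c)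
    {t : End ℂ (Dist₃ U)} (ht : IsShift t) (f : ℂ⟦X⟧) :
    Van0 N (act3 t f c) := fun _ hm _ _ =>
  act3_apply_eq_zero ht (fun _ _ _ => h _ (by omega) _ _) f

lemma Van0.sum {ι : Type*} {I : Finset ι} {N : ℤ} {c : ι → Dist₃ U}
    (h : ∀ i ∈ I, Van0 N (c i)) : Van0 N (∑ i ∈ I, c i) := fun m hm n e => by
  simp only [Finset.sum_apply]
  exact sum_eq_zero fun i hi => h i hi m hm n e

lemma Up3.sum {ι : Type*} {I : Finset ι} {c : ι → Dist₃ U} (h : ∀ i ∈ I, Up3 (c i)) :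
    Up3 (∑ i ∈ I, c i) := by
  classical
  induction I using Finset.induction_on with
  | empty => exact fun m n e => ⟨0, fun _ _ _ _ => by simp⟩
  | insert i I hi ih =>
    rw [sum_insert hi]
    exact (h i (mem_insert_self _ _)).add (ih fun j hj => h j (mem_insert_of_mem hj))

lemma commute_neg_d01_d02 : Commute (-d01 : End ℂ (Dist₃ U)) d02 :=
  Commute.neg_left (R := End ℂ (Dist₃ U)) commute_d01_d02

section

/-- The product of the formal distribution `a(z₀)` with a `V(H, 𝒮)`-valued formal distribution
`g(z₁)`. -/
def modeCorr (a : H) (g : ℤ → 𝕍 B S) : Dist₂ (𝕍 B S) := fun m n => mode m a • g n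

/-- The distribution `a(z₀) b(z₁) g(z₂)`. -/
def modeCorr₂ (a b : H) (g : ℤ → 𝕍 B S) : Dist₃ (𝕍 B S) := fun m n e => mode m a • mode n b • g e

lemma dif_pow_modeCorr₂ (k : ℕ) (a b : H) (g : ℤ → 𝕍 B S) (m : ℤ) :
    (dif ^ k) (modeCorr₂ a b g m) = fun n e => mode m a • (dif ^ k) (modeCorr b g) n e :=
  dif_pow_map k (modeCorr b g) (modeEnd B S m a)

lemma d02_pow_swap_modeCorr₂ (k : ℕ) (a b : H) (g : ℤ → 𝕍 B S) (m n e : ℤ) :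
    (d02 ^ k) (swap01 (modeCorr₂ b a g)) m n e = mode n b • (dif ^ k) (modeCorr a g) m e := by
  rw [d02_pow_apply]
  exact congrFun (congrFun (dif_pow_map k (modeCorr a g) (modeEnd B S n b)) m) e

lemma up3_swap_modeCorr₂ (a b : H) {g : ℤ → 𝕍 B S} {E : ℤ}
    (hE : ∀ e, E ≤ e → g e = 0) : Up3 (swap01 (modeCorr₂ b a g)) := by
  refine Up3.of_nested ⟨E, fun e he m n => ?_⟩ (fun e => ?_) fun e m => ?_
  · rw [swap01, modeCorr₂, hE e he, smul_zero, smul_zero]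
  · obtain ⟨N, hN⟩ := vacuumModule_truncation B S a (g e)
    exact ⟨N, fun m hm n => by rw [swap01, modeCorr₂, hN m hm, smul_zero]⟩
  · exact vacuumModule_truncation B S b _

lemma modeCorr₂_eq {a b : H} {r : ℕ} {β α : Fin r → H} {f : Fin r → ℂ⟦X⟧}
    (h : S (b ⊗ₜ a) = ∑ i, (β i ⊗ₜ α i) ⊗ₜ f i) (g : ℤ → 𝕍 B S) (m n e : ℤ) :
    modeCorr₂ a b g m n e = (∑ i, act3 (-d01) (f i) (swap01 (modeCorr₂ (β i) (α i) g))) m n e +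
        (if m + n + 1 = 0 then B a b else 0) • g e := by
  rw [modeCorr₂, relation_eq, exchange_eq_sum S h (vacuumModule_truncation B S), Finset.sum_apply,
    Finset.sum_apply, Finset.sum_apply]
  congr 1
  refine sum_congr rfl fun i _ => ?_
  rw [act3_neg_d01]
  rfl

lemma d01_modeCorr₂_eq {a b : H} {r : ℕ} {β α : Fin r → H} {f : Fin r → ℂ⟦X⟧}
    (h : S (b ⊗ₜ a) = ∑ i, (β i ⊗ₜ α i) ⊗ₜ f i) (g : ℤ → 𝕍 B S) :
    d01 (modeCorr₂ a b g) = d01 (∑ i, act3 (-d01) (f i) (swap01 (modeCorr₂ (β i) (α i) g))) := by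
  ext m n e
  rw [d01_apply, d01_apply, modeCorr₂_eq h, modeCorr₂_eq h,
    show m + 1 + n + 1 = m + (n + 1) + 1 by ring, add_sub_add_right_eq_sub]

variable {g : ℤ → 𝕍 B S} {N E : ℤ} {k : ℕ}
  (hg : ∀ a, Tr0 N ((dif ^ k) (modeCorr a g))) (hE : ∀ e, E ≤ e → g e = 0)
include hg hE

lemma tr1_modeCorr (a : H) : Tr1 E (modeCorr a g) := fun m e he => by
  rw [modeCorr, hE e he, smul_zero]

lemma pole_modeCorr (a : H) : Pole k (modeCorr a g) :=
  ⟨⟨N, hg a⟩, E, (tr1_modeCorr hg hE a).dif_pow k⟩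

lemma bound12_modeCorr₂ (a b : H) (m : ℤ) :
    Tr0 N ((dif ^ k) (modeCorr₂ a b g m)) ∧ Tr1 E ((dif ^ k) (modeCorr₂ a b g m)) := by
  rw [dif_pow_modeCorr₂]
  exact ⟨fun n e hn => by beta_reduce; rw [hg b n e hn, smul_zero],
    fun n e he => by beta_reduce; rw [(tr1_modeCorr hg hE b).dif_pow k n e he, smul_zero]⟩

lemma van0_d02_pow_swap (a b : H) : Van0 N ((d02 ^ k) (swap01 (modeCorr₂ b a g))) :=
  fun m hm n e => by rw [d02_pow_swap_modeCorr₂, hg a m e hm, smul_zero]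

lemma van0_d01_d02_pow (a b : H) : Van0 N (d01 ((d02 ^ k) (modeCorr₂ a b g))) := by
  obtain ⟨r, β, α, f, h⟩ := exists_sum_tmul (S (b ⊗ₜ a))
  have hup := fun i => up3_swap_modeCorr₂ (α i) (β i) hE
  have e1 : d01 ((d02 ^ k) (modeCorr₂ a b g)) =
      d01 (∑ i, act3 (-d01) (f i) ((d02 ^ k) (swap01 (modeCorr₂ (β i) (α i) g)))) := by
    have := LinearMap.congr_fun ((commute_d01_d02 (U := 𝕍 B S)).pow_right k).eq
    rw [← End.mul_apply, this, End.mul_apply, d01_modeCorr₂_eq h, ← End.mul_apply, ← this,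
      End.mul_apply, map_sum]
    congr 1
    refine sum_congr rfl fun i _ => ?_
    rw [d02_pow_act3 isShift_neg_d01 commute_neg_d01_d02 (hup i)]
  rw [e1]
  exact (Van0.sum fun i _ => (van0_d02_pow_swap hg hE _ _).act3 isShift_neg_d01 _).shift isShift_d01

lemma tri_modeCorr₂ (a b : H) : Tri 1 k k (modeCorr₂ a b g) where
  pole01 e := by
    obtain ⟨r, β, α, f, h⟩ := exists_sum_tmul (S (b ⊗ₜ a))
    obtain ⟨N', hN'⟩ := vacuumModule_truncation B S b (g e)
    have h1 : dif (fun m n => modeCorr₂ a b g m n e) =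
        dif (∑ i, act2 (f i) fun m n => mode n (β i) • mode m (α i) • g e) := by
      ext m n
      rw [dif_apply, dif_apply, modeCorr₂_eq h, modeCorr₂_eq h,
        show m + 1 + n + 1 = m + (n + 1) + 1 by ring,
        add_sub_add_right_eq_sub]
      simp only [Finset.sum_apply, act3_neg_d01]
      rfl
    choose M hM using fun i => vacuumModule_truncation B S (α i) (g e)
    obtain ⟨M', hM'⟩ : ∃ M' : ℤ, ∀ i, M i ≤ M' := by
      obtain ⟨M', h⟩ := (Set.finite_range M).bddAbove
      exact ⟨M', fun i => h ⟨i, rfl⟩⟩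
    refine ⟨⟨M', ?_⟩, N', ?_⟩
    · rw [pow_one, h1]
      refine Tr0.dif fun m n hm => ?_
      rw [Finset.sum_apply, Finset.sum_apply]
      refine sum_eq_zero fun i _ => act2_apply_eq_zero (fun i' j => ?_) _
      rw [hM i _ (by have := hM' i; omega), smul_zero]
    · rw [pow_one]
      exact Tr1.dif fun m n hn => by rw [modeCorr₂, hN' n hn, smul_zero]
  bound12 := ⟨max N E, fun m => ⟨(bound12_modeCorr₂ hg hE a b m).1.mono (le_max_left _ _),
    (bound12_modeCorr₂ hg hE a b m).2.mono (le_max_right _ _)⟩⟩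
  bound := by
    refine ⟨max N E, fun m n e hm => ?_⟩
    have hN := le_max_left N E
    have hE' := le_max_right N E
    rcases hm with hm | hm
    · have h1 := (van0_d01_d02_pow hg hE a b).shift_pow isShift_d12 k
      have h2 : (d01 ^ 1) ((d02 ^ k) ((d12 ^ k) (modeCorr₂ a b g))) =
          (d12 ^ k) (d01 ((d02 ^ k) (modeCorr₂ a b g))) := by
        rw [pow_one, ← End.mul_apply (d02 ^ k), (commute_d02_d12.pow_pow k k).eq,
          End.mul_apply, ← End.mul_apply d01, (commute_d01_d12.pow_right k).eq,
          End.mul_apply]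
      rw [h2]
      exact h1 m (by omega) n e
    · rw [pow_one]
      have h1 : ∀ m n e, N ≤ n ∨ E ≤ e → (d12 ^ k) (modeCorr₂ a b g) m n e = 0 := by
        intro m n e hn
        rw [d12_pow_apply]
        rcases hn with hn | hn
        · exact (bound12_modeCorr₂ hg hE a b m).1 n e hn
        · exact (bound12_modeCorr₂ hg hE a b m).2 n e hn
      refine isShift_d01 _ _ _ _ ?_ ?_ ?_ <;>
      exact isShift_d02.pow_apply_eq_zero k fun i j l _ => h1 _ _ _ (by omega)

lemma res12_modeCorr₂ (a b : H) (n : ℤ) :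
    res12 (modeCorr₂ a b g) n = modeCorr a (res (modeCorr b g) n) := by
  ext m e
  exact res_map (pole_modeCorr hg hE b) (modeEnd B S m a) n e

/-- The modes of `a(z₀)` acting on `g(z₁)` by residues preserve the bound `N`. -/
lemma tr0_dif_pow_res (a b : H) (n : ℤ) :
    Tr0 N ((dif ^ (1 + (k - n).toNat + k)) (modeCorr a (res (modeCorr b g) n))) := by
  rw [← res12_modeCorr₂ hg hE]
  refine dif_pow_res12_mem (fun m => (tri_modeCorr₂ hg hE a b).pole12 m)
    { carrier := {c | Tr0 N c}
      zero_mem' := fun _ _ _ => rfl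
      add_mem' := fun h h' => h.add h'
      smul_mem' := fun r _ h => h.smul r } (fun _ => Tr0.dif) 1 k (fun n m e hm => ?_) n
  rw [pow_one, res12]
  have : d01 ((d02 ^ k) (modeCorr₂ a b g)) m = 0 := by
    ext n e
    exact van0_d01_d02_pow hg hE a b m hm n e
  rw [this, res_zero]
  rfl

lemma res_modeCorr_eq_zero (a : H) (n e : ℤ) (he : N + E + (k - n - 1) ≤ e) :
    res (modeCorr a g) n e = 0 := by
  rw [res_eq (pole_modeCorr hg hE a)]
  exact Tay_eq_zero (hg a) ((tr1_modeCorr hg hE a).dif_pow k) he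

end

lemma Up3.swap01 {c : Dist₃ U} (h : Up3 c) : Up3 (swap01 c) := fun m n e => by
  obtain ⟨Q, hQ⟩ := h n m e
  exact ⟨Q, fun i j l hij => hQ j i l (by omega)⟩

lemma Tri.act3_d01 {j k : ℕ} {c : Dist₃ U} (h : Tri 0 j k c) (h3 : Up3 c)
    (f : ℂ⟦X⟧) : Tri 0 j k (act3 QVA.d01 f c) where
  pole01 e := by
    have key : ∀ m n, (∀ s, (dif ^ s) (fun m n => c m n e) m n = 0) →
        act3 QVA.d01 f c m n e = 0 := by
      intro m n hs
      refine finsum_eq_zero_of_forall_eq_zero fun s => ?_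
      rw [ev3_apply, d01_pow_apply, hs, smul_zero]
    obtain ⟨⟨M, hM⟩, N, hN⟩ := h.pole01 e
    exact ⟨⟨M, fun m n hm => key m n fun s => Tr0.dif_pow hM s m n hm⟩,
      N, fun m n hn => key m n fun s => Tr1.dif_pow hN s m n hn⟩
  bound12 := by
    obtain ⟨N, hN⟩ := h.bound12
    refine ⟨N, fun m => ?_⟩
    have h1 : ∀ m n e, N ≤ n ∨ N ≤ e → (QVA.d12 ^ k) (act3 QVA.d01 f c) m n e = 0 := by
      intro m n e hn
      rw [d12_pow_act3 isShift_d01 commute_d01_d12 h3]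
      refine act3_apply_eq_zero isShift_d01 (fun i j l => ?_) f
      rw [d12_pow_apply]
      rcases hn with hn | hn
      · exact (hN _).1 _ _ (by omega)
      · exact (hN _).2 _ _ (by omega)
    rw [← d12_pow_apply]
    exact ⟨fun n e hn => h1 m n e (Or.inl hn), fun n e he => h1 m n e (Or.inr he)⟩
  bound := by
    obtain ⟨N, hN⟩ := h.bound
    refine ⟨N, fun m n e hm => ?_⟩
    rw [d12_pow_act3 isShift_d01 commute_d01_d12 h3,
      d02_pow_act3 isShift_d01 commute_d01_d02 (h3.d12_pow k),
      pow_zero, End.one_apply]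
    exact act3_apply_eq_zero isShift_d01 (fun i j l => hN _ _ _ (by omega)) f

lemma Tri.add {i j k : ℕ} {c c' : Dist₃ U} (h : Tri i j k c) (h' : Tri i j k c') :
    Tri i j k (c + c') where
  pole01 e := (h.pole01 e).add (h'.pole01 e)
  bound12 := by
    obtain ⟨N, hN⟩ := h.bound12
    obtain ⟨N', hN'⟩ := h'.bound12
    refine ⟨max N N', fun m => ?_⟩
    rw [Pi.add_apply, map_add]
    exact ⟨((hN m).1.mono (le_max_left _ _)).add ((hN' m).1.mono (le_max_right _ _)),
      ((hN m).2.mono (le_max_left _ _)).add ((hN' m).2.mono (le_max_right _ _))⟩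
  bound := by
    obtain ⟨N, hN⟩ := h.bound
    obtain ⟨N', hN'⟩ := h'.bound
    refine ⟨max N N', fun m n e hm => ?_⟩
    rw [map_add, map_add, map_add, Pi.add_apply, Pi.add_apply, Pi.add_apply, hN _ _ _ (by omega),
      hN' _ _ _ (by omega), add_zero]

lemma Tri.zero (i j k : ℕ) : Tri i j k (0 : Dist₃ U) where
  pole01 _ := Pole.zero _
  bound12 := ⟨0, fun m => by
    rw [Pi.zero_apply, map_zero]
    exact ⟨fun _ _ _ => rfl, fun _ _ _ => rfl⟩⟩
  bound := ⟨0, fun m n e _ => by rw [map_zero, map_zero, map_zero]; rfl⟩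

lemma Tri.smul {i j k : ℕ} {c : Dist₃ U} (r : ℂ) (h : Tri i j k c) : Tri i j k (r • c) where
  pole01 e := (h.pole01 e).smul r
  bound12 := by
    obtain ⟨N, hN⟩ := h.bound12
    refine ⟨N, fun m => ?_⟩
    rw [Pi.smul_apply, map_smul]
    exact ⟨(hN m).1.smul r, (hN m).2.smul r⟩
  bound := by
    obtain ⟨N, hN⟩ := h.bound
    refine ⟨N, fun m n e hm => ?_⟩
    rw [map_smul, map_smul, map_smul, Pi.smul_apply, Pi.smul_apply, Pi.smul_apply,
      hN _ _ _ hm, smul_zero]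

lemma resres_add {j k : ℕ} {c c' : Dist₃ U} (h : Tri 0 j k c) (h' : Tri 0 j k c') :
    resres (c + c') = resres c + resres c' := by
  ext m n : 2
  have e1 : res12 (c + c') n = res12 c n + res12 c' n := by
    ext m e
    exact congrFun (res_add (h.pole12 m) (h'.pole12 m) n) e
  change res (res12 (c + c') n) m = res (res12 c n) m + res (res12 c' n) m
  rw [e1, res_add (h.pole_res12_zero n) (h'.pole_res12_zero n)]

lemma resres_smul {j k : ℕ} {c : Dist₃ U} (h : Tri 0 j k c) (r : ℂ) :
    resres (r • c) = r • resres c := by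
  ext m n : 2
  have e1 : res12 (r • c) n = r • res12 c n := by
    ext m e
    exact congrFun (res_smul (h.pole12 m) r n) e
  change res (res12 (r • c) n) m = r • res (res12 c n) m
  rw [e1, res_smul (h.pole_res12_zero n)]

lemma resres_zero : resres (0 : Dist₃ U) = 0 := by
  have := resres_smul (Tri.zero (U := U) 0 0 0) 0
  simpa using this

lemma Tri.sum {ι : Type*} {I : Finset ι} {i j k : ℕ} {c : ι → Dist₃ U}
    (h : ∀ x ∈ I, Tri i j k (c x)) : Tri i j k (∑ x ∈ I, c x) := by
  classical
  induction I using Finset.induction_on with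
  | empty => exact Tri.zero _ _ _
  | insert x I hx ih =>
    rw [sum_insert hx]
    exact (h x (mem_insert_self _ _)).add (ih fun y hy => h y (mem_insert_of_mem hy))

lemma resres_sum {ι : Type*} {I : Finset ι} {j k : ℕ} {c : ι → Dist₃ U}
    (h : ∀ x ∈ I, Tri 0 j k (c x)) : resres (∑ x ∈ I, c x) = ∑ x ∈ I, resres (c x) := by
  classical
  induction I using Finset.induction_on with
  | empty => simp only [sum_empty]; exact resres_zero
  | insert x I hx ih =>
    rw [sum_insert hx, sum_insert hx, resres_add (h x (mem_insert_self _ _))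
        (Tri.sum fun y hy => h y (mem_insert_of_mem hy)),
      ih fun y hy => h y (mem_insert_of_mem hy)]

/-- Exchange of the two variables. -/
def flip2 : (Dist₂ U) →ₗ[ℂ] Dist₂ U where
  toFun c m n := c n m
  map_add' _ _ := rfl
  map_smul' _ _ := rfl

lemma flip2_apply (c : Dist₂ U) (m n : ℤ) : flip2 c m n = c n m := rfl

lemma flip2_dif (c : Dist₂ U) : flip2 (dif c) = (-dif : End ℂ (Dist₂ U)) (flip2 c) := by
  ext m n
  change c (n + 1) m - c n (m + 1) = -(c n (m + 1) - c (n + 1) m)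
  abel

lemma pwEval_dif_flip (f : ℂ⟦X⟧) (x : Dist₂ U) (m n : ℤ) :
    pwEval dif f (ev2 m n) x = act2 f (flip2 x) n m :=
  pwEval_comp _ f _ x (flip2_dif) (ev2 n m) fun _ => rfl

/-- The residues of `1(z₀) y(z₁)`: multiplication by the identity field. -/
lemma res_identity {y : ℤ → U} {E : ℤ} (hy : ∀ e, E ≤ e → y e = 0) (l : ℤ) :
    res (fun n e => if n + 1 = 0 then y e else 0) l = if l + 1 = 0 then y else 0 := by
  have hp : Pole 0 (fun n e => if n + 1 = 0 then y e else 0) :=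
    ⟨⟨0, fun n e hn => if_neg (by omega)⟩, E, fun n e he => by
      change (if n + 1 = 0 then y e else 0) = 0
      rw [hy e he, ite_self]⟩
  rw [res_eq hp]
  rcases le_or_gt 0 l with hl | hl
  · rw [Tay_neg (by push_cast; omega), if_neg (by omega)]
  obtain ⟨p, rfl⟩ : ∃ p : ℕ, l = -1 - p := ⟨(-1 - l).toNat, by omega⟩
  ext s
  rw [show ((0 : ℕ) : ℤ) - (-1 - p) - 1 = p by push_cast; ring, Tay_natCast,
    finsum_eq_single _ (-1 : ℤ) fun m hm => by
      rw [pow_zero, End.one_apply, if_neg (by omega), smul_zero]]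
  rw [pow_zero, End.one_apply, if_pos (by norm_num)]
  rcases Nat.eq_zero_or_pos p with rfl | hp
  · simp
  · rw [if_neg (by omega)]
    rw [show (-(-1 : ℤ) - 1) = 0 by norm_num, Ring.choose_zero_pos ℤ hp, zero_smul]
    rfl

section

lemma commute_neg_d01_d01 : Commute (-d01 : End ℂ (Dist₃ U)) d01 :=
  Commute.neg_left (R := End ℂ (Dist₃ U)) (Commute.refl d01)

lemma swap01_d01 (c : Dist₃ U) : swap01 (d01 c) = -d01 (swap01 c) := by
  ext m n e
  change c (n + 1) m e - c n (m + 1) e = -(c n (m + 1) e - c (n + 1) m e)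
  abel

lemma swap01_act3_d01 (f : ℂ⟦X⟧)
    (c : Dist₃ U) : swap01 (act3 d01 f c) = act3 (-d01) f (swap01 c) := by
  let σ : (Dist₃ U) →ₗ[ℂ] Dist₃ U :=
    { toFun := swap01
      map_add' := fun _ _ => rfl
      map_smul' := fun _ _ => rfl }
  ext m n e
  exact pwEval_comp d01 f (ev3 n m e) c (d := σ) (t' := -d01) swap01_d01 (ev3 m n e) fun _ => rfl

lemma act3_neg (t : End ℂ (Dist₃ U)) (c : Dist₃ U) (f : ℂ⟦X⟧) :
    act3 t f (-c) = -act3 t f c := by rw [← neg_one_smul ℂ c, act3_smul, neg_one_smul]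

lemma act2_neg (c : Dist₂ U) (f : ℂ⟦X⟧) :
    act2 f (-c) = -act2 f c := by rw [← neg_one_smul ℂ c, act2_smul, neg_one_smul]

/-- The residue at `z₀ = z₁` of `a(z₀) b(z₁) w`. -/
lemma res_mode_mode (a b : H) (w : 𝕍 B S) (p : ℤ) :
    res (fun m n => mode m a • mode n b • w) 0 p = (if p + 1 = 0 then B a b else 0) • w := by
  obtain ⟨r, β, α, f, h⟩ := exists_sum_tmul (S (b ⊗ₜ a))
  obtain ⟨N, hN⟩ := vacuumModule_truncation B S b w
  choose M hM using fun i => vacuumModule_truncation B S (α i) w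
  obtain ⟨M', hM'⟩ : ∃ M' : ℤ, ∀ i, M i ≤ M' := by
    obtain ⟨M', h⟩ := (Set.finite_range M).bddAbove
    exact ⟨M', fun i => h ⟨i, rfl⟩⟩
  set c'' : Dist₂ (𝕍 B S) :=
    ∑ i, act2 (f i) fun m n => mode n (β i) • mode m (α i) • w with hc''
  have hrel : ∀ m n, mode m a • mode n b • w =
      c'' m n + (if m + n + 1 = 0 then B a b else 0) • w := by
    intro m n
    rw [relation_eq, exchange_eq_sum S h (vacuumModule_truncation B S), hc'', Finset.sum_apply,
      Finset.sum_apply]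
  have h1 : Tr1 N fun m n => mode m a • mode n b • w := fun m n hn => by
    beta_reduce; rw [hN n hn, smul_zero]
  have h0 : Tr0 M' c'' := fun m n hm => by
    rw [hc'', Finset.sum_apply, Finset.sum_apply]
    refine sum_eq_zero fun i _ => act2_apply_eq_zero (fun i' j => ?_) _
    rw [hM i _ (by have := hM' i; omega), smul_zero]
  have hd : (dif ^ 1) (fun m n => mode m a • mode n b • w) = (dif ^ 1) c'' := by
    ext m n
    rw [pow_one, dif_apply, dif_apply, hrel, hrel, show m + 1 + n + 1 = m + (n + 1) + 1 by ring,
      add_sub_add_right_eq_sub]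
  have hp : Pole 1 fun m n => mode m a • mode n b • w :=
    ⟨⟨M', by rw [hd]; exact h0.dif_pow 1⟩, N, h1.dif_pow 1⟩
  have := jacobi_formal hd h1 h0 0 p 0
  rw [mulPow01_zero, mulPow10_zero h0, hrel, add_sub_cancel_left,
    finsum_eq_single _ 0 fun i hi => by
    rw [res_eq_zero hp (by omega)]; simp] at this
  simpa using this.symm

variable {g : ℤ → 𝕍 B S} {N E : ℤ} {k : ℕ}
  (hg : ∀ a, Tr0 N ((dif ^ k) (modeCorr a g))) (hE : ∀ e, E ≤ e → g e = 0)
include hg hE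

lemma dif_resres_modeCorr₂ {a b : H} {r : ℕ} {β α : Fin r → H} {f : Fin r → ℂ⟦X⟧}
    (h : S (b ⊗ₜ a) = ∑ i, (β i ⊗ₜ α i) ⊗ₜ f i) :
    dif (resres (modeCorr₂ a b g)) =
      dif (∑ i, act2 (f i) (flip2 (resres (modeCorr₂ (β i) (α i) g)))) := by
  have hT := tri_modeCorr₂ hg hE a b
  have hTi := fun i => tri_modeCorr₂ hg hE (β i) (α i)
  have hup := fun i => up3_swap_modeCorr₂ (α i) (β i) hE
  have hupG : ∀ i, Up3 (d01 (modeCorr₂ (β i) (α i) g)) := fun i => (hup i).swap01.d01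
  have hTG : ∀ i, Tri 0 k k (d01 (modeCorr₂ (β i) (α i) g)) := fun i => (hTi i).d01
  have hTA := fun i => (hTG i).act3_d01 (hupG i) (f i)
  -- the factor `z₀ - z₁` removes the delta function from the relation for `a(z₀) b(z₁)`
  have e1 : ∑ i, act3 d01 (f i) (d01 (modeCorr₂ (β i) (α i) g)) =
      (-1 : ℂ) • swap01 (d01 (modeCorr₂ a b g)) := by
    rw [d01_modeCorr₂_eq h, map_sum]
    ext n m e
    rw [neg_smul, one_smul]
    simp only [swap01, Pi.neg_apply, Finset.sum_apply]
    rw [← sum_neg_distrib]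
    refine sum_congr rfl fun i _ => ?_
    rw [d01_act3 isShift_neg_d01 commute_neg_d01_d01 (hup i)]
    have h1 := congrFun (congrFun (congrFun
      (swap01_act3_d01 (f i) (d01 (modeCorr₂ (β i) (α i) g))) m) n) e
    rw [swap01_d01, act3_neg] at h1
    exact h1
  have hTs : Tri 0 k k (swap01 (d01 (modeCorr₂ a b g))) := by
    have := (Tri.sum (I := univ) fun i _ => hTA i).smul (-1)
    rwa [e1, smul_smul, neg_one_mul, neg_neg, one_smul] at this
  have e2 := resres_sum (I := univ) fun i _ => hTA i
  rw [e1, resres_smul hTs, neg_one_smul] at e2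
  rw [← hT.resres_d01]
  ext m n : 2
  rw [resres_comm hT.d01 hTs, ← neg_neg (resres (swap01 _) n m)]
  have e3 := congrFun (congrFun e2 n) m
  rw [Pi.neg_apply, Pi.neg_apply] at e3
  rw [e3, map_sum, Finset.sum_apply, Finset.sum_apply, Finset.sum_apply, Finset.sum_apply,
    ← sum_neg_distrib]
  refine sum_congr rfl fun i _ => ?_
  rw [resres_act3 (hTG i) (hupG i) _ (hTA i), (hTi i).resres_d01, pwEval_dif_flip]
  have hY : Up2 (flip2 (resres (modeCorr₂ (β i) (α i) g))) := by
    refine Up2.of_tr0 (M := k) (fun m n hm => (hTi i).tr1_resres n m hm) fun m => ?_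
    exact ⟨_, fun n hn => res_eq_zero ((hTi i).pole_res12 m) hn⟩
  rw [dif_act2 hY, flip2_dif, LinearMap.neg_apply, act2_neg, Pi.neg_apply, Pi.neg_apply, neg_neg]

/-- The modes of `a(z)` and `b(z)` acting on `g` by residues satisfy the exchange relation. -/
lemma resres_modeCorr₂_eq {a b : H} {r : ℕ} {β α : Fin r → H} {f : Fin r → ℂ⟦X⟧}
    (h : S (b ⊗ₜ a) = ∑ i, (β i ⊗ₜ α i) ⊗ₜ f i) (m n : ℤ) :
    resres (modeCorr₂ a b g) m n =
      (∑ i, act2 (f i) (flip2 (resres (modeCorr₂ (β i) (α i) g)))) m n +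
        (if m + n + 1 = 0 then B a b else 0) • g := by
  have hT := tri_modeCorr₂ hg hE a b
  have h0 : Tr0 k (∑ i, act2 (f i) (flip2 (resres (modeCorr₂ (β i) (α i) g)))) := fun m n hm => by
    rw [Finset.sum_apply, Finset.sum_apply]
    refine sum_eq_zero fun i _ => act2_apply_eq_zero (fun i' j => ?_) _
    exact (tri_modeCorr₂ hg hE _ _).tr1_resres _ _ (by omega)
  -- the difference of the two sides is a multiple of the delta function, by the residue at `z₀ = z₁`
  have := jacobi_formal (k := 1)
    (by rw [pow_one]; exact dif_resres_modeCorr₂ hg hE h) hT.tr1_resres h0 0 m n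
  rw [mulPow01_zero, mulPow10_zero h0, sub_eq_iff_eq_add'] at this
  rw [this]
  congr 1
  rw [finsum_eq_single _ 0 fun i hi => by
    rw [res_eq_zero hT.pole_resres (by omega), Pi.zero_apply, smul_zero]]
  have h1 : res01 (modeCorr₂ a b g) 0 = fun p e => if p + 1 = 0 then (B a b • g) e else 0 := by
    ext p e
    refine (res_mode_mode a b (g e) p).trans ?_
    rw [ite_smul, zero_smul]
    rfl
  rw [Ring.choose_zero_right, one_smul, Nat.cast_zero, add_zero, sub_zero, hT.res_resres, h1,
    res_identity (E := E) fun e he => by rw [Pi.smul_apply, hE e he, smul_zero]]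
  rw [ite_smul, zero_smul]

end

section

variable {W : Type*} [AddCommGroup W] [Module ℂ W]

/-- The representation of `T(H ⊗ ℂ[t, t⁻¹])` in which `a(n)` acts by `φ n a`. -/
def modeLift (φ : ℤ → H →ₗ[ℂ] End ℂ W) : ModeAlgebra H →ₐ[ℂ] End ℂ W :=
  TensorAlgebra.lift ℂ <| TensorProduct.lift <| LinearMap.flip <|
    Finsupp.linearCombination ℂ φ ∘ₗ (AddMonoidAlgebra.coeffLinearEquiv ℂ).toLinearMap

lemma modeLift_mode (φ : ℤ → H →ₗ[ℂ] End ℂ W) (n : ℤ) (a : H) : modeLift φ (mode n a) = φ n a := by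
  simp only [modeLift, mode, comp_apply, TensorAlgebra.lift_ι_apply,
    LinearMap.flip_apply, TensorProduct.mk_apply, TensorProduct.lift.tmul]
  have : (AddMonoidAlgebra.coeffLinearEquiv ℂ).toLinearMap (LaurentPolynomial.T n : ℂ[T;T⁻¹]) =
      Finsupp.single n 1 := rfl
  rw [this, Finsupp.linearCombination_single, one_smul]

end

/-! ### Construction of the vertex operators -/

/-- `V(H, 𝒮)` is spanned by the vectors obtained from the vacuum by applying modes. -/
lemma vacuumModule_induction {P : 𝕍 B S → Prop} (hvac : P (vacuum B S))
    (hmode : ∀ (n : ℤ) (a : H) u, P u → P (mode n a • u)) (hadd : ∀ u v, P u → P v → P (u + v))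
    (hsmul : ∀ (r : ℂ) u, P u → P (r • u)) (u : 𝕍 B S) : P u := by
  have key : ∀ (t : ModeAlgebra H) (u : 𝕍 B S), P u → P (t • u) := by
    intro t
    induction t using TensorAlgebra.induction with
    | algebraMap r => intro u hu; exact hsmul r u hu
    | mul s t hs ht => intro u hu; rw [mul_smul]; exact hs _ (ht _ hu)
    | add s t hs ht => intro u hu; rw [add_smul]; exact hadd _ _ (hs _ hu) (ht _ hu)
    | ι x =>
      intro u hu
      induction x using TensorProduct.induction_on with
      | zero => rw [map_zero, zero_smul, ← zero_smul ℂ u]; exact hsmul _ _ hu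
      | add x y hx hy => rw [map_add, add_smul]; exact hadd _ _ hx hy
      | tmul a p =>
        induction p using LaurentPolynomial.induction_on' with
        | add p q hp hq => rw [TensorProduct.tmul_add, map_add, add_smul]; exact hadd _ _ hp hq
        | C_mul_T n r =>
          have h := hsmul r _ (hmode n a u hu)
          rwa [← smul_assoc, mode, comp_apply, ← map_smul, LinearMap.flip_apply,
            TensorProduct.mk_apply, ← TensorProduct.tmul_smul, LaurentPolynomial.smul_eq_C_mul] at h
  obtain ⟨x, rfl⟩ := toVacuumModule_surjective B S u
  obtain ⟨t, rfl⟩ := Submodule.Quotient.mk_surjective _ x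
  have := key t _ hvac
  rwa [vacuum, ← map_smul, ← Submodule.Quotient.mk_smul, smul_eq_mul, mul_one] at this

section

lemma modeCorr_add (a : H) (g g' : ℤ → 𝕍 B S) :
    modeCorr a (g + g') = modeCorr a g + modeCorr a g' := by
  ext m n
  exact smul_add _ _ _

lemma modeCorr_smul (a : H) (r : ℂ) (g : ℤ → 𝕍 B S) : modeCorr a (r • g) = r • modeCorr a g := by
  ext m n
  exact smul_comm (mode m a) r (g n)

lemma tr0_dif_pow_mono {N : ℤ} {k l : ℕ}
    {c : Dist₂ U} (h : Tr0 N ((dif ^ k) c)) (hkl : k ≤ l) : Tr0 N ((dif ^ l) c) := by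
  obtain ⟨j, rfl⟩ := Nat.exists_eq_add_of_le hkl
  rw [add_comm, pow_add]
  exact h.dif_pow j

variable (B S) in
/-- The `V(H, 𝒮)`-valued distributions `g ∈ V(H, 𝒮)((z))` such that, for some `k`, the poles of
`(z₀ - z₁) ^ k a(z₀) g(z₁)` at `z₀ = 0` have order at most `N` for every `a ∈ H`. -/
def fieldSpace (N : ℤ) : Submodule ℂ (ℤ → 𝕍 B S) where
  carrier := {g | (∃ E : ℤ, ∀ e, E ≤ e → g e = 0) ∧ ∃ k : ℕ, ∀ a, Tr0 N ((dif ^ k) (modeCorr a g))}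
  zero_mem' := ⟨⟨0, fun _ _ => rfl⟩, 0, fun _ _ _ _ => smul_zero _⟩
  add_mem' := by
    rintro g g' ⟨⟨E, hE⟩, k, hk⟩ ⟨⟨E', hE'⟩, k', hk'⟩
    refine ⟨⟨max E E', fun e he => ?_⟩, max k k', fun a => ?_⟩
    · rw [Pi.add_apply, hE _ (by omega), hE' _ (by omega), add_zero]
    · rw [modeCorr_add, map_add]
      exact (tr0_dif_pow_mono (hk a) (le_max_left _ _)).add
        (tr0_dif_pow_mono (hk' a) (le_max_right _ _))
  smul_mem' := by
    rintro r g ⟨⟨E, hE⟩, k, hk⟩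
    refine ⟨⟨E, fun e he => ?_⟩, k, fun a => ?_⟩
    · rw [Pi.smul_apply, hE _ he, smul_zero]
    · rw [modeCorr_smul, map_smul]
      exact (hk a).smul r

variable {N : ℤ}

lemma exists_pole_of_mem_fieldSpace {g : ℤ → 𝕍 B S} (hg : g ∈ fieldSpace B S N)
    (a : H) : ∃ k, Pole k (modeCorr a g) := by
  obtain ⟨⟨E, hE⟩, k, hk⟩ := hg
  exact ⟨k, pole_modeCorr hk hE a⟩

lemma res_add' {c c' : Dist₂ U} (h : ∃ k, Pole k c) (h' : ∃ k, Pole k c') (n : ℤ) :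
    res (c + c') n = res c n + res c' n := by
  obtain ⟨k, h⟩ := h
  obtain ⟨k', h'⟩ := h'
  exact res_add (h.mono (le_max_left k k')) (h'.mono (le_max_right k k')) n

lemma res_smul' {c : Dist₂ U}
    (h : ∃ k, Pole k c) (r : ℂ) (n : ℤ) : res (r • c) n = r • res c n := by
  obtain ⟨k, h⟩ := h
  exact res_smul h r n

variable (B S) in
/-- The action of `a(n)` on `fieldSpace` by the residue of `(z₀ - z₁) ^ n a(z₀) g(z₁)`. -/
def fieldMode (N : ℤ) (n : ℤ) : H →ₗ[ℂ] End ℂ (fieldSpace B S N) where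
  toFun a :=
    { toFun := fun g => ⟨res (modeCorr a g.1) n, by
        obtain ⟨g, ⟨E, hE⟩, k, hk⟩ := g
        exact ⟨⟨_, res_modeCorr_eq_zero hk hE a n⟩, _, fun b => tr0_dif_pow_res hk hE b a n⟩⟩
      map_add' := fun g g' => Subtype.ext <| by
        change res (modeCorr a (g.1 + g'.1)) n = res (modeCorr a g.1) n + res (modeCorr a g'.1) n
        rw [modeCorr_add, res_add' (exists_pole_of_mem_fieldSpace g.2 a)
          (exists_pole_of_mem_fieldSpace g'.2 a)]
      map_smul' := fun r g => Subtype.ext <| by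
        change res (modeCorr a (r • g.1)) n = r • res (modeCorr a g.1) n
        rw [modeCorr_smul, res_smul' (exists_pole_of_mem_fieldSpace g.2 a)] }
  map_add' a b := LinearMap.ext fun g => Subtype.ext <| by
    change res (modeCorr (a + b) g.1) n = res (modeCorr a g.1) n + res (modeCorr b g.1) n
    rw [← res_add' (exists_pole_of_mem_fieldSpace g.2 a) (exists_pole_of_mem_fieldSpace g.2 b)]
    congr 1
    ext m n
    simp [modeCorr, add_smul]
  map_smul' r a := LinearMap.ext fun g => Subtype.ext <| by
    change res (modeCorr (r • a) g.1) n = r • res (modeCorr a g.1) n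
    rw [← res_smul' (exists_pole_of_mem_fieldSpace g.2 a)]
    congr 1
    ext m n
    simp [modeCorr]

instance (N : ℤ) : Module (ModeAlgebra H) (fieldSpace B S N) :=
  Module.compHom _ (modeLift (fieldMode B S N)).toRingHom

lemma modeAlgebra_smul_fieldSpace (t : ModeAlgebra H) (g : fieldSpace B S N) :
    t • g = modeLift (fieldMode B S N) t g := rfl

instance (N : ℤ) : IsScalarTower ℂ (ModeAlgebra H) (fieldSpace B S N) :=
  IsScalarTower.of_algebraMap_smul fun r g => by
    rw [modeAlgebra_smul_fieldSpace, AlgHom.commutes]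
    rfl

lemma coe_mode_smul (a : H) (n : ℤ) (g : fieldSpace B S N) :
    ((mode n a • g : fieldSpace B S N) : ℤ → 𝕍 B S) = res (modeCorr a g.1) n := by
  rw [modeAlgebra_smul_fieldSpace, modeLift_mode]
  rfl

lemma coe_mode_smul_mode_smul (a b : H) (m n : ℤ) (g : fieldSpace B S N) :
    ((mode m a • mode n b • g : fieldSpace B S N) : ℤ → 𝕍 B S) =
      resres (modeCorr₂ a b g.1) m n := by
  obtain ⟨⟨E, hE⟩, k, hk⟩ := g.2
  rw [coe_mode_smul, coe_mode_smul, ← res12_modeCorr₂ hk hE]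
  rfl

lemma fieldSpace_truncation (a : H) (g : fieldSpace B S N) :
    ∃ M : ℤ, ∀ m : ℤ, M ≤ m → mode m a • g = 0 := by
  obtain ⟨⟨E, hE⟩, k, hk⟩ := g.2
  exact ⟨k, fun m hm => Subtype.ext <| by
    rw [coe_mode_smul, res_eq_zero (pole_modeCorr hk hE a) hm]; rfl⟩

/-- The residue action of the modes on `fieldSpace` satisfies the defining relations. -/
lemma relator_fieldSpace (a b : H) (m n : ℤ) (g : fieldSpace B S N) :
    relator B S a b m n g = 0 := by
  obtain ⟨⟨E, hE⟩, k, hk⟩ := g.2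
  obtain ⟨r, β, α, f, h⟩ := exists_sum_tmul (S (b ⊗ₜ a))
  rw [relator, mul_smul, exchange_eq_sum S h fieldSpace_truncation, algebraMap_smul, sub_sub,
    sub_eq_zero]
  refine Subtype.ext ?_
  rw [coe_mode_smul_mode_smul, resres_modeCorr₂_eq hk hE h, Submodule.coe_add, Submodule.coe_smul,
    Submodule.coe_sum, Finset.sum_apply, Finset.sum_apply]
  congr 1
  refine sum_congr rfl fun i _ => ?_
  refine Eq.trans ?_ (act2_map (f i) (up2_mode_mode fieldSpace_truncation (α i) (β i) g)
    (fieldSpace B S N).subtype m n)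
  congr 1
  ext m n : 2
  exact (coe_mode_smul_mode_smul _ _ _ _ _).symm

end

section

variable (B S)

/-- The linear family `φ x, x ∈ X`, of formal distributions consists of fields. -/
def Trunc (φ : X →ₗ[ℂ] ℤ → End ℂ V) : Prop := ∀ x w, ∃ E : ℤ, ∀ e, E ≤ e → φ x e w = 0

/-- The modes of a state-field correspondence on `V(H, 𝒮)`, `F u n = u_n`, which is generated by
the fields `a(z)`. -/
structure IsVertexMap (F : 𝕍 B S →ₗ[ℂ] ℤ → End ℂ (𝕍 B S)) : Prop where
  vacuum : ∀ n w, F (vacuum B S) n w = if n = -1 then w else 0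
  trunc : Trunc F
  pole : ∀ u, ∃ k : ℕ, ∀ w, ∃ N : ℤ, ∀ a : H, Tr0 N ((dif ^ k) (modeCorr a fun e => F u e w))
  mode_smul : ∀ (a : H) (n : ℤ) u w,
    (fun e => F (mode n a • u) e w) = res (modeCorr a fun e => F u e w) n

lemma exists_uniform_truncation [FiniteDimensional ℂ H] (w : 𝕍 B S) :
    ∃ N : ℤ, ∀ (a : H) (m : ℤ), N ≤ m → mode m a • w = 0 := by
  let b := Module.finBasis ℂ H
  choose M hM using fun i => vacuumModule_truncation B S (b i) w
  obtain ⟨N, hN⟩ : ∃ N : ℤ, ∀ i, M i ≤ N := by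
    obtain ⟨N, h⟩ := (Set.finite_range M).bddAbove
    exact ⟨N, fun i => h ⟨i, rfl⟩⟩
  refine ⟨N, fun a m hm => ?_⟩
  rw [← b.sum_repr a, map_sum, sum_smul]
  refine sum_eq_zero fun i _ => ?_
  rw [map_smul, smul_assoc, hM i m ((hN i).trans hm), smul_zero]

/-- The identity field applied to `w`. -/
def vacuumField (w : 𝕍 B S) : ℤ → 𝕍 B S := fun e => if e = -1 then w else 0

/-- `Y(·, z) w`, by the universal property: `a(n)` acts on `fieldSpace` by residues, this satisfies
the relations of `V(H, 𝒮)`, and the identity field applied to `w` is a vacuum vector. -/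
lemma exists_field_hom [FiniteDimensional ℂ H] (w : 𝕍 B S) :
    ∃ Φ : 𝕍 B S →ₗ[ℂ] ℤ → 𝕍 B S, Φ (vacuum B S) = vacuumField B S w ∧
      (∃ N, (∀ a, Tr0 N (modeCorr a (vacuumField B S w))) ∧ ∀ u, Φ u ∈ fieldSpace B S N) ∧
      ∀ (a : H) (n : ℤ) u, Φ (mode n a • u) = res (modeCorr a (Φ u)) n := by
  obtain ⟨N, hN⟩ := exists_uniform_truncation B S w
  have hE : ∀ e, 0 ≤ e → vacuumField B S w e = 0 := fun e he => if_neg (by omega)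
  have hk : ∀ a : H, Tr0 N ((dif ^ 0) (modeCorr a (vacuumField B S w))) := fun a m n hm => by
    rw [pow_zero, End.one_apply, modeCorr, vacuumField]
    split_ifs
    · exact hN a m hm
    · exact smul_zero _
  obtain ⟨Φ, hΦ⟩ := exists_vacuumModule_hom B S (W := fieldSpace B S N)
    (w₀ := ⟨vacuumField B S w, ⟨0, hE⟩, 0, hk⟩) relator_fieldSpace fun a n hn =>
      Subtype.ext <| by
        rw [coe_mode_smul, res_eq_zero (pole_modeCorr hk hE a) (by exact_mod_cast hn)]
        rfl
  refine ⟨(fieldSpace B S N).subtype ∘ₗ (Φ.restrictScalars ℂ), ?_, ⟨N, hk, fun u => (Φ u).2⟩, ?_⟩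
  · exact congrArg Subtype.val hΦ
  · intro a n u
    change ((Φ (mode n a • u)) : ℤ → 𝕍 B S) = _
    rw [map_smul, coe_mode_smul]
    rfl

lemma exists_vertexMap [FiniteDimensional ℂ H] : ∃ F, IsVertexMap B S F := by
  choose Φ h1 h2 h3 using exists_field_hom B S
  have hpole : ∀ w u (a : H), ∃ k, Pole k (modeCorr a (Φ w u)) := fun w u a => by
    obtain ⟨N, -, hN⟩ := h2 w
    exact exists_pole_of_mem_fieldSpace (hN u) a
  -- linearity in `w` holds for the identity field and is preserved by the residue action
  have hadd : ∀ u w w', Φ (w + w') u = Φ w u + Φ w' u := by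
    intro u w w'
    induction u using vacuumModule_induction with
    | hvac => rw [h1, h1, h1]; ext e; simp only [vacuumField, Pi.add_apply]; split_ifs <;> simp
    | hmode n a u ih =>
      rw [h3, h3, h3, ih, modeCorr_add, res_add' (hpole _ _ _) (hpole _ _ _)]
    | hadd u v hu hv => rw [map_add, map_add, map_add, hu, hv]; abel
    | hsmul r u hu => rw [map_smul, map_smul, map_smul, hu, smul_add]
  have hsmul : ∀ u (r : ℂ) w, Φ (r • w) u = r • Φ w u := by
    intro u r w
    induction u using vacuumModule_induction with
    | hvac => rw [h1, h1]; ext e; simp only [vacuumField, Pi.smul_apply]; split_ifs <;> simp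
    | hmode n a u ih => rw [h3, h3, ih, modeCorr_smul, res_smul' (hpole _ _ _)]
    | hadd u v hu hv => rw [map_add, map_add, hu, hv, smul_add]
    | hsmul r' u hu => rw [map_smul, map_smul, hu, smul_comm]
  refine ⟨{ toFun := fun u e =>
              { toFun := fun w => Φ w u e
                map_add' := fun w w' => by rw [hadd]; rfl
                map_smul' := fun r w => by rw [hsmul]; rfl }
            map_add' := fun u v => by ext e w; change Φ w (u + v) e = _; rw [map_add]; rfl
            map_smul' := fun r u => by ext e w; change Φ w (r • u) e = _; rw [map_smul]; rfl }, ?_⟩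
  refine ⟨fun n w => ?_, fun u w => ?_, fun u => ?_, fun a n u w => ?_⟩
  · exact congrFun (h1 w) n
  · obtain ⟨N, -, hN⟩ := h2 w
    exact (hN u).1
  · change ∃ k : ℕ, ∀ w, ∃ N : ℤ, ∀ a : H, Tr0 N ((dif ^ k) (modeCorr a (Φ w u)))
    choose N hN0 hN using h2
    suffices h : ∃ k : ℕ, ∀ w (a : H), Tr0 (N w) ((dif ^ k) (modeCorr a (Φ w u))) from
      h.imp fun k hk w => ⟨N w, hk w⟩
    induction u using vacuumModule_induction with
    | hvac => exact ⟨0, fun w a => by rw [h1]; exact hN0 w a⟩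
    | hmode n a u ih =>
      obtain ⟨k, hk⟩ := ih
      refine ⟨1 + (k - n).toNat + k, fun w b => ?_⟩
      obtain ⟨E, hE⟩ := (hN w u).1
      rw [h3]
      exact tr0_dif_pow_res (hk w) hE b a n
    | hadd u v hu hv =>
      obtain ⟨k, hk⟩ := hu
      obtain ⟨l, hl⟩ := hv
      refine ⟨max k l, fun w a => ?_⟩
      rw [map_add, modeCorr_add, map_add]
      exact (tr0_dif_pow_mono (hk w a) (le_max_left _ _)).add
        (tr0_dif_pow_mono (hl w a) (le_max_right _ _))
    | hsmul r u hu =>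
      obtain ⟨k, hk⟩ := hu
      refine ⟨k, fun w a => ?_⟩
      rw [map_smul, modeCorr_smul, map_smul]
      exact (hk w a).smul r
  · exact h3 w a n u

end

/-! ### Weak `𝒮`-locality of the generating fields with all fields -/

lemma exists_int_bound (f : ℤ → ℤ) (m M : ℤ) : ∃ N, ∀ m', m ≤ m' → m' < M → f m' ≤ N := by
  obtain ⟨N, hN⟩ := ((Set.finite_Ico m M).image f).bddAbove
  exact ⟨N, fun m' h h' => hN ⟨m', ⟨h, h'⟩, rfl⟩⟩

lemma exists_uniform_reg {g : Dist₃ U} (h : ∀ m, Reg (g m)) {M : ℤ}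
    (h0 : ∀ m, M ≤ m → g m = 0) (m : ℤ) : ∃ N, ∀ m', m ≤ m' → Tr0 N (g m') ∧ Tr1 N (g m') := by
  choose N₀ h₀ using fun m => (h m).1
  choose N₁ h₁ using fun m => (h m).2
  obtain ⟨N, hN⟩ := exists_int_bound N₀ m M
  obtain ⟨N', hN'⟩ := exists_int_bound N₁ m M
  refine ⟨max N N', fun m' hm => ?_⟩
  rcases le_or_gt M m' with hM | hM
  · rw [h0 m' hM]
    exact ⟨fun _ _ _ => rfl, fun _ _ _ => rfl⟩
  · exact ⟨(h₀ m').mono ((hN m' hm hM).trans (le_max_left _ _)),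
      (h₁ m').mono ((hN' m' hm hM).trans (le_max_right _ _))⟩

lemma Bdd12.of_pole {k : ℕ} {c : Dist₃ U} (h : ∀ m, Pole k (c m)) {M : ℤ}
    (h0 : ∀ m, M ≤ m → c m = 0) : Bdd12 k c :=
  exists_uniform_reg h fun m hm => by rw [h0 m hm, map_zero]

lemma Bdd01.of_pole {k : ℕ} {c : Dist₃ U} (h : ∀ e, Pole k fun m n => c m n e) {E : ℤ}
    (h0 : ∀ e, E ≤ e → ∀ m n, c m n e = 0) : Bdd01 k c :=
  exists_uniform_reg (g := fun e => (dif ^ k) fun m n => c m n e) h fun e he => by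
    rw [show (fun m n => c m n e) = 0 by ext m n; exact h0 e he m n, map_zero]

lemma Bdd12.mono {k l : ℕ} {c : Dist₃ U} (h : Bdd12 k c) (hkl : k ≤ l) : Bdd12 l c := by
  obtain ⟨j, rfl⟩ := Nat.exists_eq_add_of_le hkl
  intro m
  obtain ⟨N, hN⟩ := h m
  refine ⟨N, fun m' hm => ?_⟩
  rw [add_comm, pow_add]
  exact ⟨(hN m' hm).1.dif_pow j, (hN m' hm).2.dif_pow j⟩

lemma Bdd01.mono {k l : ℕ} {c : Dist₃ U} (h : Bdd01 k c) (hkl : k ≤ l) : Bdd01 l c := by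
  obtain ⟨j, rfl⟩ := Nat.exists_eq_add_of_le hkl
  intro m
  obtain ⟨N, hN⟩ := h m
  refine ⟨N, fun m' hm => ?_⟩
  rw [add_comm, pow_add]
  exact ⟨(hN m' hm).1.dif_pow j, (hN m' hm).2.dif_pow j⟩

lemma Bdd12.add {k : ℕ} {c c' : Dist₃ U} (h : Bdd12 k c) (h' : Bdd12 k c') : Bdd12 k (c + c') := by
  intro m
  obtain ⟨N, hN⟩ := h m
  obtain ⟨N', hN'⟩ := h' m
  refine ⟨max N N', fun m' hm => ?_⟩
  rw [Pi.add_apply, map_add]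
  exact ⟨((hN m' hm).1.mono (le_max_left _ _)).add ((hN' m' hm).1.mono (le_max_right _ _)),
    ((hN m' hm).2.mono (le_max_left _ _)).add ((hN' m' hm).2.mono (le_max_right _ _))⟩

lemma Bdd01.add {k : ℕ} {c c' : Dist₃ U} (h : Bdd01 k c) (h' : Bdd01 k c') : Bdd01 k (c + c') := by
  intro e
  obtain ⟨N, hN⟩ := h e
  obtain ⟨N', hN'⟩ := h' e
  refine ⟨max N N', fun e' he => ?_⟩
  have : (fun m n => (c + c') m n e') = (fun m n => c m n e') + fun m n => c' m n e' := rfl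
  rw [this, map_add]
  exact ⟨((hN e' he).1.mono (le_max_left _ _)).add ((hN' e' he).1.mono (le_max_right _ _)),
    ((hN e' he).2.mono (le_max_left _ _)).add ((hN' e' he).2.mono (le_max_right _ _))⟩

lemma Bdd12.zero (k : ℕ) : Bdd12 k (0 : Dist₃ U) :=
  Bdd12.of_pole (fun _ => Pole.zero k) (M := 0) fun _ _ => rfl

lemma Bdd01.zero (k : ℕ) : Bdd01 k (0 : Dist₃ U) :=
  Bdd01.of_pole (fun _ => Pole.zero k) (E := 0) fun _ _ _ _ => rfl

lemma Up3.zero : Up3 (0 : Dist₃ U) := fun _ _ _ => ⟨0, fun _ _ _ _ => rfl⟩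

lemma res12_zero (n : ℤ) : res12 (0 : Dist₃ U) n = 0 := by
  ext m e
  exact congrFun (res_zero n) e

lemma res01_zero (n : ℤ) : res01 (0 : Dist₃ U) n = 0 := by
  ext m e
  exact congrFun (res_zero n) m

lemma res12_add {k : ℕ} {c c' : Dist₃ U} (h : ∀ m, Pole k (c m)) (h' : ∀ m, Pole k (c' m))
    (n : ℤ) : res12 (c + c') n = res12 c n + res12 c' n := by
  ext m e
  exact congrFun (res_add (h m) (h' m) n) e

lemma res01_add {k : ℕ} {c c' : Dist₃ U} (h : ∀ e, Pole k fun m n => c m n e)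
    (h' : ∀ e, Pole k fun m n => c' m n e) (n : ℤ) :
    res01 (c + c') n = res01 c n + res01 c' n := by
  ext m e
  exact congrFun (res_add (h e) (h' e) n) m

/-- A criterion for `Up3` when the operator with modes `m` is applied first, then the one with
modes `e`, and the one with modes `n` last. -/
lemma Up3.of_nested_fst {c : Dist₃ U} (h0 : ∃ N : ℤ, ∀ m, N ≤ m → ∀ n e, c m n e = 0)
    (h1 : ∀ m, ∃ N : ℤ, ∀ e, N ≤ e → ∀ n, c m n e = 0)
    (h2 : ∀ m e, ∃ N : ℤ, ∀ n, N ≤ n → c m n e = 0) : Up3 c := by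
  intro m n e
  obtain ⟨Q, hQ⟩ := exists_bound_of_nested (P := fun i l j => c (m + i) (n + j) (e + l) = 0)
    ((exists_nat_bound h0 m).imp fun E hE i hi l j => hE i hi _ _)
    (fun i => (exists_nat_bound (h1 (m + i)) e).imp fun E hE l hl j => hE l hl _)
    (fun i l => exists_nat_bound (h2 (m + i) (e + l)) n)
  exact ⟨Q, fun i j l hij => hQ i l j (by omega)⟩

/-- A criterion for `Up3` when the operator with modes `n` is applied first, then the one with
modes `m`, and the one with modes `e` last. -/
lemma Up3.of_nested_snd {c : Dist₃ U} (h0 : ∃ N : ℤ, ∀ n, N ≤ n → ∀ m e, c m n e = 0)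
    (h1 : ∀ n, ∃ N : ℤ, ∀ m, N ≤ m → ∀ e, c m n e = 0)
    (h2 : ∀ n m, ∃ N : ℤ, ∀ e, N ≤ e → c m n e = 0) : Up3 c := by
  intro m n e
  obtain ⟨Q, hQ⟩ := exists_bound_of_nested (P := fun j i l => c (m + i) (n + j) (e + l) = 0)
    ((exists_nat_bound h0 n).imp fun E hE i hi l j => hE i hi _ _)
    (fun i => (exists_nat_bound (h1 (n + i)) m).imp fun E hE l hl j => hE l hl _)
    (fun i l => exists_nat_bound (h2 (n + i) (m + l)) e)
  exact ⟨Q, fun i j l hij => hQ j i l (by omega)⟩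

lemma dif_pow_congr {k l : ℕ} (hkl : k ≤ l) {c c' : Dist₂ U}
    (h : (dif ^ k) c = (dif ^ k) c') : (dif ^ l) c = (dif ^ l) c' := by
  obtain ⟨j, rfl⟩ := Nat.exists_eq_add_of_le hkl
  rw [add_comm, pow_add, End.mul_apply, h, ← End.mul_apply]

section

/-- Induction over `Y ⊗ X ⊗ P`. -/
lemma triple_induction {P : Type*} [AddCommGroup P] [Module ℂ P]
    {C : (Y ⊗[ℂ] X) ⊗[ℂ] P → Prop} (zero : C 0) (add : ∀ A A', C A → C A' → C (A + A'))
    (tmul : ∀ y x f, C ((y ⊗ₜ x) ⊗ₜ f)) (A : (Y ⊗[ℂ] X) ⊗[ℂ] P) : C A := by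
  induction A using TensorProduct.induction_on with
  | zero => exact zero
  | add A A' h h' => exact add _ _ h h'
  | tmul t f =>
    induction t using TensorProduct.induction_on with
    | zero => rw [TensorProduct.zero_tmul]; exact zero
    | add A A' h h' => rw [TensorProduct.add_tmul]; exact add _ _ h h'
    | tmul y x => exact tmul y x f

variable (ψ : Y →ₗ[ℂ] ℤ → End ℂ V) (φ : X →ₗ[ℂ] ℤ → End ℂ V)

/-- The distribution `∑ ψ(yᵢ)(z₁) φ(xᵢ)(z₀) w` for `∑ yᵢ ⊗ xᵢ ∈ Y ⊗ X`. -/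
def pairDist (w : V) : Y ⊗[ℂ] X →ₗ[ℂ] Dist₂ V :=
  TensorProduct.lift <| LinearMap.mk₂ ℂ (fun y x m n => ψ y n (φ x m w))
    (by intros; ext; simp) (by intros; ext; simp) (by intros; ext; simp) (by intros; ext; simp)

lemma pairDist_tmul (w : V) (y : Y) (x : X) :
    pairDist ψ φ w (y ⊗ₜ x) = fun m n => ψ y n (φ x m w) := rfl

variable {ψ φ} (hψ : Trunc ψ) (hφ : Trunc φ)
include hψ hφ

lemma up2_pairDist (w : V) (t : Y ⊗[ℂ] X) : Up2 (pairDist ψ φ w t) := by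
  induction t using TensorProduct.induction_on with
  | zero => rw [map_zero]; exact fun _ _ => ⟨0, fun _ _ _ => rfl⟩
  | add t t' h h' => rw [map_add]; exact h.add h'
  | tmul y x =>
    obtain ⟨M, hM⟩ := hφ x w
    exact Up2.of_tr0 (M := M) (fun m n hm => by rw [pairDist_tmul]; beta_reduce; rw [hM m hm, map_zero])
      fun m => hψ _ _

/-- The distribution `∑ fᵢ(z₁ - z₀) ψ(yᵢ)(z₁) φ(xᵢ)(z₀) w` for
`∑ yᵢ ⊗ xᵢ ⊗ fᵢ ∈ Y ⊗ X ⊗ ℂ[[x]]`. -/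
def swapDist (w : V) : (Y ⊗[ℂ] X) ⊗[ℂ] ℂ⟦X⟧ →ₗ[ℂ] Dist₂ V :=
  TensorProduct.lift <| LinearMap.mk₂ ℂ (fun t f => act2 f (pairDist ψ φ w t)) (fun t t' f => by
      rw [map_add, act2_add (up2_pairDist hψ hφ w t) (up2_pairDist hψ hφ w t')])
    (fun r t f => by rw [map_smul, act2_smul])
    (fun t f g => act2_add_series (up2_pairDist hψ hφ w t) f g)
    (fun r t f => act2_smul_series _ f r)

lemma swapDist_tmul (w : V) (y : Y) (x : X) (f : ℂ⟦X⟧) :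
    swapDist hψ hφ w ((y ⊗ₜ x) ⊗ₜ f) = act2 f fun m n => ψ y n (φ x m w) := rfl

lemma up2_tmul (w : V) (y : Y) (x : X) : Up2 fun m n => ψ y n (φ x m w) :=
  up2_pairDist hψ hφ w (y ⊗ₜ x)

lemma swapDist_tmul_one (w : V) (y : Y) (x : X) :
    swapDist hψ hφ w ((y ⊗ₜ x) ⊗ₜ 1) = fun m n => ψ y n (φ x m w) := by rw [swapDist_tmul, act2_one]

lemma tr0_swapDist (w : V) (A : (Y ⊗[ℂ] X) ⊗[ℂ] ℂ⟦X⟧) : ∃ M, Tr0 M (swapDist hψ hφ w A) := by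
  induction A using TensorProduct.induction_on with
  | zero => rw [map_zero]; exact ⟨0, fun _ _ _ => rfl⟩
  | add A A' h h' =>
    obtain ⟨M, hM⟩ := h
    obtain ⟨M', hM'⟩ := h'
    rw [map_add]
    exact ⟨max M M', (hM.mono (le_max_left _ _)).add (hM'.mono (le_max_right _ _))⟩
  | tmul t f =>
    induction t using TensorProduct.induction_on with
    | zero => rw [TensorProduct.zero_tmul, map_zero]; exact ⟨0, fun _ _ _ => rfl⟩
    | add A A' h h' =>
      obtain ⟨M, hM⟩ := h
      obtain ⟨M', hM'⟩ := h'
      rw [TensorProduct.add_tmul, map_add]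
      exact ⟨max M M', (hM.mono (le_max_left _ _)).add (hM'.mono (le_max_right _ _))⟩
    | tmul y x =>
      obtain ⟨M, hM⟩ := hφ x w
      exact ⟨M, Tr0.act2 (fun m n hm => by
        rw [pairDist_tmul]; beta_reduce; rw [hM m hm, map_zero]) f⟩

end

section

variable (B S) in
/-- The fields `a(z)`, `a ∈ H`. -/
def modeFields : H →ₗ[ℂ] ℤ → End ℂ (𝕍 B S) where
  toFun a n := modeEnd B S n a
  map_add' a b := by ext n w; simp [modeEnd, add_smul]
  map_smul' r a := by ext n w; simp [modeEnd]

lemma modeFields_apply (a : H) (n : ℤ) (w : 𝕍 B S) : modeFields B S a n w = mode n a • w := rfl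

lemma trunc_modeFields : Trunc (modeFields B S) := vacuumModule_truncation B S

variable {F : 𝕍 B S →ₗ[ℂ] ℤ → End ℂ (𝕍 B S)} (hF : IsVertexMap B S F)
include hF

lemma IsVertexMap.pole_modeCorr (u : 𝕍 B S) :
    ∃ k : ℕ, ∀ w (a : H), Pole k (modeCorr a fun e => F u e w) := by
  obtain ⟨k, hk⟩ := hF.pole u
  refine ⟨k, fun w a => ?_⟩
  obtain ⟨N, hN⟩ := hk w
  obtain ⟨E, hE⟩ := hF.trunc u w
  exact QVA.pole_modeCorr hN hE a

/-- The distribution `b(z₁) c(z₀, z₂)`. -/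
def insertMode (b : H) (c : Dist₂ (𝕍 B S)) : Dist₃ (𝕍 B S) := fun m n e => mode n b • c m e

omit hF in
lemma insertMode_add (b : H) (c c' : Dist₂ (𝕍 B S)) :
    insertMode b (c + c') = insertMode b c + insertMode b c' := by
  ext m n e
  exact smul_add _ _ _

omit hF in
lemma insertMode_zero (b : H) : insertMode b (0 : Dist₂ (𝕍 B S)) = 0 := by
  ext m n e
  exact smul_zero _

omit hF in
lemma insertMode_act2 (b : H) (f : ℂ⟦X⟧) {c : Dist₂ (𝕍 B S)} (h : Up2 c) :
    insertMode b (act2 f c) = act3 (-d02) f (insertMode b c) := by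
  ext m n e
  rw [act3_neg_d02]
  exact (act2_map f h (modeEnd B S n b) m e).symm

/-- For `c = ∑ fᵢ(z₂ - z₀) Y(vᵢ, z₂) aᵢ(z₀) w` the residues at `z₁ = z₂` of
`f(z₁ - z₀) b(z₁) c(z₀, z₂)` are of the same form. -/
lemma res12_insertMode (b : H) (A : (𝕍 B S ⊗[ℂ] H) ⊗[ℂ] ℂ⟦X⟧) :
    (∃ k, ∀ w, Up3 (insertMode b (swapDist hF.trunc trunc_modeFields w A)) ∧
      Bdd12 k (insertMode b (swapDist hF.trunc trunc_modeFields w A))) ∧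
    ∀ f n, ∃ A', ∀ w,
      res12 (act3 (-d01) f (insertMode b (swapDist hF.trunc trunc_modeFields w A))) n =
      swapDist hF.trunc trunc_modeFields w A' := by
  induction A using triple_induction with
  | zero =>
    simp only [map_zero, insertMode_zero]
    refine ⟨⟨0, fun w => ⟨Up3.zero, Bdd12.zero 0⟩⟩, fun f n => ⟨0, fun w => ?_⟩⟩
    rw [act3_zero, res12_zero, map_zero]
  | add A A' h h' =>
    obtain ⟨⟨k, hk⟩, hr⟩ := h
    obtain ⟨⟨k', hk'⟩, hr'⟩ := h'
    have h1 := fun w => (hk w).2.mono (le_max_left k k')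
    have h2 := fun w => (hk' w).2.mono (le_max_right k k')
    simp only [map_add, insertMode_add]
    refine ⟨⟨max k k', fun w => ⟨(hk w).1.add (hk' w).1, (h1 w).add (h2 w)⟩⟩, fun f n => ?_⟩
    obtain ⟨D, hD⟩ := hr f n
    obtain ⟨D', hD'⟩ := hr' f n
    refine ⟨D + D', fun w => ?_⟩
    rw [act3_add isShift_neg_d01 (hk w).1 (hk' w).1,
      res12_add ((h1 w).act3 isShift_neg_d01 commute_neg_d01_d12 (hk w).1 f).pole
        ((h2 w).act3 isShift_neg_d01 commute_neg_d01_d12 (hk' w).1 f).pole, hD, hD', map_add]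
  | tmul v a g =>
    have hup2 := fun w => up2_tmul hF.trunc trunc_modeFields w v a
    set D : 𝕍 B S → Dist₃ (𝕍 B S) :=
      fun w => insertMode b fun m n => F v n (modeFields B S a m w) with hDdef
    have e1 : ∀ w, insertMode b (swapDist hF.trunc trunc_modeFields w ((v ⊗ₜ a) ⊗ₜ g)) =
        act3 (-d02) g (D w) := fun w => by rw [swapDist_tmul, insertMode_act2 b g (hup2 w)]
    have h0 : ∀ w, ∃ M : ℤ, ∀ m, M ≤ m → ∀ n e, D w m n e = 0 := fun w => by
      obtain ⟨M, hM⟩ := trunc_modeFields a w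
      exact ⟨M, fun m hm n e => by simp only [hDdef, insertMode, hM m hm, map_zero, smul_zero]⟩
    have hup : ∀ w, Up3 (D w) := fun w => by
      refine Up3.of_nested_fst (h0 w) (fun m => ?_) fun m e => vacuumModule_truncation B S b _
      obtain ⟨E, hE⟩ := hF.trunc v (modeFields B S a m w)
      exact ⟨E, fun e he n => by simp only [hDdef, insertMode, hE e he, smul_zero]⟩
    obtain ⟨k, hk⟩ := hF.pole_modeCorr v
    have hB : ∀ w, Bdd12 k (D w) := fun w => by
      obtain ⟨M, hM⟩ := h0 w
      exact Bdd12.of_pole (fun m => hk (modeFields B S a m w) b) fun m hm => by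
        ext n e; exact hM m hm n e
    have hres : ∀ w n, res12 (D w) n = fun m e => F (mode n b • v) e (modeFields B S a m w) := by
      intro w n
      ext m e
      exact (congrFun (hF.mode_smul b n v (modeFields B S a m w)) e).symm
    have hu : ∀ w n, Up2 (res12 (D w) n) := fun w n => by
      rw [hres]; exact up2_tmul hF.trunc trunc_modeFields w _ a
    simp only [e1]
    have hB' := fun w => (hB w).act3 isShift_neg_d02 commute_neg_d02_d12 (hup w) g
    have hup' := fun w => (hup w).act3 isShift_neg_d02 g
    refine ⟨⟨k, fun w => ⟨hup' w, hB' w⟩⟩, fun f n => ?_⟩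
    have hr : ∀ w (n : ℤ), n < k → res12 (act3 (-d02) g (D w)) n = act2 g (res12 (D w) n) :=
      fun w n hn => res12_act3_d02 (hup w) n g (hB w) (fun i => hu w _) hn
    refine ⟨∑ i ∈ range (k - n).toNat, ((mode (n + i) b • v) ⊗ₜ a) ⊗ₜ (hasse i f * g), fun w => ?_⟩
    rw [res12_act3_d01 (hup' w) n f (hB' w) fun i => ?_, map_sum]
    · refine sum_congr rfl fun i hi => ?_
      rw [mem_range] at hi
      rw [hr w _ (by omega), act2_act2 (hu w _), hres, swapDist_tmul]
    · rcases lt_or_ge (n + i) k with hn | hn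
      · rw [hr w _ hn]
        exact (hu w _).act2 g
      · rw [res12_eq_zero (hB' w).pole hn]
        exact fun _ _ => ⟨0, fun _ _ _ => rfl⟩

/-- Weak `𝒮`-locality of `a(z)` and `Y(v, z)`, for `a ∈ H`. -/
lemma exists_swap_mode (a : H) (v : 𝕍 B S) : ∃ (k : ℕ) (A : (𝕍 B S ⊗[ℂ] H) ⊗[ℂ] ℂ⟦X⟧), ∀ w,
      (dif ^ k) (modeCorr a fun e => F v e w) =
        (dif ^ k) (swapDist hF.trunc trunc_modeFields w A) := by
  induction v using vacuumModule_induction generalizing a with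
  | hvac =>
    refine ⟨0, (vacuum B S ⊗ₜ a) ⊗ₜ 1, fun w => ?_⟩
    congr 1
    rw [swapDist_tmul_one]
    ext m n
    simp only [modeCorr, hF.vacuum, modeFields_apply, smul_ite, smul_zero]
  | hadd u v hu hv =>
    obtain ⟨k, A, hA⟩ := hu a
    obtain ⟨l, A', hA'⟩ := hv a
    refine ⟨max k l, A + A', fun w => ?_⟩
    have : (modeCorr a fun e => F (u + v) e w) =
        (modeCorr a fun e => F u e w) + modeCorr a fun e => F v e w := by
      rw [map_add]; exact modeCorr_add a _ _
    rw [this, map_add, map_add, map_add, dif_pow_congr (le_max_left k l) (hA w),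
      dif_pow_congr (le_max_right k l) (hA' w)]
  | hsmul r u hu =>
    obtain ⟨k, A, hA⟩ := hu a
    refine ⟨k, r • A, fun w => ?_⟩
    have : (modeCorr a fun e => F (r • u) e w) = r • modeCorr a fun e => F u e w := by
      rw [map_smul]; exact modeCorr_smul a r _
    rw [this, map_smul, map_smul, map_smul, hA]
  | hmode l b v ih =>
    obtain ⟨r, β, α, f, h⟩ := exists_sum_tmul (S (b ⊗ₜ a))
    choose K A hA using fun i => ih (α i)
    obtain ⟨K', hK'⟩ := (Set.finite_range K).bddAbove
    obtain ⟨k, hk⟩ := hF.pole_modeCorr v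
    have hA' : ∀ i w, (dif ^ K') (modeCorr (α i) fun e => F v e w) =
        (dif ^ K') (swapDist hF.trunc trunc_modeFields w (A i)) := fun i w =>
      dif_pow_congr (hK' ⟨i, rfl⟩) (hA i w)
    choose hk' hA'' using fun i => res12_insertMode hF (β i) (A i)
    choose k' hk' using hk'
    choose A'' hA'' using hA''
    obtain ⟨k'', hk''⟩ := (Set.finite_range k').bddAbove
    set R := fun w i => insertMode (β i) (swapDist hF.trunc trunc_modeFields w (A i)) with hR
    set C := fun w => ∑ i, act3 (-d01) (f i) (R w i) with hC
    set c := fun w => modeCorr₂ a b fun e => F v e w with hc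
    have hRi : ∀ w i, Bdd12 (max k k'') (act3 (-d01) (f i) (R w i)) := fun w i =>
      ((hk' i w).2.mono ((hk'' ⟨i, rfl⟩).trans (le_max_right k k''))).act3 isShift_neg_d01
        commute_neg_d01_d12 (hk' i w).1 (f i)
    have hsum : ∀ w n (I : Finset (Fin r)),
        (∀ m, Pole (max k k'') ((∑ i ∈ I, act3 (-d01) (f i) (R w i)) m)) ∧
        res12 (∑ i ∈ I, act3 (-d01) (f i) (R w i)) n =
          swapDist hF.trunc trunc_modeFields w (∑ i ∈ I, A'' i (f i) n) := by
      intro w n I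
      classical
      induction I using Finset.induction_on with
      | empty =>
        simp only [sum_empty, map_zero]
        exact ⟨fun m => Pole.zero _, res12_zero n⟩
      | insert i I hi ih =>
        rw [sum_insert hi, sum_insert hi, map_add]
        refine ⟨fun m => ((hRi w i).pole m).add (ih.1 m), ?_⟩
        rw [res12_add (hRi w i).pole ih.1, ih.2, hA'']
    have hpc : ∀ w m, Pole (max k k'') (c w m) := fun w m =>
      ((hk w b).mono (le_max_left k k'')).map (modeEnd B S m a)
    have hcR : ∀ w, d01 ((d02 ^ K') (c w)) = d01 ((d02 ^ K') (C w)) := by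
      intro w
      obtain ⟨E, hE⟩ := hF.trunc v w
      have hcomm := fun x : Dist₃ (𝕍 B S) => LinearMap.congr_fun
        ((commute_d01_d02 (U := 𝕍 B S)).pow_right K').eq x
      simp only [End.mul_apply] at hcomm
      rw [hcomm, hcomm]
      simp only [hc, hC]
      rw [d01_modeCorr₂_eq h, ← hcomm, ← hcomm]
      congr 1
      rw [map_sum, map_sum]
      refine sum_congr rfl fun i _ => ?_
      rw [d02_pow_act3 isShift_neg_d01 commute_neg_d01_d02 (hk' i w).1,
        d02_pow_act3 isShift_neg_d01 commute_neg_d01_d02 (up3_swap_modeCorr₂ _ _ hE)]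
      congr 1
      ext m n e
      rw [d02_pow_swap_modeCorr₂, hA', d02_pow_apply]
      exact (congrFun (congrFun (dif_pow_map K' (swapDist hF.trunc trunc_modeFields w (A i))
        (modeEnd B S n (β i))) m) e).symm
    refine ⟨1 + (((max k k'' : ℕ) : ℤ) - l).toNat + K', ∑ i, A'' i (f i) l, fun w => ?_⟩
    have hpC := fun m => (hsum w l univ).1 m
    have key := dif_pow_res12_mem (c := c w - C w) (k := max k k'')
      (fun m => (hpc w m).congr_sub (hpC m)) ⊥ (fun x hx => by
        rw [Submodule.mem_bot] at hx ⊢; rw [hx, map_zero]) 1 K' (fun n => by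
        rw [pow_one, map_sub, map_sub, hcR, sub_self, res12_zero]; exact zero_mem _) l
    have hsub : res12 (c w - C w) l = res12 (c w) l - res12 (C w) l := by
      ext m e
      exact congrFun (res_sub (hpc w m) (hpC m) l) e
    rw [Submodule.mem_bot, hsub, map_sub, sub_eq_zero] at key
    rw [← (hsum w l univ).2, hF.mode_smul]
    obtain ⟨E, hE⟩ := hF.trunc v w
    obtain ⟨k₀, hk₀⟩ := hF.pole v
    obtain ⟨N, hN⟩ := hk₀ w
    rw [← res12_modeCorr₂ hN hE a b l]
    exact key

end

/-! ### Associativity -/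

section

/-- A criterion for `Up3` when the operator with modes `n` is applied first, then the one with
modes `e`, and the one with modes `m` last. -/
lemma Up3.of_nested_snd' {c : Dist₃ U} (h0 : ∃ N : ℤ, ∀ n, N ≤ n → ∀ m e, c m n e = 0)
    (h1 : ∀ n, ∃ N : ℤ, ∀ e, N ≤ e → ∀ m, c m n e = 0)
    (h2 : ∀ n e, ∃ N : ℤ, ∀ m, N ≤ m → c m n e = 0) : Up3 c := by
  intro m n e
  obtain ⟨Q, hQ⟩ := exists_bound_of_nested (P := fun j l i => c (m + i) (n + j) (e + l) = 0)
    ((exists_nat_bound h0 n).imp fun E hE i hi l j => hE i hi _ _)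
    (fun i => (exists_nat_bound (h1 (n + i)) e).imp fun E hE l hl j => hE l hl _)
    (fun i l => exists_nat_bound (h2 (n + i) (e + l)) m)
  exact ⟨Q, fun i j l hij => hQ j l i (by omega)⟩

lemma commute_neg_d12_d02 : Commute (-d12 : End ℂ (Dist₃ U)) d02 :=
  Commute.neg_left (R := End ℂ (Dist₃ U)) commute_d02_d12.symm

lemma Up2.zero : Up2 (0 : Dist₂ U) := fun _ _ => ⟨0, fun _ _ _ => rfl⟩

variable {ψ : Y →ₗ[ℂ] ℤ → End ℂ V} {φ : X →ₗ[ℂ] ℤ → End ℂ V} (hψ : Trunc ψ) (hφ : Trunc φ)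
include hψ hφ

lemma up2_swapDist (w : V) (A : (Y ⊗[ℂ] X) ⊗[ℂ] ℂ⟦X⟧) : Up2 (swapDist hψ hφ w A) := by
  induction A using triple_induction with
  | zero => rw [map_zero]; exact Up2.zero
  | add A A' h h' => rw [map_add]; exact h.add h'
  | tmul y x f => exact (up2_tmul hψ hφ w y x).act2 f

/-- Multiplication of `∑ yᵢ ⊗ xᵢ ⊗ fᵢ` by a power series. -/
lemma act2_swapDist (w : V) (f : ℂ⟦X⟧) (A : (Y ⊗[ℂ] X) ⊗[ℂ] ℂ⟦X⟧) : act2 f (swapDist hψ hφ w A) =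
      swapDist hψ hφ w (lTensor (Y ⊗[ℂ] X) (LinearMap.mulLeft ℂ f) A) := by
  induction A using triple_induction with
  | zero => rw [map_zero, map_zero, map_zero, act2_zero]
  | add A A' h h' =>
    rw [map_add, map_add, map_add, act2_add (up2_swapDist hψ hφ w A) (up2_swapDist hψ hφ w A'),
      h, h']
  | tmul y x g =>
    rw [lTensor_tmul, swapDist_tmul, swapDist_tmul, LinearMap.mulLeft_apply,
      act2_act2 (up2_tmul hψ hφ w y x)]

end

section

/-- The distribution `Y(u, z₀) Y(v, z₁) w`. -/
def fieldCorr (F : V →ₗ[ℂ] ℤ → End ℂ V) (u v w : V) : Dist₂ V := fun m n => F u m (F v n w)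

lemma fieldCorr_add (F : V →ₗ[ℂ] ℤ → End ℂ V)
    (u u' v w : V) : fieldCorr F (u + u') v w = fieldCorr F u v w + fieldCorr F u' v w := by
  ext m n
  simp [fieldCorr]

lemma fieldCorr_smul (F : V →ₗ[ℂ] ℤ → End ℂ V)
    (r : ℂ) (u v w : V) : fieldCorr F (r • u) v w = r • fieldCorr F u v w := by
  ext m n
  simp [fieldCorr]

variable {F : 𝕍 B S →ₗ[ℂ] ℤ → End ℂ (𝕍 B S)} (hF : IsVertexMap B S F)
include hF

lemma van0_swapDist {g : ℤ → 𝕍 B S} {N E : ℤ} {j : ℕ}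
    (hg : ∀ a, Tr0 N ((dif ^ j) (modeCorr a g))) (hE : ∀ e, E ≤ e → g e = 0)
    (A : (𝕍 B S ⊗[ℂ] H) ⊗[ℂ] ℂ⟦X⟧) :
    Van0 N ((d02 ^ j) fun m n e => swapDist hF.trunc trunc_modeFields (g e) A m n) := by
  induction A using triple_induction with
  | zero =>
    simp only [map_zero, Pi.zero_apply]
    rw [show (fun _ _ _ => (0 : 𝕍 B S)) = (0 : Dist₃ (𝕍 B S)) from rfl, map_zero]
    exact fun _ _ _ _ => rfl
  | add A A' h h' =>
    have : (fun m n e => swapDist hF.trunc trunc_modeFields (g e) (A + A') m n) =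
        (fun m n e => swapDist hF.trunc trunc_modeFields (g e) A m n) +
          fun m n e => swapDist hF.trunc trunc_modeFields (g e) A' m n := by
      ext m n e
      rw [map_add]
      rfl
    rw [this, map_add]
    intro m hm n e
    rw [Pi.add_apply, Pi.add_apply, Pi.add_apply, h m hm, h' m hm, add_zero]
  | tmul u a f =>
    set D : Dist₃ (𝕍 B S) := fun m n e => F u n (mode m a • g e) with hD
    have e1 : (fun m n e => swapDist hF.trunc trunc_modeFields (g e) ((u ⊗ₜ a) ⊗ₜ f) m n) =
        act3 (-d01) f D := by
      ext m n e
      rw [act3_neg_d01]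
      rfl
    have hup : Up3 D := by
      refine Up3.of_nested ⟨E, fun e he m n => ?_⟩ (fun e => ?_) fun e m => hF.trunc u _
      · rw [hD]; beta_reduce; rw [hE e he, smul_zero, map_zero]
      · obtain ⟨M, hM⟩ := vacuumModule_truncation B S a (g e)
        exact ⟨M, fun m hm n => by rw [hD]; beta_reduce; rw [hM m hm, map_zero]⟩
    rw [e1, d02_pow_act3 isShift_neg_d01 commute_neg_d01_d02 hup]
    refine Van0.act3 (fun m hm n e => ?_) isShift_neg_d01 f
    rw [d02_pow_apply]
    have := congrFun (congrFun (dif_pow_map j (modeCorr a g) (F u n)) m) e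
    refine this.trans ?_
    rw [hg a m e hm, map_zero]

/-- The distribution `b(z₀) Y(u, z₁) Y(v, z₂) w` has only poles on the diagonals, of order
independent of `w`. -/
lemma tri_mode_fieldCorr (b : H) (u v : 𝕍 B S) {k : ℕ} (hk : ∀ w, Pole k (fieldCorr F u v w)) :
    ∃ i j : ℕ, ∀ w, Tri i j k fun m n e => mode m b • F u n (F v e w) := by
  obtain ⟨i, hi⟩ := hF.pole_modeCorr u
  obtain ⟨i', A, hA⟩ := exists_swap_mode hF b u
  obtain ⟨j, hj⟩ := hF.pole v
  refine ⟨max i i', j, fun w => ⟨fun e => (hi (F v e w) b).mono (le_max_left _ _), ?_, ?_⟩⟩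
  · obtain ⟨⟨N, hN⟩, N', hN'⟩ := hk w
    refine ⟨max N N', fun m => ?_⟩
    have := dif_pow_map k (fieldCorr F u v w) (modeEnd B S m b)
    change Tr0 _ ((dif ^ k) fun n e => modeEnd B S m b (fieldCorr F u v w n e)) ∧
      Tr1 _ ((dif ^ k) fun n e => modeEnd B S m b (fieldCorr F u v w n e))
    rw [this]
    exact ⟨fun n e hn => by beta_reduce; rw [hN n e ((le_max_left _ _).trans hn), map_zero],
      fun n e hn => by beta_reduce; rw [hN' n e ((le_max_right _ _).trans hn), map_zero]⟩
  · obtain ⟨N, hN⟩ := hj w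
    obtain ⟨E, hE⟩ := hF.trunc v w
    obtain ⟨⟨N₁, hN₁⟩, N₂, hN₂⟩ := hk w
    set c : Dist₃ (𝕍 B S) := fun m n e => mode m b • F u n (F v e w) with hc
    have e1 : (d01 ^ max i i') ((d02 ^ j) c) = (d01 ^ max i i')
        ((d02 ^ j) fun m n e => swapDist hF.trunc trunc_modeFields (F v e w) A m n) := by
      rw [← End.mul_apply, ← End.mul_apply, (commute_d01_d02.pow_pow _ j).eq,
        End.mul_apply, End.mul_apply]
      congr 1
      ext m n e
      rw [d01_pow_apply, d01_pow_apply]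
      exact congrFun (congrFun (dif_pow_congr (le_max_right i i') (hA (F v e w))) m) n
    have hV : Van0 N ((d12 ^ k) ((d01 ^ max i i') ((d02 ^ j) c))) := by
      rw [e1]
      exact ((van0_swapDist hF hN hE A).shift_pow isShift_d01 _).shift_pow isShift_d12 k
    have h12 : ∀ m n e, max N₁ N₂ ≤ n ∨ max N₁ N₂ ≤ e → (d12 ^ k) c m n e = 0 := by
      intro m n e hn
      rw [d12_pow_apply]
      have := congrFun (congrFun (dif_pow_map k (fieldCorr F u v w) (modeEnd B S m b)) n) e
      refine this.trans ?_
      rcases hn with hn | hn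
      · rw [hN₁ n e ((le_max_left _ _).trans hn), map_zero]
      · rw [hN₂ n e ((le_max_right _ _).trans hn), map_zero]
    refine ⟨max N (max N₁ N₂), fun m n e hm => ?_⟩
    rcases hm with hm | hm
    · have h2 : (d01 ^ max i i') ((d02 ^ j) ((d12 ^ k) c)) =
          (d12 ^ k) ((d01 ^ max i i') ((d02 ^ j) c)) := by
        rw [← End.mul_apply (d02 ^ j), (commute_d02_d12.pow_pow j k).eq,
          End.mul_apply, ← End.mul_apply, (commute_d01_d12.pow_pow _ k).eq,
          End.mul_apply]
      rw [h2]
      exact hV m ((le_max_left _ _).trans hm) n e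
    · refine isShift_d01.pow_apply_eq_zero _ fun i' j' l _ => ?_
      exact isShift_d02.pow_apply_eq_zero j fun i j l _ => h12 _ _ _ (by omega)

/-- Associativity: `Y(u, z₀) Y(v, z₁) w` has only a pole at `z₀ = z₁`, of order independent of `w`,
and its expansion at the pole is `Y(Y(u, x) v, z₁) w`. -/
lemma exists_pole_fieldCorr (u v : 𝕍 B S) : ∃ k : ℕ, ∀ w, Pole k (fieldCorr F u v w) ∧
      ∀ l, res (fieldCorr F u v w) l = fun n => F (F u l v) n w := by
  induction u using vacuumModule_induction with
  | hvac =>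
    refine ⟨0, fun w => ?_⟩
    obtain ⟨E, hE⟩ := hF.trunc v w
    have e1 : fieldCorr F (vacuum B S) v w = fun m n => if m + 1 = 0 then F v n w else 0 := by
      ext m n
      rw [fieldCorr, hF.vacuum]
      simp only [eq_neg_iff_add_eq_zero]
    rw [e1]
    refine ⟨⟨⟨0, fun m n hm => if_neg (by omega)⟩, E, fun m n hn => ?_⟩, fun l => ?_⟩
    · change (if m + 1 = 0 then F v n w else 0) = 0
      rw [hE n hn, ite_self]
    · rw [res_identity hE, hF.vacuum]
      simp only [eq_neg_iff_add_eq_zero]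
      split_ifs
      · rfl
      · rw [map_zero]; rfl
  | hadd u u' h h' =>
    obtain ⟨k, hk⟩ := h
    obtain ⟨k', hk'⟩ := h'
    refine ⟨max k k', fun w => ?_⟩
    have h1 := (hk w).1.mono (le_max_left k k')
    have h2 := (hk' w).1.mono (le_max_right k k')
    rw [fieldCorr_add]
    refine ⟨h1.add h2, fun l => ?_⟩
    rw [res_add h1 h2, (hk w).2, (hk' w).2]
    ext n
    simp
  | hsmul r u h =>
    obtain ⟨k, hk⟩ := h
    refine ⟨k, fun w => ?_⟩
    rw [fieldCorr_smul]
    refine ⟨(hk w).1.smul r, fun l => ?_⟩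
    rw [res_smul (hk w).1, (hk w).2]
    ext n
    simp
  | hmode l b u ih =>
    obtain ⟨k, hk⟩ := ih
    obtain ⟨i, j, hT⟩ := tri_mode_fieldCorr hF b u v fun w => (hk w).1
    obtain ⟨k₀, hk₀⟩ := hF.pole_modeCorr u
    have e1 : ∀ w, res01 (fun m n e => mode m b • F u n (F v e w)) l =
        fieldCorr F (mode l b • u) v w := by
      intro w
      ext n e
      exact (congrFun (hF.mode_smul b l u (F v e w)) n).symm
    refine ⟨j + (i - l).toNat + k, fun w => ⟨?_, fun p => ?_⟩⟩
    · rw [← e1]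
      exact (hT w).pole_res01 l
    · have e2 : ∀ n, res12 (fun m n e => mode m b • F u n (F v e w)) n =
          modeCorr b fun e => F (F u n v) e w := by
        intro n
        ext m e
        refine (res_map (hk w).1 (modeEnd B S m b) n e).trans ?_
        rw [(hk w).2]
        rfl
      have e3 : resres (fun m n e => mode m b • F u n (F v e w)) =
          fun m n e => F (mode m b • F u n v) e w := by
        ext m n e
        change res (res12 _ n) m e = _
        rw [e2, ← hF.mode_smul]
      have h1 := (hT w).res_resres l p
      rw [e1, e3] at h1
      let φ : 𝕍 B S →ₗ[ℂ] ℤ → 𝕍 B S :=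
        { toFun := fun x e => F x e w
          map_add' := fun x y => by ext e; simp
          map_smul' := fun r x => by ext e; simp }
      rw [← h1]
      refine (res_map (hk₀ v b) φ l p).trans ?_
      rw [← hF.mode_smul]
      rfl

end

/-! ### Weak `𝒮`-locality of all fields -/

section

variable {F : 𝕍 B S →ₗ[ℂ] ℤ → End ℂ (𝕍 B S)} (hF : IsVertexMap B S F)
include hF

/-- For `c(z₀, z₂) = ∑ fᵢ(z₂ - z₀) Y(vᵢ, z₂) aᵢ(z₀)` the residues at `z₀ = z₁` of
`c(z₀, z₂) Y(u, z₁) w` are of the form `∑ gᵢ(z₂ - z₁) Y(vᵢ, z₂) Y(uᵢ, z₁) w`. -/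
lemma res01_swapDist (u : 𝕍 B S) (A : (𝕍 B S ⊗[ℂ] H) ⊗[ℂ] ℂ⟦X⟧) :
    (∃ k, ∀ w, Up3 (fun m n e => swapDist hF.trunc trunc_modeFields (F u n w) A m e) ∧
      Bdd01 k fun m n e => swapDist hF.trunc trunc_modeFields (F u n w) A m e) ∧
    ∀ l, ∃ A', ∀ w, res01 (fun m n e => swapDist hF.trunc trunc_modeFields (F u n w) A m e) l =
      swapDist hF.trunc hF.trunc w A' := by
  induction A using triple_induction with
  | zero =>
    simp only [map_zero, Pi.zero_apply]
    exact ⟨⟨0, fun w => ⟨Up3.zero, Bdd01.zero 0⟩⟩, fun l => ⟨0, fun w => by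
      rw [map_zero]; exact res01_zero l⟩⟩
  | add A A' h h' =>
    obtain ⟨⟨k, hk⟩, hr⟩ := h
    obtain ⟨⟨k', hk'⟩, hr'⟩ := h'
    have h1 := fun w => (hk w).2.mono (le_max_left k k')
    have h2 := fun w => (hk' w).2.mono (le_max_right k k')
    have e1 : ∀ w, (fun m n e => swapDist hF.trunc trunc_modeFields (F u n w) (A + A') m e) =
        (fun m n e => swapDist hF.trunc trunc_modeFields (F u n w) A m e) +
          fun m n e => swapDist hF.trunc trunc_modeFields (F u n w) A' m e := by
      intro w
      ext m n e
      rw [map_add]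
      rfl
    simp only [e1]
    refine ⟨⟨max k k', fun w => ⟨(hk w).1.add (hk' w).1, (h1 w).add (h2 w)⟩⟩, fun l => ?_⟩
    obtain ⟨D, hD⟩ := hr l
    obtain ⟨D', hD'⟩ := hr' l
    exact ⟨D + D', fun w => by rw [res01_add (h1 w).pole (h2 w).pole, hD, hD', map_add]⟩
  | tmul v b g =>
    set D : 𝕍 B S → Dist₃ (𝕍 B S) :=
      fun w m n e => F v e (mode m b • F u n w) with hD
    have e1 : ∀ w, (fun m n e => swapDist hF.trunc trunc_modeFields (F u n w) ((v ⊗ₜ b) ⊗ₜ g) m e) =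
        act3 (-d02) g (D w) := by
      intro w
      ext m n e
      rw [act3_neg_d02]
      rfl
    have hup : ∀ w, Up3 (D w) := fun w => by
      obtain ⟨E, hE⟩ := hF.trunc u w
      refine Up3.of_nested_snd ⟨E, fun n hn m e => ?_⟩ (fun n => ?_) fun n m => hF.trunc v _
      · rw [hD]; beta_reduce; rw [hE n hn, smul_zero, map_zero]
      · obtain ⟨M, hM⟩ := vacuumModule_truncation B S b (F u n w)
        exact ⟨M, fun m hm e => by rw [hD]; beta_reduce; rw [hM m hm, map_zero]⟩
    obtain ⟨k, hk⟩ := hF.pole_modeCorr u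
    have hB : ∀ w, Bdd01 k (D w) := fun w e => by
      obtain ⟨⟨N, hN⟩, N', hN'⟩ := hk w b
      refine ⟨max N N', fun e' _ => ?_⟩
      have := dif_pow_map k (modeCorr b fun e => F u e w) (F v e')
      rw [show (fun m n => D w m n e') = fun m n => F v e' (modeCorr b (fun e => F u e w) m n) from
        rfl, this]
      exact ⟨fun m n hm => by beta_reduce; rw [hN m n ((le_max_left _ _).trans hm), map_zero],
        fun m n hn => by beta_reduce; rw [hN' m n ((le_max_right _ _).trans hn), map_zero]⟩
    have hres : ∀ w l, res01 (D w) l = fun n e => F v e (F (mode l b • u) n w) := by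
      intro w l
      ext n e
      refine (res_map (hk w b) (F v e) l n).trans ?_
      rw [← hF.mode_smul]
    have hu : ∀ w l, Up2 (res01 (D w) l) := fun w l => by
      rw [hres]; exact up2_tmul hF.trunc hF.trunc w v _
    simp only [e1]
    refine ⟨⟨k, fun w => ⟨(hup w).act3 isShift_neg_d02 g,
      (hB w).act3 isShift_neg_d02 commute_neg_d02_d01 (hup w) g⟩⟩, fun l => ?_⟩
    refine ⟨∑ i ∈ range (k - l).toNat,
      (-1 : ℂ) ^ i • ((v ⊗ₜ (mode (l + i) b • u)) ⊗ₜ hasse i g), fun w => ?_⟩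
    rw [res01_act3_d02 (hup w) l g (hB w) fun i => hu w _, map_sum]
    refine sum_congr rfl fun i _ => ?_
    rw [map_smul, swapDist_tmul, hres]

/-- For `c(z₁, z₂) = ∑ fᵢ(z₂ - z₁) Y(vᵢ, z₂) Y(uᵢ, z₁) w`, the product `b(z₀) c(z₁, z₂)` can
be replaced, up to a factor `(z₀ - z₂) ^ k`, by a distribution whose residues at `z₀ = z₁` are
of the same form as `c`. -/
lemma exists_res01_mode_swapDist (b : H) (A : (𝕍 B S ⊗[ℂ] 𝕍 B S) ⊗[ℂ] ℂ⟦X⟧) :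
    ∃ (K : ℕ) (R : 𝕍 B S → Dist₃ (𝕍 B S)), (∀ w, (∀ e, Pole K fun m n => R w m n e) ∧
        (d02 ^ K) (fun m n e => mode m b • swapDist hF.trunc hF.trunc w A n e) = (d02 ^ K) (R w)) ∧
      ∀ l, ∃ A', ∀ w, res01 (R w) l = swapDist hF.trunc hF.trunc w A' := by
  induction A using triple_induction with
  | zero =>
    refine ⟨0, 0, fun w => ⟨fun e => Pole.zero 0, ?_⟩, fun l => ⟨0, fun w => ?_⟩⟩
    · congr 1
      ext m n e
      rw [map_zero]
      exact smul_zero _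
    · rw [map_zero]; exact res01_zero l
  | add A A' h h' =>
    obtain ⟨K, R, hR, hr⟩ := h
    obtain ⟨K', R', hR', hr'⟩ := h'
    have hp := fun w e => ((hR w).1 e).mono (le_max_left K K')
    have hp' := fun w e => ((hR' w).1 e).mono (le_max_right K K')
    refine ⟨max K K', R + R', fun w => ⟨fun e => (hp w e).add (hp' w e), ?_⟩, fun l => ?_⟩
    · have e1 : (fun m n e => mode m b • swapDist hF.trunc hF.trunc w (A + A') n e) =
          (fun m n e => mode m b • swapDist hF.trunc hF.trunc w A n e) +
            fun m n e => mode m b • swapDist hF.trunc hF.trunc w A' n e := by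
        ext m n e
        rw [map_add]
        exact smul_add _ _ _
      have key : ∀ {k l : ℕ} (_ : k ≤ l) {c c' : Dist₃ (𝕍 B S)}
          (_ : (d02 ^ k) c = (d02 ^ k) c'), (d02 ^ l) c = (d02 ^ l) c' := by
        intro k l hkl c c' h
        obtain ⟨j, rfl⟩ := Nat.exists_eq_add_of_le hkl
        rw [add_comm, pow_add, End.mul_apply, h, ← End.mul_apply]
      rw [e1, map_add, Pi.add_apply, map_add, key (le_max_left K K') (hR w).2,
        key (le_max_right K K') (hR' w).2]
    · obtain ⟨D, hD⟩ := hr l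
      obtain ⟨D', hD'⟩ := hr' l
      exact ⟨D + D', fun w => by
        rw [Pi.add_apply, res01_add (hp w) (hp' w), hD, hD', map_add]⟩
  | tmul v u f =>
    obtain ⟨K, A', hA'⟩ := exists_swap_mode hF b v
    obtain ⟨⟨k, hk⟩, hr⟩ := res01_swapDist hF u A'
    set Q := fun w m n e => swapDist hF.trunc trunc_modeFields (F u n w) A' m e with hQ
    have hB : ∀ w, Bdd01 k (act3 (-d12) f (Q w)) := fun w =>
      (hk w).2.act3 isShift_neg_d12 commute_neg_d12_d01 (hk w).1 f
    refine ⟨max K k, fun w => act3 (-d12) f (Q w), fun w => ⟨fun e => ?_, ?_⟩, fun l => ?_⟩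
    · exact ((hB w).pole e).mono (le_max_right _ _)
    · set D : Dist₃ (𝕍 B S) := fun m n e => mode m b • F v e (F u n w) with hD
      have hup : Up3 D := by
        obtain ⟨E, hE⟩ := hF.trunc u w
        refine Up3.of_nested_snd' ⟨E, fun n hn m e => ?_⟩ (fun n => ?_)
          fun n e => vacuumModule_truncation B S b _
        · rw [hD]; beta_reduce; rw [hE n hn, map_zero, smul_zero]
        · obtain ⟨M, hM⟩ := hF.trunc v (F u n w)
          exact ⟨M, fun e he m => by rw [hD]; beta_reduce; rw [hM e he, smul_zero]⟩
      have e1 : (fun m n e => mode m b • swapDist hF.trunc hF.trunc w ((v ⊗ₜ u) ⊗ₜ f) n e) =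
          act3 (-d12) f D := by
        ext m n e
        rw [act3_neg_d12]
        exact (act2_map f (up2_tmul hF.trunc hF.trunc w v u) (modeEnd B S m b) n e).symm
      rw [e1, d02_pow_act3 isShift_neg_d12 commute_neg_d12_d02 hup,
        d02_pow_act3 isShift_neg_d12 commute_neg_d12_d02 (hk w).1]
      congr 1
      ext m n e
      rw [d02_pow_apply, d02_pow_apply]
      exact congrFun (congrFun (dif_pow_congr (le_max_left K k) (hA' (F u n w))) m) e
    · obtain ⟨A'', hA''⟩ := hr l
      have hu : ∀ w (i : ℕ), Up2 (res01 (Q w) (l + i)) := fun w i => by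
        obtain ⟨C, hC⟩ := hr (l + i)
        rw [hC]
        exact up2_swapDist _ _ _ _
      rcases lt_or_ge l k with hl | hl
      · refine ⟨lTensor _ (LinearMap.mulLeft ℂ f) A'', fun w => ?_⟩
        rw [res01_act3_d12 (hk w).1 l f (hk w).2 (hu w) hl, hA'', act2_swapDist]
      · refine ⟨0, fun w => ?_⟩
        rw [res01_eq_zero (hB w).pole hl, map_zero]

/-- Weak `𝒮`-locality of `Y(u, z)` and `Y(v, z)`. -/
lemma exists_swap (u v : 𝕍 B S) : ∃ (k : ℕ) (A : (𝕍 B S ⊗[ℂ] 𝕍 B S) ⊗[ℂ] ℂ⟦X⟧), ∀ w,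
      (dif ^ k) (fieldCorr F u v w) = (dif ^ k) (swapDist hF.trunc hF.trunc w A) := by
  induction u using vacuumModule_induction with
  | hvac =>
    refine ⟨0, (v ⊗ₜ vacuum B S) ⊗ₜ 1, fun w => ?_⟩
    congr 1
    rw [swapDist_tmul_one]
    ext m n
    rw [fieldCorr, hF.vacuum, hF.vacuum]
    split_ifs
    · rfl
    · rw [map_zero]
  | hadd u u' hu hv =>
    obtain ⟨k, A, hA⟩ := hu
    obtain ⟨l, A', hA'⟩ := hv
    refine ⟨max k l, A + A', fun w => ?_⟩
    rw [fieldCorr_add, map_add, map_add, map_add, dif_pow_congr (le_max_left k l) (hA w),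
      dif_pow_congr (le_max_right k l) (hA' w)]
  | hsmul r u hu =>
    obtain ⟨k, A, hA⟩ := hu
    refine ⟨k, r • A, fun w => ?_⟩
    rw [fieldCorr_smul, map_smul, map_smul, map_smul, hA]
  | hmode l b u ih =>
    obtain ⟨k, A, hA⟩ := ih
    obtain ⟨K, R, hR, hr⟩ := exists_res01_mode_swapDist hF b A
    obtain ⟨i, hi⟩ := hF.pole_modeCorr u
    obtain ⟨A', hA'⟩ := hr l
    refine ⟨K + (((max i K : ℕ) : ℤ) - l).toNat + k, A', fun w => ?_⟩
    set c : Dist₃ (𝕍 B S) := fun m n e => mode m b • F u n (F v e w) with hc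
    have hp : ∀ e, Pole (max i K) fun m n => c m n e := fun e =>
      (hi (F v e w) b).mono (le_max_left _ _)
    have hpR : ∀ e, Pole (max i K) fun m n => R w m n e := fun e =>
      ((hR w).1 e).mono (le_max_right _ _)
    have e1 : res01 c l = fieldCorr F (mode l b • u) v w := by
      ext n e
      exact (congrFun (hF.mode_smul b l u (F v e w)) n).symm
    have e2 : (d12 ^ k) c =
        (d12 ^ k) fun m n e => mode m b • swapDist hF.trunc hF.trunc w A n e := by
      ext m n e
      rw [d12_pow_apply, d12_pow_apply]
      have h1 := congrFun (congrFun (dif_pow_map k (fieldCorr F u v w) (modeEnd B S m b)) n) e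
      have h2 := congrFun (congrFun (dif_pow_map k (swapDist hF.trunc hF.trunc w A)
        (modeEnd B S m b)) n) e
      refine h1.trans (Eq.trans ?_ h2.symm)
      rw [hA]
    have e3 : (d02 ^ K) ((d12 ^ k) c) = (d02 ^ K) ((d12 ^ k) (R w)) := by
      rw [e2, ← End.mul_apply, (commute_d02_d12.pow_pow K k).eq, End.mul_apply,
        (hR w).2, ← End.mul_apply, ← (commute_d02_d12.pow_pow K k).eq, End.mul_apply]
    have key := dif_pow_res01_mem (c := c - R w) (k := max i K)
      (fun e => (hp e).congr_sub (hpR e)) ⊥ (fun x hx => by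
        rw [Submodule.mem_bot] at hx ⊢; rw [hx, map_zero]) K k (fun l => by
        rw [map_sub, map_sub, e3, sub_self, res01_zero]; exact zero_mem _) l
    have hsub : res01 (c - R w) l = res01 c l - res01 (R w) l := by
      ext n e
      exact congrFun (res_sub (hp e) (hpR e) l) n
    rw [Submodule.mem_bot, hsub, map_sub, sub_eq_zero, e1, hA'] at key
    exact key

end

/-! ### The `𝒮`-Jacobi identity -/

/-- The vertex operators with given modes. -/
def ofModes (F : V →ₗ[ℂ] ℤ → End ℂ V) (hF : Trunc F) : V →ₗ[ℂ] VertexOperator ℂ V where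
  toFun u := VertexOperator.of_coeff (fun s => F u (-s - 1)) fun w => by
    obtain ⟨E, hE⟩ := hF u w
    refine ⟨-E, fun s hs => ?_⟩
    by_contra hc
    exact hs (hE _ (by omega))
  map_add' u v := LinearMap.ext fun w => by
    ext s
    change F (u + v) (-s - 1) w = F u (-s - 1) w + F v (-s - 1) w
    rw [map_add]
    rfl
  map_smul' r u := LinearMap.ext fun w => by
    ext s
    change F (r • u) (-s - 1) w = r • F u (-s - 1) w
    rw [map_smul]
    rfl

lemma ncoeff_ofModes {F : V →ₗ[ℂ] ℤ → End ℂ V} (hF : Trunc F) (u : V) (n : ℤ) :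
    ncoeff (ofModes F hF u) n = F u n := by
  ext w
  change F u (-(-n - 1) - 1) w = F u n w
  rw [neg_sub, sub_neg_eq_add, add_sub_cancel_left]

/-- The inclusion of `ℂ[[x]]` in `ℂ((x))`. -/
def powerToLaurent : ℂ⟦X⟧ →ₗ[ℂ] LaurentSeries ℂ where
  toFun f := ofPowerSeries ℤ ℂ f
  map_add' f g := map_add _ f g
  map_smul' r f := by
    rw [PowerSeries.smul_eq_C_mul, map_mul, HahnSeries.ofPowerSeries_C, HahnSeries.C_mul_eq_smul]
    rfl

lemma coeff_powerToLaurent_natCast (f : ℂ⟦X⟧) (s : ℕ) :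
    (powerToLaurent f).coeff s = coeff s f := HahnSeries.ofPowerSeries_apply_coeff f s

lemma coeff_powerToLaurent_of_neg (f : ℂ⟦X⟧) {s : ℤ} (hs : s < 0) :
    (powerToLaurent f).coeff s = 0 := by
  change (ofPowerSeries ℤ ℂ f).coeff s = 0
  rw [HahnSeries.ofPowerSeries_apply]
  apply HahnSeries.embDomain_of_notMem_range
  rintro ⟨k, hk⟩
  have : ((k : ℕ) : ℤ) = s := hk
  omega

lemma laurentCoeff_tmul (M : Type*) [AddCommGroup M] [Module ℂ M] (s : ℤ) (t : M)
    (f : LaurentSeries ℂ) : laurentCoeff M s (t ⊗ₜ f) = f.coeff s • t := by simp [laurentCoeff]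

lemma modePair_tmul (Y : V →ₗ[ℂ] VertexOperator ℂ V) (k l : ℤ) (w v u : V) :
    modePair Y k l w (v ⊗ₜ u) = ncoeff (Y v) k (ncoeff (Y u) l w) := rfl

lemma mulPow10_add {M : ℤ} {c c' : Dist₂ V} (h : Tr0 M c) (h' : Tr0 M c') (l m n : ℤ) :
    mulPow10 l m n (c + c') = mulPow10 l m n c + mulPow10 l m n c' := by
  obtain ⟨K, hK⟩ : ∃ K : ℕ, M ≤ m + K := ⟨(M - m).toNat, by omega⟩
  rw [mulPow10_eq (h.add h') l m n hK, mulPow10_eq h l m n hK, mulPow10_eq h' l m n hK,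
    ← sum_add_distrib]
  simp only [Pi.add_apply, smul_add]

lemma neg_dif_pow_eq (c : Dist₂ V) (s : ℕ) :
    ((-dif : End ℂ (Dist₂ V)) ^ s) c = ((-1) ^ s : ℂ) • (dif ^ s) c := by
  rw [← neg_one_smul ℂ (dif : End ℂ (Dist₂ V)), smul_pow, LinearMap.smul_apply]

lemma mulPow10_neg_dif_pow {M : ℤ} {c : Dist₂ V} (h : Tr0 M c) (s : ℕ) (l m n : ℤ) :
    mulPow10 l m n (((-dif : End ℂ (Dist₂ V)) ^ s) c) =
      ((-1) ^ s : ℤ) • mulPow10 (l + s) m n c := by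
  rw [neg_dif_pow_eq, ← mulPow10_dif_pow h]
  obtain ⟨K, hK⟩ : ∃ K : ℕ, M ≤ m + K := ⟨(M - m).toNat, by omega⟩
  rw [mulPow10_eq ((h.dif_pow s).smul _) l m n hK, mulPow10_eq (h.dif_pow s) l m n hK, smul_sum]
  refine sum_congr rfl fun i _ => ?_
  rw [Pi.smul_apply, Pi.smul_apply, smul_comm (_ : ℤ) (_ : ℂ),
    ← Int.cast_smul_eq_zsmul ℂ ((-1) ^ s)]
  push_cast
  rfl

lemma tr0_swapDist_of {ψ : Y →ₗ[ℂ] ℤ → End ℂ V} {φ : X →ₗ[ℂ] ℤ → End ℂ V} (hψ : Trunc ψ)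
    (hφ : Trunc φ) {w : V} {M : ℤ} (h : ∀ x m, M ≤ m → φ x m w = 0)
    (A : (Y ⊗[ℂ] X) ⊗[ℂ] ℂ⟦X⟧) : Tr0 M (swapDist hψ hφ w A) := by
  induction A using triple_induction with
  | zero => rw [map_zero]; exact fun _ _ _ => rfl
  | add A A' h h' => rw [map_add]; exact h.add h'
  | tmul y x f =>
    exact Tr0.act2 (fun m n hm => by rw [pairDist_tmul]; beta_reduce; rw [h x m hm, map_zero]) f

/-- The second term of the Jacobi identity for a sum of products with power series. -/
lemma mulPow10_swapDist {F : V →ₗ[ℂ] ℤ → End ℂ V} (hF : Trunc F) (w : V)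
    (A : (V ⊗[ℂ] V) ⊗[ℂ] ℂ⟦X⟧) (l m n : ℤ) :
    mulPow10 l m n (swapDist hF hF w A) =
      ∑ᶠ q : ℤ × ℕ, (l.negOnePow * ((-1) ^ q.2 * Ring.choose (l + q.1) q.2) : ℤ) •
        modePair (ofModes F hF) (n + l + q.1 - q.2) (m + q.2) w
          (laurentCoeff (V ⊗[ℂ] V) q.1 (lTensor (V ⊗[ℂ] V) powerToLaurent A)) := by
  set T : (V ⊗[ℂ] V) ⊗[ℂ] ℂ⟦X⟧ → ℤ × ℕ → V := fun A q =>
    (l.negOnePow * ((-1) ^ q.2 * Ring.choose (l + q.1) q.2) : ℤ) •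
        modePair (ofModes F hF) (n + l + q.1 - q.2) (m + q.2) w
          (laurentCoeff (V ⊗[ℂ] V) q.1 (lTensor (V ⊗[ℂ] V) powerToLaurent A)) with hT
  suffices h : (Function.support (T A)).Finite ∧
      mulPow10 l m n (swapDist hF hF w A) = ∑ᶠ q, T A q from h.2
  induction A using triple_induction with
  | zero =>
    have : T 0 = 0 := by ext q; simp [hT]
    rw [this, map_zero]
    simp [mulPow10]
  | add A A' h h' =>
    have : T (A + A') = T A + T A' := by ext q; simp [hT]
    obtain ⟨M, hM⟩ := tr0_swapDist hF hF w A
    obtain ⟨M', hM'⟩ := tr0_swapDist hF hF w A'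
    rw [this, map_add, mulPow10_add (hM.mono (le_max_left M M')) (hM'.mono (le_max_right M M')),
      h.2, h'.2]
    exact ⟨(h.1.union h'.1).subset (Function.support_add _ _), (finsum_add_distrib h.1 h'.1).symm⟩
  | tmul v u f =>
    set D : Dist₂ V := fun m n => F v n (F u m w) with hD
    have hu : Up2 D := up2_tmul hF hF w v u
    obtain ⟨M, hM⟩ := hF u w
    have h0 : Tr0 M D := fun m n hm => by rw [hD]; beta_reduce; rw [hM m hm, map_zero]
    obtain ⟨K, hK⟩ : ∃ K : ℕ, M ≤ m + K := ⟨(M - m).toNat, by omega⟩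
    obtain ⟨Q, hQ⟩ := hu m (n + l - K)
    have hTq : ∀ q : ℤ × ℕ, T ((v ⊗ₜ u) ⊗ₜ f) q =
        (l.negOnePow * ((-1) ^ q.2 * Ring.choose (l + q.1) q.2) : ℤ) •
          (powerToLaurent f).coeff q.1 • D (m + q.2) (n + l + q.1 - q.2) := by
      intro q
      simp only [hT]
      rw [lTensor_tmul, laurentCoeff_tmul, map_smul, modePair_tmul, ncoeff_ofModes, ncoeff_ofModes]
    set I : Finset (ℤ × ℕ) := (range Q).map ⟨Nat.cast, Nat.cast_injective⟩ ×ˢ range K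
      with hI
    have hsupp : Function.support (T ((v ⊗ₜ u) ⊗ₜ f)) ⊆ I := by
      intro q hq
      rw [Function.mem_support, hTq] at hq
      have h1 : 0 ≤ q.1 := by
        by_contra hc
        rw [coeff_powerToLaurent_of_neg _ (by omega), zero_smul, smul_zero] at hq
        exact hq rfl
      have h2 : q.2 < K := by
        by_contra hc
        rw [h0 _ _ (by omega), smul_zero, smul_zero] at hq
        exact hq rfl
      have h3 : q.1 < Q := by
        by_contra hc
        have := hQ q.2 (K + q.1.toNat - q.2) (by omega)
        rw [show n + l - K + ((K + q.1.toNat - q.2 : ℕ) : ℤ) = n + l + q.1 - q.2 by omega] at this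
        rw [this, smul_zero, smul_zero] at hq
        exact hq rfl
      rw [mem_coe, hI, mem_product, mem_map]
      exact ⟨⟨q.1.toNat, mem_range.2 (by omega), by simpa using h1⟩, mem_range.2 h2⟩
    refine ⟨(finite_toSet I).subset hsupp, ?_⟩
    rw [finsum_eq_sum_of_support_subset _ hsupp, hI, sum_product, sum_map, swapDist_tmul]
    simp only [Function.Embedding.coeFn_mk, hTq, coeff_powerToLaurent_natCast]
    rw [mulPow10_eq (h0.act2 f) l m n hK]
    have hact : ∀ i ∈ range K, act2 f D (m + i) (n + l - i) = ∑ s ∈ range Q, coeff s f •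
          ((-dif : End ℂ (Dist₂ V)) ^ s) D (m + i) (n + l - i) := by
      intro i hi
      rw [mem_range] at hi
      change pwEval _ _ _ _ = _
      rw [pwEval_eq_sum (Q := Q)]
      · rfl
      · intro s hs
        refine dif_pow_apply_eq_zero s fun a b hab => ?_
        have := hQ (i + a) (K - i + b) (by omega)
        rwa [show m + ((i + a : ℕ) : ℤ) = m + i + a by push_cast; ring,
          show n + l - K + ((K - i + b : ℕ) : ℤ) = n + l - i + b by omega] at this
    rw [sum_congr rfl fun i hi => by rw [hact i hi, smul_sum], sum_comm]
    refine sum_congr rfl fun s _ => ?_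
    have h1 := mulPow10_neg_dif_pow h0 s l m n
    have h2 : Tr0 M (((-dif : End ℂ (Dist₂ V)) ^ s) D) := fun m n hm =>
      dif_pow_apply_eq_zero s fun a b _ => h0 _ _ (by omega)
    rw [mulPow10_eq h2 l m n hK, mulPow10_eq h0 (l + s) m n hK] at h1
    have h3 := congrArg (fun x => coeff s f • x) h1
    beta_reduce at h3
    rw [smul_sum, smul_sum, smul_sum] at h3
    refine Eq.trans (sum_congr rfl fun i _ => smul_comm _ _ _) (h3.trans ?_)
    refine sum_congr rfl fun j _ => ?_
    rw [smul_comm (_ : ℤ) (coeff s f), smul_smul, Int.negOnePow_add,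
      Int.negOnePow_def (s : ℤ), add_assoc n l]
    congr 2
    push_cast
    have : ((-1 : ℤ) ^ s) * ((-1 : ℤ) ^ s) = 1 := by rw [← mul_pow]; simp
    simp only [zpow_natCast, Units.val_pow_eq_pow_val, Units.val_neg, Units.val_one]
    linear_combination (↑l.negOnePow * ((-1) ^ j * Ring.choose (l + (s : ℤ)) j)) * this

section

variable {F : 𝕍 B S →ₗ[ℂ] ℤ → End ℂ (𝕍 B S)} (hF : IsVertexMap B S F)
include hF

/-- Weak `𝒮`-locality implies the `𝒮`-Jacobi identity. -/
lemma sJacobi_of_swap {u v : 𝕍 B S} {k : ℕ} {A : (𝕍 B S ⊗[ℂ] 𝕍 B S) ⊗[ℂ] ℂ⟦X⟧}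
    (h : ∀ w, (dif ^ k) (fieldCorr F u v w) = (dif ^ k) (swapDist hF.trunc hF.trunc w A)) :
    SJacobi (ofModes F hF.trunc) u v (lTensor _ powerToLaurent A) := by
  intro w l m n
  obtain ⟨E, hE⟩ := hF.trunc v w
  obtain ⟨M, hM⟩ := tr0_swapDist hF.trunc hF.trunc w A
  obtain ⟨k', hk'⟩ := exists_pole_fieldCorr hF u v
  have h1 : Tr1 E (fieldCorr F u v w) := fun m n hn => by rw [fieldCorr, hE n hn, map_zero]
  have := jacobi_formal (h w) h1 hM l m n
  rw [mulPow10_swapDist hF.trunc] at this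
  simp only [(hk' w).2] at this
  simp only [ncoeff_ofModes]
  exact this

/-- `Y(u, x) 𝟏 ∈ V[[x]]` has constant term `u`. -/
lemma creation_of_isVertexMap (u : 𝕍 B S) :
    (∀ n, 0 ≤ n → F u n (vacuum B S) = 0) ∧ F u (-1) (vacuum B S) = u := by
  induction u using vacuumModule_induction with
  | hvac =>
    exact ⟨fun n hn => by rw [hF.vacuum, if_neg (by omega)], by rw [hF.vacuum, if_pos rfl]⟩
  | hadd u v hu hv =>
    refine ⟨fun n hn => ?_, ?_⟩
    · rw [map_add, Pi.add_apply, LinearMap.add_apply, hu.1 n hn, hv.1 n hn, add_zero]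
    · rw [map_add, Pi.add_apply, LinearMap.add_apply, hu.2, hv.2]
  | hsmul r u hu =>
    refine ⟨fun n hn => ?_, ?_⟩
    · rw [map_smul, Pi.smul_apply, LinearMap.smul_apply, hu.1 n hn, smul_zero]
    · rw [map_smul, Pi.smul_apply, LinearMap.smul_apply, hu.2]
  | hmode l a u ih =>
    obtain ⟨k, A, hA⟩ := exists_swap_mode hF a u
    have h1 : Tr1 0 (modeCorr a fun e => F u e (vacuum B S)) := fun m n hn => by
      rw [modeCorr, ih.1 n hn, smul_zero]
    have h0 : Tr0 0 ((dif ^ k) (modeCorr a fun e => F u e (vacuum B S))) := by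
      rw [hA]
      refine Tr0.dif_pow ?_ k
      exact tr0_swapDist_of hF.trunc trunc_modeFields (fun b m hm => mode_smul_vacuum B S hm b) A
    have key : ∀ n, F (mode l a • u) n (vacuum B S) =
        mulPow01 l 0 n (modeCorr a fun e => F u e (vacuum B S)) := by
      intro n
      rw [assoc_formal h1 h0 l 0 n le_rfl, finsum_eq_single _ 0 fun i hi => by
        rw [Ring.choose_zero_pos ℤ (Nat.pos_of_ne_zero hi), zero_smul], ← hF.mode_smul]
      simp
    refine ⟨fun n hn => ?_, ?_⟩
    · rw [key, mulPow01]
      refine finsum_eq_zero_of_forall_eq_zero fun i => ?_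
      rw [h1 _ _ (by omega), smul_zero]
    · rw [key, mulPow01, finsum_eq_single _ 0 fun i hi => by rw [h1 _ _ (by omega), smul_zero]]
      simp [modeCorr, ih.2]

/-- `Y(a(-1) 𝟏, x) = a(x)`. -/
lemma generator_of_isVertexMap (a : H) (n : ℤ) (w : 𝕍 B S) :
    F (mode (-1) a • vacuum B S) n w = mode n a • w := by
  obtain ⟨N, hN⟩ := vacuumModule_truncation B S a w
  have e1 := congrFun (hF.mode_smul a (-1) (vacuum B S) w) n
  beta_reduce at e1
  have hp : Pole 0 (modeCorr a fun e => F (vacuum B S) e w) := by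
    refine ⟨⟨N, fun m n hm => ?_⟩, 0, fun m n hn => ?_⟩
    · change mode m a • F (vacuum B S) n w = 0
      rw [hF.vacuum]
      split_ifs
      · exact hN m hm
      · exact smul_zero _
    · change mode m a • F (vacuum B S) n w = 0
      rw [hF.vacuum, if_neg (by omega), smul_zero]
  rw [e1, res_eq hp, show ((0 : ℕ) : ℤ) - -1 - 1 = (0 : ℕ) by norm_num, Tay_natCast,
    finsum_eq_single _ n]
  · rw [pow_zero, End.one_apply, modeCorr, hF.vacuum, if_pos (by push_cast; ring)]
    simp
  · intro m hm
    rw [pow_zero, End.one_apply, modeCorr, hF.vacuum, if_neg (by push_cast; omega),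
      smul_zero, smul_zero]

lemma isWeakQuantumVertexAlgebra_ofModes :
    IsWeakQuantumVertexAlgebra (vacuum B S) (ofModes F hF.trunc) where
  vacuum v n := by rw [ncoeff_ofModes, hF.vacuum]
  creation_regular v n hn := by rw [ncoeff_ofModes, (creation_of_isVertexMap hF v).1 n hn]
  creation v := by rw [ncoeff_ofModes, (creation_of_isVertexMap hF v).2]
  jacobi u v := by
    obtain ⟨k, A, hA⟩ := exists_swap hF u v
    exact ⟨_, sJacobi_of_swap hF hA⟩

end

/-! ### Uniqueness -/

section

open VertexOperator

lemma exists_ncoeff_eq_zero (A : VertexOperator ℂ V) (w : V) :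
    ∃ E : ℤ, ∀ e, E ≤ e → ncoeff A e w = 0 :=
  ⟨-HahnSeries.order ((HahnModule.of ℂ).symm (A w)), fun e he =>
    ncoeff_eq_zero_of_lt_order A e w (by omega)⟩

lemma exists_modePair_eq_zero (Y : V →ₗ[ℂ] VertexOperator ℂ V) (w : V)
    (A : (V ⊗[ℂ] V) ⊗[ℂ] LaurentSeries ℂ) :
    ∃ M : ℤ, ∀ m, M ≤ m → ∀ k s, modePair Y k m w (laurentCoeff (V ⊗[ℂ] V) s A) = 0 := by
  induction A using triple_induction with
  | zero => exact ⟨0, fun _ _ _ _ => by rw [map_zero, map_zero]⟩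
  | add A A' h h' =>
    obtain ⟨M, hM⟩ := h
    obtain ⟨M', hM'⟩ := h'
    exact ⟨max M M', fun m hm k s => by
      rw [map_add, map_add, hM m (by omega), hM' m (by omega), add_zero]⟩
  | tmul v u f =>
    obtain ⟨M, hM⟩ := exists_ncoeff_eq_zero (Y u) w
    exact ⟨M, fun m hm k s => by
      rw [laurentCoeff_tmul, map_smul, modePair_tmul, hM m hm, map_zero, smul_zero]⟩

/-- The associativity formula in the `𝒮`-Jacobi identity, for large `m`. -/
lemma SJacobi.assoc {Y : V →ₗ[ℂ] VertexOperator ℂ V} {u v : V}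
    {A : (V ⊗[ℂ] V) ⊗[ℂ] LaurentSeries ℂ} (h : SJacobi Y u v A) (w : V) :
    ∃ M : ℤ, ∀ m, M ≤ m → ∀ l n, (∑ᶠ i : ℕ, ((-1) ^ i * Ring.choose l i : ℤ) •
        ncoeff (Y u) (m + l - i) (ncoeff (Y v) (n + i) w)) =
      ∑ᶠ i : ℕ, (Ring.choose m i) • ncoeff (Y (ncoeff (Y u) (l + i) v)) (m + n - i) w := by
  obtain ⟨M, hM⟩ := exists_modePair_eq_zero Y w A
  refine ⟨M, fun m hm l n => ?_⟩
  rw [← h w l m n, eq_comm, sub_eq_self]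
  refine finsum_eq_zero_of_forall_eq_zero fun q => ?_
  rw [hM _ (by omega), smul_zero]

/-- By associativity, a state-field correspondence is determined by the generating fields. -/
lemma weakQuantumVertexAlgebra_unique {Y Y' : 𝕍 B S →ₗ[ℂ] VertexOperator ℂ (𝕍 B S)}
    (hY : IsWeakQuantumVertexAlgebra (vacuum B S) Y)
    (hY' : IsWeakQuantumVertexAlgebra (vacuum B S) Y')
    (h : ∀ (a : H) n w, ncoeff (Y (mode (-1) a • vacuum B S)) n w = mode n a • w)
    (h' : ∀ (a : H) n w, ncoeff (Y' (mode (-1) a • vacuum B S)) n w = mode n a • w) : Y' = Y := by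
  suffices key : ∀ u n w, ncoeff (Y' u) n w = ncoeff (Y u) n w by
    refine LinearMap.ext fun u => HVertexOperator.coeff_inj ?_
    ext s w
    have := key u (-s - 1) w
    rwa [← VertexOperator.coeff_eq_ncoeff, ← VertexOperator.coeff_eq_ncoeff] at this
  intro u
  induction u using vacuumModule_induction with
  | hvac => intro n w; rw [hY.vacuum, hY'.vacuum]
  | hadd u v hu hv => intro n w; simp [hu, hv]
  | hsmul r u hu => intro n w; simp [hu]
  | hmode l a u ih =>
    obtain ⟨L, hL⟩ := vacuumModule_truncation B S a u
    -- descending induction on `l`: in the associativity formula for `a(-1) 𝟏` and `u`, all terms but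
    -- the first involve `Y(a(l + i) u, x)` with `i > 0`
    suffices key : ∀ j : ℕ, ∀ l, L ≤ l + j → ∀ n w,
        ncoeff (Y' (mode l a • u)) n w = ncoeff (Y (mode l a • u)) n w from
      key (L - l).toNat l (by omega)
    intro j
    induction j with
    | zero => intro l hl n w; simp [hL l (by simpa using hl)]
    | succ j ihj =>
      intro l hl n w
      obtain ⟨A, hA⟩ := hY.jacobi (mode (-1) a • vacuum B S) u
      obtain ⟨A', hA'⟩ := hY'.jacobi (mode (-1) a • vacuum B S) u
      obtain ⟨M, hM⟩ := hA.assoc w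
      obtain ⟨M', hM'⟩ := hA'.assoc w
      have h1 := hM (max M M') (le_max_left _ _) l (n - max M M')
      have h2 := hM' (max M M') (le_max_right _ _) l (n - max M M')
      simp only [h, h', ih] at h1 h2
      rw [h1] at h2
      have hfin : ∀ Y : 𝕍 B S →ₗ[ℂ] VertexOperator ℂ (𝕍 B S), ∀ i : ℕ, (L - l).toNat ≤ i →
          Ring.choose (max M M') i • ncoeff (Y (mode (l + i) a • u))
            (max M M' + (n - max M M') - i) w = 0 := by
        intro Y i hi
        rw [hL _ (by omega), map_zero, map_zero]
        simp
      have hpos : 0 < (L - l).toNat + 1 := by omega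
      rw [finsum_eq_sum_range fun i hi => hfin Y i ((Nat.le_succ _).trans hi),
        finsum_eq_sum_range fun i hi => hfin Y' i ((Nat.le_succ _).trans hi),
        sum_range_succ', sum_range_succ',
        sum_congr rfl fun i _ => by
          rw [← ihj (l + (i + 1 : ℕ)) (by push_cast at hl ⊢; omega)] ] at h2
      simpa using h2.symm

end

/-! ### The weight filtration and translations of a polynomial ring -/

section

variable {ι : Type*}

/-- The weight of a monomial in the variables `X (s, j)`, where `X (s, j)` has weight `j + 1`. -/
def varWeight : (ι × ℕ →₀ ℕ) →+ ℕ := Finsupp.weight fun x : ι × ℕ => x.2 + 1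

lemma varWeight_single (i : ι × ℕ) (b : ℕ) :
    varWeight (Finsupp.single i b) = b * (i.2 + 1) := by simp [varWeight, Finsupp.weight_single]

variable (ι) in
/-- The polynomials of weight at most `k`, where `X (s, j)` has weight `j + 1`. -/
def wFil (k : ℤ) : Submodule ℂ (MvPolynomial (ι × ℕ) ℂ) :=
  MvPolynomial.restrictSupport ℂ {m | (varWeight m : ℤ) ≤ k}

lemma mem_wFil {k : ℤ} {p : MvPolynomial (ι × ℕ) ℂ} :
    p ∈ wFil ι k ↔ ∀ m, p.coeff m ≠ 0 → (varWeight m : ℤ) ≤ k := by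
  rw [wFil, MvPolynomial.mem_restrictSupport_iff]
  exact ⟨fun h m hm => h (MvPolynomial.mem_support_iff.2 hm),
    fun h m hm => h m (MvPolynomial.mem_support_iff.1 hm)⟩

lemma wFil_mono {k l : ℤ} (h : k ≤ l) : wFil ι k ≤ wFil ι l :=
  fun _ hp => mem_wFil.2 fun m hm => (mem_wFil.1 hp m hm).trans h

lemma monomial_mem_wFil {k : ℤ} {m : ι × ℕ →₀ ℕ} (h : (varWeight m : ℤ) ≤ k) (c : ℂ) :
    monomial m c ∈ wFil ι k := by
  classical
  refine mem_wFil.2 fun m' hm' => ?_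
  rw [MvPolynomial.coeff_monomial] at hm'
  split_ifs at hm' with h0
  · rwa [← h0]
  · exact absurd rfl hm'

lemma wFil_induction {k : ℤ} {C : MvPolynomial (ι × ℕ) ℂ → Prop} (zero : C 0)
    (add : ∀ p q, C p → C q → C (p + q)) (smul : ∀ (c : ℂ) p, C p → C (c • p))
    (monomial : ∀ m : ι × ℕ →₀ ℕ, (varWeight m : ℤ) ≤ k → C (monomial m 1))
    {p : MvPolynomial (ι × ℕ) ℂ} (hp : p ∈ wFil ι k) : C p := by
  rw [p.as_sum]
  refine sum_induction _ C add zero fun m hm => ?_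
  have := smul (p.coeff m) _ (monomial m (mem_wFil.1 hp m (MvPolynomial.mem_support_iff.1 hm)))
  rwa [MvPolynomial.smul_monomial, smul_eq_mul, mul_one] at this

lemma mul_mem_wFil {k l : ℤ} {p q : MvPolynomial (ι × ℕ) ℂ} (hp : p ∈ wFil ι k)
    (hq : q ∈ wFil ι l) : p * q ∈ wFil ι (k + l) := by
  refine wFil_induction (C := fun p => p * q ∈ wFil ι (k + l)) ?_ ?_ ?_ ?_ hp
  · rw [zero_mul]; exact zero_mem _
  · intro p p' h h'; rw [add_mul]; exact add_mem h h'
  · intro c p h; rw [smul_mul_assoc]; exact Submodule.smul_mem _ _ h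
  · intro m hm
    refine wFil_induction (C := fun q => _ * q ∈ wFil ι (k + l)) ?_ ?_ ?_ ?_ hq
    · rw [mul_zero]; exact zero_mem _
    · intro p p' h h'; rw [mul_add]; exact add_mem h h'
    · intro c p h; rw [mul_smul_comm]; exact Submodule.smul_mem _ _ h
    · intro m' hm'
      rw [MvPolynomial.monomial_mul]
      exact monomial_mem_wFil (by rw [map_add]; push_cast; omega) _

lemma one_mem_wFil : (1 : MvPolynomial (ι × ℕ) ℂ) ∈ wFil ι 0 := monomial_mem_wFil (by simp) 1

lemma X_mem_wFil (i : ι × ℕ) : (MvPolynomial.X i : MvPolynomial (ι × ℕ) ℂ) ∈ wFil ι (i.2 + 1) :=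
  monomial_mem_wFil (by rw [varWeight_single]; push_cast; omega) 1

lemma wFil_neg {k : ℤ} (hk : k < 0) : wFil ι k = ⊥ := by
  refine (Submodule.eq_bot_iff _).2 fun p hp => MvPolynomial.ext _ _ fun m => ?_
  by_contra h
  have := mem_wFil.1 hp m h
  omega

lemma exists_mem_wFil (p : MvPolynomial (ι × ℕ) ℂ) : ∃ k : ℕ, p ∈ wFil ι k :=
  ⟨p.support.sup varWeight, mem_wFil.2 fun m hm => by
    exact_mod_cast le_sup (f := varWeight) (MvPolynomial.mem_support_iff.2 hm)⟩

variable (ι) in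
/-- The translation `f(z) ↦ f(z + x)`, where `X (s, k)` stands for the `k`-th divided derivative
of a function `f_s`: the algebra homomorphism with
`X (s, k) ↦ ∑ₑ (k + e).choose k X (s, k + e) x ^ e`. -/
def translate : MvPolynomial (ι × ℕ) ℂ →ₐ[ℂ] PowerSeries (MvPolynomial (ι × ℕ) ℂ) :=
  aeval fun i => PowerSeries.mk fun e =>
    ((i.2 + e).choose i.2 : ℂ) • MvPolynomial.X (i.1, i.2 + e)

/-- The coefficient of `x ^ e` in the translation of a polynomial. -/
def transCoeff (e : ℤ) : MvPolynomial (ι × ℕ) ℂ →ₗ[ℂ] MvPolynomial (ι × ℕ) ℂ :=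
  if 0 ≤ e then (coeff e.toNat).restrictScalars ℂ ∘ₗ (translate ι).toLinearMap else 0

lemma transCoeff_natCast (e : ℕ) (p : MvPolynomial (ι × ℕ) ℂ) :
    transCoeff e p = coeff e (translate ι p) := by simp [transCoeff]

lemma transCoeff_of_neg {e : ℤ} (he : e < 0) (p : MvPolynomial (ι × ℕ) ℂ) :
    transCoeff e p = 0 := by simp [transCoeff, he.not_ge]

lemma transCoeff_one (e : ℤ) :
    transCoeff e (1 : MvPolynomial (ι × ℕ) ℂ) = if e = 0 then 1 else 0 := by
  rcases lt_or_ge e 0 with h | h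
  · rw [transCoeff_of_neg h, if_neg h.ne]
  · lift e to ℕ using h
    rw [transCoeff_natCast, map_one, PowerSeries.coeff_one]
    simp

lemma coeff_translate_monomial (m : ι × ℕ →₀ ℕ) (e : ℕ) :
    MvPolynomial.IsWeightedHomogeneous (fun x : ι × ℕ => x.2 + 1)
      (coeff e (translate ι (monomial m 1))) (varWeight m + e) := by
  let C (k : ℕ) (f : PowerSeries (MvPolynomial (ι × ℕ) ℂ)) : Prop := ∀ e : ℕ,
    MvPolynomial.IsWeightedHomogeneous (fun x : ι × ℕ => x.2 + 1) (coeff e f) (k + e)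
  have hmul : ∀ (k l : ℕ) (f g : PowerSeries (MvPolynomial (ι × ℕ) ℂ)),
      C k f → C l g → C (k + l) (f * g) := by
    intro k l f g hf hg e
    rw [PowerSeries.coeff_mul]
    refine MvPolynomial.IsWeightedHomogeneous.sum _ _ _ fun x hx => ?_
    have hx' := HasAntidiagonal.mem_antidiagonal.1 hx
    rw [← hx', show k + l + (x.1 + x.2) = k + x.1 + (l + x.2) by ring]
    exact (hf x.1).mul (hg x.2)
  have hone : C 0 1 := by
    intro e
    rw [PowerSeries.coeff_one]
    split_ifs with h
    · rw [h]; exact MvPolynomial.isWeightedHomogeneous_one _ _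
    · exact MvPolynomial.isWeightedHomogeneous_zero _ _ _
  have hX : ∀ i : ι × ℕ, C (i.2 + 1) (translate ι (MvPolynomial.X i)) := by
    intro i e
    rw [translate, aeval_X, coeff_mk, MvPolynomial.smul_eq_C_mul,
      show i.2 + 1 + e = 0 + (i.2 + e + 1) by ring]
    exact (MvPolynomial.isWeightedHomogeneous_C _ _).mul
      (MvPolynomial.isWeightedHomogeneous_X _ _ (i.1, i.2 + e))
  revert e
  change C _ _
  induction m using Finsupp.induction_linear with
  | zero => simpa using hone
  | add m m' h h' =>
    rw [show monomial (m + m') (1 : ℂ) = monomial m 1 * monomial m' 1 by simp, map_mul, map_add]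
    exact hmul _ _ _ _ h h'
  | single i b =>
    rw [← MvPolynomial.X_pow_eq_monomial, map_pow, varWeight_single]
    induction b with
    | zero => simpa using hone
    | succ b ih =>
      rw [pow_succ, add_one_mul]
      exact hmul _ _ _ _ ih (hX i)

lemma isWeightedHomogeneous_transCoeff (m : ι × ℕ →₀ ℕ) {e : ℤ} {m' : ι × ℕ →₀ ℕ}
    (h : (transCoeff e (monomial m 1)).coeff m' ≠ 0) :
    (varWeight m' : ℤ) = varWeight m + e := by
  rcases lt_or_ge e 0 with he | he
  · rw [transCoeff_of_neg he] at h; exact absurd rfl h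
  · lift e to ℕ using he
    rw [transCoeff_natCast] at h
    exact_mod_cast coeff_translate_monomial m e h

lemma transCoeff_mem {k : ℤ} {p : MvPolynomial (ι × ℕ) ℂ} (hp : p ∈ wFil ι k) (e : ℤ) :
    transCoeff e p ∈ wFil ι (k + e) := by
  rcases lt_or_ge e 0 with h | h
  · rw [transCoeff_of_neg h]; exact zero_mem _
  · lift e to ℕ using h
    refine wFil_induction (C := fun p => transCoeff _ p ∈ wFil ι (k + e)) ?_ ?_ ?_ ?_ hp
    · rw [map_zero]; exact zero_mem _
    · intro p p' h h'; rw [map_add]; exact add_mem h h'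
    · intro c p h; rw [map_smul]; exact Submodule.smul_mem _ _ h
    · intro m hm
      refine mem_wFil.2 fun m' h => ?_
      have := isWeightedHomogeneous_transCoeff m h
      omega

lemma transCoeff_X_mul (s : ι) (j : ℕ) (E : ℤ) (p : MvPolynomial (ι × ℕ) ℂ) {Q : ℕ} (hj : j ≤ Q)
    (hQ : E + j < Q) : transCoeff E (MvPolynomial.X (s, j) * p) =
      ∑ q ∈ range Q, (q.choose j : ℂ) • (MvPolynomial.X (s, q) * transCoeff (E + j - q) p) := by
  obtain ⟨Q, rfl⟩ := Nat.exists_eq_add_of_le hj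
  rw [sum_range_add, sum_eq_zero, zero_add]
  swap
  · intro q hq
    rw [Nat.choose_eq_zero_of_lt (mem_range.1 hq), Nat.cast_zero, zero_smul]
  rcases lt_or_ge E 0 with h | h
  · rw [transCoeff_of_neg h, sum_eq_zero]
    intro q _
    rw [transCoeff_of_neg (by push_cast; omega), mul_zero, smul_zero]
  · lift E to ℕ using h
    rw [transCoeff_natCast, map_mul, PowerSeries.coeff_mul,
      Finset.Nat.sum_antidiagonal_eq_sum_range_succ_mk]
    rw [← sum_subset (range_subset_range.2 (show E + 1 ≤ Q by push_cast at hQ; omega))]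
    · refine sum_congr rfl fun q hq => ?_
      have hq' := mem_range.1 hq
      rw [translate, aeval_X, coeff_mk, smul_mul_assoc,
        show (E + j - (j + q : ℕ) : ℤ) = ((E - q : ℕ) : ℤ) by omega, transCoeff_natCast]
      rfl
    · intro q _ hq
      rw [transCoeff_of_neg (by rw [mem_range] at hq; push_cast; omega), mul_zero, smul_zero]

/-- The coefficient of `x ^ E z ^ (-1-j)` in the associativity relation
`(z + x) ^ m Y(Y(a, z) u, x) = (z + x) ^ m Y(a, z + x) Y(u, x)` for symbols. -/
lemma sum_choose_transCoeff (s : ι) (j m : ℕ) (E : ℤ) (p : MvPolynomial (ι × ℕ) ℂ) {Q : ℕ}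
    (hj : j ≤ Q) (hQ : E + j < Q) :
    ∑ i ∈ range (j + 1), (m.choose i : ℂ) • transCoeff (E + i) (MvPolynomial.X (s, j - i) * p) =
      ∑ q ∈ range Q, ((m + q).choose j : ℂ) •
        (MvPolynomial.X (s, q) * transCoeff (E + j - q) p) := by
  have h : ∀ i ∈ range (j + 1), (m.choose i : ℂ) •
        transCoeff (E + i) (MvPolynomial.X (s, j - i) * p) =
      ∑ q ∈ range Q, ((m.choose i * q.choose (j - i) : ℕ) : ℂ) •
        (MvPolynomial.X (s, q) * transCoeff (E + j - q) p) := by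
    intro i hi
    have hi' := mem_range.1 hi
    rw [transCoeff_X_mul s (j - i) (E + i) p (Q := Q) (by omega) (by omega), smul_sum]
    refine sum_congr rfl fun q _ => ?_
    rw [smul_smul, Nat.cast_mul, show E + i + (j - i : ℕ) - q = E + j - (q : ℤ) by omega]
  rw [sum_congr rfl h, sum_comm]
  refine sum_congr rfl fun q _ => ?_
  rw [← sum_smul, Nat.add_choose_eq, Finset.Nat.sum_antidiagonal_eq_sum_range_succ_mk, Nat.cast_sum]

end

/-! ### Symbols of vectors of `V(H, 𝒮)` -/

section

variable {ι : Type*} [Fintype ι] (b : Basis ι ℂ H) (B S)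

/-- The vector `b_{s₁}(-1-j₁) ⋯ b_{sᵣ}(-1-jᵣ) 𝟏` for the list `(s₁, j₁), …, (sᵣ, jᵣ)`. -/
def basisWord (l : List (ι × ℕ)) : 𝕍 B S :=
  word (l.map fun i => (b i.1, -1 - (i.2 : ℤ))) • vacuum B S

/-- The weight of a word. -/
def listWeight (l : List (ι × ℕ)) : ℕ := (l.map fun i => i.2 + 1).sum

lemma listWeight_cons (i : ι × ℕ) (l : List (ι × ℕ)) :
    listWeight (i :: l) = i.2 + 1 + listWeight l := by simp [listWeight]

lemma basisWord_cons (i : ι × ℕ) (l : List (ι × ℕ)) :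
    basisWord B S b (i :: l) = mode (-1 - i.2) (b i.1) • basisWord B S b l := by
  rw [basisWord, List.map_cons, word_cons, mul_smul]; rfl

lemma basisWord_nil : basisWord B S b [] = vacuum B S := by simp [basisWord, word]

lemma vacuum_mem_filtration : vacuum B S ∈ filtration B S 0 :=
  Submodule.subset_span ⟨[], by simp, by simp [wordDegree], by simp [word]⟩

lemma basisWord_mem (l : List (ι × ℕ)) : basisWord B S b l ∈ filtration B S (listWeight l) := by
  induction l with
  | nil => exact basisWord_nil B S b ▸ vacuum_mem_filtration B S
  | cons i l ih =>
    rw [basisWord_cons, listWeight_cons]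
    exact filtration_mono B S (by push_cast; omega) (mode_smul_mem B S (-1 - i.2) _ ih)

lemma listWeight_perm {l l' : List (ι × ℕ)} (h : l.Perm l') : listWeight l = listWeight l' :=
  (h.map _).sum_eq

variable (hS : ∀ t, powerCoeff (H ⊗[ℂ] H) 0 (S t) = t)
include hS

lemma basisWord_perm {l l' : List (ι × ℕ)} (h : l.Perm l') :
    basisWord B S b l - basisWord B S b l' ∈ filtration B S (listWeight l - 1) := by
  induction h with
  | nil => rw [sub_self]; exact zero_mem _
  | cons i h ih =>
    rw [basisWord_cons, basisWord_cons, ← smul_sub, listWeight_cons]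
    exact filtration_mono B S (by push_cast; omega) (mode_smul_mem B S (-1 - i.2) _ ih)
  | swap i j l =>
    rw [basisWord_cons, basisWord_cons, basisWord_cons, basisWord_cons, listWeight_cons,
      listWeight_cons]
    exact filtration_mono B S (by push_cast; omega)
      (mode_comm_mem B S hS (by omega) (by omega) _ _ (basisWord_mem B S b l))
  | trans h h' ih ih' =>
    rw [← listWeight_perm h] at ih'
    have := add_mem ih ih'
    rwa [sub_add_sub_cancel] at this

omit hS

/-- The linear map sending the monomial `∏ X (s, j)` to `∏ b_s(-1-j) 𝟏`, for some ordering of the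
factors. -/
def fromSymbol : MvPolynomial (ι × ℕ) ℂ →ₗ[ℂ] 𝕍 B S :=
  (MvPolynomial.basisMonomials (ι × ℕ) ℂ).constr ℂ fun m =>
    basisWord B S b (Finsupp.toMultiset m).toList

lemma fromSymbol_monomial (m : ι × ℕ →₀ ℕ) : fromSymbol B S b (monomial m 1) =
    basisWord B S b (Finsupp.toMultiset m).toList := by
  have := (MvPolynomial.basisMonomials (ι × ℕ) ℂ).constr_basis ℂ
    (fun m => basisWord B S b (Finsupp.toMultiset m).toList) m
  rwa [MvPolynomial.coe_basisMonomials] at this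

lemma listWeight_toList (m : ι × ℕ →₀ ℕ) :
    listWeight (Finsupp.toMultiset m).toList = varWeight m := by
  have h : ∀ s : Multiset (ι × ℕ), listWeight s.toList = (s.map fun i => i.2 + 1).sum := by
    intro s
    conv_rhs => rw [← Multiset.coe_toList s]
    rw [Multiset.map_coe, Multiset.sum_coe]; rfl
  rw [h]
  induction m using Finsupp.induction_linear with
  | zero => simp
  | add m m' h h' => rw [map_add, map_add, Multiset.map_add, Multiset.sum_add, h, h']
  | single i b =>
    rw [Finsupp.toMultiset_single, varWeight_single, Multiset.map_nsmul, Multiset.sum_nsmul]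
    simp

lemma fromSymbol_one : fromSymbol B S b 1 = vacuum B S := by
  rw [show (1 : MvPolynomial (ι × ℕ) ℂ) = monomial 0 1 from rfl, fromSymbol_monomial]
  simp [basisWord_nil]

lemma fromSymbol_mem {k : ℤ} {p : MvPolynomial (ι × ℕ) ℂ} (hp : p ∈ wFil ι k) :
    fromSymbol B S b p ∈ filtration B S k := by
  refine wFil_induction (C := fun p => fromSymbol B S b p ∈ filtration B S k) ?_ ?_ ?_ ?_ hp
  · rw [map_zero]; exact zero_mem _
  · intro p p' h h'; rw [map_add]; exact add_mem h h'
  · intro c p h; rw [map_smul]; exact Submodule.smul_mem _ _ h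
  · intro m hm
    rw [fromSymbol_monomial]
    exact filtration_mono B S (by rwa [listWeight_toList]) (basisWord_mem B S b _)

include hS

lemma mode_smul_fromSymbol (s : ι) (j : ℕ) {k : ℤ} {p : MvPolynomial (ι × ℕ) ℂ}
    (hp : p ∈ wFil ι k) :
    mode (-1 - j) (b s) • fromSymbol B S b p - fromSymbol B S b (MvPolynomial.X (s, j) * p) ∈
      filtration B S (k + j) := by
  refine wFil_induction (C := fun p => mode (-1 - j) (b s) • fromSymbol B S b p -
    fromSymbol B S b (MvPolynomial.X (s, j) * p) ∈ filtration B S (k + j)) ?_ ?_ ?_ ?_ hp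
  · rw [map_zero, smul_zero, mul_zero, map_zero, sub_zero]; exact zero_mem _
  · intro p p' h h'
    rw [map_add, smul_add, mul_add, map_add, add_sub_add_comm]; exact add_mem h h'
  · intro c p h
    rw [map_smul, smul_comm, mul_smul_comm, map_smul, ← smul_sub]
    exact Submodule.smul_mem _ _ h
  · intro m hm
    rw [MvPolynomial.X, MvPolynomial.monomial_mul, one_mul, fromSymbol_monomial,
      fromSymbol_monomial, ← basisWord_cons B S b (s, j)]
    refine filtration_mono B S ?_ (basisWord_perm B S b hS ?_)
    · rw [listWeight_cons, listWeight_toList]; push_cast; omega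
    · rw [← Multiset.coe_eq_coe, ← Multiset.cons_coe, Multiset.coe_toList, Multiset.coe_toList,
        map_add, Finsupp.toMultiset_single, one_smul, Multiset.singleton_add]

/-- Every vector of `V(H, 𝒮)[k]` has a symbol of weight at most `k`. -/
lemma exists_symbol {k : ℤ} {x : 𝕍 B S} (hx : x ∈ filtration B S k) :
    ∃ p ∈ wFil ι k, fromSymbol B S b p = x := by
  suffices key : ∀ N : ℕ, ∀ k : ℤ, k < N → ∀ x ∈ filtration B S k,
      x ∈ (wFil ι k).map (fromSymbol B S b) from key (k + 1).toNat k (by omega) x hx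
  clear hx x k
  intro N
  induction N with
  | zero =>
    intro k hk x hx
    rw [filtration_neg B S (by exact_mod_cast hk), Submodule.mem_bot] at hx
    rw [hx]; exact zero_mem _
  | succ N ih =>
    intro k hk x hx
    push_cast at hk
    refine Submodule.span_le.2 ?_ hx
    rintro _ ⟨l, hl, hle, rfl⟩
    suffices h : ∀ l : List (H × ℤ), (∀ p ∈ l, p.2 < 0) → -wordDegree l ≤ k →
        word l • vacuum B S ∈ (wFil ι (-wordDegree l)).map (fromSymbol B S b) from
      Submodule.map_mono (wFil_mono hle) (h l hl hle)
    clear l hl hle hx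
    intro l hl hle
    induction l with
    | nil =>
      refine ⟨1, wFil_mono (by simp [wordDegree]) one_mem_wFil, ?_⟩
      rw [fromSymbol_one]; simp [word]
    | cons q l ihl =>
      obtain ⟨a, n⟩ := q
      have hn : n < 0 := hl (a, n) (by simp)
      have hl' : ∀ p ∈ l, p.2 < 0 := fun p hp => hl p (by simp [hp])
      have h0 := wordDegree_nonpos hl'
      rw [wordDegree_cons] at hle ⊢
      simp only at hle ⊢
      obtain ⟨p, hp, hpx⟩ := ihl hl' (by omega)
      obtain ⟨j, rfl⟩ : ∃ j : ℕ, n = -1 - j := ⟨(-1 - n).toNat, by omega⟩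
      rw [word_cons, mul_smul, ← hpx, ← b.sum_repr a, map_sum, sum_smul]
      refine sum_mem fun s _ => ?_
      rw [map_smul, smul_assoc]
      refine Submodule.smul_mem _ _ ?_
      have h1 := ih _ (by omega) _ (mode_smul_fromSymbol B S b hS s j hp)
      rw [← sub_add_cancel (mode (-1 - (j : ℤ)) (b s) • fromSymbol B S b p)]
      refine add_mem (Submodule.map_mono (wFil_mono (by omega)) h1) ⟨_, ?_, rfl⟩
      exact wFil_mono (by push_cast; omega) (mul_mem_wFil (X_mem_wFil _) hp)

omit hS

lemma exists_mem_filtration (x : 𝕍 B S) : ∃ k : ℕ, x ∈ filtration B S k := by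
  induction x using vacuumModule_induction with
  | hvac => exact ⟨0, vacuum_mem_filtration B S⟩
  | hmode n a u h =>
    obtain ⟨k, hk⟩ := h
    exact ⟨(k - n).toNat, filtration_mono B S (by omega) (mode_smul_mem B S n a hk)⟩
  | hadd u v h h' =>
    obtain ⟨k, hk⟩ := h
    obtain ⟨l, hl⟩ := h'
    exact ⟨max k l, add_mem (filtration_mono B S (by simp) hk) (filtration_mono B S (by simp) hl)⟩
  | hsmul r u h =>
    obtain ⟨k, hk⟩ := h
    exact ⟨k, Submodule.smul_mem _ _ hk⟩

lemma fromSymbol_surjective (hS : ∀ t, powerCoeff (H ⊗[ℂ] H) 0 (S t) = t) :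
    Function.Surjective (fromSymbol B S b) := by
  intro x
  obtain ⟨k, hk⟩ := exists_mem_filtration B S x
  obtain ⟨p, _, hp⟩ := exists_symbol B S b hS hk
  exact ⟨p, hp⟩

end

section

variable {ι : Type*} [Fintype ι] (b : Basis ι ℂ H)

/-- The element `b_s ⊗ t ^ (-1-j)`. -/
def negMode (i : ι × ℕ) : NegativeModes H :=
  b i.1 ⊗ₜ ⟨LaurentPolynomial.T (-1 - (i.2 : ℤ)), by
    refine AddMonoidAlgebra.mem_supported'.2 fun m hm => ?_
    rw [LaurentPolynomial.T_apply, if_neg]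
    rintro rfl
    exact hm (show -1 - (i.2 : ℤ) < 0 by omega)⟩

/-- The isomorphism of the polynomial ring with the symmetric algebra `S(H ⊗ t⁻¹ ℂ[t⁻¹])`. -/
def toSym : MvPolynomial (ι × ℕ) ℂ →ₐ[ℂ] SymmetricAlgebra ℂ (NegativeModes H) :=
  aeval fun i => SymmetricAlgebra.ι ℂ _ (negMode b i)

lemma toSym_injective : Function.Injective (toSym b) := by
  let g : NegativeModes H →ₗ[ℂ] MvPolynomial (ι × ℕ) ℂ :=
    TensorProduct.lift <| LinearMap.flip <| (Finsupp.linearCombination ℂ fun n : ℤ =>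
        b.constr ℂ fun s => (MvPolynomial.X (s, (-1 - n).toNat) : MvPolynomial (ι × ℕ) ℂ)) ∘ₗ
      (AddMonoidAlgebra.coeffLinearEquiv ℂ).toLinearMap ∘ₗ Submodule.subtype _
  have hg : ∀ i, g (negMode b i) = MvPolynomial.X i := by
    rintro ⟨s, j⟩
    have h : AddMonoidAlgebra.coeffLinearEquiv ℂ
        (LaurentPolynomial.T (-1 - (j : ℤ)) : ℂ[T;T⁻¹]) = Finsupp.single (-1 - (j : ℤ)) 1 := rfl
    simp only [g, negMode, TensorProduct.lift.tmul, LinearMap.flip_apply, comp_apply,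
      Submodule.subtype_apply, LinearEquiv.coe_coe, h, Finsupp.linearCombination_single, one_smul,
      Basis.constr_basis]
    rw [show (-1 - (-1 - (j : ℤ))).toNat = j by omega]
  refine Function.LeftInverse.injective (g := SymmetricAlgebra.lift g) fun p => ?_
  have : (SymmetricAlgebra.lift g).comp (toSym b) = AlgHom.id ℂ _ := by
    refine MvPolynomial.algHom_ext fun i => ?_
    simp [toSym, hg]
  exact DFunLike.congr_fun this p

variable (B S)

lemma grAction_negMode (i : ι × ℕ) : grAction B S (negMode b i) = grMode B S (i.2 + 1) (b i.1) := by
  have h : AddMonoidAlgebra.coeffLinearEquiv ℂ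
      (LaurentPolynomial.T (-1 - (i.2 : ℤ)) : ℂ[T;T⁻¹]) = Finsupp.single (-1 - (i.2 : ℤ)) 1 := rfl
  simp only [grAction, negMode, TensorProduct.lift.tmul, LinearMap.flip_apply, comp_apply,
    Submodule.subtype_apply, LinearEquiv.coe_coe, h, Finsupp.linearCombination_single, one_smul]
  rw [show (-(-1 - (i.2 : ℤ))).toNat = i.2 + 1 by omega]

/-- The class of `𝟏` in `gr V(H, 𝒮)`. -/
def grVacuum : Gr B S :=
  lof ℂ ℕ (fun k => GrPiece B S k) 0 (Submodule.Quotient.mk ⟨vacuum B S, vacuum_mem_filtration B S⟩)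

variable (hS : ∀ t, powerCoeff (H ⊗[ℂ] H) 0 (S t) = t)

lemma symAction_word (l : List (ι × ℕ)) :
    symAction B S hS (toSym b (l.map MvPolynomial.X).prod) (grVacuum B S) =
      lof ℂ ℕ (fun k => GrPiece B S k) (listWeight l)
        (Submodule.Quotient.mk ⟨basisWord B S b l, basisWord_mem B S b l⟩) := by
  induction l with
  | nil =>
    rw [List.map_nil, List.prod_nil, map_one, map_one, End.one_apply, grVacuum]
    refine lof_congr B S (by simp [listWeight]) _ _ ?_
    rw [basisWord_nil, sub_self]
    exact zero_mem _
  | cons i l ih =>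
    have hm : mode (-((i.2 + 1 : ℕ) : ℤ)) (b i.1) • basisWord B S b l ∈
        filtration B S ((listWeight l + (i.2 + 1) : ℕ) : ℤ) :=
      filtration_mono B S (by push_cast; omega) (mode_smul_mem B S _ _ (basisWord_mem B S b l))
    rw [List.map_cons, List.prod_cons, map_mul, map_mul, End.mul_apply, ih, toSym,
      aeval_X, symAction_ι, grAction_negMode,
      grMode_lof B S (i.2 + 1) (b i.1) (listWeight l) ⟨_, basisWord_mem B S b l⟩ hm]
    refine lof_congr B S (by rw [listWeight_cons]; omega) _ _ ?_
    rw [basisWord_cons, show -((i.2 + 1 : ℕ) : ℤ) = -1 - i.2 by push_cast; omega, sub_self]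
    exact zero_mem _

lemma monomial_eq_prod (m : ι × ℕ →₀ ℕ) : (monomial m 1 : MvPolynomial (ι × ℕ) ℂ) =
    ((Finsupp.toMultiset m).toList.map MvPolynomial.X).prod := by
  have h : ((Finsupp.toMultiset m).toList.map (MvPolynomial.X (R := ℂ))).prod =
      ((Finsupp.toMultiset m).map MvPolynomial.X).prod := by
    conv_rhs => rw [← Multiset.coe_toList (Finsupp.toMultiset m)]
    rw [Multiset.map_coe, Multiset.prod_coe]
  rw [h, MvPolynomial.monomial_eq, MvPolynomial.C_1, one_mul, Finsupp.toMultiset_map,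
    Finsupp.prod_toMultiset]
  rw [Finsupp.prod_mapDomain_index_inj (MvPolynomial.X_injective)]

/-- The class of a vector in `V[k] / V[k-1]` depends on the terms of weight `k` of its symbol
only, and is obtained from `𝟏` by the action of these terms. -/
lemma exists_lof_fromSymbol {k : ℕ} {p : MvPolynomial (ι × ℕ) ℂ} (hp : p ∈ wFil ι k) :
    ∃ q, p - q ∈ wFil ι (k - 1) ∧ ∀ h, lof ℂ ℕ (fun k => GrPiece B S k) k
      (Submodule.Quotient.mk ⟨fromSymbol B S b p, h⟩) =
        symAction B S hS (toSym b q) (grVacuum B S) := by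
  suffices h : ∃ q, p - q ∈ wFil ι (k - 1) ∧ ∃ h, lof ℂ ℕ (fun k => GrPiece B S k) k
      (Submodule.Quotient.mk ⟨fromSymbol B S b p, h⟩) =
        symAction B S hS (toSym b q) (grVacuum B S) by
    obtain ⟨q, hq, h, h'⟩ := h
    exact ⟨q, hq, fun _ => h'⟩
  refine wFil_induction (C := fun p => ∃ q, p - q ∈ wFil ι (k - 1) ∧ ∃ h,
    lof ℂ ℕ (fun k => GrPiece B S k) k (Submodule.Quotient.mk ⟨fromSymbol B S b p, h⟩) =
        symAction B S hS (toSym b q) (grVacuum B S)) ?_ ?_ ?_ ?_ hp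
  · refine ⟨0, by simp, by simp, ?_⟩
    have : (⟨fromSymbol B S b (0 : MvPolynomial (ι × ℕ) ℂ), by simp⟩ : filtration B S k) = 0 :=
      Subtype.ext (map_zero _)
    rw [this, Submodule.Quotient.mk_zero, map_zero, map_zero, map_zero, LinearMap.zero_apply]
  · rintro p p' ⟨q, hq, h, e⟩ ⟨q', hq', h', e'⟩
    refine ⟨q + q', by rw [add_sub_add_comm]; exact add_mem hq hq',
      by rw [map_add]; exact add_mem h h', ?_⟩
    rw [map_add (toSym b), map_add (symAction B S hS), LinearMap.add_apply, ← e, ← e',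
      ← map_add (lof ℂ ℕ (fun k => GrPiece B S k) k), ← Submodule.Quotient.mk_add]
    congr 3
    exact map_add _ _ _
  · rintro c p ⟨q, hq, h, e⟩
    refine ⟨c • q, by rw [← smul_sub]; exact Submodule.smul_mem _ _ hq,
      by rw [map_smul]; exact Submodule.smul_mem _ _ h, ?_⟩
    rw [map_smul (toSym b), map_smul (symAction B S hS), LinearMap.smul_apply, ← e,
      ← map_smul (lof ℂ ℕ (fun k => GrPiece B S k) k), ← Submodule.Quotient.mk_smul]
    congr 3
    exact map_smul _ _ _
  · intro m hm
    have hmem := fromSymbol_mem B S b (monomial_mem_wFil hm 1)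
    rcases eq_or_lt_of_le hm with h | h
    · refine ⟨monomial m 1, by rw [sub_self]; exact zero_mem _, hmem, ?_⟩
      rw [congrArg (toSym b) (monomial_eq_prod m), symAction_word]
      refine lof_congr B S ?_ _ _ ?_
      · rw [listWeight_toList]; exact_mod_cast h.symm
      · rw [fromSymbol_monomial, sub_self]; exact zero_mem _
    · refine ⟨0, by rw [sub_zero]; exact monomial_mem_wFil (by omega) 1, hmem, ?_⟩
      rw [map_zero, map_zero, LinearMap.zero_apply, ← map_zero (lof ℂ ℕ _ k)]
      congr 1
      refine (Submodule.Quotient.mk_eq_zero _).2 ?_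
      exact fromSymbol_mem B S b (monomial_mem_wFil (by omega) 1)

include b in
lemma exists_symAction_grVacuum (y : Gr B S) : ∃ r, y = symAction B S hS r (grVacuum B S) := by
  induction y using DirectSum.induction_on with
  | zero => exact ⟨0, by rw [map_zero, LinearMap.zero_apply]⟩
  | add y y' h h' =>
    obtain ⟨r, rfl⟩ := h
    obtain ⟨r', rfl⟩ := h'
    exact ⟨r + r', by rw [map_add, LinearMap.add_apply]⟩
  | of k y =>
    obtain ⟨⟨x, hx⟩, rfl⟩ := Submodule.Quotient.mk_surjective _ y
    obtain ⟨p, hp, rfl⟩ := exists_symbol B S b hS hx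
    obtain ⟨q, -, h⟩ := exists_lof_fromSymbol B S b hS hp
    exact ⟨_, h hx⟩

variable {B S hS}

include b in
/-- If `gr V(H, 𝒮)` is free over the symmetric algebra then the generator `𝟏` is a basis, unless
`V(H, 𝒮) = 0`. -/
lemma eq_zero_of_symAction_grVacuum (hPBW : IsPBWType B S hS) [Nontrivial (𝕍 B S)]
    {r : SymmetricAlgebra ℂ (NegativeModes H)} (hr : symAction B S hS r (grVacuum B S) = 0) :
    r = 0 := by
  have hr' : ∀ y, symAction B S hS r y = 0 := by
    intro y
    obtain ⟨r', rfl⟩ := exists_symAction_grVacuum B S b hS y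
    rw [← End.mul_apply, ← map_mul, mul_comm, map_mul, End.mul_apply, hr, map_zero]
  let _ := grModule B S hS
  have : Free (SymmetricAlgebra ℂ (NegativeModes H)) (Gr B S) := hPBW
  have hnt : Nontrivial (Gr B S) := by
    by_contra h
    rw [not_nontrivial_iff_subsingleton] at h
    have hk : ∀ k : ℕ, filtration B S k ≤ filtration B S (k - 1) := by
      intro k x hx
      have h0 : lof ℂ ℕ (fun k => GrPiece B S k) k (Submodule.Quotient.mk ⟨x, hx⟩) =
        lof ℂ ℕ (fun k => GrPiece B S k) k 0 := Subsingleton.elim _ _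
      have h1 := DirectSum.of_injective (β := fun k => GrPiece B S k) k h0
      exact (Submodule.Quotient.mk_eq_zero
        ((filtration B S (k - 1)).submoduleOf (filtration B S k))).1 h1
    have hbot : ∀ k : ℕ, filtration B S k = ⊥ := by
      intro k
      induction k with
      | zero =>
        refine le_bot_iff.1 ((hk 0).trans ?_)
        rw [filtration_neg B S (by simp)]
      | succ k ih =>
        refine le_bot_iff.1 ((hk _).trans ?_)
        rw [← ih]
        exact filtration_mono B S (by push_cast; omega)
    obtain ⟨x, y, hxy⟩ := exists_pair_ne (𝕍 B S)
    refine hxy ?_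
    have hz : ∀ x : 𝕍 B S, x = 0 := by
      intro x
      obtain ⟨k, hx⟩ := exists_mem_filtration B S x
      rwa [hbot, Submodule.mem_bot] at hx
    rw [hz x, hz y]
  let c := Free.chooseBasis (SymmetricAlgebra ℂ (NegativeModes H)) (Gr B S)
  obtain ⟨i⟩ : Nonempty (Free.ChooseBasisIndex (SymmetricAlgebra ℂ (NegativeModes H))
    (Gr B S)) := c.index_nonempty
  have h0 : r • c i = 0 := hr' _
  have h1 := congrArg (fun y => c.repr y i) h0
  simpa using h1

lemma fromSymbol_mem_iff (hPBW : IsPBWType B S hS) [Nontrivial (𝕍 B S)] {k : ℤ}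
    {p : MvPolynomial (ι × ℕ) ℂ} : fromSymbol B S b p ∈ filtration B S k ↔ p ∈ wFil ι k := by
  refine ⟨fun h => ?_, fromSymbol_mem B S b⟩
  obtain ⟨l, hl⟩ := exists_mem_wFil p
  rcases le_or_gt (l : ℤ) k with hk | hk
  · exact wFil_mono hk hl
  suffices key : ∀ d : ℕ, ∀ i : ℤ, -1 ≤ i → k ≤ i → i = l - d → p ∈ wFil ι i by
    rcases lt_or_ge k (-1) with h1 | h1
    · have h2 := key (l + 1) (-1) le_rfl (by omega) (by push_cast; omega)
      rw [wFil_neg (by omega), Submodule.mem_bot] at h2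
      rw [h2]; exact zero_mem _
    · exact key (l - k).toNat k h1 le_rfl (by omega)
  intro d
  induction d with
  | zero => intro i _ _ hi; exact wFil_mono (by push_cast at hi; omega) hl
  | succ d ih =>
    intro i hi hki hid
    push_cast at hid
    obtain ⟨j, rfl⟩ : ∃ j : ℕ, i = j - 1 := ⟨(i + 1).toNat, by omega⟩
    have hj : p ∈ wFil ι j := ih j (by omega) (by omega) (by omega)
    obtain ⟨q, hq, h'⟩ := exists_lof_fromSymbol B S b hS hj
    have h0 := h' (fromSymbol_mem B S b hj)
    have hz : toSym b q = 0 := by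
      refine eq_zero_of_symAction_grVacuum b hPBW (h0.symm.trans ?_)
      rw [← map_zero (lof ℂ ℕ _ j)]
      congr 1
      exact (Submodule.Quotient.mk_eq_zero _).2 (filtration_mono B S hki h)
    rw [(map_eq_zero_iff _ (toSym_injective b)).1 hz, sub_zero] at hq
    exact hq

lemma fromSymbol_injective (hPBW : IsPBWType B S hS) [Nontrivial (𝕍 B S)] :
    Function.Injective (fromSymbol B S b) := by
  rw [injective_iff_map_eq_zero]
  intro p hp
  have h : p ∈ wFil ι (-1) := by
    rw [← fromSymbol_mem_iff b hPBW, hp]; exact zero_mem _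
  rwa [wFil_neg (by omega), Submodule.mem_bot] at h

end

/-! ### Symbols of products of fields -/

section

open VertexOperator

variable {ι : Type*} [Fintype ι] (b : Basis ι ℂ H)

lemma neg_one_pow_mul_choose {m j q : ℕ} (hj : j ≤ m) :
    ((-1) ^ (m - j + q) * Ring.choose (-1 - (j : ℤ)) (m - j + q) : ℤ) = ((m + q).choose j : ℕ) := by
  rw [show (-1 - (j : ℤ)) = -((j + 1 : ℕ) : ℤ) by push_cast; ring, Ring.choose_neg,
    show ((j + 1 : ℕ) : ℤ) + (m - j + q : ℕ) - 1 = ((m + q : ℕ) : ℤ) by omega, Ring.choose_natCast,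
    Units.smul_def, Int.negOnePow_def, zpow_natCast, smul_eq_mul, Units.val_pow_eq_pow_val,
    Units.val_neg, Units.val_one, ← mul_assoc, ← mul_pow, neg_one_mul, neg_neg, one_pow, one_mul]
  exact_mod_cast Nat.choose_symm_of_eq_add (by omega)

variable {Y : 𝕍 B S →ₗ[ℂ] VertexOperator ℂ (𝕍 B S)} (hY : IsWeakQuantumVertexAlgebra (vacuum B S) Y)
  (hgen : ∀ (a : H) n w, ncoeff (Y (mode (-1) a • vacuum B S)) n w = mode n a • w)
  (hS : ∀ t, powerCoeff (H ⊗[ℂ] H) 0 (S t) = t)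
include hY hgen hS

omit hY hgen hS in
lemma ncoeff_sub (A A' : VertexOperator ℂ (𝕍 B S)) (n : ℤ) :
    ncoeff (A - A') n = ncoeff A n - ncoeff A' n := rfl

/-- If `p` and `q` are symbols of `u` and `w`, then the symbol of the coefficient of `x ^ E` in
`Y(u, x) w` is the product of `q` and the coefficient of `x ^ E` in the translation of `p`. -/
lemma symbol_ncoeff {K L : ℤ} {p q : MvPolynomial (ι × ℕ) ℂ} (hp : p ∈ wFil ι K)
    (hq : q ∈ wFil ι L) (n : ℤ) :
    ncoeff (Y (fromSymbol B S b p)) n (fromSymbol B S b q) -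
      fromSymbol B S b (transCoeff (-n - 1) p * q) ∈ filtration B S (K + L - n - 2) := by
  suffices key : ∀ N : ℕ, ∀ K : ℤ, K < N → ∀ p ∈ wFil ι K, ∀ (L : ℤ), ∀ q ∈ wFil ι L, ∀ n,
      ncoeff (Y (fromSymbol B S b p)) n (fromSymbol B S b q) -
        fromSymbol B S b (transCoeff (-n - 1) p * q) ∈ filtration B S (K + L - n - 2) from
    key (K + 1).toNat K (by omega) p hp L q hq n
  clear hp hq p q K L n
  intro N
  induction N with
  | zero =>
    intro K hK p hp L q hq n
    rw [wFil_neg (by exact_mod_cast hK), Submodule.mem_bot] at hp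
    rw [hp]
    simp
  | succ N ih =>
    have ih' : ∀ K : ℤ, K < N → ∀ u ∈ filtration B S K, ∀ (L : ℤ), ∀ q ∈ wFil ι L, ∀ n,
        ncoeff (Y u) n (fromSymbol B S b q) ∈ filtration B S (K + L - n - 1) := by
      intro K hK u hu L q hq n
      obtain ⟨p, hp, rfl⟩ := exists_symbol B S b hS hu
      have h1 := ih K hK p hp L q hq n
      rw [← sub_add_cancel (ncoeff (Y (fromSymbol B S b p)) n (fromSymbol B S b q))]
      exact add_mem (filtration_mono B S (by omega) h1) (filtration_mono B S (by omega)
        (fromSymbol_mem B S b (mul_mem_wFil (transCoeff_mem hp (-n - 1)) hq)))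
    intro K hK p hp L q hq n
    push_cast at hK
    refine wFil_induction (C := fun p => ncoeff (Y (fromSymbol B S b p)) n (fromSymbol B S b q) -
        fromSymbol B S b (transCoeff (-n - 1) p * q) ∈ filtration B S (K + L - n - 2))
      ?_ ?_ ?_ ?_ hp
    · simp
    · intro p p' h h'
      have h2 := add_mem h h'
      rw [← add_sub_add_comm, ← map_add, ← add_mul, ← map_add] at h2
      simpa using h2
    · intro c p h
      have h2 := Submodule.smul_mem _ c h
      rw [smul_sub] at h2
      simpa using h2
    · intro m hm
      rcases eq_or_ne m 0 with rfl | hm0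
      · rw [show (monomial 0 1 : MvPolynomial (ι × ℕ) ℂ) = 1 from rfl, fromSymbol_one,
          hY.vacuum, transCoeff_one]
        rcases eq_or_ne n (-1) with rfl | hn
        · simp
        · rw [if_neg hn, if_neg (by omega), zero_mul, map_zero, sub_zero]
          exact zero_mem _
      · obtain ⟨⟨s, j⟩, hsj⟩ := Finsupp.ne_iff.1 hm0
        obtain ⟨m', rfl⟩ : ∃ m', m = Finsupp.single (s, j) 1 + m' := by
          refine ⟨m - Finsupp.single (s, j) 1, (add_tsub_cancel_of_le ?_).symm⟩
          rw [Finsupp.single_le_iff]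
          exact Nat.one_le_iff_ne_zero.2 hsj
        rw [map_add, varWeight_single] at hm
        push_cast at hm
        have hX : monomial (Finsupp.single (s, j) 1 + m') (1 : ℂ) =
            MvPolynomial.X (s, j) * monomial m' 1 := by
          rw [MvPolynomial.X, MvPolynomial.monomial_mul, one_mul]
        rw [hX]
        have hp' : monomial m' 1 ∈ wFil ι (K - j - 1) :=
          monomial_mem_wFil (by omega) _
        generalize monomial m' (1 : ℂ) = p' at hp'
        clear hX hm hsj hm0 m' p hp
        obtain ⟨A, hA⟩ := hY.jacobi (mode (-1) (b s) • vacuum B S) (fromSymbol B S b p')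
        obtain ⟨M, hM⟩ := hA.assoc (fromSymbol B S b q)
        obtain ⟨E, hE⟩ := exists_ncoeff_eq_zero (Y (fromSymbol B S b p')) (fromSymbol B S b q)
        set m : ℕ := max M.toNat j with hmdef
        have hjm : j ≤ m := le_max_right _ _
        have hMm : M ≤ m := by omega
        set Q : ℕ := max (max j (-n + j).toNat) (E - n + j).toNat with hQdef
        have hjQ : j ≤ Q := by omega
        have hm := hM m hMm (-1 - j) (n - m)
        rw [finsum_eq_sum_range (K := m - j + Q), finsum_eq_sum_range (K := j + 1 + (m - j))] at hm
        rotate_left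
        · intro i hi
          rw [Ring.choose_natCast, Nat.choose_eq_zero_of_lt (by omega), Nat.cast_zero, zero_smul]
        · intro i hi
          rw [hE _ (by omega), map_zero, smul_zero]
        rw [sum_range_add, sum_range_add, sum_range_succ'] at hm
        set G := filtration B S (K + L - n - 2) with hG
        have hcast : ∀ (z : ℤ) (x : 𝕍 B S), x ∈ G → z • x ∈ G :=
          fun z x hx => zsmul_mem hx z
        have hA₁ : ∀ i ∈ range (m - j), ((-1) ^ i * Ring.choose (-1 - (j : ℤ)) i : ℤ) •
            ncoeff (Y (mode (-1) (b s) • vacuum B S)) (m + (-1 - j) - i)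
              (ncoeff (Y (fromSymbol B S b p')) (n - m + i) (fromSymbol B S b q)) ∈ G := by
          intro i hi
          have hi' := mem_range.1 hi
          rw [hgen]
          exact hcast _ _ (filtration_mono B S (by omega) (mode_smul_mem_of_nonneg B S
            (by omega) _ (ih' _ (by omega) _ (fromSymbol_mem B S b hp') L q hq (n - m + i))))
        have hA₂ : ∀ i ∈ range Q,
            ((-1) ^ (m - j + i) * Ring.choose (-1 - (j : ℤ)) (m - j + i) : ℤ) •
            ncoeff (Y (mode (-1) (b s) • vacuum B S)) (m + (-1 - j) - (m - j + i : ℕ))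
              (ncoeff (Y (fromSymbol B S b p')) (n - m + (m - j + i : ℕ)) (fromSymbol B S b q)) -
            ((m + i).choose j : ℂ) • fromSymbol B S b
              (MvPolynomial.X (s, i) * transCoeff (-n - 1 + j - i) p' * q) ∈ G := by
          intro i hi
          rw [hgen, neg_one_pow_mul_choose hjm, natCast_zsmul, Nat.cast_smul_eq_nsmul, ← smul_sub,
            show (m + (-1 - j) - (m - j + i : ℕ) : ℤ) = -1 - i by omega,
            show (n - m + (m - j + i : ℕ) : ℤ) = n - j + i by omega]
          refine nsmul_mem ?_ _
          have h1 := ih _ (by omega) _ hp' L q hq (n - j + i)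
          have h2 := mode_smul_mem B S (-1 - i) (b s) h1
          rw [smul_sub, show -(n - j + i) - 1 = -n - 1 + (j : ℤ) - i by ring] at h2
          have h3 := mode_smul_fromSymbol B S b hS s i
            (mul_mem_wFil (transCoeff_mem hp' (-n - 1 + j - i)) hq)
          have h4 := add_mem (filtration_mono B S (show _ ≤ K + L - n - 2 by omega) h2)
            (filtration_mono B S (show _ ≤ K + L - n - 2 by omega) h3)
          rwa [sub_add_sub_cancel, ← mul_assoc] at h4
        have hR₁ : ∀ i ∈ range j, (Ring.choose (m : ℤ) (i + 1)) •
            ncoeff (Y (ncoeff (Y (mode (-1) (b s) • vacuum B S)) (-1 - j + (i + 1 : ℕ))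
              (fromSymbol B S b p'))) (m + (n - m) - (i + 1 : ℕ)) (fromSymbol B S b q) -
            (m.choose (i + 1) : ℂ) • fromSymbol B S b (transCoeff (-n - 1 + (i + 1 : ℕ))
                (MvPolynomial.X (s, j - (i + 1)) * p') * q) ∈ G := by
          intro i hi
          have hi' := mem_range.1 hi
          rw [hgen, Ring.choose_natCast, natCast_zsmul, Nat.cast_smul_eq_nsmul, ← smul_sub,
            show (-1 - j + (i + 1 : ℕ) : ℤ) = -1 - (j - (i + 1) : ℕ) by omega,
            show (m + (n - m) - (i + 1 : ℕ) : ℤ) = n - (i + 1 : ℕ) by omega]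
          refine nsmul_mem ?_ _
          have h1 := mode_smul_fromSymbol B S b hS s (j - (i + 1)) hp'
          have h2 := ih' _ (by omega) _ h1 L q hq (n - (i + 1 : ℕ))
          rw [map_sub, ncoeff_sub, LinearMap.sub_apply] at h2
          have h3 := ih _ (by push_cast; omega) _ (mul_mem_wFil (X_mem_wFil (s, j - (i + 1))) hp')
            L q hq (n - (i + 1 : ℕ))
          rw [show -(n - (i + 1 : ℕ)) - 1 = -n - 1 + ((i + 1 : ℕ) : ℤ) by ring] at h3
          have h4 := add_mem (filtration_mono B S (show _ ≤ K + L - n - 2 by omega) h2)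
            (filtration_mono B S (show _ ≤ K + L - n - 2 by push_cast; omega) h3)
          rwa [sub_add_sub_cancel] at h4
        have hR₂ : ∀ i ∈ range (m - j), (Ring.choose (m : ℤ) (j + 1 + i)) •
            ncoeff (Y (ncoeff (Y (mode (-1) (b s) • vacuum B S)) (-1 - j + (j + 1 + i : ℕ))
              (fromSymbol B S b p'))) (m + (n - m) - (j + 1 + i : ℕ)) (fromSymbol B S b q) ∈ G := by
          intro i hi
          rw [hgen]
          exact hcast _ _ (filtration_mono B S (by omega) (ih' _ (by omega) _
            (mode_smul_mem_of_nonneg B S (by omega) _ (fromSymbol_mem B S b hp')) L q hq _))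
        have hR₀ : ncoeff (Y (fromSymbol B S b (MvPolynomial.X (s, j) * p'))) n
              (fromSymbol B S b q) -
            (Ring.choose (m : ℤ) 0) •
            ncoeff (Y (ncoeff (Y (mode (-1) (b s) • vacuum B S)) (-1 - j + (0 : ℕ))
              (fromSymbol B S b p'))) (m + (n - m) - (0 : ℕ)) (fromSymbol B S b q) ∈ G := by
          have h1 := mode_smul_fromSymbol B S b hS s j hp'
          have h2 := ih' _ (by omega) _ h1 L q hq n
          rw [map_sub, ncoeff_sub, LinearMap.sub_apply] at h2
          rw [hgen, Ring.choose_zero_right, one_smul, Nat.cast_zero, add_zero, sub_zero,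
            add_sub_cancel, ← neg_sub]
          exact neg_mem (filtration_mono B S (by omega) h2)
        have hs := congrArg (fun x => fromSymbol B S b (x * q))
          (sum_choose_transCoeff s j m (-n - 1) p' (Q := Q) hjQ (by omega))
        beta_reduce at hs
        rw [sum_range_succ', Nat.choose_zero_right, Nat.cast_one, one_smul, Nat.cast_zero,
          add_zero, Nat.sub_zero, add_mul, map_add, sum_mul, sum_mul, map_sum,
          map_sum] at hs
        simp only [smul_mul_assoc, map_smul] at hs
        have h₁ := sum_mem hA₁
        have h₂ := sum_mem hA₂
        have h₃ := sum_mem hR₁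
        have h₄ := sum_mem hR₂
        rw [sum_sub_distrib] at h₂ h₃
        have h₅ := sub_mem (sub_mem (add_mem (add_mem hR₀ h₁) h₂) h₃) h₄
        convert h₅ using 1
        linear_combination (norm := module) -hm - hs

/-- The symbol of a coefficient of `Y(u₁, x₁) ⋯ Y(uₙ, xₙ) 𝟏`. -/
lemma symbol_prodCoeff (n : ℕ) (e : Expo n) (p : Fin n → MvPolynomial (ι × ℕ) ℂ) (K : Fin n → ℤ)
    (hp : ∀ i, p i ∈ wFil ι (K i)) :
    (∏ i, transCoeff (ofLex e (toDual i)) (p i)) ∈ wFil ι (∑ i, (K i + ofLex e (toDual i))) ∧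
      prodCoeff Y (vacuum B S) n e (fun i => fromSymbol B S b (p i)) -
        fromSymbol B S b (∏ i, transCoeff (ofLex e (toDual i)) (p i)) ∈
      filtration B S (∑ i, (K i + ofLex e (toDual i)) - 1) := by
  suffices key : ∀ (n : ℕ) (e : Fin n → ℤ) (p : Fin n → MvPolynomial (ι × ℕ) ℂ) (K : Fin n → ℤ),
      (∀ i, p i ∈ wFil ι (K i)) → (∏ i, transCoeff (e i) (p i)) ∈ wFil ι (∑ i, (K i + e i)) ∧
      (List.ofFn fun i => HVertexOperator.coeff (Y (fromSymbol B S b (p i))) (e i)).prod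
        (vacuum B S) - fromSymbol B S b (∏ i, transCoeff (e i) (p i)) ∈
      filtration B S (∑ i, (K i + e i) - 1) by
    have := key n (fun i => ofLex e (toDual i)) p K hp
    rwa [← prodCoeff_apply] at this
  clear hp K p e n
  intro n
  induction n with
  | zero =>
    intro e p K hp
    refine ⟨by simpa using one_mem_wFil, ?_⟩
    simp [fromSymbol_one]
  | succ n ih =>
    intro e p K hp
    obtain ⟨h1, h2⟩ := ih (fun i => e i.succ) (fun i => p i.succ) (fun i => K i.succ) fun i => hp _
    rw [Fin.prod_univ_succ, Fin.sum_univ_succ]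
    refine ⟨mul_mem_wFil (transCoeff_mem (hp 0) _) h1, ?_⟩
    rw [List.ofFn_succ, List.prod_cons, End.mul_apply]
    obtain ⟨q, hq, hq'⟩ := exists_symbol B S b hS h2
    have hc : ∀ u, HVertexOperator.coeff (Y u) (e 0) = ncoeff (Y u) (-e 0 - 1) := by
      intro u
      rw [ncoeff_apply, show -(-e 0 - 1) - 1 = e 0 by ring]
    have h3 := symbol_ncoeff b hY hgen hS (hp 0) hq (-e 0 - 1)
    have h4 := symbol_ncoeff b hY hgen hS (hp 0) h1 (-e 0 - 1)
    have h5 := fromSymbol_mem B S b (mul_mem_wFil (transCoeff_mem (hp 0) (e 0)) hq)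
    rw [show -(-e 0 - 1) - 1 = e 0 by ring] at h3 h4
    rw [hc, eq_add_of_sub_eq hq'.symm, map_add]
    set G := filtration B S (K 0 + e 0 + ∑ i, (K (Fin.succ i) + e i.succ) - 1)
    have h6 := add_mem (add_mem (filtration_mono B S (show _ ≤ K 0 + e 0 +
        ∑ i, (K (Fin.succ i) + e i.succ) - 1 by omega) h3)
      (filtration_mono B S (show _ ≤ K 0 + e 0 + ∑ i, (K (Fin.succ i) + e i.succ) - 1 by omega) h4))
      (filtration_mono B S (show _ ≤ K 0 + e 0 + ∑ i, (K (Fin.succ i) + e i.succ) - 1 by omega) h5)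
    convert h6 using 1
    abel

end

/-! ### Linear independence of products of translations -/

section

/-- Linearly independent columns have a nonzero maximal minor. -/
lemma exists_det_ne_zero {K s I : Type*} [Field K] [Fintype s] [DecidableEq s] (w : I → s → K)
    (h : ∀ g : s → K, (∀ m, ∑ x, g x * w m x = 0) → g = 0) :
    ∃ r : s → I, (Matrix.of fun y x => w (r y) x).det ≠ 0 := by
  have htop : ⊤ ≤ Submodule.span K (Set.range w) := by
    by_contra hlt
    obtain ⟨f, hf, hle⟩ := Submodule.exists_le_ker_of_lt_top _
      (lt_of_le_of_ne le_top fun h0 => hlt h0.ge)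
    have hfw : ∀ v : s → K, f v = ∑ x, f (Pi.single x 1) * v x := by
      intro v
      conv_lhs => rw [← univ_sum_single v]
      rw [map_sum]
      refine sum_congr rfl fun x _ => ?_
      rw [mul_comm, ← smul_eq_mul, ← map_smul, ← Pi.single_smul, smul_eq_mul, mul_one]
    have hg := h (fun x => f (Pi.single x 1)) fun m => by
      rw [← hfw]
      exact hle (Submodule.subset_span ⟨m, rfl⟩)
    exact hf (LinearMap.ext fun v => by
      rw [hfw, LinearMap.zero_apply]
      exact sum_eq_zero fun x _ => by rw [congrFun hg x, Pi.zero_apply, zero_mul])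
  let c := Basis.ofSpan htop
  let c' := c.reindex (c.indexEquiv (Pi.basisFun K s))
  have hr : ∀ y, ∃ m, w m = c' y := fun y =>
    Basis.ofSpan_subset htop (by rw [Basis.reindex_apply]; exact ⟨_, rfl⟩)
  choose r hr using hr
  refine ⟨r, ?_⟩
  have h1 : LinearIndependent K (Matrix.of fun y x => w (r y) x).row := by
    have : (Matrix.of fun y x => w (r y) x).row = c' := funext hr
    rw [this]
    exact c'.linearIndependent
  exact ((Matrix.isUnit_iff_isUnit_det _).1 (Matrix.linearIndependent_rows_iff_isUnit.1 h1)).ne_zero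

open Polynomial in
/-- Hermite interpolation. -/
lemma exists_hermite {K : Type*} [Field K] {n N : ℕ} {x : Fin n → K}
    (hx : Function.Injective x) (i₀ : Fin n) (k₀ : ℕ) :
    ∃ g : ℕ → K, ∀ i k, k < N → ∑ j ∈ range (n * N), (j.choose k : K) * g j * x i ^ (j - k) =
        if i = i₀ ∧ k = k₀ then 1 else 0 := by
  let L : degreeLT K (n * N) →ₗ[K] (Fin n × Fin N → K) :=
    LinearMap.pi fun ik => lcoeff K ik.2 ∘ₗ taylor (x ik.1) ∘ₗ Submodule.subtype _
  have hL : Function.Injective L := by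
    rw [injective_iff_map_eq_zero]
    rintro ⟨f, hf⟩ h0
    have hdvd : ∏ i, (X - C (x i)) ^ N ∣ f := by
      refine prod_dvd_of_coprime (fun i _ j _ hij => ?_) fun i _ => ?_
      · exact (pairwise_coprime_X_sub_C hx hij).pow
      · rw [X_sub_C_pow_dvd_iff, ← taylor_apply, X_pow_dvd_iff]
        intro k hk
        exact congrFun h0 (i, ⟨k, hk⟩)
    have hz := eq_zero_of_dvd_of_degree_lt hdvd (by
      rw [degree_prod]
      simpa using mem_degreeLT.1 hf)
    exact Subtype.ext hz
  have hfin : FiniteDimensional K (degreeLT K (n * N)) :=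
    (degreeLTEquiv K (n * N)).symm.finiteDimensional
  have hrank : finrank K (degreeLT K (n * N)) = finrank K (Fin n × Fin N → K) := by
    rw [(degreeLTEquiv K (n * N)).finrank_eq]
    simp
  have hsurj := (LinearMap.injective_iff_surjective_of_finrank_eq_finrank hrank).1 hL
  obtain ⟨⟨g, hg⟩, h⟩ := hsurj fun ik => if ik.1 = i₀ ∧ (ik.2 : ℕ) = k₀ then 1 else 0
  refine ⟨g.coeff, fun i k hk => ?_⟩
  have h1 := congrFun h (i, ⟨k, hk⟩)
  simp only [L, LinearMap.pi_apply, comp_apply, Submodule.subtype_apply, lcoeff_apply,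
    taylor_coeff, hasseDeriv_apply] at h1
  rw [← h1, ← sum_fin _ (by simp) (mem_degreeLT.1 hg), eval_finsetSum, sum_range]
  simp

end

section

variable {ι : Type*} {R : Type*} [CommRing R]

variable (ι R) in
/-- The algebra endomorphism sending `X (s, j)` to zero for `j ≥ N`. -/
def truncateVars (N : ℕ) : MvPolynomial (ι × ℕ) R →ₐ[R] MvPolynomial (ι × ℕ) R :=
  aeval fun i => if i.2 < N then MvPolynomial.X i else 0

open Classical in
lemma coeff_truncateVars (N : ℕ) (p : MvPolynomial (ι × ℕ) R) (m : ι × ℕ →₀ ℕ) :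
    (truncateVars ι R N p).coeff m = if ∀ i ∈ m.support, i.2 < N then p.coeff m else 0 := by
  induction p using MvPolynomial.induction_on' with
  | add p q hp hq =>
    rw [map_add, MvPolynomial.coeff_add, hp, hq, MvPolynomial.coeff_add]
    split_ifs <;> simp
  | monomial m' a =>
    rw [truncateVars, MvPolynomial.aeval_monomial]
    by_cases h : ∀ i ∈ m'.support, i.2 < N
    · have h1 : (m'.prod fun i k => (if i.2 < N then MvPolynomial.X i else 0 :
          MvPolynomial (ι × ℕ) R) ^ k) = m'.prod fun i k => MvPolynomial.X i ^ k :=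
        prod_congr rfl fun i hi => by beta_reduce; rw [if_pos (h i hi)]
      rw [h1, MvPolynomial.algebraMap_eq, ← MvPolynomial.monomial_eq, MvPolynomial.coeff_monomial]
      split_ifs with h2 h3 h3
      · rfl
      · exact absurd (h2 ▸ h) h3
      · rfl
      · rfl
    · have h0 := h
      push Not at h
      obtain ⟨i, hi, hiN⟩ := h
      have h1 : (m'.prod fun i k => (if i.2 < N then MvPolynomial.X i else 0 :
          MvPolynomial (ι × ℕ) R) ^ k) = 0 :=
        prod_eq_zero hi (by
          beta_reduce
          rw [if_neg hiN.not_gt, zero_pow (Finsupp.mem_support_iff.1 hi)])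
      rw [h1, mul_zero, MvPolynomial.coeff_zero, MvPolynomial.coeff_monomial]
      split_ifs with h3 h2
      · exact absurd (h2 ▸ h3) h0
      · rfl
      · rfl

end

section

variable {ι : Type*} {K : Type*} [Field K] [Algebra ℂ K]

variable (ι) in
/-- The translation by `y`, truncated:
`X (s, k) ↦ ∑ⱼ j.choose k y ^ (j - k) X (s, j)` where `j < N`. -/
def translateAt (N : ℕ) (y : K) : MvPolynomial (ι × ℕ) ℂ →ₐ[ℂ] MvPolynomial (ι × ℕ) K :=
  aeval fun i => ∑ j ∈ range N,
    MvPolynomial.C ((j.choose i.2 : K) * y ^ (j - i.2)) * MvPolynomial.X (i.1, j)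

lemma truncateVars_translateAt (N : ℕ) (y : K) (p : MvPolynomial (ι × ℕ) ℂ) :
    truncateVars ι K N (translateAt ι N y p) = translateAt ι N y p := by
  have : ((truncateVars ι K N).restrictScalars ℂ).comp (translateAt ι N y) = translateAt ι N y := by
    refine MvPolynomial.algHom_ext fun i => ?_
    rw [AlgHom.comp_apply, translateAt, aeval_X, map_sum]
    refine sum_congr rfl fun j hj => ?_
    rw [AlgHom.restrictScalars_apply, map_mul, truncateVars, MvPolynomial.aeval_C,
      aeval_X, if_pos (mem_range.1 hj), MvPolynomial.algebraMap_eq]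
  exact DFunLike.congr_fun this p

/-- The substitution inverse to the translations by `x₁, …, xₙ`. -/
lemma exists_separation {n N : ℕ} {x : Fin n → K} (hx : Function.Injective x) :
    ∃ Ψ : MvPolynomial (ι × ℕ) K →ₐ[K] MvPolynomial (Fin n × ι × ℕ) K,
      ∀ (i : Fin n) (s : ι) (k : ℕ), k < N →
        Ψ (translateAt ι (n * N) (x i) (MvPolynomial.X (s, k))) = MvPolynomial.X (i, s, k) := by
  choose g hg using fun i₀ k₀ => exists_hermite (N := N) hx i₀ k₀
  refine ⟨aeval fun sj => ∑ i, ∑ k ∈ range N,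
    MvPolynomial.C (g i k sj.2) * MvPolynomial.X (i, sj.1, k), fun i s k hk => ?_⟩
  rw [translateAt, aeval_X, map_sum]
  have h : ∀ j ∈ range (n * N), aeval (fun sj : ι × ℕ => ∑ i,
      ∑ k ∈ range N, (MvPolynomial.C (g i k sj.2) * MvPolynomial.X (i, sj.1, k) :
        MvPolynomial (Fin n × ι × ℕ) K))
      (MvPolynomial.C ((j.choose k : K) * x i ^ (j - k)) * MvPolynomial.X (s, j)) =
      ∑ i', ∑ k' ∈ range N, MvPolynomial.C ((j.choose k : K) * g i' k' j * x i ^ (j - k)) *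
        MvPolynomial.X (i', s, k') := by
    intro j _
    rw [map_mul, MvPolynomial.aeval_C, aeval_X, MvPolynomial.algebraMap_eq, mul_sum]
    refine sum_congr rfl fun i' _ => ?_
    rw [mul_sum]
    refine sum_congr rfl fun k' _ => ?_
    rw [← mul_assoc, ← map_mul]
    congr 2
    ring
  rw [sum_congr rfl h, sum_comm, sum_eq_single i]
  · rw [sum_comm, sum_eq_single k]
    · rw [← sum_mul, ← map_sum, hg i k i k hk, if_pos ⟨rfl, rfl⟩, map_one, one_mul]
    · intro k' _ hk'
      rw [← sum_mul, ← map_sum, hg i k' i k hk, if_neg fun h => hk' h.2.symm, map_zero, zero_mul]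
    · intro h'
      exact absurd (mem_range.2 hk) h'
  · intro i' _ hi'
    rw [sum_comm]
    refine sum_eq_zero fun k' _ => ?_
    rw [← sum_mul, ← map_sum, hg i' k' i k hk, if_neg fun h => hi' h.1.symm, map_zero, zero_mul]
  · intro h'
    exact absurd (mem_univ i) h'

/-- The products of translations of monomials by distinct elements are linearly independent. -/
lemma prod_translateAt_linearIndependent {n N : ℕ} {x : Fin n → K} (hx : Function.Injective x)
    (t : Finset (Fin n → ι × ℕ →₀ ℕ)) (ht : ∀ μ ∈ t, ∀ i, ∀ a ∈ (μ i).support, a.2 < N)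
    (g : (Fin n → ι × ℕ →₀ ℕ) → K)
    (h : ∑ μ ∈ t, g μ • ∏ i, translateAt ι (n * N) (x i) (monomial (μ i) 1) = 0) :
    ∀ μ ∈ t, g μ = 0 := by
  classical
  obtain ⟨Ψ, hΨ⟩ := exists_separation (ι := ι) (N := N) hx
  let e (μ : Fin n → ι × ℕ →₀ ℕ) : Fin n × ι × ℕ →₀ ℕ := ∑ i, (μ i).mapDomain (Prod.mk i)
  have he : Function.Injective e := by
    intro μ ν h
    funext i
    ext a
    have hval : ∀ μ : Fin n → ι × ℕ →₀ ℕ, e μ (i, a) = μ i a := by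
      intro μ
      rw [Finsupp.finsetSum_apply, sum_eq_single i]
      · exact Finsupp.mapDomain_apply (Prod.mk_right_injective i) _ _
      · intro j _ hj
        refine Finsupp.mapDomain_of_notMem_range _ _ ?_
        rintro ⟨a', ha'⟩
        exact hj (congrArg Prod.fst ha')
      · simp
    rw [← hval, h, hval]
  have h1 := congrArg Ψ h
  rw [map_sum, map_zero] at h1
  have h2 : ∀ μ ∈ t, Ψ (g μ • ∏ i, translateAt ι (n * N) (x i)
      (monomial (μ i) 1)) = monomial (e μ) (g μ) := by
    intro μ hμ
    rw [map_smul, map_prod]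
    have h3 : ∀ i, Ψ (translateAt ι (n * N) (x i) (monomial (μ i) 1)) =
        monomial ((μ i).mapDomain (Prod.mk i)) 1 := by
      intro i
      rw [MvPolynomial.monomial_eq, MvPolynomial.monomial_eq, MvPolynomial.C_1, MvPolynomial.C_1,
        one_mul, one_mul, Finsupp.prod_mapDomain_index_inj (Prod.mk_right_injective i),
        Finsupp.prod, Finsupp.prod, map_prod, map_prod]
      refine prod_congr rfl fun a ha => ?_
      rw [map_pow, map_pow, hΨ i a.1 a.2 (ht μ hμ i a ha)]
    rw [prod_congr rfl fun i _ => h3 i, ← MvPolynomial.monomial_sum_one,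
      MvPolynomial.smul_monomial, smul_eq_mul, mul_one]
  rw [sum_congr rfl h2] at h1
  intro μ hμ
  have h3 := congrArg (MvPolynomial.coeff (e μ)) h1
  rw [MvPolynomial.coeff_sum, sum_eq_single μ] at h3
  · simpa using h3
  · intro ν _ hν
    rw [MvPolynomial.coeff_monomial, if_neg fun h => hν (he h)]
  · exact fun h => absurd hμ h

end

/-! ### Leading terms of iterated Laurent series -/

section

variable {n : ℕ}

/-- The total degree of a monomial in `x₁, …, xₙ`. -/
def totalDegree : Expo n →+ ℤ where
  toFun e := ∑ i : Fin n, ofLex e (toDual i)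
  map_zero' := sum_eq_zero fun _ _ => rfl
  map_add' _ _ := sum_add_distrib

/-- All terms of `f` have total degree at least `d`, and the terms of total degree `d` are those
of `f₀`. -/
def HasLead (d : ℤ) (f f₀ : IterLaurent n) : Prop :=
  ∀ e, (totalDegree e < d → f.coeff e = 0) ∧ f₀.coeff e = if totalDegree e = d then f.coeff e else 0

lemma HasLead.zero (d : ℤ) : HasLead d (0 : IterLaurent n) 0 := by intro e; simp

lemma HasLead.add {d : ℤ} {f f₀ g g₀ : IterLaurent n} (hf : HasLead d f f₀) (hg : HasLead d g g₀) :
    HasLead d (f + g) (f₀ + g₀) := by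
  intro e
  refine ⟨fun h => ?_, ?_⟩
  · rw [HahnSeries.coeff_add, (hf e).1 h, (hg e).1 h, add_zero]
  · rw [HahnSeries.coeff_add, HahnSeries.coeff_add, (hf e).2, (hg e).2]
    split_ifs <;> simp

lemma HasLead.sum {ι : Type*} {d : ℤ} {f f₀ : ι → IterLaurent n} (s : Finset ι)
    (h : ∀ i ∈ s, HasLead d (f i) (f₀ i)) : HasLead d (∑ i ∈ s, f i) (∑ i ∈ s, f₀ i) := by
  classical
  induction s using Finset.induction_on with
  | empty => exact HasLead.zero d
  | insert a s ha ih =>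
    rw [sum_insert ha, sum_insert ha]
    exact (h a (by simp)).add (ih fun i hi => h i (by simp [hi]))

lemma HasLead.smul {d : ℤ} {f f₀ : IterLaurent n} (hf : HasLead d f f₀) (c : ℤ) :
    HasLead d (c • f) (c • f₀) := by
  intro e
  refine ⟨fun h => ?_, ?_⟩
  · rw [HahnSeries.coeff_smul, (hf e).1 h, smul_zero]
  · rw [HahnSeries.coeff_smul, HahnSeries.coeff_smul, (hf e).2]
    split_ifs <;> simp

lemma HasLead.one : HasLead 0 (1 : IterLaurent n) 1 := by
  intro e
  rw [HahnSeries.coeff_one]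
  rcases eq_or_ne e 0 with rfl | h
  · simp
  · simp [h]

lemma HasLead.mul {d d' : ℤ} {f f₀ g g₀ : IterLaurent n} (hf : HasLead d f f₀)
    (hg : HasLead d' g g₀) : HasLead (d + d') (f * g) (f₀ * g₀) := by
  have hsub : ∀ {d : ℤ} {f f₀ : IterLaurent n}, HasLead d f f₀ → f₀.support ⊆ f.support := by
    intro d f f₀ h e he
    rw [HahnSeries.mem_support, (h e).2] at he
    intro h0
    rw [h0, ite_self] at he
    exact he rfl
  intro e
  refine ⟨fun h => ?_, ?_⟩
  · rw [HahnSeries.coeff_mul]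
    refine sum_eq_zero fun ij hij => ?_
    have hij' := (Finset.mem_antidiagonal.1 hij).2.2
    rw [← hij', map_add] at h
    rcases lt_or_ge (totalDegree ij.1) d with h1 | h1
    · rw [(hf _).1 h1, zero_mul]
    · rw [(hg _).1 (by omega), mul_zero]
  · have h0 : (f₀ * g₀).coeff e = ∑ ij ∈ antidiagonal f.isPWO_support g.isPWO_support e,
        f₀.coeff ij.1 * g₀.coeff ij.2 := by
      rw [HahnSeries.coeff_mul]
      refine sum_subset (fun ij hij => ?_) fun ij hij hij' => ?_
      · rw [Finset.mem_antidiagonal] at hij ⊢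
        exact ⟨hsub hf hij.1, hsub hg hij.2.1, hij.2.2⟩
      · rw [Finset.mem_antidiagonal] at hij hij'
        by_contra h
        exact hij' ⟨left_ne_zero_of_mul h, right_ne_zero_of_mul h, hij.2.2⟩
    rw [h0, HahnSeries.coeff_mul]
    split_ifs with h
    · refine sum_congr rfl fun ij hij => ?_
      have hij' := (Finset.mem_antidiagonal.1 hij).2.2
      rw [← hij', map_add] at h
      rw [(hf _).2, (hg _).2]
      rcases lt_trichotomy (totalDegree ij.1) d with h1 | h1 | h1
      · rw [(hf _).1 h1, ite_self, zero_mul, zero_mul]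
      · rw [if_pos h1, if_pos (by omega)]
      · rw [(hg _).1 (by omega), ite_self, mul_zero, mul_zero]
    · refine sum_eq_zero fun ij hij => ?_
      have hij' := (Finset.mem_antidiagonal.1 hij).2.2
      rw [← hij', map_add] at h
      rw [(hf _).2, (hg _).2]
      by_cases h1 : totalDegree ij.1 = d
      · rw [if_neg (show totalDegree ij.2 ≠ d' by omega), mul_zero]
      · rw [if_neg h1, zero_mul]

lemma HasLead.prod {ι : Type*} {d : ι → ℤ} {f f₀ : ι → IterLaurent n} (s : Finset ι)
    (h : ∀ i ∈ s, HasLead (d i) (f i) (f₀ i)) :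
    HasLead (∑ i ∈ s, d i) (∏ i ∈ s, f i) (∏ i ∈ s, f₀ i) := by
  classical
  induction s using Finset.induction_on with
  | empty => exact HasLead.one
  | insert a s ha ih =>
    rw [sum_insert ha, prod_insert ha, prod_insert ha]
    exact (h a (by simp)).mul (ih fun i hi => h i (by simp [hi]))

lemma HasLead.det {s : Type*} [Fintype s] [DecidableEq s] {α β : s → ℤ}
    {M M₀ : Matrix s s (IterLaurent n)} (h : ∀ y x, HasLead (α y - β x) (M y x) (M₀ y x)) :
    HasLead (∑ y, α y - ∑ x, β x) M.det M₀.det := by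
  rw [Matrix.det_apply, Matrix.det_apply]
  refine HasLead.sum _ fun σ _ => ?_
  rw [Units.smul_def, Units.smul_def]
  refine HasLead.smul ?_ _
  have := HasLead.prod univ fun y (_ : y ∈ univ) => h (σ y) y
  rwa [sum_sub_distrib, Equiv.sum_comp σ α] at this

lemma HasLead.ne_zero {d : ℤ} {f f₀ : IterLaurent n} (h : HasLead d f f₀) (h₀ : f₀ ≠ 0) :
    f ≠ 0 := by
  rintro rfl
  refine h₀ (HahnSeries.ext (funext fun e => ?_))
  rw [(h e).2]
  simp

/-- The variable `xᵢ`. -/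
def iterVar (i : Fin n) : IterLaurent n := HahnSeries.single (toLex (Pi.single (toDual i) 1)) 1

lemma iterVar_injective : Function.Injective (iterVar (n := n)) := by
  intro i j h
  by_contra hij
  have h1 := congrArg (fun f => f.coeff (toLex (Pi.single (toDual i) 1))) h
  simp only [iterVar, HahnSeries.coeff_single_same] at h1
  rw [HahnSeries.coeff_single_of_ne] at h1
  · exact one_ne_zero h1
  · intro h2
    have h3 := congrFun (toLex.injective h2) (toDual i)
    rw [Pi.single_eq_same, Pi.single_eq_of_ne fun h => hij (toDual.injective h)] at h3
    exact one_ne_zero h3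

lemma prod_iterVar_pow (e : Fin n → ℕ) : ∏ i, (iterVar i) ^ e i =
      (HahnSeries.single (toLex fun i => (e (ofDual i) : ℤ)) 1 : IterLaurent n) := by
  have h : ∀ (s : Finset (Fin n)) (a : Fin n → Expo n), ∏ i ∈ s, HahnSeries.single (a i) (1 : ℂ) =
      HahnSeries.single (∑ i ∈ s, a i) 1 := by
    intro s a
    classical
    induction s using Finset.induction_on with
    | empty => rfl
    | insert i s hi ih =>
      rw [prod_insert hi, sum_insert hi, ih, HahnSeries.single_mul_single, mul_one]
  simp only [iterVar, HahnSeries.single_pow, one_pow]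
  rw [h]
  congr 2
  apply ofLex.injective
  funext j
  have h1 : ofLex (∑ i, e i • (toLex (Pi.single (toDual i) 1) : Expo n)) j =
      ∑ i, e i • (Pi.single (toDual i) 1 : (Fin n)ᵒᵈ → ℤ) j :=
    map_sum ({ toFun e := ofLex e j, map_zero' := rfl, map_add' _ _ := rfl } : Expo n →+ ℤ) _ _
  rw [h1, sum_eq_single (ofDual j)]
  · simp
  · intro i _ hi
    rw [Pi.single_eq_of_ne fun h => hi (by rw [h]; rfl), smul_zero]
  · simp

end

section

variable {ι : Type*} {n : ℕ}

/-- The truncated translation with a formal variable. -/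
def translatePoly (ι : Type*) (N : ℕ) :
    MvPolynomial (ι × ℕ) ℂ →ₐ[ℂ] Polynomial (MvPolynomial (ι × ℕ) ℂ) :=
  aeval fun i => ∑ j ∈ range N, Polynomial.monomial (j - i.2)
    ((j.choose i.2 : ℂ) • MvPolynomial.X (i.1, j))

lemma coeff_translatePoly (N : ℕ) (p : MvPolynomial (ι × ℕ) ℂ) (e : ℕ) :
    (translatePoly ι N p).coeff e = truncateVars ι ℂ N (coeff e (translate ι p)) := by
  have h : (Polynomial.coeToPowerSeries.ringHom).comp (translatePoly ι N).toRingHom =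
      (PowerSeries.map (truncateVars ι ℂ N).toRingHom).comp (translate ι).toRingHom := by
    refine MvPolynomial.ringHom_ext (fun c => ?_) fun i => PowerSeries.ext fun e => ?_
    · simp only [RingHom.comp_apply, AlgHom.toRingHom_eq_coe, RingHom.coe_coe,
        MvPolynomial.algHom_C, Polynomial.algebraMap_apply, PowerSeries.algebraMap_apply,
        Polynomial.coeToPowerSeries.ringHom_apply, Polynomial.coe_C, PowerSeries.map_C,
        AlgHom.commutes]
    · simp only [RingHom.comp_apply, AlgHom.toRingHom_eq_coe, RingHom.coe_coe, translatePoly,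
        translate, aeval_X, Polynomial.coeToPowerSeries.ringHom_apply,
        Polynomial.coeff_coe, PowerSeries.coeff_map, coeff_mk,
        Polynomial.finsetSum_coeff, Polynomial.coeff_monomial, map_smul, truncateVars]
      have hx : ∀ x ∈ range N, x ≠ i.2 + e → (if x - i.2 = e then
          (x.choose i.2 : ℂ) • MvPolynomial.X (i.1, x) else 0 : MvPolynomial (ι × ℕ) ℂ) = 0 := by
        intro x _ hx
        split_ifs with h
        · rw [Nat.choose_eq_zero_of_lt (by omega), Nat.cast_zero, zero_smul]
        · rfl
      split_ifs with h
      · rw [sum_eq_single _ hx fun h' => absurd (mem_range.2 h) h',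
          if_pos (Nat.add_sub_cancel_left _ _)]
      · rw [smul_zero]
        refine sum_eq_zero fun x hx' => hx x hx' ?_
        rintro rfl
        exact h (mem_range.1 hx')
  have h1 := congrArg (coeff e) (DFunLike.congr_fun h p)
  simpa using h1

lemma translateAt_eq_sum {K : Type*} [Field K] [Algebra ℂ K] (N : ℕ) (y : K)
    (p : MvPolynomial (ι × ℕ) ℂ) {D : ℕ} (hD : (translatePoly ι N p).natDegree < D) :
    translateAt ι N y p = ∑ e ∈ range D,
      MvPolynomial.map (algebraMap ℂ K) ((translatePoly ι N p).coeff e) * MvPolynomial.C y ^ e := by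
  rw [← Polynomial.eval₂_eq_sum_range' _ hD]
  have h : (translateAt ι N y).toRingHom =
      (Polynomial.eval₂RingHom (MvPolynomial.map (algebraMap ℂ K)) (MvPolynomial.C y)).comp
        (translatePoly ι N).toRingHom := by
    refine MvPolynomial.ringHom_ext (fun c => ?_) fun i => ?_
    · simp [translatePoly, translateAt]
    · simp only [RingHom.comp_apply, AlgHom.toRingHom_eq_coe, RingHom.coe_coe, translatePoly,
        translateAt, aeval_X, map_sum]
      refine sum_congr rfl fun j _ => ?_
      simp [MvPolynomial.smul_eq_C_mul]
      ring
  exact DFunLike.congr_fun h p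

/-- The coefficients of a product of truncated translations by the variables `xᵢ`. -/
lemma coeff_prod_translateAt (N : ℕ) (p : Fin n → MvPolynomial (ι × ℕ) ℂ) {m : ι × ℕ →₀ ℕ}
    (hm : ∀ i ∈ m.support, i.2 < N) (e : Expo n) :
    ((∏ i, translateAt ι N (iterVar i : IterLaurent n) (p i)).coeff m).coeff e =
      (∏ i, transCoeff (ofLex e (toDual i)) (p i)).coeff m := by
  classical
  obtain ⟨D, hD⟩ : ∃ D, ∀ i, (translatePoly ι N (p i)).natDegree < D :=
    ⟨univ.sup (fun i => (translatePoly ι N (p i)).natDegree) + 1, fun i =>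
      Nat.lt_succ_of_le (le_sup (f := fun i => (translatePoly ι N (p i)).natDegree) (mem_univ i))⟩
  have htr : ∀ q : MvPolynomial (ι × ℕ) ℂ, (truncateVars ι ℂ N q).coeff m = q.coeff m := by
    intro q; rw [coeff_truncateVars, if_pos hm]
  rw [prod_congr rfl fun i _ => translateAt_eq_sum N (iterVar i) (p i) (hD i),
    prod_univ_sum, MvPolynomial.coeff_sum]
  have h1 : ∀ a : Fin n → ℕ, (∏ i, MvPolynomial.map (algebraMap ℂ (IterLaurent n))
        ((translatePoly ι N (p i)).coeff (a i)) * MvPolynomial.C (iterVar i) ^ a i).coeff m =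
      HahnSeries.single (toLex fun i => (a (ofDual i) : ℤ))
        ((∏ i, (translatePoly ι N (p i)).coeff (a i)).coeff m) := by
    intro a
    rw [prod_mul_distrib, ← map_prod, prod_congr rfl fun i _ =>
      (map_pow MvPolynomial.C (iterVar i) (a i)).symm, ← map_prod, prod_iterVar_pow,
      mul_comm, MvPolynomial.coeff_C_mul, MvPolynomial.coeff_map, HahnSeries.algebraMap_apply,
      HahnSeries.C_apply, HahnSeries.single_mul_single, add_zero, one_mul]
    rfl
  rw [sum_congr rfl fun a _ => h1 a, HahnSeries.coeff_sum]
  by_cases he : ∃ a : Fin n → ℕ, (∀ i, a i < D) ∧ e = toLex fun i => (a (ofDual i) : ℤ)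
  · obtain ⟨a, ha, rfl⟩ := he
    rw [sum_eq_single a]
    · rw [HahnSeries.coeff_single_same, prod_congr rfl fun i _ =>
        coeff_translatePoly N (p i) (a i), ← map_prod, htr]
      simp only [ofLex_toLex, OrderDual.ofDual_toDual, transCoeff_natCast]
    · intro a' _ ha'
      rw [HahnSeries.coeff_single_of_ne]
      intro h
      refine ha' (funext fun i => ?_)
      have := congrFun (toLex.injective h) (toDual i)
      simpa using this.symm
    · intro h
      exact absurd (Fintype.mem_piFinset.2 fun i => mem_range.2 (ha i)) h
  · rw [sum_eq_zero]
    · symm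
      by_cases hneg : ∃ i, ofLex e (toDual i) < 0
      · obtain ⟨i, hi⟩ := hneg
        rw [prod_eq_zero (mem_univ i) (transCoeff_of_neg hi _), MvPolynomial.coeff_zero]
      · push Not at hneg
        have hex : ∃ i, D ≤ (ofLex e (toDual i)).toNat := by
          by_contra hlt
          push Not at hlt
          refine he ⟨fun i => (ofLex e (toDual i)).toNat, hlt, ?_⟩
          apply ofLex.injective
          funext i
          exact (Int.toNat_of_nonneg (hneg (ofDual i))).symm
        obtain ⟨i, hi⟩ := hex
        rw [← htr, map_prod, prod_eq_zero (mem_univ i), MvPolynomial.coeff_zero]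
        rw [← Int.toNat_of_nonneg (hneg i), transCoeff_natCast, ← coeff_translatePoly]
        exact Polynomial.coeff_eq_zero_of_natDegree_lt ((hD i).trans_le hi)
    · intro a ha
      rw [HahnSeries.coeff_single_of_ne]
      rintro rfl
      exact he ⟨a, fun i => mem_range.1 (Fintype.mem_piFinset.1 ha i), rfl⟩

end

/-! ### Nondegeneracy -/

section

variable {n : ℕ}

/-- A linear functional applied to the coefficients of an element of `V((x₁))⋯((xₙ))`. -/
def coordSeries (φ : V →ₗ[ℂ] ℂ) : IterLaurentModule n V →ₗ[ℂ] IterLaurent n where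
  toFun G :=
    { coeff := fun e => φ (((HahnModule.of ℂ).symm G).coeff e)
      isPWO_support' := ((HahnModule.of ℂ).symm G).isPWO_support.mono fun e he h0 =>
        he (by beta_reduce; rw [h0, map_zero]) }
  map_add' G G' := by ext e; simp
  map_smul' c G := by ext e; exact map_smul φ c _

lemma coeff_coordSeries (φ : V →ₗ[ℂ] ℂ) (G : IterLaurentModule n V) (e : Expo n) :
    (coordSeries φ G).coeff e = φ (((HahnModule.of ℂ).symm G).coeff e) := rfl

lemma coordSeries_smul (φ : V →ₗ[ℂ] ℂ) (f : IterLaurent n) (G : IterLaurentModule n V) :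
    coordSeries φ (f • G) = f * coordSeries φ G := by
  ext e
  rw [coeff_coordSeries, HahnModule.coeff_smul, map_sum,
    HahnSeries.coeff_mul_right' ((HahnModule.of ℂ).symm G).isPWO_support fun e he h0 =>
        he (by rw [coeff_coordSeries, h0, map_zero])]
  refine sum_congr rfl fun ij _ => ?_
  rw [map_smul, smul_eq_mul, coeff_coordSeries]

end

section

lemma varWeight_of_coeff_prod_ne_zero {ι κ : Type*} {f : κ → MvPolynomial (ι × ℕ) ℂ} {k : κ → ℤ}
    (s : Finset κ) (h : ∀ i ∈ s, ∀ m, (f i).coeff m ≠ 0 → (varWeight m : ℤ) = k i)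
    {m : ι × ℕ →₀ ℕ} (hm : (∏ i ∈ s, f i).coeff m ≠ 0) : (varWeight m : ℤ) = ∑ i ∈ s, k i := by
  classical
  induction s using Finset.induction_on generalizing m with
  | empty =>
    rw [prod_empty, MvPolynomial.coeff_one] at hm
    have : m = 0 := by by_contra h; exact hm (if_neg (Ne.symm h))
    simp [this]
  | insert a s ha ih =>
    rw [prod_insert ha, MvPolynomial.coeff_mul] at hm
    obtain ⟨x, hx, hx0⟩ := exists_ne_zero_of_sum_ne_zero hm
    rw [← HasAntidiagonal.mem_antidiagonal.1 hx, map_add, sum_insert ha, Nat.cast_add,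
      h a (by simp) _ (left_ne_zero_of_mul hx0),
      ih (fun i hi => h i (by simp [hi])) (right_ne_zero_of_mul hx0)]

open VertexOperator

variable [FiniteDimensional ℂ H] {Y : 𝕍 B S →ₗ[ℂ] VertexOperator ℂ (𝕍 B S)}

/-- If `V(H, 𝒮)` is of PBW type, the leading terms of `Y(u₁, x₁) ⋯ Y(uₙ, xₙ) 𝟏` are products of
translations by `x₁, …, xₙ` of polynomials, and are linearly independent. -/
lemma isNondegenerate_of_isPBWType (hY : IsWeakQuantumVertexAlgebra (vacuum B S) Y)
    (hgen : ∀ (a : H) n w, ncoeff (Y (mode (-1) a • vacuum B S)) n w = mode n a • w)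
    {hS : ∀ t, powerCoeff (H ⊗[ℂ] H) 0 (S t) = t} (hPBW : IsPBWType B S hS) :
    IsNondegenerate (vacuum B S) Y := by
  classical
  intro n hn
  rcases subsingleton_or_nontrivial (𝕍 B S) with hV | hV
  · have h1 : Subsingleton (⨂[ℂ]^n (𝕍 B S)) := by
      refine ⟨fun t t' => ?_⟩
      have h0 : ∀ t : ⨂[ℂ]^n (𝕍 B S), t = 0 := by
        intro t
        induction t using PiTensorProduct.induction_on with
        | smul_tprod r f =>
          rw [(PiTensorProduct.tprod ℂ).map_coord_zero (⟨0, hn⟩ : Fin n) (Subsingleton.elim _ _),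
            smul_zero]
        | add x y hx hy => rw [hx, hy, add_zero]
      rw [h0 t, h0 t']
    have h2 : Subsingleton ((⨂[ℂ]^n (𝕍 B S)) ⊗[ℂ] IterLaurent n) := inferInstance
    exact Function.injective_of_subsingleton _
  let b := Module.finBasis ℂ H
  let σ : MvPolynomial (_ × ℕ) ℂ ≃ₗ[ℂ] 𝕍 B S := LinearEquiv.ofBijective
    (fromSymbol B S b) ⟨fromSymbol_injective b hPBW, fromSymbol_surjective B S b hS⟩
  have hσ : ∀ p, σ p = fromSymbol B S b p := fun _ => rfl
  have hσmem : ∀ {k : ℤ} {x : 𝕍 B S}, x ∈ filtration B S k → σ.symm x ∈ wFil _ k := by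
    intro k x hx
    rw [← fromSymbol_mem_iff b hPBW, ← hσ, LinearEquiv.apply_symm_apply]
    exact hx
  let c := (MvPolynomial.basisMonomials (Fin (finrank ℂ H) × ℕ) ℂ).map σ
  let T := Basis.piTensorProduct fun _ : Fin n => c
  let q := TensorProduct.equivFinsuppOfBasisLeft (N := IterLaurent n) T
  rw [injective_iff_map_eq_zero]
  intro t ht
  obtain ⟨g, rfl⟩ := q.symm.surjective t
  suffices hg : ∀ μ ∈ g.support, g μ = 0 by
    have : g = 0 := by
      ext μ : 1
      by_contra h
      exact h (hg μ (Finsupp.mem_support_iff.2 h))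
    rw [this, map_zero]
  obtain ⟨N, hN⟩ : ∃ N, ∀ μ ∈ g.support, ∀ i, ∀ a ∈ (μ i).support, a.2 < N := by
    refine ⟨g.support.sup (fun μ => univ.sup fun i => (μ i).support.sup Prod.snd) + 1,
      fun μ hμ i a ha => Nat.lt_succ_of_le ?_⟩
    exact (le_sup (f := Prod.snd) ha).trans
      ((le_sup (f := fun i => (μ i).support.sup Prod.snd) (mem_univ i)).trans
        (le_sup (f := fun μ : Fin n → _ →₀ ℕ => univ.sup fun i =>
          (μ i).support.sup Prod.snd) hμ))
  -- The coordinates of `Y(u₁, x₁) ⋯ Y(uₙ, xₙ) 𝟏` and their leading terms.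
  let φ (m : Fin (finrank ℂ H) × ℕ →₀ ℕ) : 𝕍 B S →ₗ[ℂ] ℂ :=
    MvPolynomial.lcoeff ℂ m ∘ₗ σ.symm.toLinearMap
  let E (m : Fin (finrank ℂ H) × ℕ →₀ ℕ) (μ : Fin n → Fin (finrank ℂ H) × ℕ →₀ ℕ) :
      IterLaurent n := coordSeries (φ m) (prodSeries Y (vacuum B S) n (T μ))
  let Q (μ : Fin n → Fin (finrank ℂ H) × ℕ →₀ ℕ) :=
    ∏ i, translateAt _ (n * N) (iterVar i : IterLaurent n) (monomial (μ i) 1)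
  have hlead : ∀ m : Fin (finrank ℂ H) × ℕ →₀ ℕ, (∀ a ∈ m.support, a.2 < n * N) → ∀ μ,
      HasLead (varWeight m - ∑ i, (varWeight (μ i) : ℤ)) (E m μ) ((Q μ).coeff m) := by
    intro m hm μ e
    have hE : (E m μ).coeff e = (σ.symm (prodCoeff Y (vacuum B S) n e
        fun i => fromSymbol B S b (monomial (μ i) 1))).coeff m := by
      have hT : prodSeries Y (vacuum B S) n (T μ) =
          prodSeries Y (vacuum B S) n (PiTensorProduct.tprod ℂ fun i =>
            fromSymbol B S b (monomial (μ i) 1)) := by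
        refine congrArg _ ((Basis.piTensorProduct_apply _ _).trans
          (congrArg _ (funext fun i => ?_)))
        rw [Basis.map_apply, MvPolynomial.coe_basisMonomials, hσ]
      rw [coeff_coordSeries, hT, prodSeries, PiTensorProduct.lift.tprod]
      rfl
    obtain ⟨h1, h2⟩ := symbol_prodCoeff b hY hgen hS n e
      (fun i => monomial (μ i) 1) (fun i => varWeight (μ i))
      fun i => monomial_mem_wFil le_rfl _
    have hdeg : ∑ i, ((varWeight (μ i) : ℤ) + ofLex e (toDual i)) =
        ∑ i, (varWeight (μ i) : ℤ) + totalDegree e := sum_add_distrib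
    rw [hdeg] at h1 h2
    have h3 := hσmem h2
    rw [map_sub, ← hσ, LinearEquiv.symm_apply_apply] at h3
    rw [coeff_prod_translateAt (n * N) _ hm, hE]
    have h5 : ∀ k : ℤ, ∀ p ∈ wFil (Fin (finrank ℂ H)) k, k < varWeight m → p.coeff m = 0 := by
      intro k p hp hk
      by_contra h
      have := mem_wFil.1 hp m h
      omega
    refine ⟨fun h => ?_, ?_⟩
    · have h6 := h5 _ _ h3 (by omega)
      have h7 := h5 _ _ h1 (by omega)
      rwa [MvPolynomial.coeff_sub, h7, sub_zero] at h6
    · split_ifs with h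
      · have h6 := h5 _ _ h3 (by omega)
        rw [MvPolynomial.coeff_sub, sub_eq_zero] at h6
        exact h6.symm
      · by_contra h0
        have h6 := varWeight_of_coeff_prod_ne_zero univ
          (fun i _ m' => isWeightedHomogeneous_transCoeff (μ i)) h0
        rw [hdeg] at h6
        omega
  have hsum : ∀ m, ∑ μ ∈ g.support, g μ * E m μ = 0 := by
    intro m
    have h1 := congrArg (coordSeries (φ m)) ht
    rw [TensorProduct.equivFinsuppOfBasisLeft_symm_apply, Finsupp.sum, map_sum, map_sum,
      map_zero] at h1
    rw [← h1]
    refine sum_congr rfl fun μ _ => ?_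
    exact (coordSeries_smul (φ m) (g μ) _).symm
  obtain ⟨r, hr⟩ := exists_det_ne_zero
    (fun (m : {m : Fin (finrank ℂ H) × ℕ →₀ ℕ // ∀ a ∈ m.support, a.2 < n * N})
      (μ : g.support) => (Q μ).coeff m.1) (by
    intro f hf
    let f' (μ : Fin n → Fin (finrank ℂ H) × ℕ →₀ ℕ) : IterLaurent n :=
      if h : μ ∈ g.support then f ⟨μ, h⟩ else 0
    have hf' : ∀ μ : g.support, f μ = f' μ := fun μ => by simp only [f', dif_pos μ.2]
    have h1 : ∑ μ ∈ g.support, f' μ • Q μ = 0 := by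
      have h2 : truncateVars _ _ (n * N) (∑ μ ∈ g.support, f' μ • Q μ) =
          ∑ μ ∈ g.support, f' μ • Q μ := by
        rw [map_sum]
        refine sum_congr rfl fun μ _ => ?_
        rw [map_smul, map_prod, prod_congr rfl fun i _ => truncateVars_translateAt _ _ _]
      rw [← h2]
      refine MvPolynomial.ext _ _ fun m => ?_
      rw [coeff_truncateVars]
      split_ifs with hm
      · have h3 := hf ⟨m, hm⟩
        rw [MvPolynomial.coeff_sum, MvPolynomial.coeff_zero, ← h3, ← sum_coe_sort]
        refine sum_congr rfl fun μ _ => ?_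
        rw [MvPolynomial.coeff_smul, smul_eq_mul, hf']
      · rfl
    funext μ
    rw [hf', Pi.zero_apply]
    exact prod_translateAt_linearIndependent iterVar_injective g.support hN f' h1 μ μ.2)
  have hdet := (HasLead.det (M := Matrix.of fun y x : g.support => E (r y).1 x)
    (α := fun y => varWeight (r y).1) (β := fun x => ∑ i, (varWeight (x.1 i) : ℤ))
    fun y x => hlead _ (r y).2 x).ne_zero hr
  have hzero := Matrix.eq_zero_of_mulVec_eq_zero (v := fun x : g.support => g x) hdet (by
    funext y
    rw [Pi.zero_apply, ← hsum (r y).1, ← sum_coe_sort]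
    exact sum_congr rfl fun x _ => mul_comm _ _)
  intro μ hμ
  exact congrFun hzero ⟨μ, hμ⟩

end

/-! ### Power series in a difference of variables -/

section

variable {n : ℕ}

/-- All terms of `f` have nonnegative exponents and total degree at least `N`. -/
def ConeDeg (N : ℕ) (f : IterLaurent n) : Prop :=
  ∀ e, f.coeff e ≠ 0 → (∀ i, 0 ≤ ofLex e i) ∧ (N : ℤ) ≤ totalDegree e

instance : SMulCommClass ℂ (IterLaurent n) (IterLaurent n) :=
  @Algebra.to_smulCommClass ℂ (IterLaurent n) _ _ HahnSeries.instAlgebra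

lemma ConeDeg.mul {N M : ℕ} {f g : IterLaurent n} (hf : ConeDeg N f) (hg : ConeDeg M g) :
    ConeDeg (N + M) (f * g) := by
  intro e he
  rw [HahnSeries.coeff_mul] at he
  obtain ⟨ij, hij, h⟩ := exists_ne_zero_of_sum_ne_zero he
  have hij' := (Finset.mem_antidiagonal.1 hij).2.2
  obtain ⟨h1, h2⟩ := hf _ (left_ne_zero_of_mul h)
  obtain ⟨h3, h4⟩ := hg _ (right_ne_zero_of_mul h)
  rw [← hij']
  exact ⟨fun i => add_nonneg (h1 i) (h3 i), by rw [map_add]; push_cast; omega⟩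

lemma ConeDeg.one : ConeDeg 0 (1 : IterLaurent n) := by
  intro e he
  rw [HahnSeries.coeff_one] at he
  obtain rfl : e = 0 := by by_contra h; simp [h] at he
  exact ⟨fun i => le_rfl, by simp⟩

lemma ConeDeg.pow {f : IterLaurent n} (hf : ConeDeg 1 f) (s : ℕ) : ConeDeg s (f ^ s) := by
  induction s with
  | zero => rw [pow_zero]; exact ConeDeg.one
  | succ s ih => rw [pow_succ]; exact ih.mul hf

lemma ConeDeg.mono {N M : ℕ} {f : IterLaurent n} (hf : ConeDeg N f) (h : M ≤ N) :
    ConeDeg M f := fun e he => ⟨(hf e he).1, by have := (hf e he).2; omega⟩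

/-- The difference `xᵢ - xⱼ`. -/
def iterDiff (i j : Fin n) : IterLaurent n := iterVar i - iterVar j

lemma iterDiff_ne_zero {i j : Fin n} (h : i ≠ j) : iterDiff i j ≠ 0 :=
  sub_ne_zero.2 fun h' => h (iterVar_injective h')

lemma coneDeg_iterDiff (i j : Fin n) : ConeDeg 1 (iterDiff i j) := by
  have hv : ∀ i : Fin n, ConeDeg 1 (iterVar i) := by
    intro i e he
    obtain rfl : e = toLex (Pi.single (toDual i) 1) := by
      by_contra h
      exact he (HahnSeries.coeff_single_of_ne h)
    refine ⟨fun j => ?_, le_of_eq ?_⟩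
    · have h : (0 : (Fin n)ᵒᵈ → ℤ) ≤ Pi.single (toDual i) 1 := by
        rw [Pi.single_nonneg]; exact zero_le_one
      exact h j
    · change _ = ∑ j : Fin n, (Pi.single (toDual i) 1 : (Fin n)ᵒᵈ → ℤ) (toDual j)
      rw [sum_eq_single i (fun j _ hj => Pi.single_eq_of_ne (fun h => hj h) _)
        (fun h => absurd (mem_univ _) h), Pi.single_eq_same]
      rfl
  intro e he
  by_cases h : (iterVar i).coeff e = 0
  · refine hv j e fun h' => he ?_
    rw [iterDiff, HahnSeries.coeff_sub, h, h', sub_zero]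
  · exact hv i e h

lemma ConeDeg.orderTop_pos {f : IterLaurent n} (hf : ConeDeg 1 f) : 0 < f.orderTop := by
  rcases eq_or_ne f 0 with rfl | h0
  · rw [HahnSeries.orderTop_zero]; exact WithTop.top_pos
  rw [← HahnSeries.order_eq_orderTop_of_ne_zero h0]
  obtain ⟨h1, h2⟩ := hf f.order (by rwa [HahnSeries.coeff_order_eq_zero.ne])
  have h3 : (0 : Expo n) ≤ f.order := Pi.toLex_monotone h1
  rw [WithTop.coe_pos]
  refine lt_of_le_of_ne h3 fun h => ?_
  rw [← h, map_zero] at h2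
  norm_num at h2

lemma ConeDeg.heval {δ : IterLaurent n} (hδ : ConeDeg 1 δ) (f : ℂ⟦X⟧) : ConeDeg 0 (heval δ f) := by
  intro e he
  rw [PowerSeries.coeff_heval] at he
  obtain ⟨s, hs⟩ : ∃ s, (HahnSeries.SummableFamily.powerSeriesFamily δ f).coeff e s ≠ 0 := by
    by_contra! h
    exact he (finsum_eq_zero_of_forall_eq_zero h)
  rw [HahnSeries.SummableFamily.coeff_apply,
    HahnSeries.SummableFamily.powerSeriesFamily_of_orderTop_pos hδ.orderTop_pos,
    HahnSeries.coeff_smul] at hs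
  exact ((hδ.pow s).mono (Nat.zero_le _)) e (right_ne_zero_of_smul hs)

lemma heval_eq {δ : IterLaurent n} (hδ : ConeDeg 1 δ) (f : ℂ⟦X⟧) : heval δ f = coeff 0 f • 1 +
      δ * heval δ (PowerSeries.mk fun s => coeff (s + 1) f) := by
  conv_lhs => rw [PowerSeries.eq_X_mul_shift_add_const f]
  rw [map_add, map_mul, PowerSeries.heval_X _ hδ.orderTop_pos, PowerSeries.heval_C,
    PowerSeries.coeff_zero_eq_constantCoeff_apply, add_comm]

lemma heval_injective {δ : IterLaurent n} (hδ : ConeDeg 1 δ) (h0 : δ ≠ 0) :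
    Function.Injective (heval δ : ℂ⟦X⟧ →ₐ[ℂ] IterLaurent n) := by
  rw [injective_iff_map_eq_zero]
  intro f hf
  by_contra hne
  obtain ⟨m, u, hu⟩ := IsDiscreteValuationRing.eq_unit_mul_pow_irreducible hne
    (PowerSeries.X_irreducible (R := ℂ))
  rw [hu, map_mul, map_pow, PowerSeries.heval_X _ hδ.orderTop_pos] at hf
  exact mul_ne_zero (PowerSeries.heval_unit δ u).ne_zero (pow_ne_zero _ h0) hf

lemma coeff_smul_eq_zero {N : ℕ} {h : IterLaurent n} (hh : ConeDeg N h)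
    {G : IterLaurentModule n V} {k : Expo n}
    (hG : ∀ e : Expo n, (∀ i, 0 ≤ ofLex e i) → (N : ℤ) ≤ totalDegree e →
      ((HahnModule.of ℂ).symm G).coeff (k - e) = 0) :
    ((HahnModule.of ℂ).symm (h • G)).coeff k = 0 := by
  rw [HahnModule.coeff_smul]
  refine sum_eq_zero fun ij hij => ?_
  by_cases h0 : h.coeff ij.1 = 0
  · rw [h0, zero_smul]
  · have hij' : ij.1 + ij.2 = k := ((mem_vaddAntidiagonal _ _).1 hij).2.2
    rw [← add_sub_cancel_left ij.1 ij.2, hij', hG _ (hh _ h0).1 (hh _ h0).2, smul_zero]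

lemma map_pow_smul {δ : IterLaurent n} (τ : IterLaurentModule n V →ₗ[ℂ] E)
    {t : End ℂ E} (ht : ∀ G, τ (δ • G) = t (τ G)) (s : ℕ) (G : IterLaurentModule n V) :
    τ (δ ^ s • G) = (t ^ s) (τ G) := by
  induction s with
  | zero => rw [pow_zero, pow_zero, one_smul]; rfl
  | succ s ih => rw [pow_succ', iter_succ, ← ih, ← ht, smul_smul δ (δ ^ s) G]

/-- Multiplication by `f(δ)` on `V((x₁))⋯((xₙ))` is given by the finite sums that define `pwEval`,
under any linear map that turns multiplication by `δ` into `t`. -/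
lemma coeff_heval_smul {δ : IterLaurent n} (hδ : ConeDeg 1 δ)
    (τ : IterLaurentModule n V →ₗ[ℂ] E) {t : End ℂ E} (ht : ∀ G, τ (δ • G) = t (τ G))
    {φ : E →ₗ[ℂ] V} {k : Expo n} (hφ : ∀ G, φ (τ G) = ((HahnModule.of ℂ).symm G).coeff k)
    {N : ℕ} {G : IterLaurentModule n V}
    (hG : ∀ e : Expo n, (∀ i, 0 ≤ ofLex e i) → (N : ℤ) ≤ totalDegree e →
      ((HahnModule.of ℂ).symm G).coeff (k - e) = 0) (f : ℂ⟦X⟧) :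
    pwEval t f φ (τ G) = ((HahnModule.of ℂ).symm (heval δ f • G)).coeff k := by
  have hpow : ∀ s, (t ^ s) (τ G) = τ (δ ^ s • G) := fun s => (map_pow_smul τ ht s G).symm
  rw [pwEval_eq_sum (Q := N)]
  · have key : ∀ Q (f : ℂ⟦X⟧), ∃ g : ℂ⟦X⟧, heval δ f =
        ∑ s ∈ range Q, coeff s f • δ ^ s + δ ^ Q * heval δ g := by
      intro Q
      induction Q with
      | zero => exact fun f => ⟨f, by simp⟩
      | succ Q ih =>
        intro f
        obtain ⟨g, hg⟩ := ih (PowerSeries.mk fun s => coeff (s + 1) f)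
        refine ⟨g, ?_⟩
        rw [heval_eq hδ, hg, sum_range_succ', mul_add, mul_sum, pow_zero, pow_succ']
        simp only [coeff_mk, pow_succ']
        rw [sum_congr rfl fun s _ => mul_smul_comm (coeff (s + 1) f) δ (δ ^ s)]
        ring
    obtain ⟨g, hg⟩ := key N f
    have h0 := coeff_smul_eq_zero ((hδ.pow N).mul (hδ.heval g)) hG
    rw [hg, add_smul, HahnModule.of_symm_add, HahnSeries.coeff_add, h0, add_zero, ← hφ,
      sum_smul, map_sum, map_sum]
    refine sum_congr rfl fun s _ => ?_
    rw [hpow, smul_assoc, τ.map_smul, φ.map_smul]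
  · intro s hs
    rw [hpow, hφ]
    exact coeff_smul_eq_zero ((hδ.pow s).mono hs) hG

end

/-! ### Products of two and three fields as iterated Laurent series -/

section

variable (V : Type*) [AddCommGroup V] [Module ℂ V]

/-- `V ⊗ V` as a tensor power. -/
def tensorSquare : V ⊗[ℂ] V ≃ₗ[ℂ] ⨂[ℂ]^2 V :=
  TensorProduct.congr (PiTensorProduct.subsingletonEquiv (s := fun _ => V) (0 : Fin 1)).symm
    (PiTensorProduct.subsingletonEquiv (s := fun _ => V) (0 : Fin 1)).symm ≪≫ₗ
    TensorPower.mulEquiv (R := ℂ) (M := V) (n := 1) (m := 1)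

/-- `V ⊗ V ⊗ V` as a tensor power. -/
def tensorCube : (V ⊗[ℂ] V) ⊗[ℂ] V ≃ₗ[ℂ] ⨂[ℂ]^3 V :=
  TensorProduct.congr (tensorSquare V)
    (PiTensorProduct.subsingletonEquiv (s := fun _ => V) (0 : Fin 1)).symm ≪≫ₗ
    TensorPower.mulEquiv (R := ℂ) (M := V) (n := 2) (m := 1)

variable {V}

lemma tensorSquare_tmul (x y : V) : tensorSquare V (x ⊗ₜ y) = PiTensorProduct.tprod ℂ ![x, y] := by
  rw [tensorSquare, LinearEquiv.trans_apply, TensorProduct.congr_tmul,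
    PiTensorProduct.subsingletonEquiv_symm_apply, PiTensorProduct.subsingletonEquiv_symm_apply,
    ← TensorPower.gMul_def, TensorPower.tprod_mul_tprod]
  congr 1
  funext i
  fin_cases i <;> rfl

lemma tensorCube_tmul (x y z : V) :
    tensorCube V ((x ⊗ₜ y) ⊗ₜ z) = PiTensorProduct.tprod ℂ ![x, y, z] := by
  rw [tensorCube, LinearEquiv.trans_apply, TensorProduct.congr_tmul, tensorSquare_tmul,
    PiTensorProduct.subsingletonEquiv_symm_apply, ← TensorPower.gMul_def,
    TensorPower.tprod_mul_tprod]
  congr 1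
  funext i
  fin_cases i <;> rfl

end

section

open VertexOperator

/-- The monomial `x₁ ^ k₁ ⋯ xₙ ^ kₙ`. -/
def expo {n : ℕ} (k : Fin n → ℤ) : Expo n := toLex fun i => k (ofDual i)

lemma coeff_iterVar_smul {n : ℕ} (i : Fin n) (G : IterLaurentModule n V) (k : Fin n → ℤ) :
    ((HahnModule.of ℂ).symm (iterVar i • G)).coeff (expo k) =
      ((HahnModule.of ℂ).symm G).coeff (expo (k - Pi.single i 1)) := by
  have h : expo k = (toLex (Pi.single (toDual i) 1) : Expo n) +ᵥ expo (k - Pi.single i 1) := by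
    apply ofLex.injective
    funext j
    change k (ofDual j) = (Pi.single (toDual i) 1 : (Fin n)ᵒᵈ → ℤ) j +
      (k (ofDual j) - (Pi.single i 1 : Fin n → ℤ) (ofDual j))
    have : (Pi.single (toDual i) 1 : (Fin n)ᵒᵈ → ℤ) j = (Pi.single i 1 : Fin n → ℤ) (ofDual j) := by
      by_cases hj : ofDual j = i
      · subst hj; simp
      · rw [Pi.single_eq_of_ne hj, Pi.single_eq_of_ne fun h => hj (by rw [h]; rfl)]
    rw [this]
    ring
  rw [h, iterVar, HahnModule.coeff_single_smul_vadd, one_smul]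

lemma exists_expo {n : ℕ} {e : Expo n} (he : ∀ i, 0 ≤ ofLex e i) :
    ∃ k : Fin n → ℕ, e = expo fun i => (k i : ℤ) :=
  ⟨fun i => (ofLex e (toDual i)).toNat, ofLex.injective (funext fun i =>
    (Int.toNat_of_nonneg (he i)).symm)⟩

lemma totalDegree_expo {n : ℕ} (k : Fin n → ℤ) : totalDegree (expo k) = ∑ i, k i := rfl

lemma expo_sub {n : ℕ} (k l : Fin n → ℤ) : expo k - expo l = expo (k - l) := rfl

lemma expo_surjective {n : ℕ} (e : Expo n) : ∃ k, e = expo k := ⟨fun i => ofLex e (toDual i), rfl⟩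

/-- The coefficients of `G(z₁, z₀) ∈ V((z₁))((z₀))`, indexed by modes. -/
def toDist₂ : IterLaurentModule 2 V →ₗ[ℂ] Dist₂ V where
  toFun G m n := ((HahnModule.of ℂ).symm G).coeff (expo ![-n - 1, -m - 1])
  map_add' _ _ := rfl
  map_smul' _ _ := rfl

/-- The coefficients of `G(z₂, z₁, z₀) ∈ V((z₂))((z₁))((z₀))`, indexed by modes. -/
def toDist₃ : IterLaurentModule 3 V →ₗ[ℂ] Dist₃ V where
  toFun G m n e := ((HahnModule.of ℂ).symm G).coeff (expo ![-e - 1, -n - 1, -m - 1])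
  map_add' _ _ := rfl
  map_smul' _ _ := rfl

lemma toDist₂_apply (G : IterLaurentModule 2 V) (m n : ℤ) :
    toDist₂ G m n = ((HahnModule.of ℂ).symm G).coeff (expo ![-n - 1, -m - 1]) := rfl

lemma toDist₃_apply (G : IterLaurentModule 3 V) (m n e : ℤ) :
    toDist₃ G m n e = ((HahnModule.of ℂ).symm G).coeff (expo ![-e - 1, -n - 1, -m - 1]) := rfl

lemma toDist₂_injective : Function.Injective (toDist₂ (V := V)) := by
  intro G G' h
  refine (HahnModule.of ℂ).symm.injective (HahnSeries.ext (funext fun e => ?_))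
  obtain ⟨k, rfl⟩ := expo_surjective e
  have h1 := congrFun (congrFun h (-k 1 - 1)) (-k 0 - 1)
  rw [toDist₂_apply, toDist₂_apply] at h1
  have h2 : (![-(-k 0 - 1) - 1, -(-k 1 - 1) - 1] : Fin 2 → ℤ) = k := by
    funext i; fin_cases i <;> simp
  rwa [h2] at h1

lemma toDist₃_injective : Function.Injective (toDist₃ (V := V)) := by
  intro G G' h
  refine (HahnModule.of ℂ).symm.injective (HahnSeries.ext (funext fun e => ?_))
  obtain ⟨k, rfl⟩ := expo_surjective e
  have h1 := congrFun (congrFun (congrFun h (-k 2 - 1)) (-k 1 - 1)) (-k 0 - 1)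
  rw [toDist₃_apply, toDist₃_apply] at h1
  have h2 : (![-(-k 0 - 1) - 1, -(-k 1 - 1) - 1, -(-k 2 - 1) - 1] : Fin 3 → ℤ) = k := by
    funext i; fin_cases i <;> simp
  rwa [h2] at h1

lemma toDist₂_iterDiff (G : IterLaurentModule 2 V) :
    toDist₂ (iterDiff (n := 2) 0 1 • G) = (-dif : End ℂ (Dist₂ V)) (toDist₂ G) := by
  funext m n
  rw [LinearMap.neg_apply, Pi.neg_apply, Pi.neg_apply, dif_apply, iterDiff, sub_smul, map_sub,
    Pi.sub_apply, Pi.sub_apply, neg_sub]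
  simp only [toDist₂_apply, coeff_iterVar_smul]
  congr 4 <;> funext i <;> fin_cases i <;> simp <;> ring

lemma toDist₃_iterDiff_zero_one (G : IterLaurentModule 3 V) :
    toDist₃ (iterDiff (n := 3) 0 1 • G) = (-d12 : End ℂ (Dist₃ V)) (toDist₃ G) := by
  funext m n e
  rw [LinearMap.neg_apply, Pi.neg_apply, Pi.neg_apply, Pi.neg_apply, d12_apply, iterDiff, sub_smul,
    map_sub, Pi.sub_apply, Pi.sub_apply, Pi.sub_apply, neg_sub]
  simp only [toDist₃_apply, coeff_iterVar_smul]
  congr 4 <;> funext i <;> fin_cases i <;> simp <;> ring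

lemma toDist₃_iterDiff_zero_two (G : IterLaurentModule 3 V) :
    toDist₃ (iterDiff (n := 3) 0 2 • G) = (-d02 : End ℂ (Dist₃ V)) (toDist₃ G) := by
  funext m n e
  rw [LinearMap.neg_apply, Pi.neg_apply, Pi.neg_apply, Pi.neg_apply, d02_apply, iterDiff, sub_smul,
    map_sub, Pi.sub_apply, Pi.sub_apply, Pi.sub_apply, neg_sub]
  simp only [toDist₃_apply, coeff_iterVar_smul]
  congr 4 <;> funext i <;> fin_cases i <;> simp <;> ring

lemma toDist₃_iterDiff_one_two (G : IterLaurentModule 3 V) :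
    toDist₃ (iterDiff (n := 3) 1 2 • G) = (-d01 : End ℂ (Dist₃ V)) (toDist₃ G) := by
  funext m n e
  rw [LinearMap.neg_apply, Pi.neg_apply, Pi.neg_apply, Pi.neg_apply, d01_apply, iterDiff, sub_smul,
    map_sub, Pi.sub_apply, Pi.sub_apply, Pi.sub_apply, neg_sub]
  simp only [toDist₃_apply, coeff_iterVar_smul]
  congr 4 <;> funext i <;> fin_cases i <;> simp <;> ring

lemma toDist₂_heval {G : IterLaurentModule 2 V} (h : Up2 (toDist₂ G)) (f : ℂ⟦X⟧) :
    toDist₂ (heval (iterDiff (n := 2) 0 1) f • G) = act2 f (toDist₂ G) := by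
  funext m n
  obtain ⟨Q, hQ⟩ := h m n
  refine (coeff_heval_smul (coneDeg_iterDiff (n := 2) 0 1)
    (toDist₂ (V := V)) toDist₂_iterDiff (φ := ev2 m n)
    (k := expo ![-n - 1, -m - 1]) (N := Q)
    (fun _ => rfl) (fun e he hd => ?_) f).symm
  obtain ⟨k, rfl⟩ := exists_expo he
  rw [totalDegree_expo, Fin.sum_univ_two] at hd
  rw [expo_sub]
  convert hQ (k 1) (k 0) (by omega) using 1
  rw [toDist₂_apply]
  congr 2
  funext i; fin_cases i <;> simp <;> ring

lemma toDist₃_heval {G : IterLaurentModule 3 V} (h : Up3 (toDist₃ G)) {δ : IterLaurent 3}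
    (hδ : ConeDeg 1 δ) {t : End ℂ (Dist₃ V)}
    (ht : ∀ G, toDist₃ (δ • G) = t (toDist₃ G)) (f : ℂ⟦X⟧) :
    toDist₃ (heval δ f • G) = act3 t f (toDist₃ G) := by
  funext m n e
  obtain ⟨Q, hQ⟩ := h m n e
  refine (coeff_heval_smul hδ (toDist₃ (V := V)) ht (φ := ev3 m n e)
    (k := expo ![-e - 1, -n - 1, -m - 1]) (N := Q)
    (fun _ => rfl) (fun e' he hd => ?_) f).symm
  obtain ⟨k, rfl⟩ := exists_expo he
  rw [totalDegree_expo, Fin.sum_univ_three] at hd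
  rw [expo_sub]
  convert hQ (k 2) (k 1) (k 0) (by omega) using 1
  rw [toDist₃_apply]
  congr 2
  funext i; fin_cases i <;> simp <;> ring

lemma mapZ_tmul (vac : V) (Y : V →ₗ[ℂ] VertexOperator ℂ V) (n : ℕ) (t : ⨂[ℂ]^n V)
    (f : IterLaurent n) : mapZ vac Y n (t ⊗ₜ f) = f • prodSeries Y vac n t := rfl

lemma mapZ_lTensor_mul (vac : V) (Y : V →ₗ[ℂ] VertexOperator ℂ V) (n : ℕ) (f : IterLaurent n)
    (x : (⨂[ℂ]^n V) ⊗[ℂ] IterLaurent n) :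
    mapZ vac Y n (lTensor _ (LinearMap.mulLeft ℂ f) x) = f • mapZ vac Y n x := by
  induction x using TensorProduct.induction_on with
  | zero => simp
  | tmul t g => exact mul_smul f g (prodSeries Y vac n t)
  | add x y hx hy => rw [map_add, map_add, map_add, smul_add, hx, hy]

/-- Nondegeneracy allows the cancellation of nonzero factors in `ℂ((x₁))⋯((xₙ))`. -/
lemma IsNondegenerate.eq_zero_of_smul {vac : V} {Y : V →ₗ[ℂ] VertexOperator ℂ V}
    (h : IsNondegenerate vac Y) {n : ℕ} (hn : 0 < n) {f : IterLaurent n} (hf : f ≠ 0)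
    {x : (⨂[ℂ]^n V) ⊗[ℂ] IterLaurent n} (hx : f • mapZ vac Y n x = 0) : x = 0 := by
  rw [← mapZ_lTensor_mul] at hx
  have h1 := h n hn (hx.trans (map_zero _).symm)
  refine Flat.lTensor_preserves_injective_linearMap (M := ⨂[ℂ]^n V) (LinearMap.mulLeft ℂ f)
    (mul_right_injective₀ hf) (h1.trans (map_zero _).symm)

variable {F : V →ₗ[ℂ] ℤ → End ℂ V} (hF : Trunc F)

lemma toDist₂_prodSeries (vac y x : V) :
    toDist₂ (prodSeries (ofModes F hF) vac 2 (tensorSquare V (y ⊗ₜ x))) =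
      fun m n => F y n (F x m vac) := by
  funext m n
  rw [tensorSquare_tmul, prodSeries, PiTensorProduct.lift.tprod]
  change prodCoeff (ofModes F hF) vac 2 (expo ![-n - 1, -m - 1]) ![y, x] = _
  rw [prodCoeff_apply]
  simp [expo, List.ofFn_succ, coeff_eq_ncoeff, ncoeff_ofModes]

lemma toDist₃_prodSeries (vac x y z : V) :
    toDist₃ (prodSeries (ofModes F hF) vac 3 (tensorCube V ((x ⊗ₜ y) ⊗ₜ z))) =
      fun m n e => F x e (F y n (F z m vac)) := by
  funext m n e
  rw [tensorCube_tmul, prodSeries, PiTensorProduct.lift.tprod]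
  change prodCoeff (ofModes F hF) vac 3 (expo ![-e - 1, -n - 1, -m - 1]) ![x, y, z] = _
  rw [prodCoeff_apply]
  simp [expo, List.ofFn_succ, coeff_eq_ncoeff, ncoeff_ofModes]

/-- The map `y ⊗ x ⊗ f ↦ y ⊗ x ⊗ f(x₁ - x₂)`. -/
def evalDiff : (V ⊗[ℂ] V) ⊗[ℂ] ℂ⟦X⟧ →ₗ[ℂ] (⨂[ℂ]^2 V) ⊗[ℂ] IterLaurent 2 :=
  TensorProduct.map (tensorSquare V).toLinearMap (heval (iterDiff (0 : Fin 2) 1)).toLinearMap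

lemma evalDiff_injective : Function.Injective (evalDiff (V := V)) := by
  rw [evalDiff, ← LinearMap.lTensor_comp_rTensor, LinearMap.coe_comp]
  refine (Flat.lTensor_preserves_injective_linearMap _ (heval_injective (coneDeg_iterDiff 0 1)
    (iterDiff_ne_zero (by decide)))).comp ?_
  exact Flat.rTensor_preserves_injective_linearMap _ (tensorSquare V).injective

lemma toDist₂_mapZ (vac : V) (A : (V ⊗[ℂ] V) ⊗[ℂ] ℂ⟦X⟧) :
    toDist₂ (mapZ vac (ofModes F hF) 2 (evalDiff A)) = swapDist hF hF vac A := by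
  induction A using triple_induction with
  | zero => simp
  | add A A' h h' => rw [map_add, map_add, map_add, map_add, h, h']
  | tmul y x f =>
    rw [evalDiff, TensorProduct.map_tmul, mapZ_tmul, swapDist_tmul, ← toDist₂_prodSeries hF vac y x]
    refine toDist₂_heval ?_ f
    rw [LinearEquiv.coe_coe, toDist₂_prodSeries]
    exact up2_tmul hF hF vac y x

/-- In the nondegenerate case a power of `z₀ - z₁` annihilates `∑ fᵢ(z₁ - z₀) yᵢ(z₁) xᵢ(z₀) 𝟏` only
if `∑ yᵢ ⊗ xᵢ ⊗ fᵢ = 0`. -/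
lemma eq_zero_of_dif_pow_swapDist {vac : V} (h : IsNondegenerate vac (ofModes F hF)) {k : ℕ}
    {A : (V ⊗[ℂ] V) ⊗[ℂ] ℂ⟦X⟧} (hA : (dif ^ k) (swapDist hF hF vac A) = 0) : A = 0 := by
  refine evalDiff_injective ?_
  rw [map_zero]
  refine h.eq_zero_of_smul (by norm_num) (f := iterDiff (n := 2) 0 1 ^ k)
    (pow_ne_zero k (iterDiff_ne_zero (by decide))) (toDist₂_injective ?_)
  refine (map_pow_smul (δ := iterDiff (n := 2) 0 1) (toDist₂ (V := V)) toDist₂_iterDiff k _).trans ?_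
  rw [toDist₂_mapZ, map_zero, neg_dif_pow_eq, hA, smul_zero]

end

/-! ### The braiding operator -/

lemma Up2.flip2 {c : Dist₂ U} (h : Up2 c) : Up2 (flip2 c) := by
  intro m n
  obtain ⟨Q, hQ⟩ := h n m
  exact ⟨Q, fun i j hij => hQ j i (by omega)⟩

lemma dif_pow_flip2 (k : ℕ) (c : Dist₂ U) :
    (dif ^ k) (flip2 c) = (-1 : ℂ) ^ k • flip2 ((dif ^ k) c) := by
  induction k generalizing c with
  | zero => simp
  | succ k ih =>
    have h : dif (flip2 c) = (-1 : ℂ) • flip2 (dif c) := by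
      rw [flip2_dif, LinearMap.neg_apply, smul_neg, neg_one_smul, neg_neg]
    rw [pow_succ, End.mul_apply, h, map_smul, ih, smul_smul, pow_succ, End.mul_apply, mul_comm]

lemma flip2_act2 (f : ℂ⟦X⟧) (c : Dist₂ U) : flip2 (act2 f c) = act2 (evalNegHom f) (flip2 c) := by
  funext m n
  rw [← pwEval_dif_flip, flip2_apply]
  refine finsum_congr fun s => ?_
  rw [evalNegHom, PowerSeries.coeff_rescale, neg_dif_pow_eq, map_smul, smul_smul, mul_comm]

section

variable {F : 𝕍 B S →ₗ[ℂ] ℤ → End ℂ (𝕍 B S)} (hF : IsVertexMap B S F)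

include hF

/-- `A = ∑ vᵢ ⊗ uᵢ ⊗ fᵢ` exchanges `u` and `v`: after multiplication by a power of `z₀ - z₁`, the
products `u(z₀) v(z₁)` and `∑ fᵢ(z₁ - z₀) vᵢ(z₁) uᵢ(z₀)` agree. -/
def Exchanges (u v : 𝕍 B S) (A : (𝕍 B S ⊗[ℂ] 𝕍 B S) ⊗[ℂ] ℂ⟦X⟧) : Prop :=
  ∃ k, ∀ w, (dif ^ k) (fieldCorr F u v w) = (dif ^ k) (swapDist hF.trunc hF.trunc w A)

variable {hF}

lemma Exchanges.add {u v u' v' u'' v'' : 𝕍 B S} {A A' : (𝕍 B S ⊗[ℂ] 𝕍 B S) ⊗[ℂ] ℂ⟦X⟧}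
    (h : Exchanges hF u v A) (h' : Exchanges hF u' v' A')
    (hadd : ∀ w, fieldCorr F u'' v'' w = fieldCorr F u v w + fieldCorr F u' v' w) :
    Exchanges hF u'' v'' (A + A') := by
  obtain ⟨k, hk⟩ := h
  obtain ⟨k', hk'⟩ := h'
  refine ⟨max k k', fun w => ?_⟩
  rw [hadd, map_add, map_add, map_add, dif_pow_congr (le_max_left k k') (hk w),
    dif_pow_congr (le_max_right k k') (hk' w)]

lemma Exchanges.smul {u v u'' v'' : 𝕍 B S} {A : (𝕍 B S ⊗[ℂ] 𝕍 B S) ⊗[ℂ] ℂ⟦X⟧} (r : ℂ)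
    (h : Exchanges hF u v A) (hsmul : ∀ w, fieldCorr F u'' v'' w = r • fieldCorr F u v w) :
    Exchanges hF u'' v'' (r • A) := by
  obtain ⟨k, hk⟩ := h
  refine ⟨k, fun w => ?_⟩
  rw [hsmul, map_smul, map_smul, map_smul, hk w]

variable (hnd : IsNondegenerate (vacuum B S) (ofModes F hF.trunc))

include hnd

lemma eq_of_dif_pow_swapDist {k : ℕ} {A A' : (𝕍 B S ⊗[ℂ] 𝕍 B S) ⊗[ℂ] ℂ⟦X⟧}
    (h : (dif ^ k) (swapDist hF.trunc hF.trunc (vacuum B S) A) =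
      (dif ^ k) (swapDist hF.trunc hF.trunc (vacuum B S) A')) : A = A' :=
  sub_eq_zero.1 (eq_zero_of_dif_pow_swapDist hF.trunc hnd (k := k) (by
    rw [map_sub, map_sub, h, sub_self]))

lemma Exchanges.unique {u v : 𝕍 B S} {A A' : (𝕍 B S ⊗[ℂ] 𝕍 B S) ⊗[ℂ] ℂ⟦X⟧}
    (h : Exchanges hF u v A) (h' : Exchanges hF u v A') : A = A' := by
  obtain ⟨k, hk⟩ := h
  obtain ⟨k', hk'⟩ := h'
  refine eq_of_dif_pow_swapDist (hF := hF) hnd (k := max k k') ?_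
  rw [← dif_pow_congr (le_max_left k k') (hk _), ← dif_pow_congr (le_max_right k k') (hk' _)]

lemma exists_braiding : ∃ R : 𝕍 B S ⊗[ℂ] 𝕍 B S →ₗ[ℂ] (𝕍 B S ⊗[ℂ] 𝕍 B S) ⊗[ℂ] ℂ⟦X⟧,
      ∀ u v, Exchanges hF u v (R (v ⊗ₜ u)) := by
  choose k A hA using exists_swap hF
  have hA' : ∀ u v, Exchanges hF u v (A u v) := fun u v => ⟨k u v, hA u v⟩
  refine ⟨TensorProduct.lift (LinearMap.mk₂ ℂ (fun v u => A u v) ?_ ?_ ?_ ?_), hA'⟩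
  · exact fun v v' u => (hA' _ _).unique hnd ((hA' u v).add (hA' u v') fun w => by
      funext m n; simp [fieldCorr])
  · exact fun r v u => (hA' _ _).unique hnd ((hA' u v).smul r fun w => by
      funext m n; simp [fieldCorr])
  · exact fun v u u' => (hA' _ _).unique hnd ((hA' u v).add (hA' u' v) fun w =>
      fieldCorr_add F u u' v w)
  · exact fun r v u => (hA' _ _).unique hnd ((hA' u v).smul r fun w => fieldCorr_smul F r u v w)

/-- The inverse relation of the braiding operator `R`: if `R (v ⊗ u) = ∑ βᵢ ⊗ αᵢ ⊗ fᵢ(x)` then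
`u ⊗ v = ∑ fᵢ(-x) R (αᵢ ⊗ βᵢ)`, because exchanging twice gives back `u(z₀) v(z₁)`. -/
lemma braiding_unitary {R : 𝕍 B S ⊗[ℂ] 𝕍 B S →ₗ[ℂ] (𝕍 B S ⊗[ℂ] 𝕍 B S) ⊗[ℂ] ℂ⟦X⟧}
    (hR : ∀ u v, Exchanges hF u v (R (v ⊗ₜ u))) {u v : 𝕍 B S} {r : ℕ}
    {β α : Fin r → 𝕍 B S} {f : Fin r → ℂ⟦X⟧}
    (h : R (v ⊗ₜ u) = ∑ i, (β i ⊗ₜ α i) ⊗ₜ f i) :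
    (u ⊗ₜ v) ⊗ₜ 1 = ∑ i, lTensor (𝕍 B S ⊗[ℂ] 𝕍 B S)
      (LinearMap.mulLeft ℂ (evalNegHom (f i))) (R (α i ⊗ₜ β i)) := by
  obtain ⟨k, hk⟩ := hR u v
  choose l hl using fun i => hR (β i) (α i)
  set K := k + ∑ i, l i with hK
  have hkK : k ≤ K := Nat.le_add_right _ _
  have hlK : ∀ i, l i ≤ K := fun i =>
    (single_le_sum (fun _ _ => Nat.zero_le _) (mem_univ i)).trans (Nat.le_add_left _ _)
  refine eq_of_dif_pow_swapDist (hF := hF) hnd (k := K) ?_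
  have hup : ∀ i, Up2 (fieldCorr F (β i) (α i) (vacuum B S)) := fun i =>
    (up2_tmul hF.trunc hF.trunc (vacuum B S) (β i) (α i)).flip2
  have e1 : swapDist hF.trunc hF.trunc (vacuum B S) ((u ⊗ₜ v) ⊗ₜ 1) =
      flip2 (fieldCorr F u v (vacuum B S)) := swapDist_tmul_one _ _ _ _ _
  rw [e1, dif_pow_flip2, dif_pow_congr hkK (hk _), ← dif_pow_flip2, h, map_sum, map_sum, map_sum,
    map_sum, map_sum]
  refine sum_congr rfl fun i _ => ?_
  rw [swapDist_tmul, flip2_act2, ← act2_swapDist, dif_pow_act2 (up2_swapDist _ _ _ _),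
    ← dif_pow_congr (hlK i) (hl i _), ← dif_pow_act2 (hup i)]
  rfl

end

/-! ### The hexagon of exchanges for three fields -/

/-- Multiplication by `(z₀ - z₁) (z₀ - z₂) (z₁ - z₂)`. -/
def triDif : End ℂ (Dist₃ U) := d01 * (d02 * d12)

/-- Equality of distributions in three variables up to multiplication by powers of the differences
of the variables. -/
def TripleRel (c c' : Dist₃ U) : Prop := ∃ k, (triDif ^ k) c = (triDif ^ k) c'

lemma triDif_pow_congr {k l : ℕ} (hkl : k ≤ l) {c c' : Dist₃ U}
    (h : (triDif ^ k) c = (triDif ^ k) c') : (triDif ^ l) c = (triDif ^ l) c' := by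
  rw [← Nat.sub_add_cancel hkl, pow_add, End.mul_apply, End.mul_apply, h]

lemma TripleRel.symm {c c' : Dist₃ U} (h : TripleRel c c') : TripleRel c' c :=
  h.imp fun _ => Eq.symm

lemma TripleRel.trans {c c' c'' : Dist₃ U} (h : TripleRel c c') (h' : TripleRel c' c'') :
    TripleRel c c'' := by
  obtain ⟨k, hk⟩ := h
  obtain ⟨k', hk'⟩ := h'
  exact ⟨max k k', (triDif_pow_congr (le_max_left _ _) hk).trans
    (triDif_pow_congr (le_max_right _ _) hk')⟩

lemma TripleRel.sum {r : ℕ} {c c' : Fin r → Dist₃ U} (h : ∀ i, TripleRel (c i) (c' i)) :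
    TripleRel (∑ i, c i) (∑ i, c' i) := by
  choose k hk using h
  refine ⟨∑ i, k i, ?_⟩
  rw [map_sum, map_sum]
  exact sum_congr rfl fun i _ => triDif_pow_congr
    (single_le_sum (fun _ _ => Nat.zero_le _) (mem_univ i)) (hk i)

lemma TripleRel.of_factor {s t : End ℂ (Dist₃ U)} (hst : Commute s t)
    (h : triDif = s * t) {k : ℕ} {c c' : Dist₃ U} (hc : (t ^ k) c = (t ^ k) c') :
    TripleRel c c' := ⟨k, by rw [h, hst.mul_pow, End.mul_apply, End.mul_apply, hc]⟩

lemma TripleRel.of_d12 {k : ℕ} {c c' : Dist₃ U}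
    (h : ∀ m, (dif ^ k) (c m) = (dif ^ k) (c' m)) : TripleRel c c' := by
  refine .of_factor (s := d01 * d02) (t := d12) (commute_d01_d12.mul_left commute_d02_d12)
    (mul_assoc _ _ _).symm (k := k) ?_
  funext m
  rw [d12_pow_apply, d12_pow_apply, h m]

lemma TripleRel.of_d02 {k : ℕ} {c c' : Dist₃ U}
    (h : ∀ n, (dif ^ k) (fun m e => c m n e) = (dif ^ k) (fun m e => c' m n e)) :
    TripleRel c c' := by
  refine .of_factor (s := d01 * d12) (t := d02) (commute_d01_d02.mul_left commute_d02_d12.symm)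
    (by rw [triDif, commute_d02_d12.eq, mul_assoc]) (k := k) ?_
  funext m n e
  rw [d02_pow_apply, d02_pow_apply, h n]

lemma TripleRel.of_d01 {k : ℕ} {c c' : Dist₃ U}
    (h : ∀ e, (dif ^ k) (fun m n => c m n e) = (dif ^ k) (fun m n => c' m n e)) :
    TripleRel c c' := by
  have hc : Commute (d01 : End ℂ (Dist₃ U)) (d02 * d12) :=
    commute_d01_d02.mul_right commute_d01_d12
  refine .of_factor (s := d02 * d12) (t := d01) hc.symm hc.eq (k := k) ?_
  funext m n e
  rw [d01_pow_apply, d01_pow_apply, h e]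

/-- The operators of multiplication by differences of the variables commute. -/
structure IsDifShift (t : End ℂ (Dist₃ U)) : Prop where
  isShift : IsShift t
  commute_d01 : Commute t d01
  commute_d02 : Commute t d02
  commute_d12 : Commute t d12

lemma isDifShift_d01 : IsDifShift (-d01 : End ℂ (Dist₃ U)) :=
  ⟨isShift_neg_d01, commute_neg_d01_d01, commute_neg_d01_d02, commute_neg_d01_d12⟩

lemma isDifShift_d02 : IsDifShift (-d02 : End ℂ (Dist₃ U)) :=
  ⟨isShift_neg_d02, commute_neg_d02_d01, Commute.neg_left (R := End ℂ (Dist₃ U)) (Commute.refl d02),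
    commute_neg_d02_d12⟩

lemma isDifShift_d12 : IsDifShift (-d12 : End ℂ (Dist₃ U)) :=
  ⟨isShift_neg_d12, commute_neg_d12_d01, commute_neg_d12_d02,
    Commute.neg_left (R := End ℂ (Dist₃ U)) (Commute.refl d12)⟩

lemma TripleRel.act3 {t : End ℂ (Dist₃ U)} (ht : IsDifShift t) (f : ℂ⟦X⟧)
    {c c' : Dist₃ U} (hc : Up3 c) (hc' : Up3 c') (h : TripleRel c c') :
    TripleRel (act3 t f c) (act3 t f c') := by
  have key : ∀ k, ∀ c : Dist₃ U, Up3 c →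
      Up3 ((triDif ^ k) c) ∧ (triDif ^ k) (QVA.act3 t f c) = QVA.act3 t f ((triDif ^ k) c) := by
    intro k c hc
    induction k with
    | zero => exact ⟨hc, rfl⟩
    | succ k ih =>
      have hs : ∀ c : Dist₃ U, (triDif ^ (k + 1)) c = d01 (d02 (d12 ((triDif ^ k) c))) := by
        intro c; rw [pow_succ']; rfl
      rw [hs, hs, ih.2, d12_act3 ht.isShift ht.commute_d12 ih.1,
        d02_act3 ht.isShift ht.commute_d02 ih.1.d12,
        d01_act3 ht.isShift ht.commute_d01 ih.1.d12.d02]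
      exact ⟨ih.1.d12.d02.d01, rfl⟩
  obtain ⟨k, hk⟩ := h
  exact ⟨k, by rw [(key k c hc).2, (key k c' hc').2, hk]⟩

section

variable {F : V →ₗ[ℂ] ℤ → End ℂ V} (hF : Trunc F)

include hF

/-- Products of three fields are lower truncated, whatever the order of the variables. -/
lemma up3_fields (x y z w : V) :
    (Up3 fun m n e => F x m (F y e (F z n w))) ∧ (Up3 fun m n e => F x e (F y m (F z n w))) ∧
    (Up3 fun m n e => F x n (F y m (F z e w))) ∧ (Up3 fun m n e => F x n (F y e (F z m w))) ∧
    (Up3 fun m n e => F x e (F y n (F z m w))) := by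
  obtain ⟨N, hN⟩ := hF z w
  have hy : ∀ i, ∃ N, ∀ j, N ≤ j → F y j (F z i w) = 0 := fun i => hF y _
  have hx : ∀ i j, ∃ N, ∀ l, N ≤ l → F x l (F y j (F z i w)) = 0 := fun i j => hF x _
  have h1 : ∀ i j l, N ≤ i → F x l (F y j (F z i w)) = 0 := fun i j l h => by
    rw [hN i h, map_zero, map_zero]
  have h2 : ∀ i, ∃ N, ∀ j, N ≤ j → ∀ l, F x l (F y j (F z i w)) = 0 := fun i =>
    (hy i).imp fun N h j hj l => by rw [h j hj, map_zero]
  have h3 : Up3 fun m n e => F x e (F y m (F z n w)) :=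
    .of_nested_snd ⟨N, fun i h _ _ => h1 i _ _ h⟩ h2 hx
  exact ⟨.of_nested_snd' ⟨N, fun i h _ _ => h1 i _ _ h⟩ h2 hx, h3,
    .of_nested ⟨N, fun i h _ _ => h1 i _ _ h⟩ h2 hx,
    .of_nested_fst ⟨N, fun i h _ _ => h1 i _ _ h⟩ h2 hx, h3.swap01⟩

lemma toDist₃_sum_heval {δ : IterLaurent 3} (hδ : ConeDeg 1 δ)
    {t : End ℂ (Dist₃ V)} (hs : IsShift t)
    (ht : ∀ G, toDist₃ (δ • G) = t (toDist₃ G)) {r : ℕ} (f : Fin r → ℂ⟦X⟧)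
    {G : Fin r → IterLaurentModule 3 V} {c : Fin r → Dist₃ V}
    (h : ∀ i, Up3 (c i) ∧ toDist₃ (G i) = c i) :
    Up3 (∑ i, act3 t (f i) (c i)) ∧
      toDist₃ (∑ i, heval δ (f i) • G i) = ∑ i, act3 t (f i) (c i) := by
  refine ⟨Up3.sum fun i _ => (h i).1.act3 hs (f i), ?_⟩
  rw [map_sum]
  refine sum_congr rfl fun i _ => ?_
  rw [toDist₃_heval (by rw [(h i).2]; exact (h i).1) hδ ht, (h i).2]

end

section

variable {F : 𝕍 B S →ₗ[ℂ] ℤ → End ℂ (𝕍 B S)} {hF : IsVertexMap B S F}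
  {x y : 𝕍 B S} {r : ℕ} {β α : Fin r → 𝕍 B S} {f : Fin r → ℂ⟦X⟧}

lemma Exchanges.apply (h : Exchanges hF x y (∑ i, (β i ⊗ₜ α i) ⊗ₜ f i)) :
    ∃ k, ∀ (φ : End ℂ (𝕍 B S)) z, (dif ^ k) (fun a b => φ (F x a (F y b z))) =
        (dif ^ k) (∑ i, act2 (f i) fun a b => φ (F (β i) b (F (α i) a z))) := by
  obtain ⟨k, hk⟩ := h
  refine ⟨k, fun φ z => ?_⟩
  have e1 : (∑ i, act2 (f i) fun a b => φ (F (β i) b (F (α i) a z))) =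
      fun a b => φ (swapDist hF.trunc hF.trunc z (∑ i, (β i ⊗ₜ α i) ⊗ₜ f i) a b) := by
    funext a b
    rw [map_sum, Finset.sum_apply, Finset.sum_apply, Finset.sum_apply, Finset.sum_apply, map_sum]
    refine sum_congr rfl fun i _ => ?_
    rw [act2_map (f i) (up2_tmul hF.trunc hF.trunc z (β i) (α i)), swapDist_tmul]
  rw [e1, dif_pow_map k (swapDist hF.trunc hF.trunc z _) φ, ← hk z,
    ← dif_pow_map k (fieldCorr F x y z) φ]
  rfl

variable (h : Exchanges hF x y (∑ i, (β i ⊗ₜ α i) ⊗ₜ f i)) (φ : ℤ → End ℂ (𝕍 B S)) (z : ℤ → 𝕍 B S)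

include h

lemma Exchanges.tripleRel_d12 : TripleRel (fun m n e => φ m (F x n (F y e (z m))))
    (∑ i, act3 (-d12) (f i) fun m n e => φ m (F (β i) e (F (α i) n (z m)))) := by
  obtain ⟨k, hk⟩ := h.apply
  refine .of_d12 (k := k) fun m => ?_
  rw [hk, Finset.sum_apply]
  refine congrArg _ (sum_congr rfl fun i _ => ?_)
  rw [act3_neg_d12]

lemma Exchanges.tripleRel_d02 : TripleRel (fun m n e => φ n (F x m (F y e (z n))))
    (∑ i, act3 (-d02) (f i) fun m n e => φ n (F (β i) e (F (α i) m (z n)))) := by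
  obtain ⟨k, hk⟩ := h.apply
  refine .of_d02 (k := k) fun n => (hk _ _).trans (congrArg _ ?_)
  funext m e
  simp only [Finset.sum_apply, act3_neg_d02]

lemma Exchanges.tripleRel_d01 : TripleRel (fun m n e => φ e (F x m (F y n (z e))))
    (∑ i, act3 (-d01) (f i) fun m n e => φ e (F (β i) n (F (α i) m (z e)))) := by
  obtain ⟨k, hk⟩ := h.apply
  refine .of_d01 (k := k) fun e => (hk _ _).trans (congrArg _ ?_)
  funext m n
  simp only [Finset.sum_apply, act3_neg_d01]

end

section

variable {F : 𝕍 B S →ₗ[ℂ] ℤ → End ℂ (𝕍 B S)} {hF : IsVertexMap B S F}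

lemma IsNondegenerate.eq_of_tripleRel {vac : V}
    {Y : V →ₗ[ℂ] VertexOperator ℂ V} (hnd : IsNondegenerate vac Y)
    {x x' : ((V ⊗[ℂ] V) ⊗[ℂ] V) ⊗[ℂ] IterLaurent 3}
    (h : TripleRel (toDist₃ (mapZ vac Y 3 (LinearMap.rTensor _ (tensorCube V).toLinearMap x)))
      (toDist₃ (mapZ vac Y 3 (LinearMap.rTensor _ (tensorCube V).toLinearMap x')))) : x = x' := by
  obtain ⟨k, hk⟩ := h
  have ht : ∀ G : IterLaurentModule 3 V,
      toDist₃ ((-(iterDiff (n := 3) 1 2 * (iterDiff 0 2 * iterDiff 0 1))) • G) =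
        triDif (toDist₃ G) := by
    intro G
    rw [neg_smul, ← smul_smul (iterDiff 1 2), ← smul_smul (iterDiff 0 2), map_neg,
      toDist₃_iterDiff_one_two, toDist₃_iterDiff_zero_two, toDist₃_iterDiff_zero_one]
    simp only [LinearMap.neg_apply, map_neg, neg_neg]
    rfl
  have h0 : (-(iterDiff 1 2 * (iterDiff 0 2 * iterDiff 0 1)) : IterLaurent 3) ^ k ≠ 0 :=
    pow_ne_zero k (neg_ne_zero.2 (mul_ne_zero (iterDiff_ne_zero (by decide))
      (mul_ne_zero (iterDiff_ne_zero (by decide)) (iterDiff_ne_zero (by decide)))))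
  rw [← sub_eq_zero]
  refine Flat.rTensor_preserves_injective_linearMap (M := IterLaurent 3)
    (tensorCube V).toLinearMap (tensorCube V).injective
    ((hnd.eq_zero_of_smul (by norm_num) h0 (toDist₃_injective ?_)).trans (map_zero _).symm)
  refine (map_pow_smul (toDist₃ (V := V)) ht k _).trans ?_
  rw [map_sub, map_sub, map_sub, map_sub, map_zero, hk, sub_self]

lemma mapZ_sum (vac : V)
    (Y : V →ₗ[ℂ] VertexOperator ℂ V) {p : ℕ} {q : Fin p → ℕ} {s : ∀ i, Fin (q i) → ℕ}
    (x : ∀ i j, Fin (s i j) → (V ⊗[ℂ] V) ⊗[ℂ] V) (a : Fin p → IterLaurent 3)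
    (b : ∀ i, Fin (q i) → IterLaurent 3) (c : ∀ i j, Fin (s i j) → IterLaurent 3) :
    mapZ vac Y 3 (LinearMap.rTensor _ (tensorCube V).toLinearMap
      (∑ i, ∑ j, ∑ k, x i j k ⊗ₜ (a i * (b i j * c i j k)))) =
    ∑ i, a i • ∑ j, b i j • ∑ k, c i j k • prodSeries Y vac 3 (tensorCube V (x i j k)) := by
  simp only [map_sum, smul_sum]
  refine sum_congr rfl fun i _ => sum_congr rfl fun j _ =>
    sum_congr rfl fun k _ => ?_
  rw [rTensor_tmul, mapZ_tmul, LinearEquiv.coe_coe, smul_smul (b i j), smul_smul (a i)]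

variable (hnd : IsNondegenerate (vacuum B S) (ofModes F hF.trunc)) {r : 𝕍 B S → 𝕍 B S → ℕ}
  {β α : ∀ x y, Fin (r x y) → 𝕍 B S} {f : ∀ x y, Fin (r x y) → ℂ⟦X⟧}
  (hR : ∀ x y, Exchanges hF y x (∑ i, (β x y i ⊗ₜ α x y i) ⊗ₜ f x y i))

include hnd hR

/-- Reversing `u(z₀) v(z₁) w(z₂) 𝟏` by exchanges of neighbouring fields in the two possible orders
gives the same result. -/
lemma hexagon (w v u : 𝕍 B S) :
    ∑ i, ∑ j, ∑ k, ((β (β w v i) u j ⊗ₜ[ℂ] β (α w v i) (α (β w v i) u j) k) ⊗ₜ[ℂ]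
        α (α w v i) (α (β w v i) u j) k) ⊗ₜ[ℂ]
      (heval (iterDiff (n := 3) 0 1) (f w v i) * (heval (iterDiff (n := 3) 0 2) (f (β w v i) u j) *
          heval (iterDiff (n := 3) 1 2) (f (α w v i) (α (β w v i) u j) k))) =
    ∑ i, ∑ j, ∑ k, ((β (β w (α v u i) j) (β v u i) k ⊗ₜ[ℂ] α (β w (α v u i) j) (β v u i) k) ⊗ₜ[ℂ]
        α w (α v u i) j) ⊗ₜ[ℂ]
      (heval (iterDiff (n := 3) 1 2) (f v u i) * (heval (iterDiff (n := 3) 0 2) (f w (α v u i) j) *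
          heval (iterDiff (n := 3) 0 1) (f (β w (α v u i) j) (β v u i) k))) := by
  have up := fun x y z => up3_fields hF.trunc x y z (vacuum B S)
  have hZ : ∀ x y z, Up3 (fun m n e => F x e (F y n (F z m (vacuum B S)))) ∧
      toDist₃ (prodSeries (ofModes F hF.trunc) (vacuum B S) 3 (tensorCube _ ((x ⊗ₜ y) ⊗ₜ z))) =
        fun m n e => F x e (F y n (F z m (vacuum B S))) := fun x y z =>
    ⟨(up x y z).2.2.2.2, toDist₃_prodSeries hF.trunc _ x y z⟩
  have s01 := fun {r : ℕ} => toDist₃_sum_heval (r := r) hF.trunc (coneDeg_iterDiff 1 2)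
    isShift_neg_d01 toDist₃_iterDiff_one_two
  have s02 := fun {r : ℕ} => toDist₃_sum_heval (r := r) hF.trunc (coneDeg_iterDiff 0 2)
    isShift_neg_d02 toDist₃_iterDiff_zero_two
  have s12 := fun {r : ℕ} => toDist₃_sum_heval (r := r) hF.trunc (coneDeg_iterDiff 0 1)
    isShift_neg_d12 toDist₃_iterDiff_zero_one
  refine hnd.eq_of_tripleRel ?_
  rw [mapZ_sum, mapZ_sum]
  refine TripleRel.trans (c' := fun m n e => F u m (F v n (F w e (vacuum B S)))) (.symm ?_) ?_
  · have a3 := fun i j => s01 (f (α w v i) (α (β w v i) u j)) fun k =>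
      hZ (β (β w v i) u j) (β (α w v i) (α (β w v i) u j) k) (α (α w v i) (α (β w v i) u j) k)
    have a2 := fun i => s02 (f (β w v i) u) fun j => a3 i j
    rw [(s12 (f w v) a2).2]
    refine ((hR w v).tripleRel_d12 (F u) fun _ => vacuum B S).trans (.sum fun i =>
      .act3 isDifShift_d12 _ (up u _ _).1 (a2 i).1 ?_)
    refine ((hR (β w v i) u).tripleRel_d02 (fun _ => 1) fun n => F (α w v i) n (vacuum B S)).trans
      (.sum fun j => .act3 isDifShift_d02 _ (up _ _ _).2.1 (a3 i j).1 ?_)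
    exact (hR (α w v i) (α (β w v i) u j)).tripleRel_d01 (F (β (β w v i) u j)) fun _ => vacuum B S
  · have a3 := fun i j => s12 (f (β w (α v u i) j) (β v u i)) fun k =>
      hZ (β (β w (α v u i) j) (β v u i) k) (α (β w (α v u i) j) (β v u i) k) (α w (α v u i) j)
    have a2 := fun i => s02 (f w (α v u i)) fun j => a3 i j
    rw [(s01 (f v u) a2).2]
    refine ((hR v u).tripleRel_d01 (fun _ => 1) fun e => F w e (vacuum B S)).trans (.sum fun i =>
      .act3 isDifShift_d01 _ (up _ _ w).2.2.1 (a2 i).1 ?_)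
    refine ((hR w (α v u i)).tripleRel_d02 (F (β v u i)) fun n => vacuum B S).trans
      (.sum fun j => .act3 isDifShift_d02 _ (up _ _ _).2.2.2.1 (a3 i j).1 ?_)
    exact (hR (β w (α v u i) j) (β v u i)).tripleRel_d12 (fun _ => 1) fun m =>
      F (α w (α v u i) j) m (vacuum B S)

end

/-! ### Restriction of power series in the differences to `ℂ((x))((z))` -/

section

instance : RightDistribClass LaurentXZ := @Distrib.rightDistribClass LaurentXZ _

/-- All terms of `ξ` have nonnegative exponents and total degree at least `N`. -/
def QuadrantDeg (N : ℕ) (ξ : LaurentXZ) : Prop :=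
  ∀ t s, (ξ.coeff t).coeff s ≠ 0 → 0 ≤ s ∧ 0 ≤ t ∧ (N : ℤ) ≤ s + t

lemma QuadrantDeg.mul {N M : ℕ} {ξ η : LaurentXZ} (hξ : QuadrantDeg N ξ)
    (hη : QuadrantDeg M η) : QuadrantDeg (N + M) (ξ * η) := by
  intro t s h
  rw [HahnSeries.coeff_mul, HahnSeries.coeff_sum] at h
  obtain ⟨ij, hij, h⟩ := exists_ne_zero_of_sum_ne_zero h
  rw [HahnSeries.coeff_mul] at h
  obtain ⟨kl, hkl, h⟩ := exists_ne_zero_of_sum_ne_zero h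
  have hij' := (Finset.mem_antidiagonal.1 hij).2.2
  have hkl' := (Finset.mem_antidiagonal.1 hkl).2.2
  have h1 := hξ _ _ (left_ne_zero_of_mul h)
  have h2 := hη _ _ (right_ne_zero_of_mul h)
  push_cast
  omega

lemma QuadrantDeg.add {N : ℕ} {ξ η : LaurentXZ} (hξ : QuadrantDeg N ξ) (hη : QuadrantDeg N η) :
    QuadrantDeg N (ξ + η) := by
  intro t s h
  by_cases h0 : (ξ.coeff t).coeff s = 0
  · refine hη t s fun h1 => h ?_
    rw [HahnSeries.coeff_add, HahnSeries.coeff_add, h0, h1, add_zero]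
  · exact hξ t s h0

lemma QuadrantDeg.sub {N : ℕ} {ξ η : LaurentXZ} (hξ : QuadrantDeg N ξ) (hη : QuadrantDeg N η) :
    QuadrantDeg N (ξ - η) := by
  intro t s h
  by_cases h0 : (ξ.coeff t).coeff s = 0
  · refine hη t s fun h1 => h ?_
    rw [HahnSeries.coeff_sub, HahnSeries.coeff_sub, h0, h1, sub_zero]
  · exact hξ t s h0

lemma eq_zero_of_quadrantDeg {ξ : LaurentXZ} (h : ∀ N, QuadrantDeg N ξ) : ξ = 0 := by
  ext t s
  by_contra h0
  obtain ⟨h1, h2, -⟩ := h 0 t s h0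
  have := (h (s + t + 1).toNat t s h0).2.2
  omega

/-- The variable `x`. -/
def varX : LaurentXZ := HahnSeries.single 0 (HahnSeries.single 1 1)

/-- The variable `z`. -/
def varZ : LaurentXZ := HahnSeries.single 1 1

lemma coeff_varX_mul (ξ : LaurentXZ) (t s : ℤ) :
    ((varX * ξ).coeff t).coeff s = (ξ.coeff t).coeff (s - 1) := by
  rw [varX, coeff_single_mul, sub_zero, coeff_single_mul, one_mul]

lemma coeff_varZ_mul (ξ : LaurentXZ) (t s : ℤ) :
    ((varZ * ξ).coeff t).coeff s = (ξ.coeff (t - 1)).coeff s := by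
  rw [varZ, coeff_single_mul, one_mul]

lemma quadrantDeg_varX : QuadrantDeg 1 varX := by
  intro t s h
  rw [← mul_one varX, coeff_varX_mul, HahnSeries.coeff_one] at h
  by_cases ht : t = 0
  · rw [if_pos ht, HahnSeries.coeff_one] at h
    by_cases hs : s - 1 = 0
    · omega
    · exact absurd (if_neg hs) h
  · rw [if_neg ht] at h
    exact absurd rfl h

lemma quadrantDeg_varZ : QuadrantDeg 1 varZ := by
  intro t s h
  rw [← mul_one varZ, coeff_varZ_mul, HahnSeries.coeff_one] at h
  by_cases ht : t - 1 = 0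
  · rw [if_pos ht, HahnSeries.coeff_one] at h
    by_cases hs : s = 0
    · omega
    · exact absurd (if_neg hs) h
  · rw [if_neg ht] at h
    exact absurd rfl h

/-- The power series `∑ c_{s,t} x ^ s z ^ t`. -/
def quadrantSeries (c : ℕ → ℕ → ℂ) : LaurentXZ :=
  ofPowerSeries ℤ (LaurentSeries ℂ)
    (PowerSeries.mk fun t => powerToLaurent (PowerSeries.mk fun s => c s t))

lemma coeff_ofPowerSeries_of_neg {R : Type*} [CommRing R] (f : PowerSeries R) {s : ℤ}
    (hs : s < 0) : (ofPowerSeries ℤ R f).coeff s = 0 := by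
  rw [HahnSeries.ofPowerSeries_apply]
  apply HahnSeries.embDomain_of_notMem_range
  rintro ⟨k, hk⟩
  have : ((k : ℕ) : ℤ) = s := hk
  omega

lemma coeff_quadrantSeries {c : ℕ → ℕ → ℂ} {d : ℤ → ℤ → ℂ} (hcd : ∀ s t : ℕ, c s t = d s t)
    (hd : ∀ s t, d s t ≠ 0 → 0 ≤ s ∧ 0 ≤ t) (t s : ℤ) :
    ((quadrantSeries c).coeff t).coeff s = d s t := by
  rcases lt_or_ge t 0 with ht | ht
  · rw [quadrantSeries, coeff_ofPowerSeries_of_neg _ ht, HahnSeries.coeff_zero]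
    by_contra h
    have := hd s t fun h' => h h'.symm
    omega
  · lift t to ℕ using ht
    rw [quadrantSeries, HahnSeries.ofPowerSeries_apply_coeff, coeff_mk]
    rcases lt_or_ge s 0 with hs | hs
    · rw [coeff_powerToLaurent_of_neg _ hs]
      by_contra h
      have := hd s t fun h' => h h'.symm
      omega
    · lift s to ℕ using hs
      rw [coeff_powerToLaurent_natCast, coeff_mk, hcd]

lemma quadrantDeg_quadrantSeries (c : ℕ → ℕ → ℂ) : QuadrantDeg 0 (quadrantSeries c) := by
  intro t s h
  rcases lt_or_ge t 0 with ht | ht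
  · rw [quadrantSeries, coeff_ofPowerSeries_of_neg _ ht, HahnSeries.coeff_zero] at h
    exact absurd rfl h
  · lift t to ℕ using ht
    rw [quadrantSeries, HahnSeries.ofPowerSeries_apply_coeff, coeff_mk] at h
    rcases lt_or_ge s 0 with hs | hs
    · exact absurd (coeff_powerToLaurent_of_neg _ hs) h
    · push_cast; omega

/-- The substitution `x₁ = x`, `x₂ = 0`, `x₃ = -z` on power series in `x₁, x₂, x₃` (terms with
negative exponents are dropped). It turns `x₁ - x₂`, `x₁ - x₃` and `x₂ - x₃` into `x`, `x + z`
and `z`. -/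
def restrictXZ : IterLaurent 3 →ₗ[ℂ] LaurentXZ where
  toFun F := quadrantSeries fun s t => (-1) ^ t * F.coeff (expo ![s, 0, t])
  map_add' F G := by
    rw [quadrantSeries, quadrantSeries, quadrantSeries, ← map_add]
    congr 1
    ext t : 1
    rw [map_add, coeff_mk, coeff_mk, coeff_mk, ← map_add]
    congr 1
    ext s
    simp [mul_add]
  map_smul' r F := by
    ext t s
    rw [RingHom.id_apply, HahnSeries.coeff_smul, HahnSeries.coeff_smul]
    rcases lt_or_ge t 0 with ht | ht
    · rw [quadrantSeries, quadrantSeries, coeff_ofPowerSeries_of_neg _ ht,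
        coeff_ofPowerSeries_of_neg _ ht, HahnSeries.coeff_zero, smul_zero]
    · lift t to ℕ using ht
      rw [quadrantSeries, quadrantSeries, HahnSeries.ofPowerSeries_apply_coeff,
        HahnSeries.ofPowerSeries_apply_coeff, coeff_mk, coeff_mk,
        ← HahnSeries.coeff_smul, ← powerToLaurent.map_smul]
      congr 2
      ext s
      simp [mul_left_comm]

lemma quadrantDeg_restrictXZ (F : IterLaurent 3) : QuadrantDeg 0 (restrictXZ F) :=
  quadrantDeg_quadrantSeries _

lemma coeff_restrictXZ {F : IterLaurent 3} (hF : ConeDeg 0 F) (t s : ℤ) :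
    ((restrictXZ F).coeff t).coeff s = (t.negOnePow : ℤ) * F.coeff (expo ![s, 0, t]) := by
  refine coeff_quadrantSeries (d := fun s t => (t.negOnePow : ℤ) * F.coeff (expo ![s, 0, t]))
    (fun s t => ?_) (fun s t h => ?_) t s
  · rw [Int.negOnePow_def]; simp
  · have h1 := (hF _ (right_ne_zero_of_mul h)).1
    exact ⟨h1 (toDual 0), h1 (toDual 2)⟩

lemma coeff_iterDiff_mul (i j : Fin 3) (F : IterLaurent 3) (k : Fin 3 → ℤ) :
    (iterDiff i j * F).coeff (expo k) =
      F.coeff (expo (k - Pi.single i 1)) - F.coeff (expo (k - Pi.single j 1)) := by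
  have h : ∀ i, (toLex (Pi.single (toDual i) 1) : Expo 3) = expo (Pi.single i 1) := by
    intro i
    apply ofLex.injective
    funext j
    change (Pi.single (toDual i) 1 : (Fin 3)ᵒᵈ → ℤ) j = (Pi.single i 1 : Fin 3 → ℤ) (ofDual j)
    by_cases hj : ofDual j = i
    · subst hj; simp
    · rw [Pi.single_eq_of_ne hj, Pi.single_eq_of_ne fun h => hj (by rw [h]; rfl)]
  rw [iterDiff, sub_mul, HahnSeries.coeff_sub, iterVar, iterVar, coeff_single_mul,
    coeff_single_mul, one_mul, one_mul, h, h, expo_sub, expo_sub]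

variable {F : IterLaurent 3} (hF : ConeDeg 0 F)

include hF in
lemma restrictXZ_iterDiff_zero_one_mul : restrictXZ (iterDiff 0 1 * F) = varX * restrictXZ F := by
  ext t s
  rw [coeff_restrictXZ ((((coneDeg_iterDiff 0 1).mono zero_le_one).mul hF)), coeff_varX_mul,
    coeff_restrictXZ hF, coeff_iterDiff_mul]
  have h : F.coeff (expo (![s, 0, t] - Pi.single 1 1)) = 0 := by
    by_contra h
    exact absurd ((hF _ h).1 (toDual 1)) (by
      change ¬ (0 : ℤ) ≤ 0 - (Pi.single 1 1 : Fin 3 → ℤ) 1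
      rw [Pi.single_eq_same]
      norm_num)
  rw [h, sub_zero]
  congr 3
  funext i
  fin_cases i <;> simp

include hF in
lemma restrictXZ_iterDiff_zero_two_mul :
    restrictXZ (iterDiff 0 2 * F) = (varX + varZ) * restrictXZ F := by
  ext t s
  rw [coeff_restrictXZ ((((coneDeg_iterDiff 0 2).mono zero_le_one).mul hF)), add_mul,
    HahnSeries.coeff_add, HahnSeries.coeff_add, coeff_varX_mul, coeff_varZ_mul,
    coeff_restrictXZ hF, coeff_restrictXZ hF, coeff_iterDiff_mul]
  have h1 : (![s, 0, t] - Pi.single 0 1 : Fin 3 → ℤ) = ![s - 1, 0, t] := by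
    funext i
    fin_cases i <;> simp
  have h2 : (![s, 0, t] - Pi.single 2 1 : Fin 3 → ℤ) = ![s, 0, t - 1] := by
    funext i
    fin_cases i <;> simp
  rw [h1, h2, Int.negOnePow_sub, Int.negOnePow_one]
  push_cast
  ring

include hF in
lemma restrictXZ_iterDiff_one_two_mul : restrictXZ (iterDiff 1 2 * F) = varZ * restrictXZ F := by
  ext t s
  rw [coeff_restrictXZ ((((coneDeg_iterDiff 1 2).mono zero_le_one).mul hF)), coeff_varZ_mul,
    coeff_restrictXZ hF, coeff_iterDiff_mul]
  have h : F.coeff (expo (![s, 0, t] - Pi.single 1 1)) = 0 := by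
    by_contra h
    exact absurd ((hF _ h).1 (toDual 1)) (by
      change ¬ (0 : ℤ) ≤ 0 - (Pi.single 1 1 : Fin 3 → ℤ) 1
      rw [Pi.single_eq_same]
      norm_num)
  have h2 : (![s, 0, t] - Pi.single 2 1 : Fin 3 → ℤ) = ![s, 0, t - 1] := by
    funext i
    fin_cases i <;> simp
  rw [h, h2, Int.negOnePow_sub, Int.negOnePow_one]
  push_cast
  ring

/-- A linear map `ψ` with `ψ 1 = 1` and `ψ (X f) = ξ ψ f` is the substitution of `ξ`, so if
`restrictXZ` turns multiplication by `δ` into multiplication by `ξ`, then it turns multiplication by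
`f(δ)` into multiplication by `ψ f`. -/
lemma restrictXZ_heval_mul {δ : IterLaurent 3} (hδ : ConeDeg 1 δ) {ξ : LaurentXZ}
    (hξ : QuadrantDeg 1 ξ) (hres : ∀ F, ConeDeg 0 F → restrictXZ (δ * F) = ξ * restrictXZ F)
    {ψ : ℂ⟦X⟧ →ₗ[ℂ] LaurentXZ} (h1 : ψ 1 = 1) (hX : ∀ f, ψ (PowerSeries.X * f) = ξ * ψ f)
    (hψ : ∀ f, QuadrantDeg 0 (ψ f)) {F : IterLaurent 3} (hF : ConeDeg 0 F) (f : ℂ⟦X⟧) :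
    restrictXZ (heval δ f * F) = ψ f * restrictXZ F := by
  rw [← sub_eq_zero]
  refine eq_zero_of_quadrantDeg fun N => ?_
  induction N generalizing f with
  | zero => exact (quadrantDeg_restrictXZ _).sub ((hψ f).mul (quadrantDeg_restrictXZ F))
  | succ N ih =>
    set g : ℂ⟦X⟧ := PowerSeries.mk fun s => coeff (s + 1) f with hg
    have hf : f = PowerSeries.X * g + coeff 0 f • 1 := by
      conv_lhs => rw [PowerSeries.eq_X_mul_shift_add_const f]
      rw [PowerSeries.smul_eq_C_mul, mul_one, PowerSeries.coeff_zero_eq_constantCoeff_apply]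
    have h : restrictXZ (heval δ f * F) - ψ f * restrictXZ F =
        ξ * (restrictXZ (heval δ g * F) - ψ g * restrictXZ F) := by
      have h2 : ψ f = ξ * ψ g + coeff 0 f • 1 := by
        conv_lhs => rw [hf]
        rw [map_add, hX, ψ.map_smul, h1]
      have h3 : (coeff 0 f • (1 : LaurentXZ)) * restrictXZ F = coeff 0 f • restrictXZ F :=
        (smul_mul_assoc _ 1 (restrictXZ F)).trans (congrArg _ (one_mul (restrictXZ F)))
      rw [h2, heval_eq hδ, ← hg, add_mul, add_mul, mul_assoc, restrictXZ.map_add,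
        hres _ ((hδ.heval g).mul hF), smul_mul_assoc, one_mul, restrictXZ.map_smul, h3]
      ring
    rw [h, add_comm]
    exact hξ.mul (ih g)

end

section

lemma powerToLaurent_mul (f g : ℂ⟦X⟧) :
    powerToLaurent (f * g) = powerToLaurent f * powerToLaurent g := map_mul (ofPowerSeries ℤ ℂ) f g

lemma powerToLaurent_one : powerToLaurent 1 = 1 := map_one (ofPowerSeries ℤ ℂ)

lemma powerToLaurent_X_mul (f : ℂ⟦X⟧) :
    powerToLaurent (PowerSeries.X * f) = HahnSeries.single 1 1 * powerToLaurent f := by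
  rw [powerToLaurent_mul]
  exact congrArg (· * _) HahnSeries.ofPowerSeries_X

lemma coeff_powerToLaurent_X_mul (f : ℂ⟦X⟧) (s : ℤ) :
    (powerToLaurent (PowerSeries.X * f)).coeff s = (powerToLaurent f).coeff (s - 1) := by
  rw [powerToLaurent_X_mul, coeff_single_mul, one_mul]

lemma coeff_substX (g : LaurentSeries ℂ) (t s : ℤ) :
    ((substX g).coeff t).coeff s = if t = 0 then g.coeff s else 0 := by
  change ((HahnSeries.single 0 g).coeff t).coeff s = _
  rw [HahnSeries.coeff_single]
  split_ifs <;> rfl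

lemma coeff_substZ (g : LaurentSeries ℂ) (t s : ℤ) :
    ((substZ g).coeff t).coeff s = if s = 0 then g.coeff t else 0 := by
  change (HahnSeries.C (g.coeff t)).coeff s = _
  rw [HahnSeries.C_apply, HahnSeries.coeff_single]
  split_ifs <;> rfl

lemma coeff_substXaddZ_natCast (g : LaurentSeries ℂ) (t : ℕ) (s : ℤ) :
    ((substXaddZ g).coeff t).coeff s = Ring.choose (s + t) t • g.coeff (s + t) := by
  change ((ofPowerSeries ℤ (LaurentSeries ℂ) _).coeff (t : ℤ)).coeff s = _
  rw [HahnSeries.ofPowerSeries_apply_coeff, coeff_mk, LaurentSeries.hasseDeriv_coeff]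

lemma coeff_substXaddZ_of_neg (g : LaurentSeries ℂ) {t : ℤ} (ht : t < 0) :
    (substXaddZ g).coeff t = 0 := coeff_ofPowerSeries_of_neg _ ht

lemma one_coeff (t s : ℤ) : ((1 : LaurentXZ).coeff t).coeff s = if t = 0 ∧ s = 0 then 1 else 0 := by
  rw [HahnSeries.coeff_one]
  by_cases ht : t = 0
  · simp [ht, HahnSeries.coeff_one]
  · simp [ht]

lemma substX_one : substX 1 = 1 := by
  ext t s
  rw [coeff_substX, one_coeff, HahnSeries.coeff_one]
  split_ifs <;> tauto

lemma substZ_one : substZ 1 = 1 := by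
  ext t s
  rw [coeff_substZ, one_coeff, HahnSeries.coeff_one]
  split_ifs <;> tauto

lemma substXaddZ_one : substXaddZ 1 = 1 := by
  ext t s
  rw [one_coeff]
  rcases lt_or_ge t 0 with ht | ht
  · rw [coeff_substXaddZ_of_neg _ ht, if_neg (by omega), HahnSeries.coeff_zero]
  · lift t to ℕ using ht
    rw [coeff_substXaddZ_natCast, HahnSeries.coeff_one]
    by_cases h : s + t = 0
    · rw [if_pos h, h]
      rcases t with _ | t
      · rw [if_pos (by omega), Ring.choose_zero_right, one_smul]
      · rw [Ring.choose_zero_succ, zero_smul, if_neg (by omega)]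
    · rw [if_neg h, smul_zero, if_neg (by omega)]

lemma substX_X_mul (f : ℂ⟦X⟧) :
    substX (powerToLaurent (PowerSeries.X * f)) = varX * substX (powerToLaurent f) := by
  ext t s
  rw [coeff_varX_mul, coeff_substX, coeff_substX, coeff_powerToLaurent_X_mul]

lemma substZ_X_mul (f : ℂ⟦X⟧) :
    substZ (powerToLaurent (PowerSeries.X * f)) = varZ * substZ (powerToLaurent f) := by
  ext t s
  rw [coeff_varZ_mul, coeff_substZ, coeff_substZ, coeff_powerToLaurent_X_mul]

lemma substXaddZ_X_mul (f : ℂ⟦X⟧) : substXaddZ (powerToLaurent (PowerSeries.X * f)) =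
      (varX + varZ) * substXaddZ (powerToLaurent f) := by
  ext t s
  rw [add_mul, HahnSeries.coeff_add, HahnSeries.coeff_add, coeff_varX_mul, coeff_varZ_mul]
  rcases lt_or_ge t 0 with ht | ht
  · rw [coeff_substXaddZ_of_neg _ ht, coeff_substXaddZ_of_neg _ ht,
      coeff_substXaddZ_of_neg _ (by omega : t - 1 < 0), HahnSeries.coeff_zero, HahnSeries.coeff_zero,
      add_zero]
  · lift t to ℕ using ht
    rw [coeff_substXaddZ_natCast, coeff_substXaddZ_natCast, coeff_powerToLaurent_X_mul]
    rcases t with _ | t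
    · rw [coeff_substXaddZ_of_neg _ (by norm_num), HahnSeries.coeff_zero, add_zero,
        Ring.choose_zero_right, Ring.choose_zero_right]
      congr 2
      push_cast
      ring
    · have h1 : ((t + 1 : ℕ) : ℤ) - 1 = (t : ℕ) := by push_cast; ring
      have h2 : s + ((t + 1 : ℕ) : ℤ) = (s + t) + 1 := by push_cast; ring
      have h3 : s - 1 + ((t + 1 : ℕ) : ℤ) = s + t := by push_cast; ring
      rw [h1, coeff_substXaddZ_natCast, h2, h3, Ring.choose_succ_succ, add_smul, add_comm,
        add_sub_cancel_right]

lemma quadrantDeg_substX (f : ℂ⟦X⟧) : QuadrantDeg 0 (substX (powerToLaurent f)) := by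
  intro t s h
  rw [coeff_substX] at h
  obtain ⟨ht, h⟩ := (ite_ne_right_iff).1 h
  by_contra hs
  exact h (coeff_powerToLaurent_of_neg _ (by push_cast at hs; omega))

lemma quadrantDeg_substZ (f : ℂ⟦X⟧) : QuadrantDeg 0 (substZ (powerToLaurent f)) := by
  intro t s h
  rw [coeff_substZ] at h
  obtain ⟨ht, h⟩ := (ite_ne_right_iff).1 h
  by_contra hs
  exact h (coeff_powerToLaurent_of_neg _ (by push_cast at hs; omega))

lemma quadrantDeg_substXaddZ (f : ℂ⟦X⟧) : QuadrantDeg 0 (substXaddZ (powerToLaurent f)) := by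
  intro t s h
  rcases lt_or_ge t 0 with ht | ht
  · rw [coeff_substXaddZ_of_neg _ ht] at h
    exact absurd rfl h
  · lift t to ℕ using ht
    rw [coeff_substXaddZ_natCast] at h
    rcases lt_or_ge (s + t) 0 with hst | hst
    · rw [coeff_powerToLaurent_of_neg _ hst, smul_zero] at h
      exact absurd rfl h
    · suffices 0 ≤ s by push_cast; omega
      by_contra hs
      obtain ⟨m, hm⟩ := Int.eq_ofNat_of_zero_le hst
      rw [hm, Ring.choose_natCast, Nat.choose_eq_zero_of_lt (by omega)] at h
      simp at h

lemma restrictXZ_one : restrictXZ 1 = 1 := by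
  ext t s
  rw [coeff_restrictXZ ConeDeg.one, one_coeff, HahnSeries.coeff_one]
  have h : expo ![s, 0, t] = 0 ↔ t = 0 ∧ s = 0 := by
    refine ⟨fun h => ⟨congrFun h (toDual 2), congrFun h (toDual 0)⟩, ?_⟩
    rintro ⟨rfl, rfl⟩
    funext i
    change (![0, 0, 0] : Fin 3 → ℤ) (ofDual i) = 0
    generalize (ofDual i : Fin 3) = j
    fin_cases j <;> rfl
  by_cases ht : t = 0 ∧ s = 0
  · rw [if_pos (h.2 ht), if_pos ht, ht.1]
    simp
  · rw [if_neg (h.not.2 ht), if_neg ht, mul_zero]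

variable {F : IterLaurent 3} (hF : ConeDeg 0 F) (f : ℂ⟦X⟧)

include hF in
lemma restrictXZ_heval_zero_one_mul : restrictXZ (heval (iterDiff 0 1) f * F) =
      substX (powerToLaurent f) * restrictXZ F :=
  restrictXZ_heval_mul (coneDeg_iterDiff 0 1) quadrantDeg_varX
    (fun _ => restrictXZ_iterDiff_zero_one_mul) (ψ := substX ∘ₗ powerToLaurent)
    (by rw [comp_apply, powerToLaurent_one, substX_one]) substX_X_mul quadrantDeg_substX
    hF f

include hF in
lemma restrictXZ_heval_zero_two_mul : restrictXZ (heval (iterDiff 0 2) f * F) =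
      substXaddZ (powerToLaurent f) * restrictXZ F :=
  restrictXZ_heval_mul (coneDeg_iterDiff 0 2) (quadrantDeg_varX.add quadrantDeg_varZ)
    (fun _ => restrictXZ_iterDiff_zero_two_mul) (ψ := substXaddZ ∘ₗ powerToLaurent)
    (by rw [comp_apply, powerToLaurent_one, substXaddZ_one]) substXaddZ_X_mul
    quadrantDeg_substXaddZ hF f

include hF in
lemma restrictXZ_heval_one_two_mul : restrictXZ (heval (iterDiff 1 2) f * F) =
      substZ (powerToLaurent f) * restrictXZ F :=
  restrictXZ_heval_mul (coneDeg_iterDiff 1 2) quadrantDeg_varZ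
    (fun _ => restrictXZ_iterDiff_one_two_mul) (ψ := substZ ∘ₗ powerToLaurent)
    (by rw [comp_apply, powerToLaurent_one, substZ_one]) substZ_X_mul quadrantDeg_substZ
    hF f

lemma restrictXZ_heval_heval_heval (f g h : ℂ⟦X⟧) (l : LaurentXZ) :
    restrictXZ (heval (iterDiff (n := 3) 0 1) f * (heval (iterDiff (n := 3) 0 2) g *
        heval (iterDiff (n := 3) 1 2) h)) * l =
      substZ (powerToLaurent h) * (substXaddZ (powerToLaurent g) *
        (substX (powerToLaurent f) * l)) := by
  have hg := (coneDeg_iterDiff (n := 3) 0 2).heval g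
  have hh := (coneDeg_iterDiff (n := 3) 1 2).heval h
  have := restrictXZ_heval_one_two_mul ConeDeg.one h
  rw [mul_one, restrictXZ_one] at this
  replace this := this.trans (mul_one (substZ (powerToLaurent h)))
  rw [restrictXZ_heval_zero_one_mul (hg.mul hh), restrictXZ_heval_zero_two_mul hh, this]
  ring

lemma restrictXZ_heval_heval_heval' (f g h : ℂ⟦X⟧) (l : LaurentXZ) :
    restrictXZ (heval (iterDiff (n := 3) 1 2) f * (heval (iterDiff (n := 3) 0 2) g *
        heval (iterDiff (n := 3) 0 1) h)) * l =
      substX (powerToLaurent h) * (substXaddZ (powerToLaurent g) *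
        (substZ (powerToLaurent f) * l)) := by
  have hg := (coneDeg_iterDiff (n := 3) 0 2).heval g
  have hh := (coneDeg_iterDiff (n := 3) 0 1).heval h
  have := restrictXZ_heval_zero_one_mul ConeDeg.one h
  rw [mul_one, restrictXZ_one] at this
  replace this := this.trans (mul_one (substX (powerToLaurent h)))
  rw [restrictXZ_heval_one_two_mul (hg.mul hh), restrictXZ_heval_zero_two_mul hh, this]
  ring

end

/-! ### Unitarity and the Yang–Baxter equation -/

section

lemma extendScalars_tmul {M : Type*} [AddCommGroup M] [Module ℂ M] (K : Type*) [CommRing K]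
    [Module ℂ K] [SMulCommClass ℂ K K] [IsScalarTower ℂ K K] {φ : M →ₗ[ℂ] M ⊗[ℂ] K} {t : M}
    {r : ℕ} {T : Fin r → M} {k : Fin r → K} (h : φ t = ∑ i, T i ⊗ₜ k i) (l : K) :
    extendScalars K φ (t ⊗ₜ l) = ∑ i, T i ⊗ₜ (k i * l) := by
  simp only [extendScalars, comp_apply, rTensor_tmul, h, TensorProduct.sum_tmul,
    map_sum, LinearEquiv.coe_coe, TensorProduct.assoc_tmul, lTensor_tmul,
    LinearMap.mul'_apply]

variable {R : V ⊗[ℂ] V →ₗ[ℂ] (V ⊗[ℂ] V) ⊗[ℂ] LaurentSeries ℂ} (θ : LaurentSeries ℂ →ₗ[ℂ] LaurentXZ)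
  {x y : V} {r : ℕ} {β α : Fin r → V} {f : Fin r → LaurentSeries ℂ}
  (h : R (x ⊗ₜ y) = ∑ i, (β i ⊗ₜ α i) ⊗ₜ f i) (z : V) (l : LaurentXZ)

include h

lemma extendScalars_map12 : extendScalars LaurentXZ (map12 R θ) (((x ⊗ₜ y) ⊗ₜ z) ⊗ₜ l) =
      ∑ i, ((β i ⊗ₜ α i) ⊗ₜ z) ⊗ₜ (θ (f i) * l) := by
  refine extendScalars_tmul _ ?_ l
  simp only [map12, comp_apply, rTensor_tmul, h, map_sum,
    lTensor_tmul, TensorProduct.sum_tmul, LinearEquiv.coe_coe,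
    TensorProduct.rightComm_tmul]

lemma extendScalars_map13 : extendScalars LaurentXZ (map13 R θ) (((x ⊗ₜ z) ⊗ₜ y) ⊗ₜ l) =
      ∑ i, ((β i ⊗ₜ z) ⊗ₜ α i) ⊗ₜ (θ (f i) * l) := by
  refine extendScalars_tmul _ ?_ l
  simp only [map13, map12, comp_apply, rTensor_tmul, h, map_sum,
    lTensor_tmul, TensorProduct.sum_tmul, LinearEquiv.coe_coe,
    TensorProduct.rightComm_tmul]

lemma extendScalars_map23 : extendScalars LaurentXZ (map23 R θ) (((z ⊗ₜ x) ⊗ₜ y) ⊗ₜ l) =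
      ∑ i, ((z ⊗ₜ β i) ⊗ₜ α i) ⊗ₜ (θ (f i) * l) := by
  refine extendScalars_tmul _ ?_ l
  simp only [map23, comp_apply, rTensor_tmul, h, map_sum,
    lTensor_tmul, TensorProduct.tmul_sum, LinearEquiv.coe_coe,
    TensorProduct.assoc_tmul, TensorProduct.assoc_symm_tmul]

end

section

variable {F : 𝕍 B S →ₗ[ℂ] ℤ → End ℂ (𝕍 B S)} {hF : IsVertexMap B S F}
  (hnd : IsNondegenerate (vacuum B S) (ofModes F hF.trunc))
  {R : 𝕍 B S ⊗[ℂ] 𝕍 B S →ₗ[ℂ]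
    (𝕍 B S ⊗[ℂ] 𝕍 B S) ⊗[ℂ] ℂ⟦X⟧}
  (hR : ∀ u v, Exchanges hF u v (R (v ⊗ₜ u)))

lemma negVar_powerToLaurent (f : ℂ⟦X⟧) :
    negVar (powerToLaurent f) = powerToLaurent (evalNegHom f) := by
  ext n
  change (n.negOnePow : ℤ) • (powerToLaurent f).coeff n = _
  rcases lt_or_ge n 0 with hn | hn
  · rw [coeff_powerToLaurent_of_neg _ hn, coeff_powerToLaurent_of_neg _ hn, smul_zero]
  · lift n to ℕ using hn
    rw [coeff_powerToLaurent_natCast, coeff_powerToLaurent_natCast, evalNegHom,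
      PowerSeries.coeff_rescale, Int.negOnePow_def]
    simp

lemma negVar_mul_powerToLaurent (f g : ℂ⟦X⟧) : negVar (powerToLaurent (evalNegHom f * g)) =
      negVar (powerToLaurent g) * powerToLaurent f := by
  rw [negVar_powerToLaurent, negVar_powerToLaurent, map_mul, powerToLaurent_mul, mul_comm]
  congr 2
  ext s
  rw [evalNegHom, PowerSeries.coeff_rescale, PowerSeries.coeff_rescale, ← mul_assoc, ← mul_pow]
  norm_num

lemma lTensor_powerToLaurent_sum {r : ℕ} (β α : Fin r → V) (f : Fin r → ℂ⟦X⟧) :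
    lTensor (V ⊗[ℂ] V) powerToLaurent (∑ i, (β i ⊗ₜ α i) ⊗ₜ f i) =
      ∑ i, (β i ⊗ₜ α i) ⊗ₜ powerToLaurent (f i) := by simp only [map_sum, lTensor_tmul]

include hnd hR

lemma isUnitary_braiding : IsUnitary (lTensor (𝕍 B S ⊗[ℂ] 𝕍 B S) powerToLaurent ∘ₗ R) := by
  choose r β α f hRf using fun x y => exists_sum_tmul (R (x ⊗ₜ y))
  have hL : ∀ x y, (lTensor _ powerToLaurent ∘ₗ R) (x ⊗ₜ y) =
      ∑ i, (β x y i ⊗ₜ α x y i) ⊗ₜ powerToLaurent (f x y i) := fun x y => by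
    rw [comp_apply, hRf, lTensor_powerToLaurent_sum]
  refine LinearMap.ext fun A => ?_
  induction A using triple_induction with
  | zero => rw [map_zero, map_zero]
  | add A A' h h' => rw [map_add, map_add, h, h']
  | tmul v u h =>
    have hflip : ∀ x y, (LinearMap.rTensor (LaurentSeries ℂ)
        (TensorProduct.comm ℂ (𝕍 B S) (𝕍 B S)).toLinearMap ∘ₗ
        lTensor _ negVar ∘ₗ (lTensor _ powerToLaurent ∘ₗ R) ∘ₗ
          (TensorProduct.comm ℂ (𝕍 B S) (𝕍 B S)).toLinearMap) (x ⊗ₜ y) =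
        ∑ i, (α y x i ⊗ₜ β y x i) ⊗ₜ negVar (powerToLaurent (f y x i)) := by
      intro x y
      rw [comp_apply, comp_apply, comp_apply, LinearEquiv.coe_coe, TensorProduct.comm_tmul, hL]
      simp only [map_sum, lTensor_tmul, rTensor_tmul, LinearEquiv.coe_coe, TensorProduct.comm_tmul]
    have hu := congrArg (TensorProduct.map (TensorProduct.comm ℂ (𝕍 B S) (𝕍 B S)).toLinearMap
      (LinearMap.mulRight ℂ h ∘ₗ negVar ∘ₗ powerToLaurent)) (braiding_unitary hnd hR (hRf v u))
    simp only [TensorProduct.map_tmul, map_sum, hRf, lTensor_tmul, LinearEquiv.coe_coe,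
      TensorProduct.comm_tmul, comp_apply, LinearMap.mulRight_apply,
      LinearMap.mulLeft_apply, negVar_mul_powerToLaurent] at hu
    rw [comp_apply, extendScalars_tmul _ (hL v u), map_sum, LinearMap.id_apply]
    simp only [extendScalars_tmul _ (hflip _ _), ← mul_assoc]
    rw [← hu, negVar_powerToLaurent, map_one, powerToLaurent_one, one_mul]

lemma isYangBaxter_braiding : IsYangBaxter (lTensor (𝕍 B S ⊗[ℂ] 𝕍 B S) powerToLaurent ∘ₗ R) := by
  choose r β α f hRf using fun x y => exists_sum_tmul (R (x ⊗ₜ y))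
  have hL : ∀ x y, (lTensor _ powerToLaurent ∘ₗ R) (x ⊗ₜ y) =
      ∑ i, (β x y i ⊗ₜ α x y i) ⊗ₜ powerToLaurent (f x y i) := fun x y => by
    rw [comp_apply, hRf, lTensor_powerToLaurent_sum]
  have hE : ∀ x y, Exchanges hF y x (∑ i, (β x y i ⊗ₜ α x y i) ⊗ₜ f x y i) := fun x y => by
    rw [← hRf]; exact hR y x
  refine LinearMap.ext fun A => ?_
  induction A using TensorProduct.induction_on with
  | zero => rw [map_zero, map_zero]
  | add A A' h h' => rw [map_add, map_add, h, h']
  | tmul t l =>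
    induction t using triple_induction with
    | zero => rw [TensorProduct.zero_tmul, map_zero, map_zero]
    | add A A' h h' => rw [TensorProduct.add_tmul, map_add, map_add, h, h']
    | tmul w v u =>
      -- restriction of the hexagon to `x₁ = x`, `x₂ = 0`, `x₃ = -z`
      have hx := congrArg (lTensor _ (LinearMap.mulRight ℂ l ∘ₗ restrictXZ)) (hexagon hnd hE w v u)
      simp only [map_sum, lTensor_tmul, comp_apply, LinearMap.mulRight_apply,
        restrictXZ_heval_heval_heval, restrictXZ_heval_heval_heval'] at hx
      simp only [comp_apply, extendScalars_map12 _ (hL _ _),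
        extendScalars_map13 _ (hL _ _), extendScalars_map23 _ (hL _ _), map_sum]
      exact hx.symm

end

end QVA

end

theorem theorem4p4 {H : Type*} [AddCommGroup H] [Module ℂ H] [FiniteDimensional ℂ H]
    (B : LinearMap.BilinForm ℂ H)
    (S : H ⊗[ℂ] H →ₗ[ℂ] (H ⊗[ℂ] H) ⊗[ℂ] PowerSeries ℂ)
    (hS : ∀ t, QVA.powerCoeff (H ⊗[ℂ] H) 0 (S t) = t)
    (hPBW : QVA.IsPBWType B S hS) :
    ∃ Y : QVA.VacuumModule B S →ₗ[ℂ] VertexOperator ℂ (QVA.VacuumModule B S),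
      QVA.IsWeakQuantumVertexAlgebra (QVA.vacuum B S) Y ∧
      (∀ (a : H) (n : ℤ) (w : QVA.VacuumModule B S),
        VertexOperator.ncoeff (Y (QVA.mode (-1) a • QVA.vacuum B S)) n w = QVA.mode n a • w) ∧
      (∀ Y' : QVA.VacuumModule B S →ₗ[ℂ] VertexOperator ℂ (QVA.VacuumModule B S),
        QVA.IsWeakQuantumVertexAlgebra (QVA.vacuum B S) Y' →
        (∀ (a : H) (n : ℤ) (w : QVA.VacuumModule B S),
          VertexOperator.ncoeff (Y' (QVA.mode (-1) a • QVA.vacuum B S)) n w =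
            QVA.mode n a • w) →
        Y' = Y) ∧
      QVA.IsNondegenerate (QVA.vacuum B S) Y ∧
      ∃ R : QVA.VacuumModule B S ⊗[ℂ] QVA.VacuumModule B S →ₗ[ℂ]
          (QVA.VacuumModule B S ⊗[ℂ] QVA.VacuumModule B S) ⊗[ℂ] LaurentSeries ℂ,
        QVA.IsQuantumVertexAlgebra (QVA.vacuum B S) Y R := by
  obtain ⟨F, hF⟩ := QVA.exists_vertexMap B S
  have hY := QVA.isWeakQuantumVertexAlgebra_ofModes hF
  have hgen : ∀ (a : H) (n : ℤ) (w : QVA.VacuumModule B S),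
      VertexOperator.ncoeff (QVA.ofModes F hF.trunc (QVA.mode (-1) a • QVA.vacuum B S)) n w =
        QVA.mode n a • w := fun a n w => by
    rw [QVA.ncoeff_ofModes, QVA.generator_of_isVertexMap hF]
  have hnd := QVA.isNondegenerate_of_isPBWType hY hgen hPBW
  obtain ⟨R, hR⟩ := QVA.exists_braiding (hF := hF) hnd
  refine ⟨QVA.ofModes F hF.trunc, hY, hgen,
    fun Y' hY' hgen' => QVA.weakQuantumVertexAlgebra_unique hY hY' hgen hgen', hnd,
    LinearMap.lTensor _ QVA.powerToLaurent ∘ₗ R, hY, QVA.isUnitary_braiding hnd hR,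
    QVA.isYangBaxter_braiding hnd hR, fun u v => ?_⟩
  obtain ⟨k, hk⟩ := hR u v
  exact QVA.sJacobi_of_swap hF hk
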